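/- **Setting.** Let $p,q\ge 0$ be integers and $\mu>0$ a real number. Let $M=\mathbb{C}^{(p+q)\cdot p\,*}$ be the open set of complex $(p+q)\times p$ matrices $z=(z^A_i)$ of rank $p$. The group $GL(p,\mathbb{C})$ acts on $M$ by right multiplication; let $G_{p,q}(\mathbb{C})=M/GL(p,\mathbb{C})$ be the Grassmann manifold and $\pi:M\to G_{p,q}(\mathbb{C})$ the projection. Put $x=z^\dagger z$. Equip $M$ with the symplectic form $\frac i2\operatorname{tr}dz\wedge dz^\dagger=\sum_{A,i}d\,\mathrm{Re}\,z^A_i\wedge d\,\mathrm{Im}\,z^A_i$, with the Poisson bracket normalized by $\{\mathrm{Re}\,z^A_i,\mathrm{Im}\,z^A_i\}=1$, and with the momentum map $J=\frac i2x$ of the $U(p)$-action. Let $i:J^{-1}(\frac i2\mu)\to M$ be the inclusion of the level set $\{x=\mu\mathbf 1\}$ and $\bar\rho:M\to J^{-1}(\frac i2\mu)$, $\bar\rho(z)=z\,x^{-1/2}\mu^{1/2}$. The manifold $G_{p,q}(\mathbb{C})=J^{-1}(\frac i2\mu)/U(p)$ carries the reduced Poisson bracket, $\pi_\mu^*\{f,g\}=i^*\{\pi^*f,\pi^*g\}$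 with $\pi_\mu=\pi\circ i$. Let $\lambda$ be a formal parameter. On $C^\infty(M)[[\lambda]]$ (complex valued functions) consider the Wick product $$F\,\tilde*\,G=\sum_{r\ge0}\frac{\lambda^r}{r!}\sum_{A_1,\dots,A_r}\sum_{i_1,\dots,i_r}\frac{\partial^rF}{\partial z^{A_1}_{i_1}\cdots\partial z^{A_r}_{i_r}}\cdot\frac{\partial^rG}{\partial\bar z^{A_1}_{i_1}\cdots\partial\bar z^{A_r}_{i_r}} .$$ An element of $C^\infty(M)[[\lambda]]$ is called invariant if it is $U(p)$-invariant, and homogeneous if it is $GL(p,\mathbb{C})$-invariant. Let $\mathcal J$ be the set of all $\sum_{i,j}G^i_j\,\tilde*\,(x-\mu\mathbf 1)^j_i$, where $G$ is a $p\times p$ matrix with entries in $C^\infty(M)[[\lambda]]$ and $G(zU)=U^\dagger G(z)U$ for all $U\in U(p)$. For $r\ge0$ let $Con(S_r)$ be the set of conjugacy classes of $S_r$; for $\alpha\in Con(S_r)$ let $|\alpha|$ be the number of cycles (fixed points included) of its elements and $k_\alpha=\sum_{\sigma\in\alpha}\sigma$ its class sum. A star product on $G_{p,q}(\mathbb{C})$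 is an associative $\mathbb{C}[[\lambda]]$-bilinear product $*$ on $C^\infty(G_{p,q}(\mathbb{C}))[[\lambda]]$ with unit $1$, given in every order by bidifferential operators, such that for $f,g\in C^\infty(G_{p,q}(\mathbb{C}))$ one has $f*g=fg+O(\lambda)$ and $f*g-g*f=\frac{i\lambda}2\{f,g\}+O(\lambda^2)$, and such that pointwise complex conjugation (with $\bar\lambda=\lambda$) satisfies $\overline{f*g}=\bar g*\bar f$ for all $f,g\in C^\infty(G_{p,q}(\mathbb{C}))[[\lambda]]$. **Statement.** (1) For every $r$ the element $\sum_\alpha c^{|\alpha|}k_\alpha$ of the group algebra of $S_r$ over the field $\mathbb{C}(c)$ is invertible, and its inverse is of the form $\sum_\alpha s_\alpha(c)k_\alpha$ with rational functions $s_\alpha\in\mathbb{C}(c)$ (which are thereby uniquely determined, and depend only on $\alpha$). (2) For all $p,q\ge0$ and $\mu>0$: every invariant $F\in C^\infty(M)[[\lambda]]$ has a unique decomposition $F=PF+K$ with $PF$ homogeneous and $K\in\mathcal J$. After the substitution $c=\lambda^{-1}\mu+p$, every $s_\alpha(c)$ is a formal power series in $\lambda$. There exists a star product $*$ on $G_{p,q}(\mathbb{C})$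 such that for all $f,g\in C^\infty(G_{p,q}(\mathbb{C}))[[\lambda]]$ the product $\pi^*f\,\tilde*\,\pi^*g$ is invariant and $$\pi^*(f*g)=P(\pi^*f\,\tilde*\,\pi^*g)=\sum_{r=0}^\infty\frac{\mu^r}{r!}\,\bar\rho^*i^*\sum_{A_1,\dots,A_r}\Big\langle\rho\Big(\sum_{\alpha\in Con(S_r)}s_\alpha(c)k_\alpha\Big)\frac{\partial^r\pi^*f}{\partial z^{A_1}\cdots\partial z^{A_r}},\frac{\partial^r\pi^*g}{\partial z^\dagger_{A_1}\cdots\partial z^\dagger_{A_r}}\Big\rangle,$$ where the series converges in the $\lambda$-adic sense (each power of $\lambda$ receives contributions from finitely many $r$). Here, for fixed $A_1,\dots,A_r$, the derivatives $\partial^r\pi^*f/\partial z^{A_1}_{i_1}\cdots\partial z^{A_r}_{i_r}$ and $\partial^r\pi^*g/\partial\bar z^{A_1}_{i_1}\cdots\partial\bar z^{A_r}_{i_r}$ are the $(i_1,\dots,i_r)$-components of tensors in $(\mathbb{C}^p)^{\otimes r}$; $\rho$ is the linear extension of $\rho(\sigma)(e_{i_1}\otimes\cdots\otimes e_{i_r})=e_{i_{\sigma(1)}}\otimes\cdots\otimes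 e_{i_{\sigma(r)}}$; and $\langle u,v\rangle=\sum_{i_1,\dots,i_r}u_{i_1\cdots i_r}v_{i_1\cdots i_r}$. -/

import Mathlib

attribute [local instance] Matrix.normedAddCommGroup Matrix.normedSpace

noncomputable section

namespace GrassStar

open Matrix
open scoped ContDiff ComplexOrder

/-! ## The manifold of full rank matrices and its smooth functions -/

/-- The set of complex `(p+q) × p` matrices of rank `p`, an open subset of all matrices. -/
def fullRankSet (p q : ℕ) : Set (Matrix (Fin (p + q)) (Fin p) ℂ) := {z | z.rank = p}

/-- The manifold of complex `(p+q) × p` matrices of rank `p`. -/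
abbrev FullRank (p q : ℕ) : Type := fullRankSet p q

theorem rank_eq_iff_isUnit {p : ℕ} (A : Matrix (Fin p) (Fin p) ℂ) :
    A.rank = p ↔ IsUnit A := by
  constructor
  · intro h
    rw [← Matrix.mulVec_injective_iff_isUnit]
    have h1 : Function.Surjective A.mulVecLin := by
      rw [← LinearMap.range_eq_top]
      apply Submodule.eq_top_of_finrank_eq
      rw [← Matrix.rank, h]
      simp
    exact (LinearMap.injective_iff_surjective.mpr h1)
  · intro h
    simpa using Matrix.rank_of_isUnit A h

theorem mem_fullRankSet_iff {p q : ℕ} (z : Matrix (Fin (p + q)) (Fin p) ℂ) :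
    z ∈ fullRankSet p q ↔ (zᴴ * z).det ≠ 0 := by
  rw [← isUnit_iff_ne_zero, ← Matrix.isUnit_iff_isUnit_det, ← rank_eq_iff_isUnit,
    Matrix.rank_conjTranspose_mul_self]
  rfl

theorem isOpen_fullRankSet (p q : ℕ) : IsOpen (fullRankSet p q) := by
  have h : fullRankSet p q = {z | (zᴴ * z).det ≠ 0} := by
    ext z
    exact mem_fullRankSet_iff z
  rw [h]
  refine isOpen_ne_fun ?_ continuous_const
  exact Continuous.matrix_det (Continuous.matrix_mul continuous_id.matrix_conjTranspose
    continuous_id)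

/-- Extension by zero of a function on the full rank matrices to all matrices. -/
def zeroExt {p q : ℕ} (F : FullRank p q → ℂ) : Matrix (Fin (p + q)) (Fin p) ℂ → ℂ :=
  Function.extend Subtype.val F 0

theorem zeroExt_apply {p q : ℕ} (F : FullRank p q → ℂ) (z : FullRank p q) :
    zeroExt F z.1 = F z := Subtype.val_injective.extend_apply F 0 z

/-- Real smoothness of a complex valued function on the open set of full rank matrices. The value
of the extension outside of this open set plays no role. -/
def IsSmooth {p q : ℕ} (F : FullRank p q → ℂ) : Prop :=
  ContDiffOn ℝ ∞ (zeroExt F) (fullRankSet p q)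

theorem isSmooth_of_eqOn {p q : ℕ} {F : FullRank p q → ℂ}
    {f : Matrix (Fin (p + q)) (Fin p) ℂ → ℂ} (hf : ContDiffOn ℝ ∞ f (fullRankSet p q))
    (h : ∀ z : FullRank p q, F z = f z.1) : IsSmooth F :=
  hf.congr fun z hz => by rw [zeroExt_apply F ⟨z, hz⟩, h]

theorem isSmooth_of_contDiff {p q : ℕ} {f : Matrix (Fin (p + q)) (Fin p) ℂ → ℂ}
    (hf : ContDiff ℝ ∞ f) : IsSmooth (fun z : FullRank p q => f z.1) :=
  isSmooth_of_eqOn hf.contDiffOn fun _ => rfl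

/-- The algebra of smooth complex valued functions on the full rank matrices. -/
def SmoothFun (p q : ℕ) : Subalgebra ℂ (FullRank p q → ℂ) where
  carrier := {F | IsSmooth F}
  mul_mem' {F G} hF hG := isSmooth_of_eqOn (ContDiffOn.mul hF hG) fun z => by
    simp [zeroExt_apply]
  add_mem' {F G} hF hG := isSmooth_of_eqOn (ContDiffOn.add hF hG) fun z => by
    simp [zeroExt_apply]
  algebraMap_mem' c := isSmooth_of_eqOn (f := fun _ => c) contDiffOn_const fun _ => rfl

/-- Pointwise complex conjugation of smooth functions. -/
def conjFun {p q : ℕ} (F : SmoothFun p q) : SmoothFun p q :=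
  ⟨fun z => starRingEnd ℂ (F.1 z), by
    refine isSmooth_of_eqOn (f := fun z => Complex.conjCLE (zeroExt F.1 z))
      (Complex.conjCLE.contDiff.comp_contDiffOn F.2) fun z => ?_
    simp [zeroExt_apply]⟩

/-- The derivative of a smooth function in a constant (real) direction `v`. -/
def dirDeriv {p q : ℕ} (v : Matrix (Fin (p + q)) (Fin p) ℂ) : Module.End ℂ (SmoothFun p q) where
  toFun F := ⟨fun z => fderiv ℝ (zeroExt F.1) z.1 v,
    isSmooth_of_eqOn (f := fun z => fderiv ℝ (zeroExt F.1) z v)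
      ((ContDiffOn.fderiv_of_isOpen F.2 (isOpen_fullRankSet p q) (m := ∞) (by simp)).clm_apply
        contDiffOn_const) fun _ => rfl⟩
  map_add' F G := by
    ext z
    have hd : ∀ H : SmoothFun p q, DifferentiableAt ℝ (zeroExt H.1) z.1 := fun H =>
      (ContDiffOn.contDiffAt H.2 ((isOpen_fullRankSet p q).mem_nhds z.2)).differentiableAt
        (by simp)
    have he : zeroExt (F + G).1 =ᶠ[nhds z.1] zeroExt F.1 + zeroExt G.1 := by
      filter_upwards [(isOpen_fullRankSet p q).mem_nhds z.2] with w hw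
      have h := fun H : SmoothFun p q => zeroExt_apply H.1 ⟨w, hw⟩
      simp only [Pi.add_apply]
      rw [h, h, h]
      rfl
    exact congrArg (fun L => L v) (he.fderiv_eq.trans (fderiv_add (hd F) (hd G)))
  map_smul' c F := by
    ext z
    have hd : DifferentiableAt ℝ (zeroExt F.1) z.1 :=
      (ContDiffOn.contDiffAt F.2 ((isOpen_fullRankSet p q).mem_nhds z.2)).differentiableAt
        (by simp)
    have he : zeroExt (c • F).1 =ᶠ[nhds z.1] c • zeroExt F.1 := by
      filter_upwards [(isOpen_fullRankSet p q).mem_nhds z.2] with w hw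
      have h := fun H : SmoothFun p q => zeroExt_apply H.1 ⟨w, hw⟩
      simp only [Pi.smul_apply]
      rw [h, h]
      rfl
    exact congrArg (fun L => L v) (he.fderiv_eq.trans (fderiv_const_smul hd c))

/-- The Wirtinger derivative `∂/∂z^A_i = (∂/∂x^A_i - i ∂/∂y^A_i) / 2`, for the index `a = (A, i)`
and `z^A_i = x^A_i + i y^A_i`. -/
def dz {p q : ℕ} (a : Fin (p + q) × Fin p) : Module.End ℂ (SmoothFun p q) :=
  (1 / 2 : ℂ) • (dirDeriv (Matrix.single a.1 a.2 1) -
    Complex.I • dirDeriv (Matrix.single a.1 a.2 Complex.I))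

/-- The Wirtinger derivative `∂/∂z̄^A_i = (∂/∂x^A_i + i ∂/∂y^A_i) / 2`, which is the derivative with
respect to the entry `(i, A)` of `z†`. -/
def dzbar {p q : ℕ} (a : Fin (p + q) × Fin p) : Module.End ℂ (SmoothFun p q) :=
  (1 / 2 : ℂ) • (dirDeriv (Matrix.single a.1 a.2 1) +
    Complex.I • dirDeriv (Matrix.single a.1 a.2 Complex.I))

/-- The iterated derivative `∂^r/∂z^{a 0} ⋯ ∂z^{a (r-1)}`. -/
def iterDz {p q r : ℕ} (a : Fin r → Fin (p + q) × Fin p) : Module.End ℂ (SmoothFun p q) :=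
  (List.ofFn fun k => dz (a k)).prod

/-- The iterated derivative `∂^r/∂z̄^{a 0} ⋯ ∂z̄^{a (r-1)}`. -/
def iterDzbar {p q r : ℕ} (a : Fin r → Fin (p + q) × Fin p) : Module.End ℂ (SmoothFun p q) :=
  (List.ofFn fun k => dzbar (a k)).prod

/-- The coordinate function `z ↦ z^A_i`. -/
def coordFun {p q : ℕ} (A : Fin (p + q)) (i : Fin p) : SmoothFun p q :=
  ⟨fun z => z.1 A i, isSmooth_of_contDiff (f := fun z => z A i)
    ((contDiff_apply ℝ ℂ i).comp (contDiff_apply ℝ (Fin p → ℂ) A))⟩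

/-- The entry `(j, i)` of the matrix valued function `x - μ`, where `x = z† z`. -/
def momentumEntry {p q : ℕ} (μ : ℝ) (j i : Fin p) : SmoothFun p q :=
  ∑ A, conjFun (coordFun A j) * coordFun A i -
    algebraMap ℂ (SmoothFun p q) (if j = i then (μ : ℂ) else 0)

/-- The Poisson bracket of the symplectic form `(i/2) tr dz ∧ dz† = ∑ dx^A_i ∧ dy^A_i`, normalized
by `{x^A_i, y^A_i} = 1`. -/
def poisson {p q : ℕ} (F G : SmoothFun p q) : SmoothFun p q :=
  (2 / Complex.I) • ∑ a, (dz a F * dzbar a G - dzbar a F * dz a G)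

/-! ## Formal power series in `λ` (the variable `X` of `PowerSeries`) -/

/-- Coefficientwise application of a map to a power series. -/
def mapCoeff {R S : Type} [Semiring R] [Semiring S] (T : R → S) (F : PowerSeries R) :
    PowerSeries S :=
  PowerSeries.mk fun n => T (PowerSeries.coeff n F)

/-- The series `S` is the sum `∑ r, t r` of power series, in the `λ`-adic sense: every coefficient
of the partial sums is eventually constant, equal to the coefficient of `S`. -/
def HasLambdaSum {R : Type} [Semiring R] (t : ℕ → PowerSeries R) (S : PowerSeries R) : Prop :=
  ∀ n, ∃ N, ∀ m, N ≤ m → PowerSeries.coeff n (∑ r ∈ Finset.range m, t r) = PowerSeries.coeff n S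

/-- The Wick product
`F *~ G = ∑ r, (λ^r / r!) ∑ ∂^r F / ∂z^{a 1} ⋯ ∂z^{a r} · ∂^r G / ∂z̄^{a 1} ⋯ ∂z̄^{a r}`. -/
def wick {p q : ℕ} (F G : PowerSeries (SmoothFun p q)) : PowerSeries (SmoothFun p q) :=
  PowerSeries.mk fun n => ∑ r ∈ Finset.range (n + 1), ((r.factorial : ℂ)⁻¹) •
    ∑ a : Fin r → Fin (p + q) × Fin p,
      PowerSeries.coeff (n - r) (mapCoeff (iterDz a) F * mapCoeff (iterDzbar a) G)

/-! ## Group actions, invariant and homogeneous functions, the star ideal -/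

/-- The right action of `GL(p, ℂ)` on full rank matrices. -/
def mulGL {p q : ℕ} (z : FullRank p q) (g : GL (Fin p) ℂ) : FullRank p q :=
  ⟨z.1 * g.1, by
    have h := z.2
    change (z.1 * g.1).rank = p
    rw [Matrix.rank_mul_eq_left_of_isUnit_det _ _
      ((Matrix.isUnit_iff_isUnit_det _).mp g.isUnit)]
    exact h⟩

/-- The right action of `U(p)` on full rank matrices. -/
def mulU {p q : ℕ} (z : FullRank p q) (U : Matrix.unitaryGroup (Fin p) ℂ) : FullRank p q :=
  mulGL z (Unitary.toUnits U)

/-- `U(p)`-invariant formal functions. -/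
def IsInvariant {p q : ℕ} (F : PowerSeries (SmoothFun p q)) : Prop :=
  ∀ (n : ℕ) (z : FullRank p q) (U : Matrix.unitaryGroup (Fin p) ℂ),
    (PowerSeries.coeff n F).1 (mulU z U) = (PowerSeries.coeff n F).1 z

/-- Homogeneous, that is `GL(p, ℂ)`-invariant, formal functions. -/
def IsHomogeneous {p q : ℕ} (F : PowerSeries (SmoothFun p q)) : Prop :=
  ∀ (n : ℕ) (z : FullRank p q) (g : GL (Fin p) ℂ),
    (PowerSeries.coeff n F).1 (mulGL z g) = (PowerSeries.coeff n F).1 z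

/-- The value at `z` of the coefficient of `λ^n` of a matrix valued formal function. -/
def evalMat {p q : ℕ} (G : Fin p → Fin p → PowerSeries (SmoothFun p q)) (n : ℕ)
    (z : FullRank p q) : Matrix (Fin p) (Fin p) ℂ :=
  Matrix.of fun i j => (PowerSeries.coeff n (G i j)).1 z

/-- Formal functions with values in the complexified Lie algebra `u(p) ⊗ ℂ = gl(p, ℂ)` which are
`Ad`-equivariant: `G (z U) = U† G(z) U`. -/
def IsEquivariant {p q : ℕ} (G : Fin p → Fin p → PowerSeries (SmoothFun p q)) : Prop :=
  ∀ (n : ℕ) (z : FullRank p q) (U : Matrix.unitaryGroup (Fin p) ℂ),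
    evalMat G n (mulU z U) = (U.1)ᴴ * evalMat G n z * U.1

/-- The star ideal generated by `x - μ`: all `∑ i j, G^i_j *~ (x - μ)^j_i` with `G` equivariant. -/
def wickIdeal (p q : ℕ) (μ : ℝ) : Set (PowerSeries (SmoothFun p q)) :=
  {F | ∃ G : Fin p → Fin p → PowerSeries (SmoothFun p q), IsEquivariant G ∧
    F = ∑ i, ∑ j, wick (G i j) (PowerSeries.C (momentumEntry μ j i))}

/-- `H = P F`, where `P` is the projection of the invariant formal functions onto the homogeneous
ones along the star ideal. -/
def IsProjection {p q : ℕ} (μ : ℝ) (F H : PowerSeries (SmoothFun p q)) : Prop :=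
  IsInvariant F ∧ IsHomogeneous H ∧ F - H ∈ wickIdeal p q μ

/-! ## The Grassmann manifold and its smooth functions -/

/-- `z₁ ∼ z₂` if and only if `z₂ = z₁ g` for some `g` in `GL(p, ℂ)`. -/
def grassSetoid (p q : ℕ) : Setoid (FullRank p q) where
  r z₁ z₂ := ∃ g : GL (Fin p) ℂ, z₂ = mulGL z₁ g
  iseqv :=
    { refl := fun z => ⟨1, Subtype.ext (by simp [mulGL])⟩
      symm := by
        rintro z₁ z₂ ⟨g, rfl⟩
        refine ⟨g⁻¹, Subtype.ext ?_⟩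
        change z₁.1 = z₁.1 * g.1 * (g⁻¹).1
        rw [Matrix.mul_assoc, ← Units.val_mul, mul_inv_cancel, Units.val_one, Matrix.mul_one]
      trans := by
        rintro z₁ z₂ z₃ ⟨g, rfl⟩ ⟨h, rfl⟩
        refine ⟨g * h, Subtype.ext ?_⟩
        change z₁.1 * g.1 * h.1 = z₁.1 * (g * h).1
        rw [Units.val_mul, Matrix.mul_assoc] }

/-- The complex Grassmann manifold `G_{p,q}(ℂ)`. -/
def Grass (p q : ℕ) : Type := Quotient (grassSetoid p q)

/-- The canonical projection `π`. -/
def proj {p q : ℕ} (z : FullRank p q) : Grass p q := Quotient.mk (grassSetoid p q) z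

/-- The algebra `C^∞(G_{p,q}(ℂ))`. Since `π` is a surjective submersion, a function on the Grassmann
manifold is smooth if and only if its pullback along `π` is. -/
def SmoothGrass (p q : ℕ) : Subalgebra ℂ (Grass p q → ℂ) where
  carrier := {f | f ∘ proj ∈ SmoothFun p q}
  mul_mem' hf hg := (SmoothFun p q).mul_mem hf hg
  add_mem' hf hg := (SmoothFun p q).add_mem hf hg
  algebraMap_mem' c := (SmoothFun p q).algebraMap_mem c

/-- The pullback `π^*`. -/
def pullback (p q : ℕ) : SmoothGrass p q →+* SmoothFun p q where
  toFun f := ⟨f.1 ∘ proj, f.2⟩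
  map_one' := rfl
  map_mul' _ _ := rfl
  map_zero' := rfl
  map_add' _ _ := rfl

/-- The pullback `π^*` of formal functions. -/
def pullbackSeries {p q : ℕ} (f : PowerSeries (SmoothGrass p q)) : PowerSeries (SmoothFun p q) :=
  PowerSeries.map (pullback p q) f

/-- Pointwise complex conjugation of smooth functions on the Grassmann manifold. -/
def conjGrass {p q : ℕ} (f : SmoothGrass p q) : SmoothGrass p q :=
  ⟨fun y => starRingEnd ℂ (f.1 y), (conjFun (pullback p q f)).2⟩

/-! ## Phase space reduction -/

/-- The level set `J⁻¹((i/2) μ)` of the momentum map `J(z) = (i/2) z† z`. -/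
def LevelSet (p q : ℕ) (μ : ℝ) : Type :=
  {z : FullRank p q // (Complex.I / 2) • (z.1ᴴ * z.1) =
    (Complex.I / 2) • ((μ : ℂ) • (1 : Matrix (Fin p) (Fin p) ℂ))}

/-- The inclusion `i` of the level set. -/
def incl {p q : ℕ} {μ : ℝ} (ζ : LevelSet p q μ) : FullRank p q := ζ.1

/-- The matrix `x^{-1/2}` for `x = z† z`, by the functional calculus of Hermitian matrices. -/
def invSqrtGram {p q : ℕ} (z : FullRank p q) : Matrix (Fin p) (Fin p) ℂ :=
  (Matrix.isHermitian_conjTranspose_mul_self z.1).cfc fun t => (√t)⁻¹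

theorem posDef_gram {p q : ℕ} (z : FullRank p q) : (z.1ᴴ * z.1).PosDef := by
  open scoped MatrixOrder in
  exact (Matrix.posSemidef_conjTranspose_mul_self z.1).posDef_iff_isUnit.mpr
    ((Matrix.isUnit_iff_isUnit_det _).mpr
      (isUnit_iff_ne_zero.mpr ((mem_fullRankSet_iff z.1).mp z.2)))

theorem invSqrtGram_spec {p q : ℕ} (z : FullRank p q) :
    (invSqrtGram z)ᴴ * (z.1ᴴ * z.1) * invSqrtGram z = 1 := by
  have hx := Matrix.isHermitian_conjTranspose_mul_self z.1
  have h1 : ∀ i, 0 < hx.eigenvalues i := (posDef_gram z).eigenvalues_pos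
  have h2 : (invSqrtGram z)ᴴ = invSqrtGram z := by
    rw [← Matrix.star_eq_conjTranspose, invSqrtGram, Matrix.IsHermitian.cfc, ← map_star,
      Matrix.star_eq_conjTranspose, Matrix.diagonal_conjTranspose]
    congr 2
    ext i
    simp
  rw [h2]
  conv_lhs =>
    enter [1, 2]
    rw [hx.spectral_theorem]
  rw [invSqrtGram, Matrix.IsHermitian.cfc, ← map_mul, ← map_mul, Matrix.diagonal_mul_diagonal,
    Matrix.diagonal_mul_diagonal, ← map_one (Unitary.conjStarAlgAut ℂ _ hx.eigenvectorUnitary),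
    ← Matrix.diagonal_one]
  congr 2
  ext i
  have h3 : (√(hx.eigenvalues i))⁻¹ * hx.eigenvalues i * (√(hx.eigenvalues i))⁻¹ = 1 := by
    have h4 := Real.sqrt_pos.mpr (h1 i)
    field_simp
    exact (Real.sq_sqrt (h1 i).le).symm
  simp only [Function.comp_apply]
  rw [← RCLike.ofReal_mul, ← RCLike.ofReal_mul]
  exact (congrArg (RCLike.ofReal (K := ℂ)) h3).trans RCLike.ofReal_one

/-- The retraction `ρ̄(z) = z (z† z)^{-1/2} μ^{1/2}` onto the level set. -/
def rhoBar {p q : ℕ} {μ : ℝ} (hμ : 0 < μ) (z : FullRank p q) : LevelSet p q μ :=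
  have h : ((((√μ : ℝ) : ℂ)) • (z.1 * invSqrtGram z))ᴴ * (((√μ : ℝ) : ℂ) • (z.1 * invSqrtGram z)) =
      (μ : ℂ) • (1 : Matrix (Fin p) (Fin p) ℂ) := by
    rw [Matrix.conjTranspose_smul, Matrix.smul_mul, Matrix.mul_smul, smul_smul,
      Matrix.conjTranspose_mul]
    have h1 := invSqrtGram_spec z
    rw [← Matrix.mul_assoc] at h1
    rw [← Matrix.mul_assoc, h1]
    congr 1
    simp only [RCLike.star_def, Complex.conj_ofReal]
    rw [← Complex.ofReal_mul, Real.mul_self_sqrt hμ.le]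
  ⟨⟨((√μ : ℝ) : ℂ) • (z.1 * invSqrtGram z), by
    rw [mem_fullRankSet_iff, h, Matrix.det_smul, Matrix.det_one, mul_one]
    exact pow_ne_zero _ (by exact_mod_cast hμ.ne')⟩, congrArg (fun M => (Complex.I / 2) • M) h⟩

/-- Pullback of arbitrary complex valued functions, as a ring homomorphism. -/
def compHom {M N : Type} (φ : M → N) : (N → ℂ) →+* (M → ℂ) where
  toFun F := F ∘ φ
  map_one' := rfl
  map_mul' _ _ := rfl
  map_zero' := rfl
  map_add' _ _ := rfl

/-- A formal smooth function, regarded as a formal function. -/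
def forget {p q : ℕ} (F : PowerSeries (SmoothFun p q)) : PowerSeries (FullRank p q → ℂ) :=
  PowerSeries.map (SmoothFun p q).val.toRingHom F

/-- The operation `ρ̄^* i^*`: restriction to the level set followed by pullback along `ρ̄`. -/
def rhoBarStarInclStar {p q : ℕ} {μ : ℝ} (hμ : 0 < μ) (F : PowerSeries (SmoothFun p q)) :
    PowerSeries (FullRank p q → ℂ) :=
  PowerSeries.map (compHom (rhoBar (p := p) (q := q) hμ))
    (PowerSeries.map (compHom (incl (p := p) (q := q) (μ := μ))) (forget F))

/-- The Poisson bracket of the reduced phase space `G_{p,q}(ℂ) = J⁻¹((i/2) μ) / U(p)`: the function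
`b` is the bracket of `f` and `g` if `π_μ^* b = i^* {π^* f, π^* g}`. -/
def IsReducedBracket {p q : ℕ} (μ : ℝ) (f g b : SmoothGrass p q) : Prop :=
  ∀ ζ : LevelSet p q μ,
    b.1 (proj (incl ζ)) = (poisson (pullback p q f) (pullback p q g)).1 (incl ζ)

/-! ## Star products -/

/-- Differential operators of order at most `k` on the Grassmann manifold, described algebraically:
order at most `0` means multiplication by a function, and order at most `k + 1` means that all
commutators with multiplication operators have order at most `k`. -/
def IsDiffOp {p q : ℕ} : ℕ → (SmoothGrass p q → SmoothGrass p q) → Prop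
  | 0, D => ∃ b, ∀ f, D f = b * f
  | k + 1, D => ∀ a, IsDiffOp k fun f => D (a * f) - a * D f

/-- A star product on `G_{p,q}(ℂ)`, as reduced phase space at level `μ`: an associative
`ℂ[[λ]]`-bilinear product on `C^∞(G_{p,q}(ℂ))[[λ]]` given by bidifferential operators, which in
zeroth order is the pointwise product, whose commutator is in first order the Poisson bracket,
for which the constant function one is a unit and complex conjugation (with `λ` real) is an
antilinear involution. The deformation parameter is normalized by
`f * g - g * f = (i λ / 2) {f, g} + O(λ²)`. -/
structure IsStarProduct {p q : ℕ} (μ : ℝ)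
    (star : PowerSeries (SmoothGrass p q) →ₗ[PowerSeries ℂ]
      PowerSeries (SmoothGrass p q) →ₗ[PowerSeries ℂ] PowerSeries (SmoothGrass p q)) : Prop where
  assoc : ∀ f g h, star (star f g) h = star f (star g h)
  one_left : ∀ f, star 1 f = f
  one_right : ∀ f, star f 1 = f
  bidifferential : ∀ n, ∃ k, ∀ f : SmoothGrass p q,
    IsDiffOp k (fun g => PowerSeries.coeff n (star (PowerSeries.C f) (PowerSeries.C g))) ∧
    IsDiffOp k (fun g => PowerSeries.coeff n (star (PowerSeries.C g) (PowerSeries.C f)))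
  zeroth : ∀ f g : SmoothGrass p q,
    PowerSeries.coeff 0 (star (PowerSeries.C f) (PowerSeries.C g)) = f * g
  first : ∀ f g : SmoothGrass p q, ∃ b, IsReducedBracket μ f g b ∧
    PowerSeries.coeff 1 (star (PowerSeries.C f) (PowerSeries.C g) -
      star (PowerSeries.C g) (PowerSeries.C f)) = (Complex.I / 2) • b
  conj : ∀ f g, mapCoeff conjGrass (star f g) =
    star (mapCoeff conjGrass g) (mapCoeff conjGrass f)

/-! ## The group algebra of the symmetric group -/

/-- The set `Con(S_r)` of conjugacy classes. -/
abbrev Con (r : ℕ) : Type := ConjClasses (Equiv.Perm (Fin r))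

/-- The number `|α|` of cycles (fixed points included) of the elements of the class `α`. -/
def numCycles {r : ℕ} (α : Con r) : ℕ :=
  Quotient.lift (s := IsConj.setoid (Equiv.Perm (Fin r))) (fun σ => σ.partition.parts.card)
    (fun _ _ h => by rw [Equiv.Perm.partition_eq_of_isConj.mp h]) α

/-- The class sum `k_α`, the sum of all permutations in `α`, in the group algebra over `R`. -/
def classSum (R : Type) [CommRing R] {r : ℕ} (α : Con r) :
    MonoidAlgebra R (Equiv.Perm (Fin r)) :=
  ∑ σ with ConjClasses.mk σ = α, MonoidAlgebra.single σ 1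

/-- The element `∑_α c^{|α|} k_α` of the group algebra of `S_r` over the field `ℂ(c)` of rational
functions. -/
def cycleSum (r : ℕ) : MonoidAlgebra (RatFunc ℂ) (Equiv.Perm (Fin r)) :=
  ∑ α : Con r, (RatFunc.X ^ numCycles α : RatFunc ℂ) • classSum (RatFunc ℂ) α

/-- The formal Laurent series `c = λ^{-1} μ + p`. -/
def cLaurent (p : ℕ) (μ : ℝ) : LaurentSeries ℂ := HahnSeries.single (-1) (μ : ℂ) + (p : LaurentSeries ℂ)

/-- The (linearly extended) action of the symmetric group on tensors, in components:
`ρ(σ) (e_{i 1} ⊗ ⋯ ⊗ e_{i r}) = e_{i (σ 1)} ⊗ ⋯ ⊗ e_{i (σ r)}`, so that the `J`-component of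
`ρ(σ) t` is the `J ∘ σ⁻¹`-component of `t`. The components lie in an `R`-module `V`. -/
def rho {R V : Type} [CommRing R] [AddCommGroup V] [Module R V] {p r : ℕ}
    (a : MonoidAlgebra R (Equiv.Perm (Fin r))) (t : (Fin r → Fin p) → V) :
    (Fin r → Fin p) → V :=
  fun J => ∑ σ : Equiv.Perm (Fin r), a.coeff σ • t (J ∘ ⇑σ⁻¹)

/-- The tensor with components `∂^r F / ∂z^{A 1}_{i 1} ⋯ ∂z^{A r}_{i r}`, for fixed `A`. -/
def tensorDz {p q r : ℕ} (A : Fin r → Fin (p + q)) (F : PowerSeries (SmoothFun p q)) :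
    (Fin r → Fin p) → PowerSeries (SmoothFun p q) :=
  fun I => mapCoeff (iterDz fun k => (A k, I k)) F

/-- The tensor with components `∂^r G / ∂z̄^{A 1}_{i 1} ⋯ ∂z̄^{A r}_{i r}`, for fixed `A`. -/
def tensorDzbar {p q r : ℕ} (A : Fin r → Fin (p + q)) (G : PowerSeries (SmoothFun p q)) :
    (Fin r → Fin p) → PowerSeries (SmoothFun p q) :=
  fun I => mapCoeff (iterDzbar fun k => (A k, I k)) G

/-- The contraction `⟨u, v⟩ = ∑ u_{i 1 ⋯ i r} v_{i 1 ⋯ i r}`. The antiholomorphic derivatives are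
already components of a conjugate tensor, so no further conjugation occurs. -/
def pairing {p q r : ℕ} (u v : (Fin r → Fin p) → PowerSeries (SmoothFun p q)) :
    PowerSeries (SmoothFun p q) :=
  ∑ I, u I * v I

/-- The summand
`(μ^r / r!) ρ̄^* i^* ∑_A ⟨ρ(∑_α S_α k_α) ∂^r F / ∂z^{A 1} ⋯ ∂z^{A r}, ∂^r G / ∂z†_{A 1} ⋯ ∂z†_{A r}⟩`
for coefficients `S_α` in `ℂ[[λ]]`. -/
def productTerm {p q : ℕ} {μ : ℝ} (hμ : 0 < μ) (r : ℕ) (S : Con r → PowerSeries ℂ)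
    (F G : PowerSeries (SmoothFun p q)) : PowerSeries (FullRank p q → ℂ) :=
  ((μ : ℂ) ^ r / (r.factorial : ℂ)) • rhoBarStarInclStar hμ
    (∑ A : Fin r → Fin (p + q),
      pairing (rho (∑ α, S α • classSum (PowerSeries ℂ) α) (tensorDz A F)) (tensorDzbar A G))

end GrassStar

end

/-! The Wick product is an exponential in commuting derivations, hence associative, and it is
U(p)-invariant. The entries of `x` are bilinear in `z` and `z̄`, so the series for a product with
them stops at first order: `G *~ (x-μ)^j_i = G (x-μ)^j_i + λ E_ij G`, with `E_ij = ∑_A z^A_i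
∂/∂z^A_j` (`wick_momentum`). Invariant functions Wick-commute with the entries of `x - μ`
(`wick_momentum_comm`), so products of elements of the ideal with invariant functions, on either
side, stay in the ideal. Once every invariant function is congruent to exactly one homogeneous one,
the projected product is therefore associative and unital. Three points carry the proof.

Existence of the projection. An invariant `F` is integrated along the path from `z` to `z x^{-1/2}
μ^{1/2}`. This writes `F` as a homogeneous function plus `∑ G_jk (x-μ)_kj` with smooth equivariant
`G` (`eq_homPart_add`). Replacing pointwise by Wick products costs an invariant term of order `λ`,
and iteration gives a `λ`-adically convergent decomposition (`exists_projection`).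

Uniqueness. The function `φ = tr x - μ log det x` satisfies `E_ij φ = (x-μ)_ji`. Integration by
parts against `exp(-N φ) det x^{-(p+q)}` times a homogeneous function therefore annihilates `u
(x-μ)_ji + λ E_ij u` at the numerical value `λ = -1/N`, up to a cutoff error which is exponentially
smaller than the main term. Testing the lowest nonzero coefficient of a homogeneous element of the
ideal against a cut-off version of its own conjugate gives a contradiction as `N → ∞`
(`eq_zero_of_pencil`, `eq_zero_of_mem_starIdeal`).

The explicit formula. Let `T_m(σ)` be the contraction of `∂^r f` and `∂̄^r g`, permuted by `σ`, with
`x` inserted in the first `m` of the `r` index pairs. Then `T_0(1)`, divided by `r!`, is the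
coefficient of `λ^r` in the Wick product, while every `T_r(σ)` is homogeneous. Modulo the ideal
`T_{m+1}(σ) = (μ + pλ) T_m(σ) + λ ∑_{k>m} T_m(σ (m k))` (`contrDeriv_succ_sub_mem`), so passing from
`m+1` to `m` is right multiplication of coefficients by a shifted Jucys-Murphy element. The product
of these elements is `∑_σ κ^{|σ|} λ^{r-|σ|} σ` with `κ = μ + pλ` (`cycleGenFrom_succ`). Its inverse
`W` exists over `ℂ[[λ]]`, and `T_0(1)` is congruent to `∑ W_σ T_r(σ)`. Since `κ = λ c`, the inverse
of `∑ c^{|σ|} σ` is `λ^r W`; this is where the functions `s_α` come from, why they are power series,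
and why the sum over `r` converges. On the level set `x = μ`, so `T_r(σ)` becomes `μ^r T_0(σ)`,
which is the stated expression. -/

noncomputable section

/-! ## Formal series in `X` and their `X`-adic sums -/

namespace PowerSeries

section LamSum

variable {A B R : Type*}

/-- The `X`-adic sum `∑ r, X ^ r * K r`. -/
def lamSum [Semiring B] (K : ℕ → PowerSeries B) : PowerSeries B :=
  mk fun n => ∑ r ∈ Finset.range (n + 1), coeff (n - r) (K r)

theorem coeff_lamSum [Semiring B] (K : ℕ → PowerSeries B) (n : ℕ) :
    coeff n (lamSum K) = ∑ r ∈ Finset.range (n + 1), coeff (n - r) (K r) := coeff_mk _ _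

/-- This recursion reduces statements about `X`-adic sums to induction on the order of a
coefficient. -/
theorem lamSum_eq_add [Semiring B] (K : ℕ → PowerSeries B) :
    lamSum K = K 0 + X * lamSum fun r => K (r + 1) := by
  ext n
  cases n with
  | zero => simp [coeff_lamSum]
  | succ n =>
    rw [coeff_lamSum, Finset.sum_range_succ', map_add, coeff_succ_X_mul, coeff_lamSum, add_comm]
    simp

theorem lamSum_add [Semiring B] (K L : ℕ → PowerSeries B) :
    (lamSum fun r => K r + L r) = lamSum K + lamSum L := by
  ext n
  simp [coeff_lamSum, Finset.sum_add_distrib]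

theorem lamSum_X_mul [Semiring B] (K : ℕ → PowerSeries B) :
    (lamSum fun r => X * K r) = X * lamSum K := by
  ext n
  cases n with
  | zero => simp [coeff_lamSum]
  | succ n =>
    rw [coeff_lamSum, Finset.sum_range_succ, coeff_succ_X_mul, coeff_lamSum]
    simp only [Nat.sub_self, coeff_zero_X_mul, add_zero]
    refine Finset.sum_congr rfl fun r hr => ?_
    rw [Nat.succ_sub (by simpa [Nat.lt_succ_iff] using hr), coeff_succ_X_mul]

theorem lamSum_C_coeff [Semiring B] (F : PowerSeries B) :
    (lamSum fun r => C (coeff r F)) = F := by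
  ext n
  rw [coeff_lamSum, Finset.sum_eq_single n]
  · simp
  · intro r hr hrn
    rw [coeff_C, if_neg]
    have := Finset.mem_range.mp hr
    omega
  · simp

theorem lamSum_congr_single [Semiring B] (K : ℕ → PowerSeries B) (h : ∀ r, r ≠ 0 → K r = 0) :
    lamSum K = K 0 := by
  rw [lamSum_eq_add]
  have : (lamSum fun r => K (r + 1)) = 0 := by
    ext n
    simp [coeff_lamSum, h]
  rw [this, mul_zero, add_zero]

/-- No continuity is assumed: commuting with `X` already forces the map to respect each order, by
peeling off one summand at a time. -/
theorem map_lamSum [Semiring A] [Semiring B] (L : PowerSeries A →+ PowerSeries B)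
    (hL : ∀ F, L (X * F) = X * L F) (K : ℕ → PowerSeries A) :
    L (lamSum K) = lamSum fun r => L (K r) := by
  ext n
  induction n generalizing K with
  | zero =>
    rw [lamSum_eq_add K, lamSum_eq_add fun r => L (K r), map_add, hL]
    simp
  | succ n ih =>
    rw [lamSum_eq_add K, lamSum_eq_add fun r => L (K r), map_add, hL, map_add, map_add,
      coeff_succ_X_mul, coeff_succ_X_mul, ih]

/-- Additive maps compatible with multiplication by `X` are determined by their values on
constants. -/
theorem addMonoidHom_eq_of_C [Semiring A] [Semiring B] (L L' : PowerSeries A →+ PowerSeries B)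
    (hL : ∀ F, L (X * F) = X * L F) (hL' : ∀ F, L' (X * F) = X * L' F)
    (h : ∀ a, L (C a) = L' (C a)) (F : PowerSeries A) : L F = L' F := by
  rw [← lamSum_C_coeff F, map_lamSum L hL, map_lamSum L' hL']
  simp only [h]

/-! ### Linear and bilinear maps of functions, extended to formal series -/

section Extend

variable [CommRing R] [CommRing A] [Algebra R A] [CommRing B] [Algebra R B]

theorem smul_series_def (c : PowerSeries R) (F : PowerSeries A) :
    c • F = map (algebraMap R A) c * F := rfl

theorem X_smul_series (F : PowerSeries A) : (X : PowerSeries R) • F = X * F := by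
  rw [smul_series_def, map_X]

theorem C_smul_series (c : R) (F : PowerSeries A) : (C c : PowerSeries R) • F = c • F := by
  ext n
  rw [smul_series_def, map_C, coeff_C_mul, coeff_smul, Algebra.smul_def]

/-- The `R⟦X⟧`-linear extension of an `R`-linear map to formal series. -/
def extendLin (L : A →ₗ[R] PowerSeries B) : PowerSeries A →ₗ[PowerSeries R] PowerSeries B :=
  let T : PowerSeries A →+ PowerSeries B :=
    { toFun := fun F => lamSum fun n => L (coeff n F)
      map_zero' := by ext n; simp [coeff_lamSum]
      map_add' := fun F G => by simp only [map_add, lamSum_add] }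
  have hX : ∀ F, T (X * F) = X * T F := fun F => by
    change lamSum _ = X * lamSum _
    rw [lamSum_eq_add]
    simp only [coeff_zero_X_mul, coeff_succ_X_mul, map_zero, zero_add]
  { toFun := T
    map_add' := T.map_add
    -- The scalar is treated as the variable: both sides are additive in `c` and commute with `X`,
    -- so constant `c` suffices.
    map_smul' := fun c F => by
      refine addMonoidHom_eq_of_C
        (T.comp ((LinearMap.toSpanSingleton (PowerSeries R) (PowerSeries A) F).toAddMonoidHom))
        ((LinearMap.toSpanSingleton (PowerSeries R) (PowerSeries B) (T F)).toAddMonoidHom)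
        (fun c => ?_) (fun c => ?_) (fun a => ?_) c
      · simp only [AddMonoidHom.coe_comp, Function.comp_apply, LinearMap.toAddMonoidHom_coe,
          LinearMap.toSpanSingleton_apply]
        rw [← smul_eq_mul X c, smul_assoc, X_smul_series, hX]
      · simp only [LinearMap.toAddMonoidHom_coe, LinearMap.toSpanSingleton_apply]
        rw [← smul_eq_mul X c, smul_assoc, X_smul_series]
      · simp only [AddMonoidHom.coe_comp, Function.comp_apply, LinearMap.toAddMonoidHom_coe,
          LinearMap.toSpanSingleton_apply, C_smul_series]
        ext n
        change coeff n (lamSum _) = coeff n (a • lamSum _)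
        rw [coeff_smul, coeff_lamSum, coeff_lamSum, Finset.smul_sum]
        simp only [coeff_smul, map_smul] }

theorem extendLin_apply (L : A →ₗ[R] PowerSeries B) (F : PowerSeries A) :
    extendLin L F = lamSum fun n => L (coeff n F) := rfl

theorem extendLin_C (L : A →ₗ[R] PowerSeries B) (a : A) : extendLin L (C a) = L a := by
  rw [extendLin_apply, lamSum_congr_single]
  · simp
  · intro r hr
    simp [coeff_C, hr]

theorem linearMap_X_mul (L : PowerSeries A →ₗ[PowerSeries R] PowerSeries B) (F : PowerSeries A) :
    L (X * F) = X * L F := by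
  rw [← X_smul_series (R := R), map_smul, X_smul_series]

/-- Applied once in each argument, this reduces identities between multilinear maps of formal series
to functions independent of the formal parameter. -/
theorem linearMap_eq_of_C (L L' : PowerSeries A →ₗ[PowerSeries R] PowerSeries B)
    (h : ∀ a, L (C a) = L' (C a)) (F : PowerSeries A) : L F = L' F :=
  addMonoidHom_eq_of_C L.toAddMonoidHom L'.toAddMonoidHom (linearMap_X_mul L) (linearMap_X_mul L')
    h F

/-- The `R⟦X⟧`-bilinear extension of an `R`-bilinear map to formal series. -/
def extendBilin {A' : Type*} [CommRing A'] [Algebra R A']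
    (β : A →ₗ[R] A' →ₗ[R] PowerSeries B) :
    PowerSeries A →ₗ[PowerSeries R] PowerSeries A' →ₗ[PowerSeries R] PowerSeries B :=
  have hadd : ∀ L L' : A' →ₗ[R] PowerSeries B, extendLin (L + L') = extendLin L + extendLin L' :=
    fun L L' => by
      ext1 F
      exact linearMap_eq_of_C _ _ (fun a => by simp [extendLin_C]) F
  have hsmul : ∀ (c : R) (L : A' →ₗ[R] PowerSeries B) (F), extendLin (c • L) F = c • extendLin L F :=
    fun c L F => by
      rw [← C_smul_series c]
      exact linearMap_eq_of_C _ (C c • extendLin L) (fun a => by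
        simp [extendLin_C, C_smul_series]) F
  have hβ : ∀ G, ∃ L : A →ₗ[R] PowerSeries B, ∀ a, L a = extendLin (β a) G := fun G =>
    ⟨{ toFun := fun a => extendLin (β a) G
       map_add' := fun a b => by simp [hadd]
       map_smul' := fun c a => by simp [hsmul] }, fun _ => rfl⟩
  LinearMap.mk₂ (PowerSeries R) (fun F G => lamSum fun n => extendLin (β (coeff n F)) G)
    (fun F F' G => by
      obtain ⟨L, hL⟩ := hβ G
      simpa only [extendLin_apply L, hL] using map_add (extendLin L) F F')
    (fun c F G => by
      obtain ⟨L, hL⟩ := hβ G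
      simpa only [extendLin_apply L, hL] using map_smul (extendLin L) c F)
    (fun F G G' => by simp only [map_add, lamSum_add])
    (fun c F G => by
      simp only [map_smul]
      exact (map_lamSum (LinearMap.lsmul (PowerSeries R) (PowerSeries B) c).toAddMonoidHom
        (linearMap_X_mul (LinearMap.lsmul (PowerSeries R) (PowerSeries B) c)) _).symm)

theorem extendBilin_C {A' : Type*} [CommRing A'] [Algebra R A']
    (β : A →ₗ[R] A' →ₗ[R] PowerSeries B) (a : A) (a' : A') :
    extendBilin β (C a) (C a') = β a a' := by
  change (lamSum fun n => extendLin (β (coeff n (C a))) (C a')) = _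
  rw [lamSum_congr_single]
  · simp [extendLin_C]
  · intro r hr
    simp [coeff_C, hr, extendLin_C]

end Extend

end LamSum

end PowerSeries
end

noncomputable section
namespace GrassStar
open Matrix
open scoped ContDiff ComplexOrder ComplexConjugate

/-! ## Calculus on full rank matrices -/

theorem fderiv_fderiv_apply_comm {E : Type*} [NormedAddCommGroup E] [NormedSpace ℝ E] {f : E → ℂ}
    {x : E} (h : ContDiffAt ℝ ∞ f x) (v w : E) :
    fderiv ℝ (fun y => fderiv ℝ f y w) x v = fderiv ℝ (fun y => fderiv ℝ f y v) x w := by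
  have hs : IsSymmSndFDerivAt ℝ f x := h.isSymmSndFDerivAt (by
    simp only [minSmoothness_of_isRCLikeNormedField]
    exact WithTop.coe_le_coe.mpr le_top)
  have hd : DifferentiableAt ℝ (fderiv ℝ f) x :=
    (h.fderiv_right (m := 1) (by exact WithTop.coe_le_coe.mpr le_top)).differentiableAt (by simp)
  have key : ∀ v w, fderiv ℝ (fun y => fderiv ℝ f y w) x v = fderiv ℝ (fderiv ℝ f) x v w :=
    fun v w => by
      rw [(hd.hasFDerivAt.clm_apply (hasFDerivAt_const w x)).fderiv]
      simp
  rw [key, key]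
  exact hs v w

section Calculus

variable {p q : ℕ}

@[ext]
theorem SmoothFun.ext {F G : SmoothFun p q} (h : ∀ z, F.1 z = G.1 z) : F = G :=
  Subtype.ext (funext h)

theorem SmoothFun.coe_add (F G : SmoothFun p q) (z) : (F + G).1 z = F.1 z + G.1 z := rfl
theorem SmoothFun.coe_sub (F G : SmoothFun p q) (z) : (F - G).1 z = F.1 z - G.1 z := rfl
theorem SmoothFun.coe_mul (F G : SmoothFun p q) (z) : (F * G).1 z = F.1 z * G.1 z := rfl
theorem SmoothFun.coe_smul (c : ℂ) (F : SmoothFun p q) (z) : (c • F).1 z = c * F.1 z := rfl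
theorem SmoothFun.coe_zero (z) : (0 : SmoothFun p q).1 z = 0 := rfl

/-- Evaluation at a point. -/
def evalAt (z : FullRank p q) : SmoothFun p q →ₐ[ℂ] ℂ :=
  (Pi.evalAlgHom ℂ (fun _ : FullRank p q => ℂ) z).comp (SmoothFun p q).val

theorem SmoothFun.coe_sum {ι : Type*} (s : Finset ι) (F : ι → SmoothFun p q) (z) :
    (∑ i ∈ s, F i).1 z = ∑ i ∈ s, (F i).1 z := map_sum (evalAt z) F s

theorem SmoothFun.coe_prod {ι : Type*} (s : Finset ι) (F : ι → SmoothFun p q) (z) :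
    (∏ i ∈ s, F i).1 z = ∏ i ∈ s, (F i).1 z := map_prod (evalAt z) F s

theorem fullRankSet_mem_nhds (z : FullRank p q) : fullRankSet p q ∈ nhds z.1 :=
  (isOpen_fullRankSet p q).mem_nhds z.2

theorem contDiffAt_zeroExt (F : SmoothFun p q) (z : FullRank p q) :
    ContDiffAt ℝ ∞ (zeroExt F.1) z.1 :=
  ContDiffOn.contDiffAt F.2 (fullRankSet_mem_nhds z)

theorem differentiableAt_zeroExt (F : SmoothFun p q) (z : FullRank p q) :
    DifferentiableAt ℝ (zeroExt F.1) z.1 :=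
  (contDiffAt_zeroExt F z).differentiableAt (by simp)

theorem zeroExt_eventuallyEq (F : SmoothFun p q) (z : FullRank p q)
    {f : Matrix (Fin (p + q)) (Fin p) ℂ → ℂ} (h : ∀ w : FullRank p q, F.1 w = f w.1) :
    zeroExt F.1 =ᶠ[nhds z.1] f := by
  filter_upwards [fullRankSet_mem_nhds z] with w hw
  exact (zeroExt_apply F.1 ⟨w, hw⟩).trans (h _)

theorem dirDeriv_apply (v) (F : SmoothFun p q) (z : FullRank p q) :
    (dirDeriv v F).1 z = fderiv ℝ (zeroExt F.1) z.1 v := rfl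

/-- Chain rule along a curve. -/
theorem hasDerivAt_zeroExt_comp (F : SmoothFun p q) (z : FullRank p q)
    {γ : ℝ → Matrix (Fin (p + q)) (Fin p) ℂ} {v} {t : ℝ} (hγ : HasDerivAt γ v t) (h : γ t = z.1) :
    HasDerivAt (fun s => zeroExt F.1 (γ s)) ((dirDeriv v F).1 z) t := by
  have hd := (differentiableAt_zeroExt F z).hasFDerivAt
  rw [← h] at hd
  have := hd.comp_hasDerivAt t hγ
  rwa [h] at this

theorem hasDerivAt_line (z v : Matrix (Fin (p + q)) (Fin p) ℂ) :
    HasDerivAt (fun t : ℝ => z + t • v) v 0 := by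
  refine hasDerivAt_pi.mpr fun A => hasDerivAt_pi.mpr fun i => ?_
  have := ((hasDerivAt_id (0 : ℝ)).smul_const (v A i)).const_add (z A i)
  simpa using this

theorem hasDerivAt_zeroExt_line (F : SmoothFun p q) (z : FullRank p q) (v) :
    HasDerivAt (fun t : ℝ => zeroExt F.1 (z.1 + t • v)) ((dirDeriv v F).1 z) 0 :=
  hasDerivAt_zeroExt_comp F z (hasDerivAt_line z.1 v) (by simp)

theorem eventually_mem_fullRankSet (z : FullRank p q)
    {γ : ℝ → Matrix (Fin (p + q)) (Fin p) ℂ} {t : ℝ} (hγ : ContinuousAt γ t) (h : γ t = z.1) :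
    ∀ᶠ s in nhds t, γ s ∈ fullRankSet p q :=
  hγ.eventually_mem (by rw [h]; exact fullRankSet_mem_nhds z)

/-- Any curve with the right velocity computes the derivative, and only its points inside the open
set of full rank matrices enter, so the junk values of the extension by zero never matter. -/
theorem dirDeriv_eq_of_hasDerivAt {F : SmoothFun p q} {z : FullRank p q} {v}
    {γ : ℝ → Matrix (Fin (p + q)) (Fin p) ℂ} {t : ℝ} (hγ : HasDerivAt γ v t) (h : γ t = z.1)
    {f : ℝ → ℂ} {c : ℂ} (hf : HasDerivAt f c t)
    (hFf : ∀ s (hs : γ s ∈ fullRankSet p q), F.1 ⟨γ s, hs⟩ = f s) : (dirDeriv v F).1 z = c := by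
  refine (hasDerivAt_zeroExt_comp F z hγ h).unique (hf.congr_of_eventuallyEq ?_)
  filter_upwards [eventually_mem_fullRankSet z hγ.continuousAt h] with s hs
  exact (zeroExt_apply F.1 ⟨_, hs⟩).trans (hFf s hs)

theorem dirDeriv_mul (v) (F G : SmoothFun p q) :
    dirDeriv v (F * G) = dirDeriv v F * G + F * dirDeriv v G := by
  ext z
  have h := (hasDerivAt_zeroExt_line F z v).mul (hasDerivAt_zeroExt_line G z v)
  rw [dirDeriv_eq_of_hasDerivAt (F := F * G) (hasDerivAt_line z.1 v) (by simp) h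
    fun s hs => by
      simp only [Pi.mul_apply]
      rw [zeroExt_apply F.1 ⟨_, hs⟩, zeroExt_apply G.1 ⟨_, hs⟩]
      rfl]
  simp only [SmoothFun.coe_add, SmoothFun.coe_mul, zero_smul, add_zero, zeroExt_apply]

theorem dirDeriv_comm (v w) (F : SmoothFun p q) :
    dirDeriv v (dirDeriv w F) = dirDeriv w (dirDeriv v F) := by
  ext z
  have key : ∀ v w, (dirDeriv v (dirDeriv w F)).1 z =
      fderiv ℝ (fun y => fderiv ℝ (zeroExt F.1) y w) z.1 v := fun v w => by
    rw [dirDeriv_apply, (zeroExt_eventuallyEq (dirDeriv w F) z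
      (f := fun y => fderiv ℝ (zeroExt F.1) y w) fun _ => rfl).fderiv_eq]
  rw [key, key]
  exact fderiv_fderiv_apply_comm (contDiffAt_zeroExt F z) v w

theorem dirDeriv_add_left (v w) (F : SmoothFun p q) :
    dirDeriv (v + w) F = dirDeriv v F + dirDeriv w F := by
  ext z
  exact map_add (fderiv ℝ (zeroExt F.1) z.1) v w

theorem dirDeriv_smul_left (r : ℝ) (v) (F : SmoothFun p q) :
    dirDeriv (r • v) F = (r : ℂ) • dirDeriv v F := by
  ext z
  exact (map_smul (fderiv ℝ (zeroExt F.1) z.1) r v).trans (Complex.real_smul ..)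

theorem dirDeriv_sum_left {ι : Type*} (s : Finset ι)
    (v : ι → Matrix (Fin (p + q)) (Fin p) ℂ) (F : SmoothFun p q) :
    dirDeriv (∑ i ∈ s, v i) F = ∑ i ∈ s, dirDeriv (v i) F := by
  ext z
  rw [SmoothFun.coe_sum]
  exact map_sum (fderiv ℝ (zeroExt F.1) z.1) v s

theorem dz_apply (a : Fin (p + q) × Fin p) (F : SmoothFun p q) :
    dz a F = (1 / 2 : ℂ) • (dirDeriv (single a.1 a.2 1) F -
      Complex.I • dirDeriv (single a.1 a.2 Complex.I) F) := rfl

theorem dzbar_apply (a : Fin (p + q) × Fin p) (F : SmoothFun p q) :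
    dzbar a F = (1 / 2 : ℂ) • (dirDeriv (single a.1 a.2 1) F +
      Complex.I • dirDeriv (single a.1 a.2 Complex.I) F) := rfl

theorem dz_mul (a) (F G : SmoothFun p q) : dz a (F * G) = dz a F * G + F * dz a G := by
  simp only [dz_apply, dirDeriv_mul, Algebra.smul_def]
  ring

theorem dzbar_mul (a) (F G : SmoothFun p q) : dzbar a (F * G) = dzbar a F * G + F * dzbar a G := by
  simp only [dzbar_apply, dirDeriv_mul, Algebra.smul_def]
  ring

theorem commute_dz_dz (a b : Fin (p + q) × Fin p) : Commute (dz a) (dz b) := by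
  refine LinearMap.ext fun F => ?_
  change dz a (dz b F) = dz b (dz a F)
  simp only [dz_apply, map_smul, map_sub, dirDeriv_comm (single a.1 a.2 _)]
  module

theorem commute_dz_dzbar (a b : Fin (p + q) × Fin p) : Commute (dz a) (dzbar b) := by
  refine LinearMap.ext fun F => ?_
  change dz a (dzbar b F) = dzbar b (dz a F)
  simp only [dz_apply, dzbar_apply, map_smul, map_add, map_sub, dirDeriv_comm (single a.1 a.2 _)]
  module

theorem commute_dzbar_dzbar (a b : Fin (p + q) × Fin p) : Commute (dzbar a) (dzbar b) := by
  refine LinearMap.ext fun F => ?_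
  change dzbar a (dzbar b F) = dzbar b (dzbar a F)
  simp only [dzbar_apply, map_smul, map_add, dirDeriv_comm (single a.1 a.2 _)]
  module

theorem dirDeriv_single (A : Fin (p + q)) (i : Fin p) (c : ℂ) (F : SmoothFun p q) :
    dirDeriv (single A i c) F = c • dz (A, i) F + conj c • dzbar (A, i) F := by
  have h : single A i c = c.re • single A i (1 : ℂ) + c.im • single A i Complex.I := by
    rw [Matrix.smul_single, Matrix.smul_single, ← Matrix.single_add]
    congr 1
    simp [Complex.re_add_im]
  rw [h, dirDeriv_add_left, dirDeriv_smul_left, dirDeriv_smul_left, dz_apply, dzbar_apply]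
  ext z
  simp only [SmoothFun.coe_add, SmoothFun.coe_sub, SmoothFun.coe_smul]
  conv_rhs => rw [← Complex.re_add_im c]
  simp only [map_add, map_mul, Complex.conj_ofReal, Complex.conj_I]
  linear_combination ((c.im : ℂ) * (dirDeriv (single A i Complex.I) F).1 z) * Complex.I_sq

/-- The derivative of `F` in direction `v` in terms of the Wirtinger derivatives. -/
theorem dirDeriv_eq_sum (v : Matrix (Fin (p + q)) (Fin p) ℂ) (F : SmoothFun p q) :
    dirDeriv v F = ∑ A, ∑ i, (v A i • dz (A, i) F + conj (v A i) • dzbar (A, i) F) := by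
  conv_lhs => rw [Matrix.matrix_eq_sum_single v]
  simp only [dirDeriv_sum_left, dirDeriv_single]

/-- The Wirtinger combination retains the part of the differential which is complex linear in `v`.
This form allows `∂/∂z` to be taken in directions that are not coordinate directions. -/
theorem dirDeriv_sub_I (v : Matrix (Fin (p + q)) (Fin p) ℂ) (F : SmoothFun p q) :
    (1 / 2 : ℂ) • (dirDeriv v F - Complex.I • dirDeriv (Complex.I • v) F) =
      ∑ A, ∑ i, v A i • dz (A, i) F := by
  simp only [dirDeriv_eq_sum, Finset.smul_sum, ← Finset.sum_sub_distrib]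
  refine Finset.sum_congr rfl fun A _ => Finset.sum_congr rfl fun i _ => ?_
  ext z
  simp only [SmoothFun.coe_add, SmoothFun.coe_sub, SmoothFun.coe_smul, Matrix.smul_apply,
    smul_eq_mul, map_mul, Complex.conj_I]
  linear_combination (1 / 2 * (conj (v A i) * (dzbar (A, i) F).1 z -
    v A i * (dz (A, i) F).1 z)) * Complex.I_sq

theorem dirDeriv_add_I (v : Matrix (Fin (p + q)) (Fin p) ℂ) (F : SmoothFun p q) :
    (1 / 2 : ℂ) • (dirDeriv v F + Complex.I • dirDeriv (Complex.I • v) F) =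
      ∑ A, ∑ i, conj (v A i) • dzbar (A, i) F := by
  simp only [dirDeriv_eq_sum, Finset.smul_sum, ← Finset.sum_add_distrib]
  refine Finset.sum_congr rfl fun A _ => Finset.sum_congr rfl fun i _ => ?_
  ext z
  simp only [SmoothFun.coe_add, SmoothFun.coe_smul, Matrix.smul_apply,
    smul_eq_mul, map_mul, Complex.conj_I]
  linear_combination (1 / 2 * (-conj (v A i) * (dzbar (A, i) F).1 z +
    v A i * (dz (A, i) F).1 z)) * Complex.I_sq

theorem dirDeriv_conjFun (v) (F : SmoothFun p q) :
    dirDeriv v (conjFun F) = conjFun (dirDeriv v F) := by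
  ext z
  refine dirDeriv_eq_of_hasDerivAt (F := conjFun F) (hasDerivAt_line z.1 v) (by simp)
    (Complex.conjCLE.hasFDerivAt.comp_hasDerivAt 0 (hasDerivAt_zeroExt_line F z v))
    fun s hs => ?_
  simp only [Function.comp_apply]
  rw [zeroExt_apply F.1 ⟨_, hs⟩]
  rfl

theorem conjFun_apply (F : SmoothFun p q) (z) : (conjFun F).1 z = conj (F.1 z) := rfl

theorem conjFun_dz (a) (F : SmoothFun p q) : conjFun (dz a F) = dzbar a (conjFun F) := by
  ext z
  simp only [dz_apply, dzbar_apply, dirDeriv_conjFun, conjFun_apply, SmoothFun.coe_add,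
    SmoothFun.coe_sub, SmoothFun.coe_smul, map_mul, map_sub, Complex.conj_I, map_div₀, map_one,
    map_ofNat]
  ring

theorem conjFun_conjFun (F : SmoothFun p q) : conjFun (conjFun F) = F := by
  ext z
  simp [conjFun_apply]

theorem conjFun_dzbar (a) (F : SmoothFun p q) : conjFun (dzbar a F) = dz a (conjFun F) := by
  rw [← conjFun_conjFun (dz a (conjFun F)), conjFun_dz, conjFun_conjFun]

theorem conjFun_mul (F G : SmoothFun p q) : conjFun (F * G) = conjFun F * conjFun G := by
  ext z
  simp [conjFun_apply, SmoothFun.coe_mul]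

theorem conjFun_add (F G : SmoothFun p q) : conjFun (F + G) = conjFun F + conjFun G := by
  ext z
  simp [conjFun_apply, SmoothFun.coe_add]

theorem conjFun_smul (c : ℂ) (F : SmoothFun p q) : conjFun (c • F) = conj c • conjFun F := by
  ext z
  simp [conjFun_apply, SmoothFun.coe_smul]

/-- Complex conjugation as a ring homomorphism. -/
def conjHom (p q : ℕ) : SmoothFun p q →+* SmoothFun p q where
  toFun := conjFun
  map_one' := by ext z; exact map_one (starRingEnd ℂ)
  map_mul' := conjFun_mul
  map_zero' := by ext z; exact map_zero (starRingEnd ℂ)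
  map_add' := conjFun_add

theorem dirDeriv_coordFun (v) (A : Fin (p + q)) (i : Fin p) :
    dirDeriv v (coordFun A i) = algebraMap ℂ _ (v A i) := by
  ext z
  have h := hasDerivAt_pi.mp (hasDerivAt_pi.mp (hasDerivAt_line z.1 v) A) i
  exact dirDeriv_eq_of_hasDerivAt (F := coordFun A i) (hasDerivAt_line z.1 v) (by simp) h
    fun _ _ => rfl

theorem dz_coordFun (A B : Fin (p + q)) (i j : Fin p) :
    dz (A, i) (coordFun B j) = if A = B ∧ i = j then 1 else 0 := by
  simp only [dz_apply, dirDeriv_coordFun, Matrix.single_apply]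
  split_ifs
  · ext z
    simp only [SmoothFun.coe_sub, SmoothFun.coe_smul]
    change 1 / 2 * (1 - Complex.I * Complex.I) = (1 : ℂ)
    rw [Complex.I_mul_I]; norm_num
  · simp

theorem dzbar_coordFun (A B : Fin (p + q)) (i j : Fin p) :
    dzbar (A, i) (coordFun B j) = 0 := by
  simp only [dzbar_apply, dirDeriv_coordFun, Matrix.single_apply]
  split_ifs
  · ext z
    simp only [SmoothFun.coe_add, SmoothFun.coe_smul]
    change 1 / 2 * (1 + Complex.I * Complex.I) = (0 : ℂ)
    rw [Complex.I_mul_I]; norm_num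
  · simp

theorem dz_conj_coordFun (A B : Fin (p + q)) (i j : Fin p) :
    dz (A, i) (conjFun (coordFun B j)) = 0 := by
  rw [← conjFun_dzbar, dzbar_coordFun]
  exact map_zero (conjHom p q)

theorem dzbar_conj_coordFun (A B : Fin (p + q)) (i j : Fin p) :
    dzbar (A, i) (conjFun (coordFun B j)) = if A = B ∧ i = j then 1 else 0 := by
  rw [← conjFun_dz, dz_coordFun, apply_ite (conjFun (p := p) (q := q))]
  exact congrArg₂ (ite _) (map_one (conjHom p q)) (map_zero (conjHom p q))

/-! ### The group action on functions -/

theorem contDiff_mul_right {m n k : Type*} [Fintype m] [Fintype n] [Fintype k]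
    (g : Matrix n k ℂ) : ContDiff ℝ ∞ fun z : Matrix m n ℂ => z * g := by
  refine contDiff_pi.mpr fun A => contDiff_pi.mpr fun i => ?_
  simp only [Matrix.mul_apply]
  exact ContDiff.sum fun j _ => ContDiff.mul
    ((contDiff_apply ℝ ℂ j).comp (contDiff_apply ℝ (n → ℂ) A)) contDiff_const

/-- The action of `GL(p, ℂ)` on smooth functions, `F ↦ (z ↦ F (z g))`. -/
def pullGL (g : GL (Fin p) ℂ) : SmoothFun p q →ₐ[ℂ] SmoothFun p q where
  toFun F := ⟨fun z => F.1 (mulGL z g), by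
    refine isSmooth_of_eqOn (f := fun z => zeroExt F.1 (z * g.1)) ?_ fun z =>
      (zeroExt_apply F.1 (mulGL z g)).symm
    refine ContDiffOn.comp (t := fullRankSet p q) F.2 ?_ fun z hz => (mulGL ⟨z, hz⟩ g).2
    exact (contDiff_mul_right g.1).contDiffOn⟩
  map_one' := rfl
  map_mul' _ _ := rfl
  map_zero' := rfl
  map_add' _ _ := rfl
  commutes' _ := rfl

theorem pullGL_apply (g : GL (Fin p) ℂ) (F : SmoothFun p q) (z) :
    (pullGL g F).1 z = F.1 (mulGL z g) := rfl

theorem dirDeriv_pullGL (g : GL (Fin p) ℂ) (v) (F : SmoothFun p q) :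
    dirDeriv v (pullGL g F) = pullGL g (dirDeriv (v * g.1) F) := by
  ext z
  have h : HasDerivAt (fun t : ℝ => (z.1 + t • v) * g.1) (v * g.1) 0 := by
    simp only [Matrix.add_mul, Matrix.smul_mul]
    exact hasDerivAt_line _ _
  refine dirDeriv_eq_of_hasDerivAt (F := pullGL g F) (hasDerivAt_line z.1 v) (by simp)
    (hasDerivAt_zeroExt_comp F (mulGL z g) h (by simp; rfl)) fun s hs => ?_
  exact (zeroExt_apply F.1 (mulGL ⟨_, hs⟩ g)).symm

theorem single_mul_eq_smul (A : Fin (p + q)) (k : Fin p) (c : ℂ) (g : Matrix (Fin p) (Fin p) ℂ)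
    (B : Fin (p + q)) (j : Fin p) : (single A k c * g) B j = if A = B then c * g k j else 0 := by
  split_ifs with h
  · subst h; simp
  · simp [Ne.symm h]

/-- Chain rule for `z ↦ z g`, which is complex linear: holomorphic derivatives pick up `g`,
antiholomorphic ones its conjugate. -/
theorem dz_pullGL (g : GL (Fin p) ℂ) (A : Fin (p + q)) (k : Fin p) (F : SmoothFun p q) :
    dz (A, k) (pullGL g F) = ∑ j, g.1 k j • pullGL g (dz (A, j) F) := by
  have h : (single A k Complex.I : Matrix (Fin (p + q)) (Fin p) ℂ) * g.1 =
      Complex.I • ((single A k 1 : Matrix (Fin (p + q)) (Fin p) ℂ) * g.1) := by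
    rw [← Matrix.smul_mul, Matrix.smul_single, smul_eq_mul, mul_one]
  rw [dz_apply, dirDeriv_pullGL, dirDeriv_pullGL, h, ← map_smul, ← map_sub, ← map_smul,
    dirDeriv_sub_I]
  simp [single_mul_eq_smul, Finset.sum_ite_eq]

theorem dzbar_pullGL (g : GL (Fin p) ℂ) (A : Fin (p + q)) (k : Fin p) (F : SmoothFun p q) :
    dzbar (A, k) (pullGL g F) = ∑ j, conj (g.1 k j) • pullGL g (dzbar (A, j) F) := by
  have h : (single A k Complex.I : Matrix (Fin (p + q)) (Fin p) ℂ) * g.1 =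
      Complex.I • ((single A k 1 : Matrix (Fin (p + q)) (Fin p) ℂ) * g.1) := by
    rw [← Matrix.smul_mul, Matrix.smul_single, smul_eq_mul, mul_one]
  rw [dzbar_apply, dirDeriv_pullGL, dirDeriv_pullGL, h, ← map_smul, ← map_add, ← map_smul,
    dirDeriv_add_I]
  simp [single_mul_eq_smul, Finset.sum_ite_eq, apply_ite (starRingEnd ℂ)]

end Calculus
end GrassStar
end

noncomputable section
namespace GrassStar
open Matrix
open scoped ContDiff ComplexOrder ComplexConjugate

/-! ## Fundamental vector fields of the action of `GL(p, ℂ)` -/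

section Fields

variable {p q : ℕ}

/-- The holomorphic vector field `∑ A, z^A_i ∂/∂z^A_j`. -/
def holE (i j : Fin p) : Module.End ℂ (SmoothFun p q) :=
  ∑ A, LinearMap.mulLeft ℂ (coordFun A i) ∘ₗ dz (A, j)

/-- The antiholomorphic vector field `∑ A, z̄^A_i ∂/∂z̄^A_j`. -/
def antiE (i j : Fin p) : Module.End ℂ (SmoothFun p q) :=
  ∑ A, LinearMap.mulLeft ℂ (conjFun (coordFun A i)) ∘ₗ dzbar (A, j)

theorem holE_apply (i j : Fin p) (F : SmoothFun p q) :
    holE i j F = ∑ A, coordFun A i * dz (A, j) F := by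
  simp [holE, LinearMap.sum_apply]

theorem antiE_apply (i j : Fin p) (F : SmoothFun p q) :
    antiE i j F = ∑ A, conjFun (coordFun A i) * dzbar (A, j) F := by
  simp [antiE, LinearMap.sum_apply]

theorem holE_mul (i j : Fin p) (F G : SmoothFun p q) :
    holE i j (F * G) = holE i j F * G + F * holE i j G := by
  simp only [holE_apply, dz_mul, Finset.sum_mul, Finset.mul_sum, ← Finset.sum_add_distrib]
  exact Finset.sum_congr rfl fun A _ => by ring

theorem coordFun_apply (A : Fin (p + q)) (i : Fin p) (z) : (coordFun A i).1 z = z.1 A i := rfl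

/-- The vectors `z B` are the directions tangent to the GL-orbits; their complex linear and
antilinear parts are spanned by the fields `E_ij` and their conjugates. -/
theorem dirDeriv_mul_matrix (z : FullRank p q) (B : Matrix (Fin p) (Fin p) ℂ)
    (F : SmoothFun p q) :
    (dirDeriv (z.1 * B) F).1 z =
      ∑ i, ∑ j, (B i j * (holE i j F).1 z + conj (B i j) * (antiE i j F).1 z) := by
  simp only [dirDeriv_eq_sum, holE_apply, antiE_apply, SmoothFun.coe_sum, SmoothFun.coe_add,
    SmoothFun.coe_smul, SmoothFun.coe_mul, conjFun_apply, coordFun_apply, Matrix.mul_apply,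
    map_sum, map_mul, Finset.sum_mul, Finset.mul_sum, ← Finset.sum_add_distrib]
  rw [Finset.sum_congr rfl fun A _ => Finset.sum_comm, Finset.sum_comm]
  refine Finset.sum_congr rfl fun i _ => ?_
  rw [Finset.sum_comm]
  exact Finset.sum_congr rfl fun j _ => Finset.sum_congr rfl fun A _ => by ring

theorem holE_eq_dirDeriv (i j : Fin p) (F : SmoothFun p q) (z : FullRank p q) :
    (holE i j F).1 z = 1 / 2 * ((dirDeriv (z.1 * single i j (1 : ℂ)) F).1 z -
      Complex.I * (dirDeriv (z.1 * single i j Complex.I) F).1 z) := by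
  have key : ∀ c : ℂ, (dirDeriv (z.1 * single i j c) F).1 z =
      c * (holE i j F).1 z + conj c * (antiE i j F).1 z := fun c => by
    rw [dirDeriv_mul_matrix, Finset.sum_eq_single i _ (by simp), Finset.sum_eq_single j _ (by simp)]
    · simp
    · intro k _ hk
      simp [hk.symm]
    · intro k _ hk
      simp [hk.symm]
  rw [key, key, Complex.conj_I]
  simp only [map_one]
  linear_combination (1 / 2 * ((holE i j F).1 z - (antiE i j F).1 z)) * Complex.I_sq

/-- The entry `(k, l)` of the matrix valued function `x = z† z`. -/
def gram (k l : Fin p) : SmoothFun p q := ∑ A, conjFun (coordFun A k) * coordFun A l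

theorem gram_apply (k l : Fin p) (z : FullRank p q) : (gram k l).1 z = (z.1ᴴ * z.1) k l := by
  simp only [gram, SmoothFun.coe_sum, SmoothFun.coe_mul, conjFun_apply, coordFun_apply,
    Matrix.mul_apply, Matrix.conjTranspose_apply]
  rfl

theorem momentumEntry_eq (μ : ℝ) (j i : Fin p) : momentumEntry (q := q) μ j i =
    gram j i - algebraMap ℂ _ (if j = i then (μ : ℂ) else 0) := rfl

theorem dz_gram (A : Fin (p + q)) (j k l : Fin p) :
    dz (A, j) (gram k l) = if j = l then conjFun (coordFun A k) else 0 := by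
  simp only [gram, map_sum, dz_mul, dz_conj_coordFun, dz_coordFun, zero_mul, zero_add]
  split_ifs with h <;> simp only [h, and_true, and_false, if_false, mul_ite, mul_one, mul_zero, Finset.sum_ite_eq,
    Finset.mem_univ, if_true, Finset.sum_const_zero]

theorem dzbar_gram (A : Fin (p + q)) (j k l : Fin p) :
    dzbar (A, j) (gram k l) = if j = k then coordFun A l else 0 := by
  simp only [gram, map_sum, dzbar_mul, dzbar_conj_coordFun, dzbar_coordFun, mul_zero, add_zero]
  split_ifs with h <;> simp only [h, and_true, and_false, if_false, ite_mul, one_mul, zero_mul, Finset.sum_ite_eq,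
    Finset.mem_univ, if_true, Finset.sum_const_zero]

theorem dz_algebraMap (a) (c : ℂ) : dz a (algebraMap ℂ (SmoothFun p q) c) = 0 := by
  have h : dz a (1 : SmoothFun p q) = dz a 1 + dz a 1 := by
    conv_lhs => rw [← mul_one (1 : SmoothFun p q), dz_mul, mul_one, one_mul]
  rw [Algebra.algebraMap_eq_smul_one, map_smul, left_eq_add.mp h, smul_zero]

theorem dzbar_algebraMap (a) (c : ℂ) : dzbar a (algebraMap ℂ (SmoothFun p q) c) = 0 := by
  have h : dzbar a (1 : SmoothFun p q) = dzbar a 1 + dzbar a 1 := by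
    conv_lhs => rw [← mul_one (1 : SmoothFun p q), dzbar_mul, mul_one, one_mul]
  rw [Algebra.algebraMap_eq_smul_one, map_smul, left_eq_add.mp h, smul_zero]

theorem holE_gram (i j k l : Fin p) :
    holE i j (gram (q := q) k l) = if j = l then gram k i else 0 := by
  rw [holE_apply]
  by_cases h : j = l
  · simp only [dz_gram, if_pos h]
    exact Finset.sum_congr rfl fun A _ => mul_comm _ _
  · simp only [dz_gram, if_neg h, mul_zero, Finset.sum_const_zero]

theorem holE_algebraMap (i j : Fin p) (c : ℂ) : holE i j (algebraMap ℂ (SmoothFun p q) c) = 0 := by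
  simp [holE_apply, dz_algebraMap]

/-! ### Infinitesimal invariance -/

theorem dirDeriv_eq_zero_of_curve {F : SmoothFun p q} {z : FullRank p q}
    {v : Matrix (Fin (p + q)) (Fin p) ℂ} {γ : ℝ → Matrix (Fin (p + q)) (Fin p) ℂ}
    (hγ : HasDerivAt γ v 0) (h0 : γ 0 = z.1)
    (h : ∀ᶠ t in nhds 0, ∃ w : FullRank p q, γ t = w.1 ∧ F.1 w = F.1 z) :
    (dirDeriv v F).1 z = 0 := by
  refine (hasDerivAt_zeroExt_comp F z hγ h0).unique
    ((hasDerivAt_const (0 : ℝ) (F.1 z)).congr_of_eventuallyEq ?_)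
  filter_upwards [h] with t ⟨w, hw, hF⟩
  rw [hw, zeroExt_apply, hF]

theorem hasDerivAt_add_smul {m n : Type*} [Fintype m] [Fintype n] (z v : Matrix m n ℂ)
    {f : ℝ → ℂ} {c : ℂ} {t : ℝ} (hf : HasDerivAt f c t) :
    HasDerivAt (fun t : ℝ => z + f t • v) (c • v) t := by
  refine hasDerivAt_pi.mpr fun A => hasDerivAt_pi.mpr fun i => ?_
  exact (hf.mul_const (v A i)).const_add (z A i)

theorem dirDeriv_eq_zero_of_homogeneous {F : SmoothFun p q} (hF : ∀ g, pullGL g F = F)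
    (z : FullRank p q) (B : Matrix (Fin p) (Fin p) ℂ) : (dirDeriv (z.1 * B) F).1 z = 0 := by
  have hcont : ContinuousAt (fun t : ℝ => (1 + (t : ℂ) • B).det) 0 := by
    refine Continuous.continuousAt (Continuous.matrix_det ?_)
    exact continuous_const.add (Complex.continuous_ofReal.smul continuous_const)
  have hev : ∀ᶠ t : ℝ in nhds 0, (1 + (t : ℂ) • B).det ≠ 0 :=
    hcont.eventually_ne (by simp)
  have hγ := hasDerivAt_add_smul z.1 (z.1 * B) (Complex.ofRealCLM.hasDerivAt (x := 0))
  simp only [Complex.ofRealCLM_apply, Complex.ofReal_one, one_smul] at hγ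
  refine dirDeriv_eq_zero_of_curve hγ (by simp) ?_
  filter_upwards [hev] with t ht
  refine ⟨mulGL z (Matrix.GeneralLinearGroup.mkOfDetNeZero _ ht), ?_, ?_⟩
  · change _ = z.1 * (1 + (t : ℂ) • B)
    rw [Matrix.mul_add, Matrix.mul_one, Matrix.mul_smul]
  · exact congrArg (fun F => F.1 z) (hF (Matrix.GeneralLinearGroup.mkOfDetNeZero _ ht))

/-- The derivative vanishes along `z e_ij` and along `z (i e_ij)`; combining the two separates the
holomorphic from the antiholomorphic field. -/
theorem holE_antiE_eq_zero_of_homogeneous {F : SmoothFun p q} (hF : ∀ g, pullGL g F = F)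
    (i j : Fin p) : holE i j F = 0 ∧ antiE i j F = 0 := by
  have key : ∀ (c : ℂ) (z : FullRank p q),
      c * (holE i j F).1 z + conj c * (antiE i j F).1 z = 0 := fun c z => by
    rw [← dirDeriv_eq_zero_of_homogeneous hF z (single i j c), dirDeriv_mul_matrix,
      Finset.sum_eq_single i _ (by simp), Finset.sum_eq_single j _ (by simp)]
    · simp
    · intro k _ hk
      simp [hk.symm]
    · intro k _ hk
      simp [hk.symm]
  have h1 := key 1
  have h2 := key Complex.I
  simp only [map_one, one_mul, Complex.conj_I] at h1 h2
  have h3 : ∀ z, (holE i j F).1 z = (antiE i j F).1 z := fun z => by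
    have := mul_left_cancel₀ Complex.I_ne_zero
      (show Complex.I * ((holE i j F).1 z - (antiE i j F).1 z) = Complex.I * 0 by
        linear_combination h2 z)
    linear_combination this
  have h4 : ∀ z, (antiE i j F).1 z = 0 := fun z => by linear_combination (h1 z - h3 z) / 2
  exact ⟨SmoothFun.ext fun z => (h3 z).trans (h4 z), SmoothFun.ext h4⟩

/-- The action of `U(p)` on smooth functions. -/
abbrev pullU (U : Matrix.unitaryGroup (Fin p) ℂ) : SmoothFun p q →ₐ[ℂ] SmoothFun p q :=
  pullGL (Unitary.toUnits U)

/-- For an orthogonal projection `exp(itP) = 1 + (exp(it) - 1) P`, which gives one-parameter groups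
of unitary matrices in closed form. -/
theorem unitary_of_projection {P : Matrix (Fin p) (Fin p) ℂ} (hP : P * P = P) (hP' : Pᴴ = P)
    (t : ℝ) : 1 + (Complex.exp (t * Complex.I) - 1) • P ∈ Matrix.unitaryGroup (Fin p) ℂ := by
  rw [Matrix.mem_unitaryGroup_iff, Matrix.star_eq_conjTranspose, Matrix.conjTranspose_add,
    Matrix.conjTranspose_smul, hP', Matrix.conjTranspose_one]
  simp only [Matrix.add_mul, Matrix.mul_add, Matrix.one_mul, Matrix.mul_one, Matrix.smul_mul,
    Matrix.mul_smul, hP]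
  have h : star (Complex.exp (t * Complex.I) - 1) = Complex.exp (-(t * Complex.I)) - 1 := by
    simp only [star_sub, star_one, Complex.star_def]
    rw [← Complex.exp_conj]
    simp
  have h2 : Complex.exp (t * Complex.I) * Complex.exp (-(t * Complex.I)) = 1 := by
    rw [← Complex.exp_add]; simp
  rw [h]
  ext i j
  simp only [Matrix.add_apply, Matrix.smul_apply, smul_eq_mul]
  linear_combination (P i j) * h2

theorem dirDeriv_eq_zero_of_invariant {F : SmoothFun p q} (hF : ∀ U, pullU U F = F)
    (z : FullRank p q) {P : Matrix (Fin p) (Fin p) ℂ} (hP : P * P = P) (hP' : Pᴴ = P) :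
    (dirDeriv (z.1 * (Complex.I • P)) F).1 z = 0 := by
  have hf : HasDerivAt (fun t : ℝ => Complex.exp (t * Complex.I) - 1) Complex.I 0 := by
    have h1 : HasDerivAt (fun t : ℂ => Complex.exp (t * Complex.I) - 1) Complex.I
        ((0 : ℝ) : ℂ) := by
      have := (((hasDerivAt_id ((0 : ℝ) : ℂ)).mul_const Complex.I).cexp).sub_const 1
      simpa using this
    exact h1.comp_ofReal
  have hγ := hasDerivAt_add_smul z.1 (z.1 * P) hf
  rw [← Matrix.mul_smul] at hγ
  refine dirDeriv_eq_zero_of_curve hγ (by simp) (Filter.Eventually.of_forall fun t => ?_)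
  let U : Matrix.unitaryGroup (Fin p) ℂ := ⟨_, unitary_of_projection hP hP' t⟩
  refine ⟨mulU z U, ?_, congrArg (fun F => F.1 z) (hF U)⟩
  change _ = z.1 * (1 + (Complex.exp (t * Complex.I) - 1) • P)
  rw [Matrix.mul_add, Matrix.mul_one, Matrix.mul_smul]

/-- Invariance kills the derivatives in the skew-Hermitian directions `z (iP)`. Written in the
fields `E_ij` and their conjugates, this says that the matrix of differences is orthogonal to every
projection `P`, and projections span all matrices over `ℂ`. -/
theorem holE_eq_antiE_of_invariant {F : SmoothFun p q} (hF : ∀ U, pullU U F = F)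
    (i j : Fin p) : holE i j F = antiE j i F := by
  ext z
  have key : ∀ P : Matrix (Fin p) (Fin p) ℂ, P * P = P → Pᴴ = P →
      ∑ i, ∑ j, P i j * ((holE i j F).1 z - (antiE j i F).1 z) = 0 := fun P hP hP' => by
    have h := dirDeriv_eq_zero_of_invariant hF z hP hP'
    rw [dirDeriv_mul_matrix] at h
    have hc : ∀ i j, conj (P i j) = P j i := fun i j => by
      conv_rhs => rw [← hP']
      rfl
    simp only [Matrix.smul_apply, smul_eq_mul, map_mul, hc, Complex.conj_I,
      Finset.sum_add_distrib] at h
    rw [Finset.sum_comm (f := fun i j => -Complex.I * P j i * (antiE i j F).1 z)] at h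
    rw [← Finset.sum_add_distrib] at h
    simp only [← Finset.sum_add_distrib] at h
    refine mul_left_cancel₀ Complex.I_ne_zero ?_
    rw [mul_zero, ← h, Finset.mul_sum]
    refine Finset.sum_congr rfl fun i _ => ?_
    rw [Finset.mul_sum]
    exact Finset.sum_congr rfl fun j _ => by ring
  have hsum : ∀ (i j : Fin p) (c : ℂ) (M : Fin p → Fin p → ℂ),
      ∑ k, ∑ l, (single i j c : Matrix (Fin p) (Fin p) ℂ) k l * M k l = c * M i j :=
    fun i j c M => by
      rw [Finset.sum_eq_single i _ (by simp), Finset.sum_eq_single j _ (by simp)]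
      · simp
      · intro k _ hk
        simp [hk.symm]
      · intro k _ hk
        simp [hk.symm]
  set M : Fin p → Fin p → ℂ := fun i j => (holE i j F).1 z - (antiE j i F).1 z with hM
  have hdiag : ∀ i, M i i = 0 := fun i => by
    have := key (single i i 1) (by simp) (by simp)
    rw [hsum] at this
    simpa using this
  suffices M i j = 0 by exact sub_eq_zero.mp this
  rcases eq_or_ne i j with rfl | hij
  · exact hdiag i
  -- The matrix is the projection onto a line in the span of `e_i` and `e_j`; the phases `c = 1` and
  -- `c = i` isolate a single off-diagonal entry.
  have hoff : ∀ c : ℂ, c * conj c = 1 → c * M i j + conj c * M j i = 0 := fun c hc => by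
    have h := key ((1 / 2 : ℂ) • (single i i 1 + single j j 1 + single i j c + single j i (conj c)))
      (by
        have hc' : conj c * c = 1 := by rw [mul_comm]; exact hc
        simp only [Matrix.smul_mul, Matrix.mul_smul, Matrix.add_mul, Matrix.mul_add,
          Matrix.single_mul_single_same, Matrix.single_mul_single_of_ne _ _ _ _ hij,
          Matrix.single_mul_single_of_ne _ _ _ _ hij.symm, hc, hc', one_mul, mul_one]
        module)
      (by
        simp only [Matrix.conjTranspose_smul, Matrix.conjTranspose_add,
          Matrix.conjTranspose_single]
        simp
        abel)
    simp only [Matrix.smul_apply, Matrix.add_apply, smul_eq_mul, mul_assoc, ← Finset.mul_sum,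
      add_mul, Finset.sum_add_distrib] at h
    have h' := fun i j c => hsum i j c M
    simp only [hM] at h' hdiag
    rw [h', h', h', h', hdiag, hdiag] at h
    simp only [hM]
    linear_combination 2 * h
  have h1 := hoff 1 (by simp)
  have h2 := hoff Complex.I (by simp)
  simp only [map_one, one_mul, Complex.conj_I] at h1 h2
  have h3 : Complex.I * (M i j - M j i) = Complex.I * 0 := by linear_combination h2
  have h4 := mul_left_cancel₀ Complex.I_ne_zero h3
  linear_combination (h1 + h4) / 2

end Fields
end GrassStar
end

noncomputable section

/-! ## Products of exponential type -/

namespace ExpProduct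
open TensorProduct PowerSeries

section

variable {A ι : Type*} [CommRing A] [Algebra ℂ A] [Fintype ι] (D D' : ι → Module.End ℂ A)

/-- The bidifferential operator `∑ a, D a ⊗ D' a`. -/
def bidiff : Module.End ℂ (A ⊗[ℂ] A) := ∑ a, TensorProduct.map (D a) (D' a)

theorem bidiff_tmul (u v : A) : bidiff D D' (u ⊗ₜ v) = ∑ a, D a u ⊗ₜ D' a v := by
  simp [bidiff, LinearMap.sum_apply]

theorem bidiff_pow_tmul (r : ℕ) (u v : A) : (bidiff D D' ^ r) (u ⊗ₜ v) =
    ∑ a : Fin r → ι, (List.ofFn fun k => D (a k)).prod u ⊗ₜ[ℂ] (List.ofFn fun k => D' (a k)).prod v := by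
  induction r with
  | zero => simp
  | succ r ih =>
    rw [pow_succ', Module.End.mul_apply, ih, map_sum, ← (Fin.consEquiv fun _ => ι).sum_comp,
      Fintype.sum_prod_type, Finset.sum_comm]
    refine Finset.sum_congr rfl fun a _ => ?_
    rw [bidiff_tmul]
    refine Finset.sum_congr rfl fun b _ => ?_
    simp [List.ofFn_succ, Fin.consEquiv]

/-- The bilinear map `(u, v) ↦ ∑ r, X ^ r / r! * m ((∑ a, D a ⊗ D' a) ^ r (u ⊗ v))`. -/
def coeffMap : A →ₗ[ℂ] A →ₗ[ℂ] PowerSeries A :=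
  LinearMap.mk₂ ℂ (fun u v => PowerSeries.mk fun r =>
      (r.factorial : ℂ)⁻¹ • LinearMap.mul' ℂ A ((bidiff D D' ^ r) (u ⊗ₜ v)))
    (fun u u' v => by ext; simp [TensorProduct.add_tmul])
    (fun c u v => by ext; simp [← TensorProduct.smul_tmul', smul_comm c])
    (fun u v v' => by ext; simp [TensorProduct.tmul_add])
    (fun c u v => by ext; simp [smul_comm c])

theorem coeff_coeffMap (u v : A) (r : ℕ) : coeff r (coeffMap D D' u v) =
    (r.factorial : ℂ)⁻¹ • LinearMap.mul' ℂ A ((bidiff D D' ^ r) (u ⊗ₜ v)) := by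
  rw [coeffMap, LinearMap.mk₂_apply, coeff_mk]

/-- The product `F ⋆ G = ∑ r, X ^ r / r! * m ((∑ a, D a ⊗ D' a) ^ r (F ⊗ G))`. -/
def product : PowerSeries A →ₗ[PowerSeries ℂ] PowerSeries A →ₗ[PowerSeries ℂ] PowerSeries A :=
  extendBilin (coeffMap D D')

theorem product_C_C (u v : A) : product D D' (C u) (C v) = coeffMap D D' u v :=
  extendBilin_C _ _ _

theorem product_C_right (F : PowerSeries A) (v : A) :
    product D D' F (C v) = lamSum fun n => coeffMap D D' (coeff n F) v := by
  change (lamSum fun n => extendLin (coeffMap D D' (coeff n F)) (C v)) = _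
  simp only [extendLin_C]

theorem product_C_left (u : A) (G : PowerSeries A) :
    product D D' (C u) G = lamSum fun n => coeffMap D D' u (coeff n G) := by
  change (lamSum fun n => extendLin (coeffMap D D' (coeff n (C u))) G) = _
  rw [lamSum_congr_single]
  · simp [extendLin_apply]
  · intro r hr
    simp [coeff_C, hr, extendLin_apply, lamSum_congr_single]

/-- `D a ⊗ D' a ⊗ 1`. -/
def bidiff12 : Module.End ℂ (A ⊗[ℂ] (A ⊗[ℂ] A)) :=
  ∑ a, TensorProduct.map (D a) (TensorProduct.map (D' a) LinearMap.id)
/-- `D a ⊗ 1 ⊗ D' a`. -/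
def bidiff13 : Module.End ℂ (A ⊗[ℂ] (A ⊗[ℂ] A)) :=
  ∑ a, TensorProduct.map (D a) (TensorProduct.map LinearMap.id (D' a))
/-- `1 ⊗ D a ⊗ D' a`. -/
def bidiff23 : Module.End ℂ (A ⊗[ℂ] (A ⊗[ℂ] A)) :=
  ∑ a, TensorProduct.map LinearMap.id (TensorProduct.map (D a) (D' a))

theorem bidiff12_tmul (u v w : A) :
    bidiff12 D D' (u ⊗ₜ (v ⊗ₜ w)) = ∑ a, D a u ⊗ₜ (D' a v ⊗ₜ w) := by
  simp [bidiff12, LinearMap.sum_apply]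
theorem bidiff13_tmul (u v w : A) :
    bidiff13 D D' (u ⊗ₜ (v ⊗ₜ w)) = ∑ a, D a u ⊗ₜ (v ⊗ₜ D' a w) := by
  simp [bidiff13, LinearMap.sum_apply]
theorem bidiff23_tmul (u v w : A) :
    bidiff23 D D' (u ⊗ₜ (v ⊗ₜ w)) = ∑ a, u ⊗ₜ (D a v ⊗ₜ D' a w) := by
  simp [bidiff23, LinearMap.sum_apply]

theorem end_ext {V : Type*} [AddCommGroup V] [Module ℂ V] {f g : A ⊗[ℂ] (A ⊗[ℂ] A) →ₗ[ℂ] V}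
    (h : ∀ u v w, f (u ⊗ₜ (v ⊗ₜ w)) = g (u ⊗ₜ (v ⊗ₜ w))) : f = g := by
  refine TensorProduct.ext' fun u x => ?_
  induction x with
  | zero => simp
  | tmul v w => exact h u v w
  | add x y hx hy => rw [TensorProduct.tmul_add, map_add, map_add, hx, hy]

variable {D D'}

theorem apply_comm {S T : Module.End ℂ A} (h : Commute S T) (u : A) : S (T u) = T (S u) :=
  LinearMap.congr_fun h.eq u

theorem commute_12_13 (hD : ∀ a b, Commute (D a) (D b)) : Commute (bidiff12 D D') (bidiff13 D D') := by
  refine end_ext fun u v w => ?_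
  simp only [Module.End.mul_apply, bidiff12_tmul, bidiff13_tmul, map_sum]
  rw [Finset.sum_comm]
  simp only [apply_comm (hD _ _) u]

theorem commute_12_23 (hDD' : ∀ a b, Commute (D a) (D' b)) : Commute (bidiff12 D D') (bidiff23 D D') := by
  refine end_ext fun u v w => ?_
  simp only [Module.End.mul_apply, bidiff12_tmul, bidiff23_tmul, map_sum]
  rw [Finset.sum_comm]
  simp only [apply_comm (hDD' _ _) v]

theorem commute_13_23 (hD' : ∀ a b, Commute (D' a) (D' b)) : Commute (bidiff13 D D') (bidiff23 D D') := by
  refine end_ext fun u v w => ?_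
  simp only [Module.End.mul_apply, bidiff13_tmul, bidiff23_tmul, map_sum]
  rw [Finset.sum_comm]
  simp only [apply_comm (hD' _ _) w]

variable (A) in
/-- `u ⊗ (v ⊗ w) ↦ (u * v) ⊗ w`. -/
def mul12 : A ⊗[ℂ] (A ⊗[ℂ] A) →ₗ[ℂ] A ⊗[ℂ] A :=
  TensorProduct.map (LinearMap.mul' ℂ A) LinearMap.id ∘ₗ
    (TensorProduct.assoc ℂ A A A).symm.toLinearMap

variable (A) in
/-- `u ⊗ (v ⊗ w) ↦ u ⊗ (v * w)`. -/
def mul23 : A ⊗[ℂ] (A ⊗[ℂ] A) →ₗ[ℂ] A ⊗[ℂ] A :=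
  TensorProduct.map LinearMap.id (LinearMap.mul' ℂ A)

theorem mul12_tmul (u v w : A) : mul12 A (u ⊗ₜ (v ⊗ₜ w)) = (u * v) ⊗ₜ w := by simp [mul12]
theorem mul23_tmul (u v w : A) : mul23 A (u ⊗ₜ (v ⊗ₜ w)) = u ⊗ₜ (v * w) := by simp [mul23]

theorem comp_pow {V W : Type*} [AddCommGroup V] [Module ℂ V] [AddCommGroup W] [Module ℂ W]
    {f : V →ₗ[ℂ] W} {P : Module.End ℂ W} {Q : Module.End ℂ V} (h : P ∘ₗ f = f ∘ₗ Q) (r : ℕ)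
    (x : V) : (P ^ r) (f x) = f ((Q ^ r) x) := by
  induction r with
  | zero => simp
  | succ r ih =>
    rw [pow_succ', Module.End.mul_apply, ih, pow_succ', Module.End.mul_apply]
    exact LinearMap.congr_fun h _

/-! ### Associativity of exponential products of commuting derivations -/

section Leibniz

variable (hL : ∀ a u v, D a (u * v) = D a u * v + u * D a v)
  (hL' : ∀ a u v, D' a (u * v) = D' a u * v + u * D' a v)

-- The Leibniz rule for the `D a`: differentiating `u v` against `w` differentiates either `u` or
-- `v` against `w`.
include hL in
theorem bidiff_mul12 :
    bidiff D D' ∘ₗ mul12 A = mul12 A ∘ₗ (bidiff13 D D' + bidiff23 D D') := by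
  refine end_ext fun u v w => ?_
  simp only [LinearMap.comp_apply, LinearMap.add_apply, mul12_tmul, bidiff_tmul, bidiff13_tmul,
    bidiff23_tmul, map_sum, map_add, hL, TensorProduct.add_tmul, Finset.sum_add_distrib]

include hL' in
theorem bidiff_mul23 :
    bidiff D D' ∘ₗ mul23 A = mul23 A ∘ₗ (bidiff12 D D' + bidiff13 D D') := by
  refine end_ext fun u v w => ?_
  simp only [LinearMap.comp_apply, LinearMap.add_apply, mul23_tmul, bidiff_tmul, bidiff12_tmul,
    bidiff13_tmul, map_sum, map_add, hL', TensorProduct.tmul_add, Finset.sum_add_distrib]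

theorem mul12_bidiff12 (s : ℕ) (u v w : A) : mul12 A ((bidiff12 D D' ^ s) (u ⊗ₜ (v ⊗ₜ w))) =
    LinearMap.mul' ℂ A ((bidiff D D' ^ s) (u ⊗ₜ v)) ⊗ₜ w := by
  let f : A ⊗[ℂ] A →ₗ[ℂ] A ⊗[ℂ] (A ⊗[ℂ] A) :=
    (TensorProduct.assoc ℂ A A A).toLinearMap ∘ₗ (TensorProduct.mk ℂ (A ⊗[ℂ] A) A).flip w
  have hf : bidiff12 D D' ∘ₗ f = f ∘ₗ bidiff D D' := by
    refine TensorProduct.ext' fun u v => ?_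
    simp [f, bidiff12_tmul, bidiff_tmul]
  have h := comp_pow hf s (u ⊗ₜ v)
  have h1 : f (u ⊗ₜ v) = u ⊗ₜ (v ⊗ₜ w) := by simp [f]
  rw [h1] at h
  rw [h]
  simp [f, mul12]

theorem mul23_bidiff23 (s : ℕ) (u v w : A) : mul23 A ((bidiff23 D D' ^ s) (u ⊗ₜ (v ⊗ₜ w))) =
    u ⊗ₜ LinearMap.mul' ℂ A ((bidiff D D' ^ s) (v ⊗ₜ w)) := by
  let f : A ⊗[ℂ] A →ₗ[ℂ] A ⊗[ℂ] (A ⊗[ℂ] A) := TensorProduct.mk ℂ A (A ⊗[ℂ] A) u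
  have hf : bidiff23 D D' ∘ₗ f = f ∘ₗ bidiff D D' := by
    refine TensorProduct.ext' fun v w => ?_
    simp [f, bidiff23_tmul, bidiff_tmul]
  have h := comp_pow hf s (v ⊗ₜ w)
  change (bidiff23 D D' ^ s) (u ⊗ₜ (v ⊗ₜ w)) = _ at h
  rw [h]
  simp [f, mul23]

/-- The degree `n` part of `exp S exp T = exp (S + T)` for commuting operators, that is, the
binomial theorem. -/
theorem sum_pow_mul_pow {V : Type*} [AddCommGroup V] [Module ℂ V] {S T : Module.End ℂ V}
    (h : Commute S T) (n : ℕ) :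
    ∑ r ∈ Finset.range (n + 1), (((n - r).factorial : ℂ)⁻¹ * (r.factorial : ℂ)⁻¹) •
      (S ^ (n - r) * T ^ r) = (n.factorial : ℂ)⁻¹ • (S + T) ^ n := by
  rw [add_comm S T, h.symm.add_pow, Finset.smul_sum]
  refine Finset.sum_congr rfl fun r hr => ?_
  have hr : r ≤ n := by simpa [Nat.lt_succ_iff] using hr
  rw [(h.symm.pow_pow r (n - r)).eq, ← nsmul_eq_mul', ← Nat.cast_smul_eq_nsmul ℂ, smul_smul,
    Nat.cast_choose ℂ hr]
  congr 1
  have := Nat.factorial_ne_zero n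
  have := Nat.factorial_ne_zero r
  have := Nat.factorial_ne_zero (n - r)
  field_simp

include hL hL'

/-- With `B_12`, `B_13`, `B_23` acting on three tensor factors, the Leibniz rules turn both
bracketings into full multiplication after `exp(λ(B_12 + B_13 + B_23))`, because the three operators
commute. -/
theorem product_assoc (hD : ∀ a b, Commute (D a) (D b)) (hDD' : ∀ a b, Commute (D a) (D' b))
    (hD' : ∀ a b, Commute (D' a) (D' b)) (F G H : PowerSeries A) :
    product D D' (product D D' F G) H = product D D' F (product D D' G H) := by
  set P := product D D' with hP
  have key : ∀ u v w, P (P (C u) (C v)) (C w) = P (C u) (P (C v) (C w)) := fun u v w => by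
    rw [hP, product_C_C, product_C_C, product_C_right, product_C_left]
    ext n
    have hl : coeff n (lamSum fun s => coeffMap D D' (coeff s (coeffMap D D' u v)) w) =
        (LinearMap.mul' ℂ A) (mul12 A ((∑ s ∈ Finset.range (n + 1),
          (((n - s).factorial : ℂ)⁻¹ * (s.factorial : ℂ)⁻¹) •
          ((bidiff13 D D' + bidiff23 D D') ^ (n - s) * bidiff12 D D' ^ s)) (u ⊗ₜ (v ⊗ₜ w)))) := by
      simp only [coeff_lamSum, coeff_coeffMap, LinearMap.sum_apply, LinearMap.smul_apply,
        Module.End.mul_apply, map_sum, map_smul, ← comp_pow (bidiff_mul12 hL), mul12_bidiff12,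
        PowerSeries.coeff_smul, smul_smul, mul_comm]
    have hr : coeff n (lamSum fun s => coeffMap D D' u (coeff s (coeffMap D D' v w))) =
        (LinearMap.mul' ℂ A) (mul23 A ((∑ s ∈ Finset.range (n + 1),
          (((n - s).factorial : ℂ)⁻¹ * (s.factorial : ℂ)⁻¹) •
          ((bidiff12 D D' + bidiff13 D D') ^ (n - s) * bidiff23 D D' ^ s)) (u ⊗ₜ (v ⊗ₜ w)))) := by
      simp only [coeff_lamSum, coeff_coeffMap, LinearMap.sum_apply, LinearMap.smul_apply,
        Module.End.mul_apply, map_sum, map_smul, ← comp_pow (bidiff_mul23 hL'), mul23_bidiff23,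
        PowerSeries.coeff_smul, smul_smul, mul_comm]
    have hm : ∀ x, LinearMap.mul' ℂ A (mul12 A x) = LinearMap.mul' ℂ A (mul23 A x) := fun x => by
      refine LinearMap.congr_fun (f := LinearMap.mul' ℂ A ∘ₗ mul12 A)
        (g := LinearMap.mul' ℂ A ∘ₗ mul23 A) (end_ext fun u v w => ?_) x
      simp [mul12_tmul, mul23_tmul, mul_assoc]
    have h12 := commute_12_13 (D' := D') hD
    have h23 := commute_12_23 hDD'
    have h13 := commute_13_23 (D := D) hD'
    rw [hl, hr, hm, sum_pow_mul_pow (h12.symm.add_left h23.symm),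
      sum_pow_mul_pow (h23.add_left h13)]
    congr 5
    abel
  have k1 : ∀ u v H, P (P (C u) (C v)) H = P (C u) (P (C v) H) := fun u v H =>
    linearMap_eq_of_C (P (P (C u) (C v))) (P (C u) ∘ₗ P (C v)) (key u v) H
  have k2 : ∀ u G H, P (P (C u) G) H = P (C u) (P G H) := fun u G H =>
    linearMap_eq_of_C (P.flip H ∘ₗ P (C u)) (P (C u) ∘ₗ P.flip H) (fun v => k1 u v H) G
  exact linearMap_eq_of_C (P.flip H ∘ₗ P.flip G) (P.flip (P G H)) (fun u => k2 u G H) F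

end Leibniz

/-- Algebra endomorphisms which preserve the bidifferential operator preserve the product. -/
theorem map_product {R : A →ₐ[ℂ] A}
    (hR : ∀ u v, ∑ a, D a (R u) ⊗ₜ[ℂ] D' a (R v) = ∑ a, R (D a u) ⊗ₜ[ℂ] R (D' a v))
    (F G : PowerSeries A) : PowerSeries.map R.toRingHom (product D D' F G) =
      product D D' (PowerSeries.map R.toRingHom F) (PowerSeries.map R.toRingHom G) := by
  let M : PowerSeries A →ₗ[PowerSeries ℂ] PowerSeries A :=
    { toFun := PowerSeries.map R.toRingHom
      map_add' := map_add _
      map_smul' := fun c F => by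
        rw [smul_series_def, smul_series_def, map_mul, ← RingHom.comp_apply, ← PowerSeries.map_comp]
        congr 3
        ext x
        simp }
  have key : ∀ u v, M (product D D' (C u) (C v)) = product D D' (M (C u)) (M (C v)) :=
    fun u v => by
      change PowerSeries.map R.toRingHom _ = product D D' (PowerSeries.map R.toRingHom _)
        (PowerSeries.map R.toRingHom _)
      rw [PowerSeries.map_C, PowerSeries.map_C, product_C_C, product_C_C]
      ext n
      have hf : bidiff D D' ∘ₗ TensorProduct.map R.toLinearMap R.toLinearMap =
          TensorProduct.map R.toLinearMap R.toLinearMap ∘ₗ bidiff D D' := by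
        refine TensorProduct.ext' fun u v => ?_
        simpa [bidiff_tmul] using hR u v
      have h := comp_pow hf n (u ⊗ₜ v)
      rw [TensorProduct.map_tmul] at h
      have hm : ∀ x, LinearMap.mul' ℂ A (TensorProduct.map R.toLinearMap R.toLinearMap x) =
          R (LinearMap.mul' ℂ A x) := fun x => by
        refine LinearMap.congr_fun (f := LinearMap.mul' ℂ A ∘ₗ TensorProduct.map R.toLinearMap
          R.toLinearMap) (g := R.toLinearMap ∘ₗ LinearMap.mul' ℂ A)
          (TensorProduct.ext' fun u v => ?_) x
        simp
      rw [PowerSeries.coeff_map, coeff_coeffMap, coeff_coeffMap]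
      change R _ = (n.factorial : ℂ)⁻¹ • LinearMap.mul' ℂ A
        ((bidiff D D' ^ n) (R.toLinearMap u ⊗ₜ R.toLinearMap v))
      rw [h, hm, map_smul]
  have k1 : ∀ u G, M (product D D' (C u) G) = product D D' (M (C u)) (M G) := fun u G =>
    linearMap_eq_of_C (M ∘ₗ product D D' (C u)) (product D D' (M (C u)) ∘ₗ M) (key u) G
  exact linearMap_eq_of_C (M ∘ₗ (product D D').flip G) ((product D D').flip (M G) ∘ₗ M)
    (fun u => k1 u G) F

end

end ExpProduct
end

noncomputable section

/-! ## Coefficientwise linear maps and the explicit form of the product -/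

namespace GrassStar
open PowerSeries

theorem coeff_mapCoeff {R S : Type} [Semiring R] [Semiring S] (T : R → S) (F : PowerSeries R)
    (n : ℕ) : coeff n (mapCoeff T F) = T (coeff n F) := coeff_mk _ _

section MapLin

variable {A B : Type} [CommRing A] [Algebra ℂ A] [CommRing B] [Algebra ℂ B]

theorem linearMap_lamSum (L : PowerSeries A →ₗ[PowerSeries ℂ] PowerSeries B)
    (K : ℕ → PowerSeries A) : L (lamSum K) = lamSum fun r => L (K r) :=
  map_lamSum L.toAddMonoidHom (linearMap_X_mul L) K

/-- Coefficientwise application of a linear map, as a linear map of formal series. -/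
def mapLin (T : A →ₗ[ℂ] B) : PowerSeries A →ₗ[PowerSeries ℂ] PowerSeries B where
  toFun := mapCoeff T
  map_add' F G := by ext n; simp [coeff_mapCoeff]
  map_smul' c F := by
    ext n
    simp [coeff_mapCoeff, smul_series_def, coeff_mul, ← Algebra.smul_def]

theorem coeff_mapLin (T : A →ₗ[ℂ] B) (F : PowerSeries A) (n : ℕ) :
    coeff n (mapLin T F) = T (coeff n F) := coeff_mapCoeff _ _ _

theorem mapLin_C (T : A →ₗ[ℂ] B) (u : A) : mapLin T (C u) = C (T u) := by
  ext n
  rw [coeff_mapLin, coeff_C, coeff_C]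
  split_ifs <;> simp

theorem map_eq_mapLin (T : A →ₐ[ℂ] B) (F : PowerSeries A) :
    PowerSeries.map T.toRingHom F = mapLin T.toLinearMap F := by
  ext n
  rw [coeff_map, coeff_mapLin]
  rfl

end MapLin
end GrassStar

/-! ### The explicit series, and factors for which it stops at first order -/

namespace ExpProduct
open PowerSeries GrassStar
open scoped TensorProduct

variable {A ι : Type} [CommRing A] [Algebra ℂ A] [Fintype ι] (D D' : ι → Module.End ℂ A)

theorem product_eq_lamSum (F G : PowerSeries A) : product D D' F G =
    lamSum fun r => ((r.factorial : ℂ)⁻¹) • ∑ a : Fin r → ι,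
      mapLin (List.ofFn fun k => D (a k)).prod F * mapLin (List.ofFn fun k => D' (a k)).prod G := by
  let L : PowerSeries A →ₗ[PowerSeries ℂ] PowerSeries A →ₗ[PowerSeries ℂ] PowerSeries A :=
    LinearMap.mk₂ (PowerSeries ℂ) (fun F G => lamSum fun r => ((r.factorial : ℂ)⁻¹) •
      ∑ a : Fin r → ι, mapLin (List.ofFn fun k => D (a k)).prod F *
        mapLin (List.ofFn fun k => D' (a k)).prod G)
      (fun F F' G => by
        simp only [map_add, add_mul, Finset.sum_add_distrib, smul_add, lamSum_add])
      (fun c F G => by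
        simp only [map_smul, smul_mul_assoc, ← Finset.smul_sum]
        have h := linearMap_lamSum (LinearMap.lsmul (PowerSeries ℂ) (PowerSeries A) c)
        simp only [LinearMap.lsmul_apply] at h
        rw [h]
        simp only [← C_smul_series, smul_comm c])
      (fun F G G' => by
        simp only [map_add, mul_add, Finset.sum_add_distrib, smul_add, lamSum_add])
      (fun c F G => by
        simp only [map_smul, mul_smul_comm, ← Finset.smul_sum]
        have h := linearMap_lamSum (LinearMap.lsmul (PowerSeries ℂ) (PowerSeries A) c)
        simp only [LinearMap.lsmul_apply] at h
        rw [h]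
        simp only [← C_smul_series, smul_comm c])
  have hC : ∀ u v, product D D' (C u) (C v) = L (C u) (C v) := fun u v => by
    rw [product_C_C, LinearMap.mk₂_apply]
    ext n : 1
    rw [coeff_lamSum, coeff_coeffMap, bidiff_pow_tmul, Finset.sum_eq_single n]
    · simp only [PowerSeries.coeff_smul, map_sum, Nat.sub_self, mapLin_C, LinearMap.mul'_apply,
        ← map_mul, coeff_zero_C]
    · intro r hr hrn
      have h : n - r ≠ 0 := by
        have := Finset.mem_range.mp hr
        omega
      simp only [PowerSeries.coeff_smul, map_sum, mapLin_C, ← map_mul, coeff_C, if_neg h,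
        Finset.sum_const_zero, smul_zero]
    · simp
  have h1 : ∀ u G, product D D' (C u) G = L (C u) G := fun u G =>
    linearMap_eq_of_C (product D D' (C u)) (L (C u)) (hC u) G
  exact linearMap_eq_of_C ((product D D').flip G) (L.flip G) (fun u => h1 u G) F

/-- Two applications of the bidifferential operator already give zero, so only the orders zero and
one survive. The entries of the momentum map satisfy the hypothesis. -/
theorem product_C_eq {m : A} (hm : ∀ a b, D' b (D' a m) = 0) (F : PowerSeries A) :
    product D D' F (C m) = F * C m + X * ∑ a, mapLin (D a) F * C (D' a m) := by
  let L : PowerSeries A →ₗ[PowerSeries ℂ] PowerSeries A :=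
    LinearMap.mulRight _ (C m) + (X : PowerSeries ℂ) •
      ∑ a, LinearMap.mulRight _ (C (D' a m)) ∘ₗ mapLin (D a)
  have hL : ∀ F, L F = F * C m + X * ∑ a, mapLin (D a) F * C (D' a m) := fun F => by
    simp [L, X_smul_series, LinearMap.sum_apply]
  rw [← hL]
  refine linearMap_eq_of_C ((product D D').flip (C m)) L (fun u => ?_) F
  rw [hL, LinearMap.flip_apply, product_C_C]
  simp only [mapLin_C, ← map_mul, ← map_sum]
  ext n : 1
  rw [coeff_coeffMap]
  match n with
  | 0 => simp
  | 1 =>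
    rw [map_add, coeff_succ_X_mul, coeff_zero_C, coeff_C, if_neg one_ne_zero, zero_add, pow_one,
      bidiff_tmul, map_sum]
    simp
  | n + 2 =>
    have h : (bidiff D D' ^ (n + 2)) (u ⊗ₜ[ℂ] m) = 0 := by
      rw [pow_add, Module.End.mul_apply, pow_two, Module.End.mul_apply, bidiff_tmul, map_sum]
      simp only [bidiff_tmul, hm, TensorProduct.tmul_zero, Finset.sum_const_zero, map_zero]
    rw [h, map_zero, smul_zero, map_add, coeff_succ_X_mul, coeff_C, coeff_C, if_neg (by omega),
      if_neg (by omega), add_zero]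

theorem C_product_eq {m : A} (hm : ∀ a b, D b (D a m) = 0) (F : PowerSeries A) :
    product D D' (C m) F = F * C m + X * ∑ a, mapLin (D' a) F * C (D a m) := by
  let L : PowerSeries A →ₗ[PowerSeries ℂ] PowerSeries A :=
    LinearMap.mulRight _ (C m) + (X : PowerSeries ℂ) •
      ∑ a, LinearMap.mulRight _ (C (D a m)) ∘ₗ mapLin (D' a)
  have hL : ∀ F, L F = F * C m + X * ∑ a, mapLin (D' a) F * C (D a m) := fun F => by
    simp [L, X_smul_series, LinearMap.sum_apply]
  rw [← hL]
  refine linearMap_eq_of_C (product D D' (C m)) L (fun u => ?_) F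
  rw [hL, product_C_C]
  simp only [mapLin_C, ← map_mul, ← map_sum]
  ext n : 1
  rw [coeff_coeffMap]
  match n with
  | 0 => simp [mul_comm]
  | 1 =>
    rw [map_add, coeff_succ_X_mul, coeff_zero_C, coeff_C, if_neg one_ne_zero, zero_add, pow_one,
      bidiff_tmul, map_sum]
    simp [mul_comm]
  | n + 2 =>
    have h : (bidiff D D' ^ (n + 2)) (m ⊗ₜ[ℂ] u) = 0 := by
      rw [pow_add, Module.End.mul_apply, pow_two, Module.End.mul_apply, bidiff_tmul, map_sum]
      simp only [bidiff_tmul, hm, TensorProduct.zero_tmul, Finset.sum_const_zero, map_zero]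
    rw [h, map_zero, smul_zero, map_add, coeff_succ_X_mul, coeff_C, coeff_C, if_neg (by omega),
      if_neg (by omega), add_zero]

end ExpProduct
end

noncomputable section
namespace GrassStar
open Matrix
open scoped ContDiff ComplexOrder ComplexConjugate

/-! ## The Wick product and the star ideal -/

section Wick

open PowerSeries (coeff C X lamSum lamSum_add lamSum_X_mul coeff_lamSum linearMap_eq_of_C
  addMonoidHom_eq_of_C smul_series_def)

variable {p q : ℕ}

theorem wick_eq_product (F G : PowerSeries (SmoothFun p q)) :
    wick F G = ExpProduct.product dz dzbar F G := by
  ext n : 1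
  rw [ExpProduct.product_eq_lamSum, coeff_lamSum, wick, PowerSeries.coeff_mk]
  refine Finset.sum_congr rfl fun r _ => ?_
  rw [PowerSeries.coeff_smul, map_sum]
  rfl

theorem wick_assoc (F G H : PowerSeries (SmoothFun p q)) :
    wick (wick F G) H = wick F (wick G H) := by
  simp only [wick_eq_product]
  exact ExpProduct.product_assoc (D := dz (p := p) (q := q)) (D' := dzbar (p := p) (q := q))
    (fun a u v => by rw [dz_mul])
    (fun a u v => by rw [dzbar_mul]) (fun a b => commute_dz_dz a b)
    (fun a b => commute_dz_dzbar a b) (fun a b => commute_dzbar_dzbar a b) F G H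

/-- The Wick product as a bilinear map. -/
def wickBilin (p q : ℕ) : PowerSeries (SmoothFun p q) →ₗ[PowerSeries ℂ]
    PowerSeries (SmoothFun p q) →ₗ[PowerSeries ℂ] PowerSeries (SmoothFun p q) :=
  ExpProduct.product dz dzbar

theorem wickBilin_apply (F G : PowerSeries (SmoothFun p q)) : wickBilin p q F G = wick F G :=
  (wick_eq_product F G).symm

theorem dzbar_dzbar_momentum (μ : ℝ) (j i : Fin p) (a b : Fin (p + q) × Fin p) :
    dzbar b (dzbar a (momentumEntry μ j i)) = 0 := by
  rw [momentumEntry_eq, map_sub, dzbar_algebraMap, sub_zero]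
  obtain ⟨A, k⟩ := a
  obtain ⟨B, l⟩ := b
  rw [dzbar_gram]
  split_ifs
  · exact dzbar_coordFun _ _ _ _
  · exact map_zero _

theorem dz_dz_momentum (μ : ℝ) (j i : Fin p) (a b : Fin (p + q) × Fin p) :
    dz b (dz a (momentumEntry μ j i)) = 0 := by
  rw [momentumEntry_eq, map_sub, dz_algebraMap, sub_zero]
  obtain ⟨A, k⟩ := a
  obtain ⟨B, l⟩ := b
  rw [dz_gram]
  split_ifs
  · exact dz_conj_coordFun _ _ _ _
  · exact map_zero _

/-- The entry is bilinear in `z̄` and `z`; its only nonzero antiholomorphic derivatives are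
coordinates `z^A_i`, which assemble the first order term into the field `E_ij`. This formula is what
makes the star ideal accessible to computation. -/
theorem wick_momentum (μ : ℝ) (j i : Fin p) (F : PowerSeries (SmoothFun p q)) :
    wick F (C (momentumEntry μ j i)) =
      F * C (momentumEntry μ j i) + X * mapLin (holE i j) F := by
  rw [wick_eq_product, ExpProduct.product_C_eq (dz (p := p) (q := q)) (dzbar (p := p) (q := q)) fun a b => by
    rw [dzbar_dzbar_momentum]]
  congr 2
  ext n : 1
  rw [map_sum, coeff_mapLin, holE_apply, Fintype.sum_prod_type]
  refine Finset.sum_congr rfl fun A _ => ?_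
  simp only [PowerSeries.coeff_mul_C, coeff_mapLin, momentumEntry_eq, map_sub, dzbar_algebraMap,
    sub_zero, dzbar_gram, mul_ite, mul_zero, Finset.sum_ite_eq', Finset.mem_univ, if_true]
  rw [mul_comm]

theorem momentum_wick (μ : ℝ) (j i : Fin p) (F : PowerSeries (SmoothFun p q)) :
    wick (C (momentumEntry μ j i)) F =
      F * C (momentumEntry μ j i) + X * mapLin (antiE j i) F := by
  rw [wick_eq_product, ExpProduct.C_product_eq (dz (p := p) (q := q)) (dzbar (p := p) (q := q)) fun a b => by
    rw [dz_dz_momentum]]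
  congr 2
  ext n : 1
  rw [map_sum, coeff_mapLin, antiE_apply, Fintype.sum_prod_type]
  refine Finset.sum_congr rfl fun A _ => ?_
  simp only [PowerSeries.coeff_mul_C, coeff_mapLin, momentumEntry_eq, map_sub, dz_algebraMap,
    sub_zero, dz_gram, mul_ite, mul_zero, Finset.sum_ite_eq', Finset.mem_univ, if_true]
  rw [mul_comm]

/-! ### Invariance -/

/-- The action of `GL(p, ℂ)` on formal functions. -/
def pullSeries (g : GL (Fin p) ℂ) :
    PowerSeries (SmoothFun p q) →ₗ[PowerSeries ℂ] PowerSeries (SmoothFun p q) :=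
  mapLin (pullGL g).toLinearMap

theorem coeff_pullSeries (g : GL (Fin p) ℂ) (F : PowerSeries (SmoothFun p q)) (n : ℕ) :
    coeff n (pullSeries g F) = pullGL g (coeff n F) := coeff_mapLin _ _ _

theorem isHomogeneous_iff {F : PowerSeries (SmoothFun p q)} :
    IsHomogeneous F ↔ ∀ g, pullSeries g F = F := by
  constructor
  · intro h g
    ext n z
    rw [coeff_pullSeries]
    exact h n z g
  · intro h n z g
    rw [← pullGL_apply, ← coeff_pullSeries, h]

theorem isInvariant_iff {F : PowerSeries (SmoothFun p q)} :
    IsInvariant F ↔ ∀ U : Matrix.unitaryGroup (Fin p) ℂ, pullSeries (Unitary.toUnits U) F = F := by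
  constructor
  · intro h U
    ext n z
    rw [coeff_pullSeries]
    exact h n z U
  · intro h n z U
    rw [mulU, ← pullGL_apply, ← coeff_pullSeries, h]

theorem IsHomogeneous.isInvariant {F : PowerSeries (SmoothFun p q)} (h : IsHomogeneous F) :
    IsInvariant F := fun n z U => h n z (Unitary.toUnits U)

theorem isEquivariant_iff {G : Fin p → Fin p → PowerSeries (SmoothFun p q)} :
    IsEquivariant G ↔ ∀ (U : Matrix.unitaryGroup (Fin p) ℂ) (i j : Fin p),
      pullSeries (Unitary.toUnits U) (G i j) = ∑ k, ∑ l, (conj (U.1 k i) * U.1 l j) • G k l := by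
  have key : ∀ (U : Matrix.unitaryGroup (Fin p) ℂ) n z i j,
      (evalMat G n (mulU z U)) i j = (coeff n (pullSeries (Unitary.toUnits U) (G i j))).1 z :=
    fun U n z i j => by rw [coeff_pullSeries]; rfl
  have key2 : ∀ (U : Matrix.unitaryGroup (Fin p) ℂ) n z i j,
      ((U.1)ᴴ * evalMat G n z * U.1) i j =
        (coeff n (∑ k, ∑ l, (conj (U.1 k i) * U.1 l j) • G k l)).1 z := fun U n z i j => by
    simp only [map_sum, SmoothFun.coe_sum, PowerSeries.coeff_smul, SmoothFun.coe_smul,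
      Matrix.mul_apply, Finset.sum_mul]
    rw [Finset.sum_comm]
    refine Finset.sum_congr rfl fun k _ => Finset.sum_congr rfl fun l _ => ?_
    change conj (U.1 k i) * (coeff n (G k l)).1 z * _ = _
    ring
  constructor
  · intro h U i j
    ext n z
    rw [← key, h n z U, key2]
  · intro h n z U
    ext i j
    rw [key, h, key2]

theorem unitary_sum_mul_conj (U : Matrix.unitaryGroup (Fin p) ℂ) (j l : Fin p) :
    ∑ k, U.1 k j * conj (U.1 k l) = if j = l then 1 else 0 := by
  have h := congrFun (congrFun (Matrix.UnitaryGroup.star_mul_self U) l) j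
  rw [Matrix.one_apply, Matrix.mul_apply] at h
  simp only [eq_comm (a := j)]
  rw [← h]
  exact Finset.sum_congr rfl fun k _ => mul_comm _ _

theorem sum_smul_tmul_unitary {V W : Type*} [AddCommGroup V] [Module ℂ V] [AddCommGroup W]
    [Module ℂ W] (U : Matrix.unitaryGroup (Fin p) ℂ) (v : Fin p → V) (w : Fin p → W) :
    ∑ k, (∑ j, U.1 k j • v j) ⊗ₜ[ℂ] (∑ j, conj (U.1 k j) • w j) = ∑ j, v j ⊗ₜ[ℂ] w j := by
  have h := unitary_sum_mul_conj U
  simp only [TensorProduct.sum_tmul, TensorProduct.tmul_sum, TensorProduct.smul_tmul_smul]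
  calc _ = ∑ j, ∑ l, (∑ k, U.1 k j * conj (U.1 k l)) • (v j ⊗ₜ[ℂ] w l) := by
        simp only [Finset.sum_smul]
        rw [Finset.sum_comm]
        conv_rhs => rw [Finset.sum_comm]
        exact Finset.sum_congr rfl fun j _ => Finset.sum_comm
    _ = _ := by
        simp only [h, ite_smul, one_smul, zero_smul, Finset.sum_ite_eq, Finset.mem_univ, if_true]

/-- The two kinds of derivatives transform with `U` and its conjugate, so unitarity preserves their
contraction. For a general element of `GL(p, ℂ)` the argument breaks down. -/
theorem pullSeries_wick (U : Matrix.unitaryGroup (Fin p) ℂ) (F G : PowerSeries (SmoothFun p q)) :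
    pullSeries (Unitary.toUnits U) (wick F G) =
      wick (pullSeries (Unitary.toUnits U) F) (pullSeries (Unitary.toUnits U) G) := by
  simp only [wick_eq_product, pullSeries, ← map_eq_mapLin]
  refine ExpProduct.map_product (D := dz (p := p) (q := q)) (D' := dzbar (p := p) (q := q))
    (fun u v => ?_) F G
  rw [Fintype.sum_prod_type, Fintype.sum_prod_type]
  refine Finset.sum_congr rfl fun A _ => ?_
  refine (Finset.sum_congr rfl fun k _ => ?_).trans (sum_smul_tmul_unitary U
    (fun j => pullGL (p := p) (q := q) (Unitary.toUnits U) (dz (A, j) u))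
    (fun j => pullGL (p := p) (q := q) (Unitary.toUnits U) (dzbar (A, j) v)))
  rw [dz_pullGL, dzbar_pullGL]
  rfl

theorem IsInvariant.wick {F G : PowerSeries (SmoothFun p q)} (hF : IsInvariant F)
    (hG : IsInvariant G) : IsInvariant (wick F G) := by
  rw [isInvariant_iff] at hF hG ⊢
  intro U
  rw [pullSeries_wick, hF, hG]

/-- The Wick commutator with the momentum map is `λ` times the infinitesimal U(p)-action, which
kills invariant functions. -/
theorem wick_momentum_comm {F : PowerSeries (SmoothFun p q)} (hF : IsInvariant F) (μ : ℝ)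
    (j i : Fin p) :
    wick (C (momentumEntry μ j i)) F = wick F (C (momentumEntry μ j i)) := by
  rw [wick_momentum, momentum_wick]
  congr 2
  ext n : 1
  rw [coeff_mapLin, coeff_mapLin,
    holE_eq_antiE_of_invariant fun U => SmoothFun.ext fun z => hF n z U]

/-! ### The star ideal -/

/-- The equivariant matrix valued formal functions. -/
def equivariants (p q : ℕ) :
    Submodule (PowerSeries ℂ) (Fin p → Fin p → PowerSeries (SmoothFun p q)) where
  carrier := {G | IsEquivariant G}
  add_mem' {G G'} hG hG' := by
    simp only [Set.mem_ofPred_eq, isEquivariant_iff] at hG hG' ⊢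
    intro U i j
    simp only [Pi.add_apply, map_add, hG, hG', smul_add, Finset.sum_add_distrib]
  zero_mem' := by
    simp only [Set.mem_ofPred_eq, isEquivariant_iff]
    intro U i j
    simp
  smul_mem' c G hG := by
    simp only [Set.mem_ofPred_eq, isEquivariant_iff] at hG ⊢
    intro U i j
    simp only [Pi.smul_apply, map_smul, hG, Finset.smul_sum]
    refine Finset.sum_congr rfl fun k _ => Finset.sum_congr rfl fun l _ => ?_
    simp only [← PowerSeries.C_smul_series, smul_smul, mul_comm]

/-- The map `G ↦ ∑ i j, G^i_j *~ (x - μ)^j_i`. -/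
def idealMap (p q : ℕ) (μ : ℝ) : (Fin p → Fin p → PowerSeries (SmoothFun p q))
    →ₗ[PowerSeries ℂ] PowerSeries (SmoothFun p q) :=
  ∑ i, ∑ j, (wickBilin p q).flip (C (momentumEntry μ j i)) ∘ₗ
    LinearMap.proj (φ := fun _ => PowerSeries (SmoothFun p q)) j ∘ₗ
    LinearMap.proj (φ := fun _ => Fin p → PowerSeries (SmoothFun p q)) i

theorem idealMap_apply (μ : ℝ) (G : Fin p → Fin p → PowerSeries (SmoothFun p q)) :
    idealMap p q μ G = ∑ i, ∑ j, wick (G i j) (C (momentumEntry μ j i)) := by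
  simp [idealMap, LinearMap.sum_apply, wickBilin_apply]

/-- The star ideal as a submodule. -/
def starIdeal (p q : ℕ) (μ : ℝ) : Submodule (PowerSeries ℂ) (PowerSeries (SmoothFun p q)) :=
  (equivariants p q).map (idealMap p q μ)

theorem mem_starIdeal {μ : ℝ} {F : PowerSeries (SmoothFun p q)} :
    F ∈ starIdeal p q μ ↔ F ∈ wickIdeal p q μ := by
  constructor
  · rintro ⟨G, hG, rfl⟩
    exact ⟨G, hG, idealMap_apply μ G⟩
  · rintro ⟨G, hG, rfl⟩
    exact ⟨G, hG, idealMap_apply μ G⟩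

/-- The equivariant witnesses `G` can be summed `λ`-adically along with the elements themselves.
This closure is needed because both the projection and the star product are infinite series. -/
theorem lamSum_mem_starIdeal {μ : ℝ} {K : ℕ → PowerSeries (SmoothFun p q)}
    (hK : ∀ r, K r ∈ starIdeal p q μ) : lamSum K ∈ starIdeal p q μ := by
  choose G hG hGK using hK
  refine ⟨fun i j => lamSum fun r => G r i j, ?_, ?_⟩
  · change IsEquivariant _
    rw [isEquivariant_iff]
    intro U i j
    have h : ∀ r, pullSeries (Unitary.toUnits U) (G r i j) = _ :=
      fun r => isEquivariant_iff.mp (hG r) U i j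
    rw [linearMap_lamSum]
    simp only [h]
    ext n : 1
    simp only [coeff_lamSum, map_sum, PowerSeries.coeff_smul, Finset.smul_sum]
    rw [Finset.sum_comm]
    exact Finset.sum_congr rfl fun k _ => Finset.sum_comm
  · rw [idealMap_apply]
    have hw : ∀ i j, wick (lamSum fun r => G r i j) (C (momentumEntry μ j i)) =
        lamSum fun r => wick (G r i j) (C (momentumEntry μ j i)) := fun i j => by
      have := linearMap_lamSum ((wickBilin p q).flip (C (momentumEntry μ j i))) fun r => G r i j
      simpa only [LinearMap.flip_apply, wickBilin_apply] using this
    have hK' : K = fun r => ∑ i, ∑ j, wick (G r i j) (C (momentumEntry μ j i)) :=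
      funext fun r => by rw [← hGK, idealMap_apply]
    simp only [hw, hK']
    ext n : 1
    simp only [coeff_lamSum, map_sum]
    rw [Finset.sum_comm]
    rw [Finset.sum_congr rfl fun i _ => Finset.sum_comm, Finset.sum_comm]
    exact Finset.sum_congr rfl fun r _ => Finset.sum_comm

theorem mem_starIdeal_of_C {A : Type} [CommRing A] [Algebra ℂ A] {μ : ℝ}
    (L : PowerSeries A →ₗ[PowerSeries ℂ] PowerSeries (SmoothFun p q))
    (h : ∀ a, L (C a) ∈ starIdeal p q μ) (F : PowerSeries A) : L F ∈ starIdeal p q μ := by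
  have := linearMap_lamSum L fun r => C (coeff r F)
  rw [PowerSeries.lamSum_C_coeff] at this
  exact this ▸ lamSum_mem_starIdeal fun r => h _

theorem wick_mem_starIdeal {μ : ℝ} {F K : PowerSeries (SmoothFun p q)} (hF : IsInvariant F)
    (hK : K ∈ starIdeal p q μ) : wick F K ∈ starIdeal p q μ := by
  obtain ⟨G, hG, rfl⟩ := hK
  refine ⟨fun i j => wick F (G i j), ?_, ?_⟩
  · change IsEquivariant _
    rw [isEquivariant_iff]
    intro U i j
    rw [pullSeries_wick, isInvariant_iff.mp hF, isEquivariant_iff.mp hG]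
    simp only [← wickBilin_apply, map_sum, ← PowerSeries.C_smul_series, map_smul]
  · simp only [idealMap_apply, ← wickBilin_apply, map_sum]
    simp only [wickBilin_apply, wick_assoc]

/-- The invariant factor on the right is moved past `x - μ` by `wick_momentum_comm` and absorbed
into `G`. -/
theorem starIdeal_wick_mem {μ : ℝ} {F K : PowerSeries (SmoothFun p q)} (hF : IsInvariant F)
    (hK : K ∈ starIdeal p q μ) : wick K F ∈ starIdeal p q μ := by
  obtain ⟨G, hG, rfl⟩ := hK
  refine ⟨fun i j => wick (G i j) F, ?_, ?_⟩
  · change IsEquivariant _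
    rw [isEquivariant_iff]
    intro U i j
    rw [pullSeries_wick, isInvariant_iff.mp hF, isEquivariant_iff.mp hG]
    simp only [← wickBilin_apply, map_sum, ← PowerSeries.C_smul_series, map_smul,
      LinearMap.sum_apply, LinearMap.smul_apply]
  · simp only [idealMap_apply, ← wickBilin_apply, map_sum, LinearMap.sum_apply]
    simp only [wickBilin_apply, wick_assoc, wick_momentum_comm hF]

end Wick
end GrassStar
end

noncomputable section
namespace GrassStar

/-! ## The number of cycles -/

section Cycles

open Equiv Equiv.Perm

/-- The number of cycles of a permutation, fixed points included. -/
def cyc {α : Type*} [Fintype α] [DecidableEq α] (σ : Perm α) : ℕ := σ.partition.parts.card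

variable {α : Type*} [Fintype α] [DecidableEq α]

theorem cyc_eq (σ : Perm α) :
    cyc σ = σ.cycleType.card + (Fintype.card α - σ.support.card) := by
  rw [cyc, parts_partition, Multiset.card_add, Multiset.card_replicate]

theorem cyc_add_card_support (σ : Perm α) :
    cyc σ + σ.support.card = σ.cycleType.card + Fintype.card α := by
  have := σ.support.card_le_univ
  rw [cyc_eq]
  omega

theorem cyc_le_card (σ : Perm α) : cyc σ ≤ Fintype.card α := by
  have h := σ.partition.parts.card_nsmul_le_sum (a := 1) fun x hx => σ.partition.parts_pos hx
  rwa [σ.partition.parts_sum, smul_eq_mul, mul_one] at h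

theorem card_fixed_le_cyc (σ : Perm α) (s : Finset α) (hs : ∀ k ∈ s, σ k = k) :
    s.card ≤ cyc σ := by
  have h : Disjoint s σ.support := Finset.disjoint_left.mpr fun k hk hk' =>
    mem_support.mp hk' (hs k hk)
  have h1 := (s ∪ σ.support).card_le_univ
  rw [Finset.card_union_of_disjoint h] at h1
  rw [cyc_eq]
  omega

theorem cyc_one : cyc (1 : Perm α) = Fintype.card α := by simp [cyc_eq]

theorem cyc_eq_of_isConj {σ τ : Perm α} (h : IsConj σ τ) : cyc σ = cyc τ := by
  rw [cyc, cyc, partition_eq_of_isConj.mp h]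

/-- Multiplication by this transposition makes `m` a fixed point and closes up the rest of its
cycle, so one cycle becomes two. -/
theorem cyc_swap_mul {τ : Perm α} {m : α} (h : τ m ≠ m) :
    cyc (swap m (τ m) * τ) = cyc τ + 1 := by
  set f := τ.cycleOf m with hf
  have hfm : f m = τ m := cycleOf_apply_self τ m
  have hcyc : f.IsCycle := isCycle_cycleOf τ h
  have hmem : f ∈ τ.cycleFactorsFinset := cycleOf_mem_cycleFactorsFinset_iff.mpr (mem_support.mpr h)
  set g := f⁻¹ * τ with hg
  have hτ : τ = f * g := by rw [hg, mul_inv_cancel_left]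
  have hdis : Disjoint f g := by
    have := disjoint_mul_inv_of_mem_cycleFactorsFinset hmem
    have hc : τ * f⁻¹ = f⁻¹ * τ := by
      have h1 : Commute (τ * f⁻¹) f := this.commute
      have h2 : Commute (τ * f⁻¹ * f) f := h1.mul_left (Commute.refl f)
      rw [inv_mul_cancel_right] at h2
      exact h2.inv_right.eq
    rw [hg, ← hc]
    exact this.symm
  -- The hypothesis on cardinalities covers both outcomes: a 2-cycle collapses to the identity, and
  -- a longer cycle loses one point of its support.
  have key : ∀ f' : Perm α, Disjoint f' g → f'.cycleType.card + f.support.card =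
      f'.support.card + 2 → cyc (f' * g) = cyc (f * g) + 1 := fun f' hd hcard => by
    have h1 := cyc_add_card_support (f' * g)
    have h2 := cyc_add_card_support (f * g)
    rw [hd.card_support_mul, hd.cycleType_mul, Multiset.card_add] at h1
    rw [hdis.card_support_mul, hdis.cycleType_mul, Multiset.card_add, hcyc.cycleType,
      Multiset.card_singleton] at h2
    omega
  conv_lhs => rw [hτ, ← mul_assoc, ← hτ]
  conv_rhs => rw [hτ]
  rw [← hfm]
  by_cases h2 : f (f m) = m
  · have h3 := hcyc.eq_swap_of_apply_apply_eq_self (x := m) (by rwa [hfm]) h2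
    have h4 : swap m (f m) * f = 1 := by
      conv_lhs => rw [h3, swap_apply_left]
      exact swap_mul_self _ _
    refine key _ ?_ ?_
    · rw [h4]; exact disjoint_one_left g
    · rw [h4]
      conv_lhs => rw [h3]
      rw [card_support_swap (by rw [hfm]; exact h.symm)]
      simp
  · have h3 := hcyc.swap_mul (x := m) (by rwa [hfm]) h2
    have h4 := support_swap_mul_eq f m h2
    refine key _ ?_ ?_
    · rw [disjoint_iff_disjoint_support] at hdis ⊢
      rw [h4]
      exact hdis.mono_left Finset.sdiff_subset
    · rw [h3.cycleType, Multiset.card_singleton, h4, Finset.card_sdiff_of_subset, Finset.card_singleton]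
      · have : 0 < f.support.card := Finset.card_pos.mpr ⟨m, by rw [mem_support, hfm]; exact h⟩
        omega
      · rw [Finset.singleton_subset_iff, mem_support, hfm]
        exact h

theorem cyc_mul_swap {τ : Perm α} {m l : α} (h : τ l = m) (hl : l ≠ m) :
    cyc (τ * swap m l) = cyc τ + 1 := by
  have h1 : τ m ≠ m := fun h2 => hl (τ.injective (h.trans h2.symm))
  rw [mul_swap_eq_swap_mul, h, swap_comm, cyc_swap_mul h1]

end Cycles

/-! ## The generating function of the number of cycles in the group algebra -/

section GroupAlgebra

open Equiv MonoidAlgebra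

variable {R : Type} [CommRing R] {r : ℕ}

/-- The part of `∑ σ, κ^{|σ|} l^{r - |σ|} σ` of permutations fixing `0, …, m - 1`, divided by
`κ^m`. -/
def cycleGenFrom (r : ℕ) (κ l : R) (m : ℕ) : MonoidAlgebra R (Perm (Fin r)) :=
  ∑ τ with ∀ k : Fin r, k.1 < m → τ k = k, single τ (κ ^ (cyc τ - m) * l ^ (r - cyc τ))

/-- The group algebra element `∑ σ, κ^{|σ|} l^{r - |σ|} σ`. -/
def cycleGen (r : ℕ) (κ l : R) : MonoidAlgebra R (Perm (Fin r)) :=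
  ∑ τ : Perm (Fin r), single τ (κ ^ cyc τ * l ^ (r - cyc τ))

/-- A multiple of a shifted Jucys-Murphy element. -/
def jucysMurphy (κ l : R) (m : Fin r) : MonoidAlgebra R (Perm (Fin r)) :=
  single 1 κ + ∑ k with m < k, single (swap m k) l

theorem cycleGenFrom_zero (κ l : R) : cycleGenFrom r κ l 0 = cycleGen r κ l := by
  simp [cycleGenFrom, cycleGen]

theorem cycleGenFrom_self (κ l : R) : cycleGenFrom r κ l r = 1 := by
  have h : (Finset.univ.filter fun τ : Perm (Fin r) => ∀ k : Fin r, k.1 < r → τ k = k) = {1} := by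
    ext τ
    simp [Equiv.ext_iff]
  rw [cycleGenFrom, h, Finset.sum_singleton, cyc_one]
  rw [Fintype.card_fin, Nat.sub_self, pow_zero, pow_zero, mul_one]
  rfl

/-- Jucys' factorization. A permutation fixing all points below `m` either fixes `m` as well, or is
uniquely `τ (m k)` with `k > m` and `τ` fixing `m` too. In the second case the transposition merges
two cycles, which trades a factor `κ` for a factor `l`. -/
theorem cycleGenFrom_succ (κ l : R) (m : Fin r) :
    cycleGenFrom r κ l m.1 = cycleGenFrom r κ l (m.1 + 1) * jucysMurphy κ l m := by
  classical
  set P : Perm (Fin r) → Prop := fun τ => ∀ k : Fin r, k.1 < m.1 → τ k = k with hP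
  set Q : Perm (Fin r) → Prop := fun τ => ∀ k : Fin r, k.1 < m.1 + 1 → τ k = k with hQ
  have hQP : ∀ τ, Q τ ↔ P τ ∧ τ m = m := fun τ => by
    constructor
    · exact fun h => ⟨fun k hk => h k (by omega), h m (by omega)⟩
    · rintro ⟨h1, h2⟩ k hk
      rcases Nat.lt_succ_iff_lt_or_eq.mp hk with h | h
      · exact h1 k h
      · rw [show k = m from Fin.ext h, h2]
  -- The `m + 1` fixed points are cycles themselves, so the natural number subtractions in the
  -- exponents are genuine.
  have hcard : ∀ τ, Q τ → m.1 + 1 ≤ cyc τ := fun τ h => by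
    have h2 := card_fixed_le_cyc τ (Finset.Iic m) fun k hk => h k (by
      have := Finset.mem_Iic.mp hk
      omega)
    rwa [Fin.card_Iic] at h2
  have hinv : ∀ τ : Perm (Fin r), τ (τ⁻¹ m) = m := fun τ => τ.apply_symm_apply m
  have hle : ∀ τ : Perm (Fin r), cyc τ ≤ r := fun τ => by simpa using cyc_le_card τ
  have hs : ∀ (τ : Perm (Fin r)) (j k : Fin r), j.1 < m.1 → m < k → (swap m k) j = j :=
    fun τ j k hj hk => swap_apply_of_ne_of_ne (fun h => by subst h; exact lt_irrefl _ hj)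
      (fun h => by subst h; exact lt_asymm hj hk)
  have hfix : (Finset.univ.filter P).filter (fun τ => τ m = m) = Finset.univ.filter Q := by
    ext τ
    simp only [Finset.mem_filter, Finset.mem_univ, true_and, hQP]
  change ∑ τ with P τ, single τ (κ ^ (cyc τ - m.1) * l ^ (r - cyc τ)) =
    (∑ τ with Q τ, single τ (κ ^ (cyc τ - (m.1 + 1)) * l ^ (r - cyc τ))) * _
  rw [← Finset.sum_filter_add_sum_filter_not _ (fun τ => τ m = m), hfix, jucysMurphy, mul_add]
  congr 1
  · rw [Finset.sum_mul]
    refine Finset.sum_congr rfl fun τ hτ => ?_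
    have h := hcard τ (Finset.mem_filter.mp hτ).2
    rw [single_mul_single, mul_one, show cyc τ - m.1 = cyc τ - (m.1 + 1) + 1 by omega, pow_succ]
    congr 1
    ring
  · rw [Finset.sum_mul_sum, ← Finset.sum_product']
    -- Here `k` must be the preimage of `m`: then `τ (m k)` fixes `m`, and `k > m` because the
    -- smaller points are fixed by `τ`.
    refine Finset.sum_nbij' (fun τ => (τ * swap m (τ⁻¹ m), τ⁻¹ m)) (fun x => x.1 * swap m x.2)
      ?_ ?_ ?_ ?_ ?_
    · intro τ hτ
      simp only [Finset.mem_filter, Finset.mem_univ, true_and] at hτ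
      obtain ⟨h1, h2⟩ := hτ
      have hk : m < τ⁻¹ m := by
        rcases lt_trichotomy m (τ⁻¹ m) with h | h | h
        · exact h
        · exact absurd (Perm.eq_inv_iff_eq.mp h) h2
        · have h3 := h1 _ h
          rw [hinv] at h3
          exact absurd h3.symm h.ne
      simp only [Finset.mem_product, Finset.mem_filter, Finset.mem_univ, true_and, hk, and_true]
      rw [hQP]
      refine ⟨fun j hj => ?_, ?_⟩
      · rw [Perm.mul_apply, hs τ j _ hj hk, h1 j hj]
      · rw [Perm.mul_apply, swap_apply_left, hinv]
    · rintro ⟨τ, k⟩ hx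
      simp only [Finset.mem_product, Finset.mem_filter, Finset.mem_univ, true_and, hQP] at hx ⊢
      obtain ⟨⟨h1, h2⟩, hk⟩ := hx
      refine ⟨fun j hj => ?_, ?_⟩
      · rw [Perm.mul_apply, hs τ j _ hj hk, h1 j hj]
      · rw [Perm.mul_apply, swap_apply_left]
        exact fun h => hk.ne' (τ.injective (h.trans h2.symm))
    · intro τ _
      simp only [mul_swap_mul_self]
    · rintro ⟨τ, k⟩ hx
      simp only [Finset.mem_product, Finset.mem_filter, Finset.mem_univ, true_and, hQP] at hx
      have h : (τ * swap m k)⁻¹ m = k := by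
        rw [Perm.inv_eq_iff_eq, Perm.mul_apply, swap_apply_right, hx.1.2]
      simp only [h, mul_swap_mul_self]
    · intro τ hτ
      simp only [Finset.mem_filter, Finset.mem_univ, true_and] at hτ
      have h1 := cyc_mul_swap (τ := τ) (m := m) (l := τ⁻¹ m) (hinv τ)
        fun h => hτ.2 (Perm.inv_eq_iff_eq.mp h).symm
      have h2 := hle (τ * swap m (τ⁻¹ m))
      simp only [single_mul_single, mul_swap_mul_self]
      rw [h1, show cyc τ + 1 - (m.1 + 1) = cyc τ - m.1 by omega,
        show r - cyc τ = r - (cyc τ + 1) + 1 by omega, pow_succ, mul_assoc]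

theorem commute_single_cycleGen (κ l : R) (σ : Perm (Fin r)) :
    single σ 1 * cycleGen r κ l = cycleGen r κ l * single σ 1 := by
  rw [cycleGen, Finset.mul_sum, Finset.sum_mul]
  refine Fintype.sum_equiv (MulAut.conj σ).toEquiv _ _ fun τ => ?_
  have h : cyc (σ * τ * σ⁻¹) = cyc τ := (cyc_eq_of_isConj (isConj_iff.mpr ⟨σ, rfl⟩)).symm
  rw [single_mul_single, show (MulAut.conj σ).toEquiv τ = σ * τ * σ⁻¹ from rfl,
    single_mul_single, h, inv_mul_cancel_right, mul_one, one_mul]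

theorem map_cycleGen {R' : Type} [CommRing R'] (f : R →+* R') (κ l : R) :
    MonoidAlgebra.mapRingHom (Perm (Fin r)) f (cycleGen r κ l) = cycleGen r (f κ) (f l) := by
  simp only [cycleGen, map_sum, mapRingHom_single, map_mul, map_pow]

/-- The two exponents add up to `r`. Homogeneity relates the variable `c` to the pair `(λ c, λ)`. -/
theorem cycleGen_mul (a κ l : R) : cycleGen r (a * κ) (a * l) = a ^ r • cycleGen r κ l := by
  rw [cycleGen, cycleGen, Finset.smul_sum]
  refine Finset.sum_congr rfl fun τ _ => ?_
  have h : cyc τ + (r - cyc τ) = r := Nat.add_sub_of_le (by simpa using cyc_le_card τ)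
  rw [smul_single', mul_pow, mul_pow, mul_mul_mul_comm, ← pow_add, h]

theorem coeff_sum_smul_classSum (s : Con r → R) (σ : Perm (Fin r)) :
    (∑ α, s α • classSum R α).coeff σ = s (ConjClasses.mk σ) := by
  classical
  simp only [classSum, coeff_sum, coeff_smul, Finsupp.coe_finsetSum, Finset.sum_apply,
    Finsupp.smul_apply, coeff_single, Finsupp.single_apply, smul_eq_mul]
  rw [Finset.sum_eq_single (ConjClasses.mk σ)]
  · rw [Finset.sum_eq_single σ]
    · simp
    · intro τ _ h
      rw [if_neg h]
    · simp
  · intro α _ h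
    rw [Finset.sum_eq_zero, mul_zero]
    intro τ hτ
    rw [if_neg]
    rintro rfl
    exact h (Finset.mem_filter.mp hτ).2.symm
  · simp

theorem eq_sum_smul_classSum {B : MonoidAlgebra R (Perm (Fin r))}
    (hB : ∀ σ τ, IsConj σ τ → B.coeff σ = B.coeff τ) :
    ∑ α : Con r, B.coeff (Quotient.out α) • classSum R α = B := by
  ext σ
  rw [coeff_sum_smul_classSum]
  exact hB _ _ (ConjClasses.mk_eq_mk_iff_isConj.mp (Quotient.out_eq _))

/-- The inverse of a central element is central, hence a class function. -/
theorem coeff_eq_of_isConj_of_mul_cycleGen_eq_one {B : MonoidAlgebra R (Perm (Fin r))} {κ l : R}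
    (h : B * cycleGen r κ l = 1) (h' : cycleGen r κ l * B = 1) {σ τ : Perm (Fin r)}
    (hστ : IsConj σ τ) : B.coeff σ = B.coeff τ := by
  obtain ⟨c, rfl⟩ := isConj_iff.mp hστ
  have h1 : single c 1 * B = B * single c 1 := by
    calc single c 1 * B = B * (cycleGen r κ l * single c 1) * B := by
          rw [← mul_assoc, h, one_mul]
      _ = B * single c 1 * (cycleGen r κ l * B) := by
          rw [← commute_single_cycleGen]; simp only [mul_assoc]
      _ = _ := by rw [h', mul_one]
  have h2 := congrArg (fun b => b.coeff (c * σ)) h1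
  simpa [coeff_single_mul_apply, coeff_mul_single_apply] using h2

theorem cycleSum_eq (r : ℕ) : cycleSum r = cycleGen r RatFunc.X 1 := by
  ext σ
  rw [cycleSum, coeff_sum_smul_classSum, cycleGen, coeff_sum]
  classical
  simp only [Finsupp.coe_finsetSum, Finset.sum_apply, coeff_single, Finsupp.single_apply,
    Finset.sum_ite_eq', Finset.mem_univ, if_true, one_pow, mul_one]
  rfl

/-- Modulo `X` the element is an invertible scalar. As `X` generates the maximal ideal and the group
algebra is a finite module, Nakayama makes left and right multiplication surjective, and a left and
a right inverse coincide. -/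
theorem isUnit_single_one_add_X_smul {G : Type} [Group G] [Finite G] {κ : PowerSeries ℂ}
    (hκ : IsUnit κ) (N : MonoidAlgebra (PowerSeries ℂ) G) :
    IsUnit (single 1 κ + (PowerSeries.X : PowerSeries ℂ) • N) := by
  set a := single 1 κ + (PowerSeries.X : PowerSeries ℂ) • N with ha
  have hsm : ∀ b : MonoidAlgebra (PowerSeries ℂ) G, single 1 κ * b = κ • b := fun b => by
    ext g; simp [coeff_single_mul_apply]
  have hsm' : ∀ b : MonoidAlgebra (PowerSeries ℂ) G, b * single 1 κ = κ • b := fun b => by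
    ext g; simp [coeff_mul_single_apply, mul_comm]
  obtain ⟨u, hu⟩ := hκ
  have key : ∀ L : MonoidAlgebra (PowerSeries ℂ) G →ₗ[PowerSeries ℂ]
      MonoidAlgebra (PowerSeries ℂ) G,
      (∀ b, ∃ c, L b = κ • b + (PowerSeries.X : PowerSeries ℂ) • c) → ∃ b, L b = 1 := by
    intro L hL
    have hfg : (⊤ : Submodule (PowerSeries ℂ) (MonoidAlgebra (PowerSeries ℂ) G)).FG :=
      Module.Finite.fg_top
    have h := Submodule.le_of_le_smul_of_le_jacobson_bot (N' := ⊤) (N := LinearMap.range L)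
      (I := Ideal.span {(PowerSeries.X : PowerSeries ℂ)}) hfg
      (by
        rw [IsLocalRing.jacobson_eq_maximalIdeal ⊥ bot_ne_top, PowerSeries.maximalIdeal_eq_span_X])
      (fun b _ => by
        obtain ⟨c, hc⟩ := hL ((↑u⁻¹ : PowerSeries ℂ) • b)
        rw [← hu, smul_smul, Units.mul_inv, one_smul] at hc
        rw [← sub_eq_iff_eq_add.mpr hc]
        refine Submodule.sub_mem _ (Submodule.mem_sup_left ⟨_, rfl⟩) (Submodule.mem_sup_right ?_)
        exact Submodule.smul_mem_smul (Ideal.mem_span_singleton_self _) Submodule.mem_top)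
    exact h (x := 1) Submodule.mem_top
  obtain ⟨b, hb⟩ := key (LinearMap.mulLeft _ a) fun b => ⟨N * b, by
    rw [LinearMap.mulLeft_apply, ha, add_mul, hsm, smul_mul_assoc]⟩
  obtain ⟨c, hc⟩ := key (LinearMap.mulRight _ a) fun b => ⟨b * N, by
    rw [LinearMap.mulRight_apply, ha, mul_add, hsm', mul_smul_comm]⟩
  exact isUnit_iff_exists.mpr ⟨b, hb, by
    rw [LinearMap.mulLeft_apply] at hb
    rw [LinearMap.mulRight_apply] at hc
    rwa [← left_inv_eq_right_inv hc hb]⟩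

theorem isUnit_cycleGen (r : ℕ) {κ : PowerSeries ℂ} (hκ : IsUnit κ) :
    IsUnit (cycleGen r κ PowerSeries.X) := by
  have h : ∀ n ≤ r, IsUnit (cycleGenFrom r κ PowerSeries.X (r - n)) := by
    intro n
    induction n with
    | zero => intro _; rw [Nat.sub_zero, cycleGenFrom_self]; exact isUnit_one
    | succ n ih =>
      intro hn
      have h1 := cycleGenFrom_succ κ PowerSeries.X (⟨r - (n + 1), by omega⟩ : Fin r)
      simp only at h1
      rw [h1, show r - (n + 1) + 1 = r - n by omega]
      refine (ih (by omega)).mul ?_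
      have h2 := isUnit_single_one_add_X_smul hκ
        (∑ k with (⟨r - (n + 1), by omega⟩ : Fin r) < k,
          single (swap (⟨r - (n + 1), by omega⟩ : Fin r) k) 1)
      rwa [Finset.smul_sum, Finset.sum_congr rfl fun k _ => smul_single' _ _ _, mul_one] at h2
  simpa [cycleGenFrom_zero] using h r le_rfl

/-- The power series `μ + p λ`. -/
def kappa (p : ℕ) (μ : ℝ) : PowerSeries ℂ := PowerSeries.C (μ : ℂ) + (p : ℂ) • PowerSeries.X

theorem constantCoeff_kappa (p : ℕ) (μ : ℝ) : PowerSeries.constantCoeff (kappa p μ) = μ := by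
  simp [kappa]

theorem isUnit_kappa (p : ℕ) {μ : ℝ} (hμ : 0 < μ) : IsUnit (kappa p μ) := by
  rw [PowerSeries.isUnit_iff_constantCoeff, constantCoeff_kappa, isUnit_iff_ne_zero]
  exact_mod_cast hμ.ne'

/-- Multiplication by `λ` removes the pole of `c`: `λ c = μ + pλ`. -/
theorem ofPowerSeries_kappa (p : ℕ) (μ : ℝ) : HahnSeries.ofPowerSeries ℤ ℂ (kappa p μ) =
    HahnSeries.ofPowerSeries ℤ ℂ PowerSeries.X * cLaurent p μ := by
  rw [kappa, map_add, HahnSeries.ofPowerSeries_C, PowerSeries.smul_eq_C_mul, map_mul,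
    HahnSeries.ofPowerSeries_C, HahnSeries.ofPowerSeries_X, cLaurent, mul_add,
    HahnSeries.single_mul_single, map_natCast, add_neg_cancel, one_mul, mul_comm]
  rfl

/-- The pole makes `c` transcendental over `ℂ`: after multiplication of `P(c)` by `λ^{deg P}` the
constant term is the leading coefficient times `μ^{deg P}`. Hence `c` can be substituted into every
rational function. -/
theorem eval₂_cLaurent_ne_zero (p : ℕ) {μ : ℝ} (hμ : 0 < μ) {P : Polynomial ℂ} (hP : P ≠ 0) :
    P.eval₂ (HahnSeries.C : ℂ →+* LaurentSeries ℂ) (cLaurent p μ) ≠ 0 := by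
  intro h
  set L := HahnSeries.ofPowerSeries ℤ ℂ
  have h1 : L (∑ k ∈ Finset.range (P.natDegree + 1),
      PowerSeries.C (P.coeff k) * PowerSeries.X ^ (P.natDegree - k) * kappa p μ ^ k) = 0 := by
    rw [map_sum, ← mul_zero (L PowerSeries.X ^ P.natDegree), ← h, Polynomial.eval₂_eq_sum_range,
      Finset.mul_sum]
    refine Finset.sum_congr rfl fun k hk => ?_
    have hk' : P.natDegree - k + k = P.natDegree :=
      Nat.sub_add_cancel (Nat.lt_succ_iff.mp (Finset.mem_range.mp hk))
    rw [map_mul, map_mul, map_pow, map_pow, ofPowerSeries_kappa, HahnSeries.ofPowerSeries_C,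
      mul_pow]
    conv_rhs => rw [← hk', pow_add]
    ring
  have h2 := (map_eq_zero_iff L HahnSeries.ofPowerSeries_injective).mp h1
  have h3 := congrArg PowerSeries.constantCoeff h2
  rw [map_sum, map_zero, Finset.sum_range_succ, Finset.sum_eq_zero] at h3
  · simp only [zero_add, map_mul, map_pow, constantCoeff_kappa, Nat.sub_self, pow_zero, mul_one,
      PowerSeries.constantCoeff_C] at h3
    rcases mul_eq_zero.mp h3 with h4 | h4
    · exact hP (Polynomial.leadingCoeff_eq_zero.mp h4)
    · exact pow_ne_zero _ (by exact_mod_cast hμ.ne') h4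
  · intro k hk
    have hk' : P.natDegree - k ≠ 0 := by have := Finset.mem_range.mp hk; omega
    simp [hk']

/-- The substitution `c = λ⁻¹ μ + p` in rational functions. -/
def evalCLaurent (p : ℕ) {μ : ℝ} (hμ : 0 < μ) : RatFunc ℂ →+* LaurentSeries ℂ :=
  RatFunc.liftRingHom (Polynomial.eval₂RingHom HahnSeries.C (cLaurent p μ)) fun _ hP =>
    mem_nonZeroDivisors_of_ne_zero (eval₂_cLaurent_ne_zero p hμ (nonZeroDivisors.ne_zero hP))

theorem evalCLaurent_apply (p : ℕ) {μ : ℝ} (hμ : 0 < μ) (x : RatFunc ℂ) :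
    evalCLaurent p hμ x = x.eval HahnSeries.C (cLaurent p μ) :=
  RatFunc.liftRingHom_apply _ _ x

/-- By homogeneity the cycle sum at `c` is `λ^{-r}` times the generating element at `(μ + pλ, λ)`,
so its inverse is `λ^r W`. The factor `λ^r` is the source of the `λ`-adic convergence. -/
theorem mapRingHom_evalCLaurent_mul (p : ℕ) {μ : ℝ} (hμ : 0 < μ)
    {W : MonoidAlgebra (PowerSeries ℂ) (Perm (Fin r))}
    (hW : W * cycleGen r (kappa p μ) PowerSeries.X = 1) :
    (HahnSeries.ofPowerSeries ℤ ℂ PowerSeries.X ^ r •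
      mapRingHom (Perm (Fin r)) (HahnSeries.ofPowerSeries ℤ ℂ) W) *
      mapRingHom (Perm (Fin r)) (evalCLaurent p hμ) (cycleSum r) = 1 := by
  have h := congrArg (mapRingHom (Perm (Fin r)) (HahnSeries.ofPowerSeries ℤ ℂ)) hW
  rw [map_one, map_mul, map_cycleGen, ofPowerSeries_kappa] at h
  nth_rewrite 2 [← mul_one (HahnSeries.ofPowerSeries ℤ ℂ PowerSeries.X)] at h
  rw [cycleGen_mul, mul_smul_comm] at h
  rw [cycleSum_eq, map_cycleGen, map_one, evalCLaurent_apply, RatFunc.eval_X, smul_mul_assoc, h]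

/-- A single specialization suffices, here `p = 0` and `μ = 1`. Since `ℂ(c)` embeds in the Laurent
series, an inverse there makes left multiplication injective over `ℂ(c)`, and finite dimension makes
it surjective. -/
theorem isUnit_cycleSum (r : ℕ) : IsUnit (cycleSum r) := by
  obtain ⟨W, hW⟩ := (isUnit_cycleGen r (isUnit_kappa 0 one_pos)).exists_left_inv
  have h := mapRingHom_evalCLaurent_mul 0 one_pos hW
  have hinj : Function.Injective (LinearMap.mulLeft (RatFunc ℂ) (cycleSum r)) := by
    rw [← LinearMap.ker_eq_bot, LinearMap.ker_eq_bot']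
    intro b hb
    rw [LinearMap.mulLeft_apply] at hb
    have h1 : mapRingHom (Perm (Fin r)) (evalCLaurent 0 one_pos) b = 0 := by
      rw [← one_mul (mapRingHom (Perm (Fin r)) (evalCLaurent 0 one_pos) b), ← h, mul_assoc,
        ← map_mul, hb, map_zero, mul_zero]
    ext σ
    have h2 := congrArg (fun b => b.coeff σ) h1
    simpa using h2
  obtain ⟨b, hb⟩ := LinearMap.surjective_of_injective hinj 1
  rw [LinearMap.mulLeft_apply] at hb
  refine isUnit_iff_exists.mpr ⟨b, hb, hinj ?_⟩
  rw [LinearMap.mulLeft_apply, LinearMap.mulLeft_apply, ← mul_assoc, hb, one_mul, mul_one]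

/-- The inverse of `cycleGen r (kappa p μ) X`. -/
def invCycleGen (p : ℕ) {μ : ℝ} (hμ : 0 < μ) (r : ℕ) :
    MonoidAlgebra (PowerSeries ℂ) (Perm (Fin r)) :=
  ↑(isUnit_cycleGen r (isUnit_kappa p hμ)).unit⁻¹

variable (p : ℕ) {μ : ℝ} (hμ : 0 < μ)

theorem invCycleGen_mul : invCycleGen p hμ r * cycleGen r (kappa p μ) PowerSeries.X = 1 :=
  IsUnit.val_inv_mul _

theorem mul_invCycleGen : cycleGen r (kappa p μ) PowerSeries.X * invCycleGen p hμ r = 1 :=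
  IsUnit.mul_val_inv _

theorem coeff_invCycleGen_eq_of_isConj {σ τ : Perm (Fin r)} (h : IsConj σ τ) :
    (invCycleGen p hμ r).coeff σ = (invCycleGen p hμ r).coeff τ :=
  coeff_eq_of_isConj_of_mul_cycleGen_eq_one (invCycleGen_mul p hμ) (mul_invCycleGen p hμ) h

/-- A permutation is conjugate to its inverse. Together with the reality of the coefficients, this
makes complex conjugation an involution of the star product. -/
theorem coeff_invCycleGen_inv (σ : Perm (Fin r)) :
    (invCycleGen p hμ r).coeff σ⁻¹ = (invCycleGen p hμ r).coeff σ :=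
  coeff_invCycleGen_eq_of_isConj p hμ
    (Perm.isConj_iff_cycleType_eq.mpr (Perm.cycleType_inv σ))

/-- The element to be inverted has real coefficients, because `μ` is real, and inverses are unique.
-/
theorem map_conj_coeff_invCycleGen (σ : Perm (Fin r)) :
    PowerSeries.map (starRingEnd ℂ) ((invCycleGen p hμ r).coeff σ) =
      (invCycleGen p hμ r).coeff σ := by
  have h := congrArg (mapRingHom (Perm (Fin r)) (PowerSeries.map (starRingEnd ℂ)))
    (invCycleGen_mul (r := r) p hμ)
  have hκ : PowerSeries.map (starRingEnd ℂ) (kappa p μ) = kappa p μ := by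
    rw [kappa, PowerSeries.smul_eq_C_mul, map_add, map_mul, PowerSeries.map_C, PowerSeries.map_C,
      PowerSeries.map_X, Complex.conj_ofReal, map_natCast]
  rw [map_mul, map_cycleGen, map_one, PowerSeries.map_X, hκ] at h
  have h2 := left_inv_eq_right_inv h (mul_invCycleGen p hμ)
  have h3 := congrArg (fun b => b.coeff σ) h2
  simpa using h3

/-- The formal power series `s_α(λ⁻¹ μ + p)`. -/
def classCoeff (r : ℕ) (α : Con r) : PowerSeries ℂ :=
  PowerSeries.X ^ r * (invCycleGen p hμ r).coeff (Quotient.out α)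

theorem classCoeff_mk (σ : Perm (Fin r)) : classCoeff p hμ r (ConjClasses.mk σ) =
    PowerSeries.X ^ r * (invCycleGen p hμ r).coeff σ := by
  rw [classCoeff, coeff_invCycleGen_eq_of_isConj p hμ
    (ConjClasses.mk_eq_mk_iff_isConj.mp (Quotient.out_eq (ConjClasses.mk σ)))]

/-- The rational functions `s_α`. -/
def ratCoeff (r : ℕ) (α : Con r) : RatFunc ℂ :=
  (↑(isUnit_cycleSum r).unit⁻¹ : MonoidAlgebra (RatFunc ℂ) (Perm (Fin r))).coeff (Quotient.out α)

theorem sum_ratCoeff (r : ℕ) : ∑ α, ratCoeff r α • classSum (RatFunc ℂ) α =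
    ↑(isUnit_cycleSum r).unit⁻¹ := by
  refine eq_sum_smul_classSum fun σ τ h => ?_
  have h1 := (isUnit_cycleSum r).val_inv_mul
  have h2 := (isUnit_cycleSum r).mul_val_inv
  refine coeff_eq_of_isConj_of_mul_cycleGen_eq_one (κ := RatFunc.X) (l := 1) ?_ ?_ h
  · rw [← cycleSum_eq, h1]
  · rw [← cycleSum_eq, h2]

theorem ofPowerSeries_classCoeff (r : ℕ) (α : Con r) :
    HahnSeries.ofPowerSeries ℤ ℂ (classCoeff p hμ r α) =
      (ratCoeff r α).eval HahnSeries.C (cLaurent p μ) := by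
  have h1 := congrArg (mapRingHom (Perm (Fin r)) (evalCLaurent p hμ))
    (isUnit_cycleSum r).mul_val_inv
  rw [map_mul, map_one] at h1
  have h2 := left_inv_eq_right_inv (mapRingHom_evalCLaurent_mul p hμ
    (invCycleGen_mul (r := r) p hμ)) h1
  have h3 := congrArg (fun b => b.coeff (Quotient.out α)) h2
  rw [← evalCLaurent_apply p hμ, ratCoeff, classCoeff, map_mul, map_pow]
  simpa using h3

theorem coeff_zero_invCycleGen_one :
    PowerSeries.constantCoeff ((invCycleGen p hμ 1).coeff 1) = (μ : ℂ)⁻¹ := by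
  have h := congrArg (fun b => PowerSeries.constantCoeff (b.coeff 1))
    (invCycleGen_mul (r := 1) p hμ)
  have h1 : cycleGen 1 (kappa p μ) PowerSeries.X = single 1 (kappa p μ) := by
    rw [cycleGen, Fintype.sum_unique]
    have : (default : Perm (Fin 1)) = 1 := Subsingleton.elim _ _
    rw [this, cyc_one]
    simp
  rw [h1] at h
  simp only [coeff_mul_single_one, map_mul, constantCoeff_kappa, coeff_one_one, map_one] at h
  exact eq_inv_of_mul_eq_one_left h

theorem invCycleGen_zero : invCycleGen p hμ 0 = 1 := by
  have h := invCycleGen_mul (r := 0) p hμ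
  have h1 : cycleGen 0 (kappa p μ) PowerSeries.X = 1 := by
    rw [← cycleGenFrom_zero, cycleGenFrom_self]
  rwa [h1, mul_one] at h

end GroupAlgebra
end GrassStar
end

noncomputable section

/-! ## Contraction of tensors along a permutation -/

namespace Contraction

open Equiv Function

variable {A : Type*} [CommRing A] {r p : ℕ}

/-- The contraction of a tensor with `r` pairs of indices with matrices `y k`, where the first
indices are permuted by `σ`. -/
def contr (σ : Perm (Fin r)) (T : (Fin r → Fin p) → (Fin r → Fin p) → A) :
    MultilinearMap A (fun _ : Fin r => Fin p → Fin p → A) A :=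
  ∑ I : Fin r → Fin p, ∑ K : Fin r → Fin p, T (I ∘ ⇑σ⁻¹) K •
    (MultilinearMap.mkPiAlgebra A (Fin r) A).compLinearMap fun k =>
      LinearMap.proj (φ := fun _ => A) (I k) ∘ₗ LinearMap.proj (φ := fun _ => Fin p → A) (K k)

variable (σ : Perm (Fin r)) (T : (Fin r → Fin p) → (Fin r → Fin p) → A)

theorem contr_apply (y : Fin r → Fin p → Fin p → A) :
    contr σ T y = ∑ I : Fin r → Fin p, ∑ K : Fin r → Fin p,
      T (I ∘ ⇑σ⁻¹) K * ∏ k, y k (K k) (I k) := by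
  simp [contr]

theorem map_contr {B : Type*} [CommRing B] (φ : A →+* B) (y : Fin r → Fin p → Fin p → A) :
    φ (contr σ T y) = contr σ (fun L K => φ (T L K)) fun k a b => φ (y k a b) := by
  simp only [contr_apply, map_sum, map_mul, map_prod]

theorem contr_one : contr σ T (fun _ a b => if a = b then 1 else 0) = ∑ I, T (I ∘ ⇑σ⁻¹) I := by
  classical
  rw [contr_apply]
  refine Finset.sum_congr rfl fun I _ => ?_
  rw [Finset.sum_eq_single I]
  · simp
  · intro K _ h
    obtain ⟨k, hk⟩ := Function.ne_iff.mp h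
    rw [Finset.prod_eq_zero (Finset.mem_univ k) (if_neg hk), mul_zero]
  · simp

/-- Relabelling both families of summation indices by `σ` moves the permutation to the other tensor
factor, as its inverse. -/
theorem contr_transpose (x : Fin p → Fin p → A) :
    contr σ T (fun _ => x) = contr σ⁻¹ (fun L K => T K L) fun _ a b => x b a := by
  rw [contr_apply, contr_apply, Finset.sum_comm]
  refine Fintype.sum_equiv (arrowCongr σ (Equiv.refl _)) _ _ fun K => ?_
  refine Fintype.sum_equiv (arrowCongr σ (Equiv.refl _)) _ _ fun I => ?_
  have h : ∀ J : Fin r → Fin p, (arrowCongr σ (Equiv.refl _)) J = J ∘ ⇑σ⁻¹ := fun _ => rfl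
  have h2 : (K ∘ ⇑σ⁻¹) ∘ ⇑(σ⁻¹)⁻¹ = K := by
    funext s
    simp
  rw [h, h, h2]
  congr 1
  exact Fintype.prod_equiv σ _ _ fun k => by simp

/-- A change of basis in the tensor is equivalent to the transposed change of basis in the slot
matrices, and the permutation only reorders the factors. Since `x(zg) = g† x(z) g`, this yields the
invariance of contractions with `x`. -/
theorem contr_transform {T' : (Fin r → Fin p) → (Fin r → Fin p) → A} {g h : Fin p → Fin p → A}
    (hT : ∀ L K, T L K = ∑ L', ∑ K', ((∏ s, g (L s) (L' s)) * ∏ s, h (K s) (K' s)) * T' L' K')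
    (y : Fin r → Fin p → Fin p → A) :
    contr σ T y = contr σ T' fun k a b => ∑ c, ∑ d, h c a * y k c d * g d b := by
  classical
  have h1 : ∀ I' K' : Fin r → Fin p,
      ∏ k, ∑ c, ∑ d, h c (K' k) * y k c d * g d (I' k) =
        ∑ K : Fin r → Fin p, ∑ I : Fin r → Fin p,
          ∏ k, (h (K k) (K' k) * y k (K k) (I k) * g (I k) (I' k)) := fun I' K' => by
    rw [Finset.prod_univ_sum, Fintype.piFinset_univ]
    refine Finset.sum_congr rfl fun K _ => ?_
    rw [Finset.prod_univ_sum, Fintype.piFinset_univ]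
  have h2 : ∀ I K : Fin r → Fin p, T (I ∘ ⇑σ⁻¹) K = ∑ I', ∑ K',
      ((∏ k, g (I k) (I' k)) * ∏ s, h (K s) (K' s)) * T' (I' ∘ ⇑σ⁻¹) K' := fun I K => by
    rw [hT]
    symm
    refine Fintype.sum_equiv (arrowCongr σ (Equiv.refl _)) _ _ fun I' => ?_
    refine Finset.sum_congr rfl fun K' _ => ?_
    congr 2
    exact Fintype.prod_equiv σ _ _ fun k => by simp
  simp only [contr_apply, h1, h2, Finset.sum_mul, Finset.mul_sum]
  calc _ = ∑ I : Fin r → Fin p, ∑ I' : Fin r → Fin p, ∑ K : Fin r → Fin p, ∑ K' : Fin r → Fin p,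
        ((∏ k, g (I k) (I' k)) * ∏ s, h (K s) (K' s)) * T' (I' ∘ ⇑σ⁻¹) K' *
          ∏ k, y k (K k) (I k) := Finset.sum_congr rfl fun I _ => Finset.sum_comm
    _ = ∑ I' : Fin r → Fin p, ∑ I : Fin r → Fin p, ∑ K' : Fin r → Fin p, ∑ K : Fin r → Fin p,
        ((∏ k, g (I k) (I' k)) * ∏ s, h (K s) (K' s)) * T' (I' ∘ ⇑σ⁻¹) K' *
          ∏ k, y k (K k) (I k) := by
      rw [Finset.sum_comm]
      exact Finset.sum_congr rfl fun I' _ => Finset.sum_congr rfl fun I _ => Finset.sum_comm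
    _ = _ := by
      refine Finset.sum_congr rfl fun I' _ => ?_
      rw [Finset.sum_comm]
      refine Finset.sum_congr rfl fun K' _ => ?_
      rw [Finset.sum_comm]
      refine Finset.sum_congr rfl fun K _ => Finset.sum_congr rfl fun I _ => ?_
      rw [Finset.prod_mul_distrib, Finset.prod_mul_distrib]
      ring

theorem derivation_prod {ι : Type*} [DecidableEq ι] {E : A →+ A}
    (hE : ∀ u v, E (u * v) = E u * v + u * E v) (s : Finset ι) (u : ι → A) :
    E (∏ k ∈ s, u k) = ∑ k ∈ s, ∏ l ∈ s, update u k (E (u k)) l := by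
  induction s using Finset.induction_on with
  | empty =>
    have h := hE 1 1
    simp only [mul_one, one_mul, left_eq_add] at h
    simpa using h
  | insert a s ha ih =>
    rw [Finset.prod_insert ha, hE, ih, Finset.sum_insert ha, Finset.prod_insert ha, update_self,
      Finset.mul_sum]
    congr 1
    · congr 1
      refine Finset.prod_congr rfl fun l hl => ?_
      rw [update_of_ne (by rintro rfl; exact ha hl)]
    · refine Finset.sum_congr rfl fun k hk => ?_
      rw [Finset.prod_insert ha, update_of_ne (by rintro rfl; exact ha hk)]

theorem prod_update_apply (y : Fin r → Fin p → Fin p → A) (k : Fin r) (v : Fin p → Fin p → A)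
    (I K : Fin r → Fin p) :
    ∏ l, update y k v l (K l) (I l) =
      ∏ l, update (fun l => y l (K l) (I l)) k (v (K k) (I k)) l := by
  refine Finset.prod_congr rfl fun l _ => ?_
  rcases eq_or_ne l k with rfl | h
  · rw [update_self, update_self]
  · rw [update_of_ne h, update_of_ne h]

theorem sum_contr_update {i j : Fin p} (k : Fin r) (K : Fin r → Fin p)
    (y : Fin r → Fin p → Fin p → A) :
    ∑ I : Fin r → Fin p, (if I k = i then T (update I k j ∘ ⇑σ⁻¹) K else 0) *
        ∏ l, y l (K l) (I l) =
      ∑ I : Fin r → Fin p, T (I ∘ ⇑σ⁻¹) K *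
        ∏ l, update y k (fun a b => if b = j then y k a i else 0) l (K l) (I l) := by
  have h1 : ∀ I : Fin r → Fin p, T (I ∘ ⇑σ⁻¹) K *
      ∏ l, update y k (fun a b => if b = j then y k a i else 0) l (K l) (I l) =
      if I k = j then T (I ∘ ⇑σ⁻¹) K * ∏ l, y l (K l) (update I k i l) else 0 := fun I => by
    rw [prod_update_apply]
    split_ifs with h
    · congr 1
      refine Finset.prod_congr rfl fun l _ => ?_
      rcases eq_or_ne l k with rfl | h'
      · rw [update_self, update_self]
      · rw [update_of_ne h', update_of_ne h']
    · rw [Finset.prod_eq_zero (Finset.mem_univ k) (update_self k _ _), mul_zero]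
  simp only [h1, ite_mul, zero_mul]
  rw [← Finset.sum_filter, ← Finset.sum_filter]
  refine Finset.sum_nbij' (fun I => update I k j) (fun I => update I k i) ?_ ?_ ?_ ?_ ?_
  · intro I _; simp
  · intro I _; simp
  · intro I hI
    have h := (Finset.mem_filter.mp hI).2
    simp [← h]
  · intro I hI
    have h := (Finset.mem_filter.mp hI).2
    simp [← h]
  · intro I hI
    have h := (Finset.mem_filter.mp hI).2
    simp [← h]

/-- Leibniz rule over the slots. The index substitution which the derivation makes in the tensor can
be shifted onto the slot in question, where it puts column `i` of the matrix into column `j`; the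
sign is that of the commutator in the hypothesis on `T`. -/
theorem derivation_contr {E : A →+ A} (hE : ∀ u v, E (u * v) = E u * v + u * E v) {i j : Fin p}
    (hT : ∀ L K, E (T L K) = -∑ s, if L s = i then T (update L s j) K else 0)
    (y : Fin r → Fin p → Fin p → A) :
    E (contr σ T y) = ∑ k, contr σ T (update y k fun a b =>
      E (y k a b) - if b = j then y k a i else 0) := by
  have h1 : ∀ I K : Fin r → Fin p, E (T (I ∘ ⇑σ⁻¹) K) =
      -∑ k, if I k = i then T (update I k j ∘ ⇑σ⁻¹) K else 0 := fun I K => by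
    rw [hT]
    congr 1
    symm
    refine Fintype.sum_equiv σ _ _ fun k => ?_
    have h : update I k j ∘ ⇑σ⁻¹ = update (I ∘ ⇑σ⁻¹) (σ k) j := by
      funext s
      simp only [comp_apply, update_apply, Perm.inv_eq_iff_eq]
    have h' : (I ∘ ⇑σ⁻¹) (σ k) = I k := by simp
    simp only [h, h']
  have h2 : ∀ k, contr σ T (update y k fun a b => E (y k a b) - if b = j then y k a i else 0) =
      contr σ T (update y k fun a b => E (y k a b)) -
        contr σ T (update y k fun a b => if b = j then y k a i else 0) := fun k => by
    rw [← MultilinearMap.map_update_sub]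
    rfl
  simp only [h2, Finset.sum_sub_distrib]
  rw [contr_apply, map_sum]
  simp only [map_sum, hE, Finset.sum_add_distrib, h1, derivation_prod hE]
  rw [sub_eq_add_neg, add_comm]
  congr 1
  · simp only [contr_apply, Finset.mul_sum]
    rw [Finset.sum_congr rfl fun I _ => Finset.sum_comm, Finset.sum_comm]
    refine Finset.sum_congr rfl fun k _ => Finset.sum_congr rfl fun I _ =>
      Finset.sum_congr rfl fun K _ => ?_
    rw [prod_update_apply]
  · simp only [neg_mul, Finset.sum_neg_distrib, neg_inj, Finset.sum_mul, contr_apply]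
    rw [Finset.sum_congr rfl fun I _ => Finset.sum_comm, Finset.sum_comm]
    refine Finset.sum_congr rfl fun k _ => ?_
    rw [Finset.sum_comm]
    conv_rhs => rw [Finset.sum_comm]
    exact Finset.sum_congr rfl fun K _ => sum_contr_update σ T k K y

/-- The matrix unit with entry one at `(a, b)`. -/
def unitMat (A : Type*) [CommRing A] {p : ℕ} (a b : Fin p) : Fin p → Fin p → A :=
  fun c d => if c = a ∧ d = b then 1 else 0

theorem sum_unitMat : ∑ j : Fin p, unitMat A j j = fun a b => if a = b then 1 else 0 := by
  funext a b
  simp only [Finset.sum_apply, unitMat, ite_and]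
  rw [Finset.sum_eq_single a]
  · simp only [eq_comm (a := a), if_true]
  · intro j _ hj
    rw [if_neg hj.symm]
  · simp

/-- The tensor `∑ e_ji ⊗ e_ij` is the flip of two factors. This is how transpositions, and with them
the group algebra, enter the calculation. -/
theorem sum_contr_unitMat_unitMat {m k : Fin r} (hmk : m ≠ k) {y : Fin r → Fin p → Fin p → A}
    (hm : y m = fun a b => if a = b then 1 else 0) (hk : y k = fun a b => if a = b then 1 else 0) :
    ∑ i, ∑ j, contr σ T (update (update y m (unitMat A j i)) k (unitMat A i j)) =
      contr (σ * swap m k) T y := by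
  have hprod : ∀ u : Fin r → A, ∏ l, u l = (∏ l ∈ (Finset.univ.erase m).erase k, u l) * u k * u m :=
    fun u => by
      rw [Finset.prod_erase_mul _ _ (Finset.mem_erase.mpr ⟨hmk.symm, Finset.mem_univ k⟩),
        Finset.prod_erase_mul _ _ (Finset.mem_univ m)]
  have h1 : ∀ I K : Fin r → Fin p, ∑ i, ∑ j,
      ∏ l, update (update y m (unitMat A j i)) k (unitMat A i j) l (K l) (I l) =
        ∏ l, y l (K l) (I (swap m k l)) := fun I K => by
    have h2 : ∀ i j, ∏ l, update (update y m (unitMat A j i)) k (unitMat A i j) l (K l) (I l) =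
        (∏ l ∈ (Finset.univ.erase m).erase k, y l (K l) (I (swap m k l))) *
          unitMat A i j (K k) (I k) * unitMat A j i (K m) (I m) := fun i j => by
      rw [hprod, update_self, update_of_ne hmk, update_self]
      congr 2
      refine Finset.prod_congr rfl fun l hl => ?_
      have hl' := Finset.mem_erase.mp hl
      have hl'' := (Finset.mem_erase.mp hl'.2).1
      rw [update_of_ne hl'.1, update_of_ne hl'', swap_apply_of_ne_of_ne hl'' hl'.1]
    simp only [h2]
    rw [hprod (fun l => y l (K l) (I (swap m k l))), swap_apply_left, swap_apply_right, hm, hk,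
      Finset.sum_eq_single (K k), Finset.sum_eq_single (I k)]
    · simp only [unitMat, mul_assoc, if_true, and_true, ite_and]
      congr 1
      simp only [eq_comm]
      split_ifs <;> simp_all
    · intro j _ hj
      simp [unitMat, hj.symm]
    · simp
    · intro i _ hi
      simp [unitMat, hi.symm]
    · simp
  calc _ = ∑ I : Fin r → Fin p, ∑ K : Fin r → Fin p, T (I ∘ ⇑σ⁻¹) K * ∑ i, ∑ j,
      ∏ l, update (update y m (unitMat A j i)) k (unitMat A i j) l (K l) (I l) := by
        simp only [contr_apply, Finset.mul_sum]
        rw [Finset.sum_congr rfl fun i _ => Finset.sum_comm, Finset.sum_comm]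
        refine Finset.sum_congr rfl fun I _ => ?_
        rw [Finset.sum_congr rfl fun i _ => Finset.sum_comm, Finset.sum_comm]
    _ = _ := by
        simp only [h1, contr_apply]
        refine Fintype.sum_equiv (arrowCongr (swap m k) (Equiv.refl _)) _ _ fun I => ?_
        refine Finset.sum_congr rfl fun K _ => ?_
        have h3 : (arrowCongr (swap m k) (Equiv.refl _)) I = I ∘ ⇑(swap m k) := by
          funext s; simp
        rw [h3]
        congr 2
        funext s
        simp

end Contraction
end

noncomputable section
namespace GrassStar
open Matrix
open scoped ContDiff ComplexOrder ComplexConjugate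

/-! ## Contractions of iterated derivatives -/

section IteratedDerivatives

open Function Contraction
open PowerSeries (C X)

variable {p q r : ℕ}

/-- The commutator arises from differentiating the coefficient `z_i` of `E_ij`: it replaces an index
`i` of the derivative by `j`, with a minus sign. -/
theorem holE_dz (i j k : Fin p) (B : Fin (p + q)) (u : SmoothFun p q) :
    holE i j (dz (B, k) u) = dz (B, k) (holE i j u) - if k = i then dz (B, j) u else 0 := by
  have h : ∀ A : Fin (p + q), (dz (p := p) (q := q) (B, k)) (coordFun A i * dz (A, j) u) =
      coordFun A i * dz (A, j) (dz (B, k) u) +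
        if B = A then (if k = i then dz (B, j) u else 0) else 0 := fun A => by
    have hc : dz (B, k) (dz (A, j) u) = dz (A, j) (dz (B, k) u) :=
      LinearMap.congr_fun (commute_dz_dz (p := p) (q := q) (B, k) (A, j)) u
    rw [dz_mul, dz_coordFun, hc, add_comm]
    congr 1
    by_cases h1 : B = A
    · subst h1
      by_cases h2 : k = i
      · rw [if_pos ⟨rfl, h2⟩, if_pos rfl, if_pos h2, one_mul]
      · rw [if_neg fun h => h2 h.2, if_pos rfl, if_neg h2, zero_mul]
    · rw [if_neg fun h => h1 h.1, if_neg h1, zero_mul]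
  rw [holE_apply, holE_apply, map_sum, Finset.sum_congr rfl fun A _ => h A,
    Finset.sum_add_distrib, Finset.sum_ite_eq, if_pos (Finset.mem_univ B), add_sub_cancel_right]

theorem holE_dzbar (i j : Fin p) (b : Fin (p + q) × Fin p) (u : SmoothFun p q) :
    holE i j (dzbar b u) = dzbar b (holE i j u) := by
  rw [holE_apply, holE_apply, map_sum]
  refine Finset.sum_congr rfl fun A _ => ?_
  have hc : dz (A, j) (dzbar b u) = dzbar b (dz (A, j) u) :=
    LinearMap.congr_fun (commute_dz_dzbar (p := p) (q := q) (A, j) b) u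
  have hb : dzbar b (coordFun A i) = 0 := dzbar_coordFun _ _ _ _
  rw [dzbar_mul, hc, hb, zero_mul, zero_add]

theorem iterDz_zero (a : Fin 0 → Fin (p + q) × Fin p) : iterDz a = 1 := by simp [iterDz]

theorem iterDzbar_zero (a : Fin 0 → Fin (p + q) × Fin p) : iterDzbar a = 1 := by simp [iterDzbar]

theorem iterDz_succ (a : Fin (r + 1) → Fin (p + q) × Fin p) :
    iterDz a = dz (a 0) * iterDz fun k => a k.succ := by simp [iterDz, List.ofFn_succ]

theorem iterDzbar_succ (a : Fin (r + 1) → Fin (p + q) × Fin p) :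
    iterDzbar a = dzbar (a 0) * iterDzbar fun k => a k.succ := by simp [iterDzbar, List.ofFn_succ]

theorem holE_iterDz (i j : Fin p) {f : SmoothFun p q} (hf : holE i j f = 0)
    (A : Fin r → Fin (p + q)) (L : Fin r → Fin p) :
    holE i j (iterDz (fun k => (A k, L k)) f) =
      -∑ s, if L s = i then iterDz (fun k => (A k, update L s j k)) f else 0 := by
  induction r with
  | zero => simp [iterDz_zero, hf]
  | succ r ih =>
    have h := ih (fun k => A k.succ) (fun k => L k.succ)
    rw [iterDz_succ, Module.End.mul_apply, holE_dz, h, Fin.sum_univ_succ, map_neg, map_sum,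
      neg_add, sub_eq_add_neg, add_comm]
    congr 2
    · congr 1
      rw [iterDz_succ, Module.End.mul_apply, update_self]
      rfl
    · refine Finset.sum_congr rfl fun s _ => ?_
      rw [iterDz_succ, Module.End.mul_apply, update_of_ne (Fin.succ_ne_zero s).symm]
      have h2 : (fun k : Fin r => (A k.succ, update L s.succ j k.succ)) =
          fun k => (A k.succ, update (fun k => L k.succ) s j k) := by
        funext k
        rcases eq_or_ne k s with rfl | hk
        · rw [update_self, update_self]
        · rw [update_of_ne hk, update_of_ne (by simpa using hk)]
      rw [h2]
      split_ifs
      · rfl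
      · exact map_zero _

theorem holE_iterDzbar (i j : Fin p) {f : SmoothFun p q} (hf : holE i j f = 0)
    (a : Fin r → Fin (p + q) × Fin p) : holE i j (iterDzbar a f) = 0 := by
  induction r with
  | zero => rwa [iterDzbar_zero, Module.End.one_apply]
  | succ r ih => rw [iterDzbar_succ, Module.End.mul_apply, holE_dzbar, ih, map_zero]

theorem iterate_pull {B : Type*} [AddCommGroup B] [Module ℂ B] {ι : Type*}
    {d : ι × Fin p → Module.End ℂ B} {R : B →ₗ[ℂ] B} {g : Fin p → Fin p → ℂ}
    (hd : ∀ A k u, d (A, k) (R u) = ∑ j, g k j • R (d (A, j) u)) {f : B} (hf : R f = f)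
    (A : Fin r → ι) (L : Fin r → Fin p) :
    (List.ofFn fun k => d (A k, L k)).prod f =
      ∑ L' : Fin r → Fin p, (∏ s, g (L s) (L' s)) • R ((List.ofFn fun k => d (A k, L' k)).prod f) := by
  induction r with
  | zero => simp [hf]
  | succ r ih =>
    rw [List.ofFn_succ, List.prod_cons, Module.End.mul_apply, ih, map_sum]
    simp only [map_smul, hd, Finset.smul_sum]
    rw [Finset.sum_comm, ← Fintype.sum_prod_type' fun (j : Fin p) (L' : Fin r → Fin p) =>
        (∏ s : Fin r, g (L s.succ) (L' s)) • g (L 0) j •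
          R (d (A 0, j) ((List.ofFn fun k : Fin r => d (A k.succ, L' k)).prod f))]
    refine Fintype.sum_equiv (Fin.consEquiv fun _ => Fin p) _ _ fun x => ?_
    rw [Fin.prod_univ_succ, List.ofFn_succ, List.prod_cons, Module.End.mul_apply, smul_smul,
      mul_comm]
    rfl

theorem neg_sum_ite_mul {B ι : Type*} [CommRing B] (s : Finset ι) (P : ι → Prop) [DecidablePred P]
    (u : ι → B) (v : B) : (-∑ k ∈ s, if P k then u k else 0) * v =
      -∑ k ∈ s, if P k then u k * v else 0 := by
  simp only [neg_mul, Finset.sum_mul, ite_mul, zero_mul]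

/-- The tensor `∑ A, ∂^r f / ∂z^A_L · ∂^r g / ∂z̄^A_K`. -/
def dTensor (f g : SmoothFun p q) (L K : Fin r → Fin p) : SmoothFun p q :=
  ∑ A : Fin r → Fin (p + q), iterDz (fun k => (A k, L k)) f * iterDzbar (fun k => (A k, K k)) g

theorem holE_dTensor (i j : Fin p) {f g : SmoothFun p q} (hf : holE i j f = 0)
    (hg : holE i j g = 0) (L K : Fin r → Fin p) :
    holE i j (dTensor f g L K) =
      -∑ s, if L s = i then dTensor f g (update L s j) K else 0 := by
  rw [dTensor, map_sum]
  simp only [holE_mul, holE_iterDz i j hf, holE_iterDzbar i j hg, mul_zero, add_zero,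
    neg_sum_ite_mul]
  rw [Finset.sum_neg_distrib, Finset.sum_comm]
  congr 1
  refine Finset.sum_congr rfl fun s _ => ?_
  split_ifs
  · rfl
  · exact Finset.sum_const_zero

theorem dTensor_pull (g : GL (Fin p) ℂ) {f h : SmoothFun p q} (hf : pullGL g f = f)
    (hh : pullGL g h = h) (L K : Fin r → Fin p) :
    dTensor f h L K = ∑ L', ∑ K',
      ((∏ s, algebraMap ℂ (SmoothFun p q) (g.1 (L s) (L' s))) *
        ∏ s, algebraMap ℂ (SmoothFun p q) (conj (g.1 (K s) (K' s)))) *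
          pullGL g (dTensor f h L' K') := by
  have h1 : ∀ A : Fin r → Fin (p + q), iterDz (fun k => (A k, L k)) f = _ := fun A =>
    iterate_pull (R := (pullGL (p := p) (q := q) g).toLinearMap) (d := dz (p := p) (q := q))
      (g := fun a b => g.1 a b) (fun A k u => dz_pullGL g A k u) hf A L
  have h2 : ∀ A : Fin r → Fin (p + q), iterDzbar (fun k => (A k, K k)) h = _ := fun A =>
    iterate_pull (R := (pullGL (p := p) (q := q) g).toLinearMap) (d := dzbar (p := p) (q := q))
      (g := fun a b => conj (g.1 a b)) (fun A k u => dzbar_pullGL g A k u) hh A K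
  rw [dTensor]
  simp only [h1, h2, Finset.sum_mul_sum]
  rw [Finset.sum_comm]
  refine Finset.sum_congr rfl fun L' _ => ?_
  rw [Finset.sum_comm]
  refine Finset.sum_congr rfl fun K' _ => ?_
  rw [dTensor, map_sum, Finset.mul_sum]
  refine Finset.sum_congr rfl fun A _ => ?_
  have h3 : (∏ s, algebraMap ℂ (SmoothFun p q) (g.1 (L s) (L' s))) *
      ∏ s, algebraMap ℂ (SmoothFun p q) (conj (g.1 (K s) (K' s))) =
      algebraMap ℂ (SmoothFun p q) ((∏ s, g.1 (L s) (L' s)) * ∏ s, conj (g.1 (K s) (K' s))) := by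
    rw [map_mul, map_prod, map_prod]
  have h4 := map_mul (pullGL (p := p) (q := q) g) (iterDz (fun k => (A k, L' k)) f)
    (iterDzbar (fun k => (A k, K' k)) h)
  rw [h3, ← Algebra.smul_def, h4]
  exact smul_mul_smul_comm _ _ _ _

theorem conjFun_iterDz (a : Fin r → Fin (p + q) × Fin p) (f : SmoothFun p q) :
    conjFun (iterDz a f) = iterDzbar a (conjFun f) := by
  induction r with
  | zero => simp [iterDz_zero, iterDzbar_zero]
  | succ r ih => rw [iterDz_succ, iterDzbar_succ, Module.End.mul_apply, conjFun_dz, ih]; rfl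

theorem conjFun_iterDzbar (a : Fin r → Fin (p + q) × Fin p) (f : SmoothFun p q) :
    conjFun (iterDzbar a f) = iterDz a (conjFun f) := by
  rw [← conjFun_conjFun (iterDz a (conjFun f)), conjFun_iterDz, conjFun_conjFun]

theorem conjHom_apply (f : SmoothFun p q) : conjHom p q f = conjFun f := rfl

theorem conjFun_dTensor (f g : SmoothFun p q) (L K : Fin r → Fin p) :
    conjFun (dTensor f g L K) = dTensor (conjFun g) (conjFun f) K L := by
  rw [dTensor, dTensor, ← conjHom_apply, map_sum]
  simp only [map_mul, conjHom_apply, conjFun_iterDz, conjFun_iterDzbar]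
  exact Finset.sum_congr rfl fun A _ => mul_comm _ _

/-! ### The recursion modulo the star ideal -/

/-- The matrices `x` in the slots `k < m`, and `1` in the remaining slots. -/
def slots (q : ℕ) (m : ℕ) (k : Fin r) (a b : Fin p) : SmoothFun p q :=
  if k.1 < m then gram a b else if a = b then 1 else 0

/-- The contraction of the iterated derivatives with `x` in the first `m` slots. -/
def contrDeriv (f g : SmoothFun p q) (m : ℕ) (σ : Equiv.Perm (Fin r)) : SmoothFun p q :=
  contr σ (dTensor f g) (slots q m)

theorem update_slots_gram (m : Fin r) :
    update (slots q m.1) m (fun a b : Fin p => gram a b) = slots q (m.1 + 1) := by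
  funext k a b
  rcases eq_or_ne k m with rfl | h
  · rw [update_self, slots, if_pos (Nat.lt_succ_self _)]
  · rw [update_of_ne h, slots, slots]
    have : k.1 ≠ m.1 := fun h' => h (Fin.ext h')
    simp only [show k.1 < m.1 + 1 ↔ k.1 < m.1 by omega]

theorem update_slots_one (m : Fin r) :
    update (slots q m.1) m (fun a b : Fin p => if a = b then 1 else 0) = slots q m.1 := by
  refine update_eq_self_iff.mpr ?_ |>.trans rfl
  funext a b
  rw [slots, if_neg (lt_irrefl _)]

variable {f g : SmoothFun p q} (m : Fin r) (σ : Equiv.Perm (Fin r))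

/-- Contraction is linear in slot `m`, and `∑ (x-μ)_ji e_ji = x - μ 1`; this is the pointwise part
of the element of the star ideal. -/
theorem sum_contr_unitMat_mul_momentum (μ : ℝ) :
    ∑ i, ∑ j, contr σ (dTensor f g) (update (slots q m.1) m (unitMat _ j i)) *
        momentumEntry μ j i = contrDeriv f g (m.1 + 1) σ - (μ : ℂ) • contrDeriv f g m.1 σ := by
  have h : ∑ i : Fin p, ∑ j, (momentumEntry (q := q) μ j i) • unitMat (SmoothFun p q) j i =
      (fun a b => gram a b) -
        algebraMap ℂ (SmoothFun p q) μ • fun a b => if a = b then 1 else 0 := by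
    funext a b
    simp only [Finset.sum_apply, Pi.smul_apply, smul_eq_mul, unitMat, mul_ite, mul_one, mul_zero,
      ite_and]
    rw [Finset.sum_eq_single b, Finset.sum_eq_single a]
    · rw [if_pos rfl, if_pos rfl, momentumEntry_eq]
      change _ = gram a b - algebraMap ℂ (SmoothFun p q) μ * (if a = b then 1 else 0)
      congr 1
      by_cases hab : a = b
      · rw [if_pos hab, if_pos hab, mul_one]
      · rw [if_neg hab, if_neg hab, mul_zero, map_zero]
    · intro j _ hj
      rw [if_neg hj.symm]
    · simp
    · intro i _ hi
      refine Finset.sum_eq_zero fun j _ => ?_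
      rw [if_neg hi.symm, ite_self]
    · simp
  have h2 := congrArg (fun v => contr σ (dTensor f g) (update (slots q m.1) m v)) h
  simp only [MultilinearMap.map_update_sum, MultilinearMap.map_update_smul,
    MultilinearMap.map_update_sub, update_slots_gram, update_slots_one] at h2
  simp only [smul_eq_mul] at h2
  rw [contrDeriv, contrDeriv, Algebra.smul_def, ← h2]
  exact Finset.sum_congr rfl fun i _ => Finset.sum_congr rfl fun j _ => mul_comm _ _

theorem sum_sum_neg {ι ι' B : Type*} [AddCommGroup B] (s : Finset ι) (t : Finset ι')
    (u : ι → ι' → B) : ∑ i ∈ s, ∑ j ∈ t, -u i j = -∑ i ∈ s, ∑ j ∈ t, u i j := by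
  simp only [Finset.sum_neg_distrib]

/-- The part of order `λ`, slot by slot: slots with `x` cancel, slot `m` itself yields the constant
`p`, and each later slot, holding the identity, combines with slot `m` into a transposition. -/
theorem sum_holE_contr_unitMat (hf : ∀ i j, holE i j f = 0) (hg : ∀ i j, holE i j g = 0) :
    ∑ i, ∑ j, holE i j (contr σ (dTensor f g) (update (slots q m.1) m (unitMat _ j i))) =
      -((p : ℂ) • contrDeriv f g m.1 σ + ∑ k with m < k, contrDeriv f g m.1 (σ * Equiv.swap m k)) := by
  set T : (Fin r → Fin p) → (Fin r → Fin p) → SmoothFun p q := dTensor f g with hT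
  set y : Fin p → Fin p → Fin r → Fin p → Fin p → SmoothFun p q :=
    fun i j => update (slots q m.1) m (unitMat _ j i) with hy
  have h1 : ∀ i j, holE i j (contr σ T (y i j)) =
      ∑ k, contr σ T (update (y i j) k fun a b =>
        holE i j (y i j k a b) - if b = j then y i j k a i else 0) := fun i j =>
    derivation_contr σ T (E := (holE i j).toAddMonoidHom) (fun u v => holE_mul i j u v)
      (fun L K => holE_dTensor i j (hf i j) (hg i j) L K) (y i j)
  have hE1 : ∀ (i j : Fin p) (P : Prop) [Decidable P],
      holE i j (if P then 1 else 0 : SmoothFun p q) = 0 := fun i j P _ => by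
    split_ifs
    · rw [← map_one (algebraMap ℂ (SmoothFun p q)), holE_algebraMap]
    · exact map_zero _
  -- `E_ij x_ab = δ_jb x_ai` is exactly the matrix with column `i` of `x` put into column `j`.
  have hlt : ∀ k : Fin r, k < m → ∀ i j, contr σ T (update (y i j) k fun a b =>
        holE i j (y i j k a b) - if b = j then y i j k a i else 0) = 0 := fun k hk i j => by
    refine MultilinearMap.map_coord_zero _ k ?_
    rw [update_self]
    funext a b
    rw [hy]
    simp only [update_of_ne hk.ne, slots]
    rw [if_pos (show k.1 < m.1 from hk), if_pos (show k.1 < m.1 from hk), holE_gram]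
    by_cases h : b = j
    · rw [if_pos h.symm, if_pos h]
      exact sub_self _
    · rw [if_neg fun h' => h h'.symm, if_neg h]
      exact sub_self _
  -- The result no longer depends on `i`, so summation over `i` produces the factor `p`, and
  -- summation over `j` restores the identity in the slot.
  have heq : ∀ i j, contr σ T (update (y i j) m fun a b =>
        holE i j (y i j m a b) - if b = j then y i j m a i else 0) =
        -contr σ T (update (slots q m.1) m (unitMat _ j j)) := fun i j => by
    rw [← neg_one_smul (SmoothFun p q), ← MultilinearMap.map_update_smul]
    congr 1
    simp only [hy, update_self, update_idem]
    congr 1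
    funext a b
    rw [Pi.smul_apply, Pi.smul_apply, neg_one_smul]
    have e1 : holE i j (unitMat (SmoothFun p q) j i a b) = 0 := hE1 i j _
    rw [e1, zero_sub]
    congr 1
    by_cases h : b = j
    · rw [if_pos h]
      simp only [unitMat, h, and_true]
    · rw [if_neg h, unitMat, if_neg fun h' => h h'.2]
  -- In a slot holding the identity, moving column `i` to column `j` leaves `e_ij`, the partner of
  -- the `e_ji` in slot `m`.
  have hgt : ∀ k : Fin r, m < k → ∀ i j, contr σ T (update (y i j) k fun a b =>
        holE i j (y i j k a b) - if b = j then y i j k a i else 0) =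
        -contr σ T (update (y i j) k (unitMat _ i j)) := fun k hk i j => by
    rw [← neg_one_smul (SmoothFun p q), ← MultilinearMap.map_update_smul]
    congr 1
    congr 1
    funext a b
    rw [Pi.smul_apply, Pi.smul_apply, neg_one_smul]
    simp only [hy, update_of_ne hk.ne', slots]
    rw [if_neg (show ¬k.1 < m.1 from hk.asymm), if_neg (show ¬k.1 < m.1 from hk.asymm), hE1,
      zero_sub, unitMat, ite_and]
    congr 1
    by_cases h : b = j
    · simp only [if_pos h]
    · simp only [if_neg h, ite_self]
  have hslot : ∀ k : Fin r, m ≤ k →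
      slots q m.1 k = fun a b : Fin p => if a = b then (1 : SmoothFun p q) else 0 := fun k hk => by
    funext a b
    rw [slots, if_neg (show ¬k.1 < m.1 from not_lt.mpr hk)]
  calc _ = ∑ k, ∑ i, ∑ j, contr σ T (update (y i j) k fun a b =>
        holE i j (y i j k a b) - if b = j then y i j k a i else 0) := by
        refine (Finset.sum_congr rfl fun i _ => Finset.sum_congr rfl fun j _ => h1 i j).trans ?_
        rw [Finset.sum_congr rfl fun i _ => Finset.sum_comm, Finset.sum_comm]
    _ = ∑ k, if k = m then -((p : ℂ) • contrDeriv f g m.1 σ) else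
        if m < k then -contrDeriv f g m.1 (σ * Equiv.swap m k) else 0 := by
        refine Finset.sum_congr rfl fun k _ => ?_
        rcases lt_trichotomy k m with h | rfl | h
        · rw [if_neg h.ne, if_neg h.asymm]
          exact Finset.sum_eq_zero fun i _ => Finset.sum_eq_zero fun j _ => hlt k h i j
        · rw [if_pos rfl]
          rw [Finset.sum_congr rfl fun i _ => Finset.sum_congr rfl fun j _ => heq i j,
            sum_sum_neg, ← MultilinearMap.map_update_sum, sum_unitMat, update_slots_one, Finset.sum_const,
            Finset.card_univ, Fintype.card_fin, ← Nat.cast_smul_eq_nsmul ℂ]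
          rfl
        · rw [if_neg h.ne', if_pos h]
          rw [Finset.sum_congr rfl fun i _ => Finset.sum_congr rfl fun j _ => hgt k h i j,
            sum_sum_neg, sum_contr_unitMat_unitMat σ T h.ne (hslot m le_rfl) (hslot k h.le)]
          rfl
    _ = _ := by
        rw [Finset.sum_ite, Finset.filter_eq', if_pos (Finset.mem_univ m), Finset.sum_singleton,
          neg_add, ← Finset.sum_filter, Finset.filter_filter, Finset.sum_neg_distrib]
        congr 2
        refine Finset.sum_congr (Finset.filter_congr fun k _ => ?_) fun _ _ => rfl
        exact ⟨fun h => h.2, fun h => ⟨h.ne', h⟩⟩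

/-- Contractions with slots that transform equivariantly. -/
theorem pullGL_contr (γ : GL (Fin p) ℂ) (hf : pullGL γ f = f) (hg : pullGL γ g = g)
    {y w : Fin r → Fin p → Fin p → SmoothFun p q}
    (h : ∀ k a b, pullGL γ (w k a b) = ∑ c, ∑ d, algebraMap ℂ (SmoothFun p q) (conj (γ.1 c a)) *
      y k c d * algebraMap ℂ (SmoothFun p q) (γ.1 d b)) :
    pullGL γ (contr σ (dTensor f g) w) = contr σ (dTensor f g) y := by
  have h1 := contr_transform σ (dTensor f g) (T' := fun L K => pullGL γ (dTensor f g L K))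
    (g := fun a b => algebraMap ℂ (SmoothFun p q) (γ.1 a b))
    (h := fun a b => algebraMap ℂ (SmoothFun p q) (conj (γ.1 a b)))
    (dTensor_pull γ hf hg) y
  have h2 := map_contr σ (dTensor f g) (pullGL (p := p) (q := q) γ).toRingHom w
  rw [h1]
  refine h2.trans ?_
  congr 1
  funext k a b
  exact h k a b

theorem pullGL_gram (γ : GL (Fin p) ℂ) (a b : Fin p) :
    pullGL γ (gram (q := q) a b) = ∑ c, ∑ d, algebraMap ℂ (SmoothFun p q) (conj (γ.1 c a)) *
      gram c d * algebraMap ℂ (SmoothFun p q) (γ.1 d b) := by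
  ext z
  simp only [SmoothFun.coe_sum, SmoothFun.coe_mul, gram_apply, pullGL_apply]
  have h : (mulGL z γ).1ᴴ * (mulGL z γ).1 = (γ.1)ᴴ * (z.1ᴴ * z.1) * γ.1 := by
    change (z.1 * γ.1)ᴴ * (z.1 * γ.1) = _
    rw [Matrix.conjTranspose_mul]
    simp only [Matrix.mul_assoc]
  rw [h, Matrix.mul_apply]
  simp only [Matrix.mul_apply (M := (γ.1)ᴴ), Finset.sum_mul]
  rw [Finset.sum_comm]
  rfl

/-- With `x` in all slots the transformation of the derivatives is compensated for all of GL, not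
only for unitary matrices. These contractions are therefore their own projections. -/
theorem pullGL_contrDeriv (γ : GL (Fin p) ℂ) (hf : pullGL γ f = f) (hg : pullGL γ g = g) :
    pullGL γ (contrDeriv f g r σ) = contrDeriv f g r σ :=
  pullGL_contr σ γ hf hg fun k a b => by
    simp only [slots, if_pos k.2]
    exact pullGL_gram γ a b

theorem pullU_slots (U : Matrix.unitaryGroup (Fin p) ℂ) (m : ℕ) (k : Fin r) (a b : Fin p) :
    pullU U (slots q m k a b) = ∑ c, ∑ d, algebraMap ℂ (SmoothFun p q) (conj (U.1 c a)) *
      slots q m k c d * algebraMap ℂ (SmoothFun p q) (U.1 d b) := by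
  by_cases h : k.1 < m
  · simp only [slots, if_pos h]
    exact pullGL_gram _ a b
  · simp only [slots, if_neg h]
    ext z
    simp only [SmoothFun.coe_sum, SmoothFun.coe_mul]
    have h1 : ∀ c d : Fin p, ((if c = d then 1 else 0 : SmoothFun p q)).1 z =
        (1 : Matrix (Fin p) (Fin p) ℂ) c d := fun c d => by
      rw [Matrix.one_apply]
      split_ifs <;> rfl
    have h2 := congrFun (congrFun (Matrix.UnitaryGroup.star_mul_self U) a) b
    rw [pullGL_apply]
    have h3 : ((if a = b then 1 else 0 : SmoothFun p q)).1 (mulGL z (Unitary.toUnits U)) =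
        (1 : Matrix (Fin p) (Fin p) ℂ) a b := by
      rw [Matrix.one_apply]
      split_ifs <;> rfl
    rw [h3, ← h2, ← Matrix.mul_one (star U.1), Matrix.mul_apply]
    simp only [Matrix.mul_apply (M := star U.1), Finset.sum_mul, h1]
    rw [Finset.sum_comm]
    rfl

/-- The free indices `i, j` enter through `e_ji` in slot `m`. Equivariance holds for U(p) only,
since the later slots contain the identity, which is preserved by `U† 1 U`. -/
theorem isEquivariant_contr (hf : ∀ γ, pullGL γ f = f) (hg : ∀ γ, pullGL γ g = g) :
    IsEquivariant fun i j => C (contr σ (dTensor f g) (update (slots q m.1) m (unitMat _ j i))) := by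
  rw [isEquivariant_iff]
  intro U i j
  -- The conjugated matrix unit is expanded in matrix units again, so that linearity in slot `m`
  -- gives the equivariance law.
  have h1 : (fun a b => algebraMap ℂ (SmoothFun p q) (U.1 a j * conj (U.1 b i))) =
      ∑ k, ∑ l, algebraMap ℂ (SmoothFun p q) (conj (U.1 k i) * U.1 l j) • unitMat _ l k := by
    funext a b
    simp only [Finset.sum_apply, Pi.smul_apply, smul_eq_mul, unitMat, mul_ite, mul_one, mul_zero,
      ite_and]
    rw [Finset.sum_eq_single b, Finset.sum_eq_single a]
    · rw [if_pos rfl, if_pos rfl, mul_comm]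
    · intro l _ hl
      rw [if_neg hl.symm]
    · simp
    · intro k _ hk
      refine Finset.sum_eq_zero fun l _ => ?_
      rw [if_neg hk.symm, ite_self]
    · simp
  have h2 : pullU U (contr σ (dTensor f g) (update (slots q m.1) m (unitMat _ j i))) =
      contr σ (dTensor f g) (update (slots q m.1) m fun a b =>
        algebraMap ℂ (SmoothFun p q) (U.1 a j * conj (U.1 b i))) := by
    refine pullGL_contr σ _ (hf _) (hg _) fun k a b => ?_
    rcases eq_or_ne k m with rfl | hk
    · simp only [update_self, ← map_mul, ← map_sum]
      have h3 : ∑ c, ∑ d, conj (U.1 c a) * (U.1 c j * conj (U.1 d i)) * U.1 d b =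
          (if a = j then 1 else 0) * if b = i then 1 else 0 := by
        have e1 := unitary_sum_mul_conj U j a
        have e2 := unitary_sum_mul_conj U b i
        simp only [eq_comm (a := a)]
        rw [← e1, ← e2, Finset.sum_mul_sum]
        exact Finset.sum_congr rfl fun c _ => Finset.sum_congr rfl fun d _ => by ring
      have h4 : unitMat (SmoothFun p q) j i a b =
          algebraMap ℂ _ ((if a = j then 1 else 0) * if b = i then 1 else 0) := by
        rw [unitMat]
        by_cases ha : a = j
        · by_cases hb : b = i
          · rw [if_pos ⟨ha, hb⟩, if_pos ha, if_pos hb, mul_one, map_one]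
          · rw [if_neg fun h => hb h.2, if_neg hb, mul_zero, map_zero]
        · rw [if_neg fun h => ha h.1, if_neg ha, zero_mul, map_zero]
      rw [h4, ← h3]
      exact AlgHom.commutes _ _
    · simp only [update_of_ne hk]
      exact pullU_slots U _ k a b
  rw [pullSeries, mapLin_C]
  refine (congrArg C h2).trans ?_
  rw [h1]
  simp only [MultilinearMap.map_update_sum, MultilinearMap.map_update_smul, map_sum]
  refine Finset.sum_congr rfl fun k _ => Finset.sum_congr rfl fun l _ => ?_
  rw [smul_eq_mul, ← Algebra.smul_def]
  ext n : 1
  rw [PowerSeries.coeff_smul, PowerSeries.coeff_C, PowerSeries.coeff_C]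
  split_ifs
  · rfl
  · rw [smul_zero]

theorem C_sub_smul_add_X_mul_C {B : Type} [CommRing B] [Algebra ℂ B] (a b s : B) (μ c : ℂ) :
    C (a - μ • b) + X * C (-(c • b + s)) =
      C a - ((C μ + c • X : PowerSeries ℂ) • C b + (X : PowerSeries ℂ) • C s) := by
  have h1 : ∀ (c : ℂ) (u : B), (C (c • u) : PowerSeries B) = c • C u := fun c u => by
    ext n : 1
    rw [PowerSeries.coeff_smul, PowerSeries.coeff_C, PowerSeries.coeff_C]
    split_ifs
    · rfl
    · rw [smul_zero]
  have h2 : (c • X : PowerSeries ℂ) • (C b : PowerSeries B) = c • (X * C b) := by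
    rw [PowerSeries.smul_eq_C_mul, mul_smul, PowerSeries.C_smul_series]
    exact congrArg _ (PowerSeries.X_smul_series _)
  have h3 : (X : PowerSeries ℂ) • (C s : PowerSeries B) = X * C s := PowerSeries.X_smul_series _
  have h4 : (C μ : PowerSeries ℂ) • (C b : PowerSeries B) = μ • C b := PowerSeries.C_smul_series _ _
  rw [add_smul, h2, h3, h4, map_sub, map_neg, map_add, h1, h1, mul_neg, mul_add, mul_smul_comm]
  abel

theorem smul_sub_smul_mem {R M : Type*} [CommRing R] [AddCommGroup M] [Module R M]
    {S : Submodule R M} (a : R) {x y : M} (h : x - y ∈ S) : a • x - a • y ∈ S :=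
  smul_sub a x y ▸ S.smul_mem a h

/-- The ideal element with `G_ij` the contraction having `e_ji` in slot `m`: its pointwise part is
`T_{m+1}(σ) - μ T_m(σ)`, its first order part `-λ (p T_m(σ) + ∑_{k>m} T_m(σ (m k)))`. -/
theorem contrDeriv_succ_sub_mem (μ : ℝ) (hf : ∀ γ, pullGL γ f = f) (hg : ∀ γ, pullGL γ g = g) :
    C (contrDeriv f g (m.1 + 1) σ) - (kappa p μ • C (contrDeriv f g m.1 σ) +
      (X : PowerSeries ℂ) • ∑ k with m < k, C (contrDeriv f g m.1 (σ * Equiv.swap m k))) ∈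
      starIdeal p q μ := by
  refine ⟨_, isEquivariant_contr m σ hf hg, ?_⟩
  rw [idealMap_apply]
  simp only [wick_momentum, mapLin_C, ← map_mul, Finset.sum_add_distrib, ← Finset.mul_sum,
    ← map_sum]
  rw [sum_contr_unitMat_mul_momentum, sum_holE_contr_unitMat m σ
    (fun i j => (holE_antiE_eq_zero_of_homogeneous hf i j).1)
    (fun i j => (holE_antiE_eq_zero_of_homogeneous hg i j).1), kappa]
  exact C_sub_smul_add_X_mul_C _ _ _ _ _

/-- The same congruence, read as right multiplication of the coefficients by a Jucys-Murphy element.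
-/
theorem sum_coeff_smul_contrDeriv_sub_mem (μ : ℝ) (hf : ∀ γ, pullGL γ f = f)
    (hg : ∀ γ, pullGL γ g = g) (a : MonoidAlgebra (PowerSeries ℂ) (Equiv.Perm (Fin r))) :
    ∑ σ, a.coeff σ • C (contrDeriv f g (m.1 + 1) σ) -
      ∑ σ, (a * jucysMurphy (kappa p μ) X m).coeff σ • C (contrDeriv f g m.1 σ) ∈
        starIdeal p q μ := by
  have h : ∑ σ, (a * jucysMurphy (kappa p μ) X m).coeff σ • C (contrDeriv f g m.1 σ) =
      ∑ σ, a.coeff σ • (kappa p μ • C (contrDeriv f g m.1 σ) +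
      (X : PowerSeries ℂ) • ∑ k with m < k, C (contrDeriv f g m.1 (σ * Equiv.swap m k))) := by
    simp only [jucysMurphy, mul_add, MonoidAlgebra.coeff_add, Finsupp.add_apply, add_smul, smul_add,
      Finset.sum_add_distrib, Finset.mul_sum,
      MonoidAlgebra.coeff_sum, Finsupp.coe_finsetSum, Finset.sum_apply,
      MonoidAlgebra.coeff_mul_single_apply, Finset.sum_smul, Finset.smul_sum, mul_smul]
    congr 1
    rw [Finset.sum_comm]
    conv_rhs => rw [Finset.sum_comm]
    refine Finset.sum_congr rfl fun k _ => ?_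
    refine Fintype.sum_equiv (Equiv.mulRight (Equiv.swap m k)) _ _ fun σ => ?_
    simp [mul_assoc]
  rw [h, ← Finset.sum_sub_distrib]
  refine Submodule.sum_mem _ fun σ _ => ?_
  exact smul_sub_smul_mem _ (contrDeriv_succ_sub_mem m σ μ hf hg)

/-- Removing the matrices `x` one slot after another multiplies the coefficients by the successive
factors of the generating element. Starting from its inverse, one ends with the coefficient `1` at
the identity permutation. -/
theorem sum_invCycleGen_smul_contrDeriv_sub_mem {μ : ℝ} (hμ : 0 < μ) (hf : ∀ γ, pullGL γ f = f)
    (hg : ∀ γ, pullGL γ g = g) :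
    ∑ σ, (invCycleGen p hμ r).coeff σ • C (contrDeriv f g r σ) -
        C (contrDeriv f g 0 (1 : Equiv.Perm (Fin r))) ∈ starIdeal p q μ := by
  have h : ∀ n ≤ r, ∑ σ, (invCycleGen p hμ r).coeff σ • C (contrDeriv f g r σ) -
      ∑ σ, (invCycleGen p hμ r * cycleGenFrom r (kappa p μ) X (r - n)).coeff σ •
        C (contrDeriv f g (r - n) σ) ∈ starIdeal p q μ := by
    intro n
    induction n with
    | zero =>
      intro _
      rw [Nat.sub_zero, cycleGenFrom_self, mul_one, sub_self]
      exact Submodule.zero_mem _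
    | succ n ih =>
      intro hn
      have h1 := cycleGenFrom_succ (kappa p μ) X (⟨r - (n + 1), by omega⟩ : Fin r)
      have h2 := sum_coeff_smul_contrDeriv_sub_mem (⟨r - (n + 1), by omega⟩ : Fin r) μ hf hg
        (invCycleGen p hμ r * cycleGenFrom r (kappa p μ) X (r - n))
      simp only [show r - (n + 1) + 1 = r - n by omega] at h1 h2
      rw [h1, ← mul_assoc, ← sub_add_sub_cancel]
      exact Submodule.add_mem _ (ih (by omega)) h2
  have h3 := h r le_rfl
  rw [Nat.sub_self, cycleGenFrom_zero, invCycleGen_mul] at h3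
  classical
  have h4 : ∑ σ, (1 : MonoidAlgebra (PowerSeries ℂ) (Equiv.Perm (Fin r))).coeff σ •
      C (contrDeriv f g 0 σ) = C (contrDeriv f g 0 (1 : Equiv.Perm (Fin r))) := by
    rw [Finset.sum_eq_single 1]
    · rw [MonoidAlgebra.coeff_one_one, one_smul]
    · intro σ _ hσ
      rw [MonoidAlgebra.one_def, MonoidAlgebra.coeff_single, Finsupp.single_apply, if_neg hσ.symm,
        zero_smul]
    · exact fun h => absurd (Finset.mem_univ _) h
  rwa [h4] at h3

theorem contrDeriv_zero_one (f g : SmoothFun p q) :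
    contrDeriv f g 0 (1 : Equiv.Perm (Fin r)) =
      ∑ a : Fin r → Fin (p + q) × Fin p, iterDz a f * iterDzbar a g := by
  have h : (slots q 0 : Fin r → Fin p → Fin p → SmoothFun p q) =
      fun _ a b => if a = b then 1 else 0 := rfl
  rw [contrDeriv, h, contr_one]
  simp only [dTensor]
  rw [Finset.sum_comm, ← Fintype.sum_prod_type']
  exact Fintype.sum_equiv (Equiv.arrowProdEquivProdArrow (Fin r) (fun _ => Fin (p + q)) fun _ => Fin p).symm _ _
    fun x => rfl

theorem conjFun_contrDeriv (f g : SmoothFun p q) (σ : Equiv.Perm (Fin r)) :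
    conjFun (contrDeriv f g r σ) = contrDeriv (conjFun g) (conjFun f) r σ⁻¹ := by
  have h : (slots q r : Fin r → Fin p → Fin p → SmoothFun p q) = fun _ a b => gram a b := by
    funext k a b
    rw [slots, if_pos k.2]
  have h2 : ∀ a b : Fin p, conjFun (gram (q := q) a b) = gram b a := fun a b => by
    rw [gram, gram, ← conjHom_apply, map_sum]
    simp only [map_mul, conjHom_apply, conjFun_conjFun]
    exact Finset.sum_congr rfl fun A _ => mul_comm _ _
  rw [contrDeriv, contrDeriv, h, ← conjHom_apply, map_contr, contr_transpose]
  simp only [conjHom_apply, h2, conjFun_dTensor]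

end IteratedDerivatives
end GrassStar
end

noncomputable section

/-! ## Integration of compactly supported smooth functions -/

section General

open MeasureTheory
open scoped ContDiff

variable {E : Type*} [NormedAddCommGroup E] [NormedSpace ℝ E] {U K : Set E} {f : E → ℂ}

theorem contDiff_of_contDiffOn_of_eq_zero (hU : IsOpen U) (hK : IsClosed K) (hKU : K ⊆ U)
    (hf : ContDiffOn ℝ ∞ f U) (h0 : ∀ x ∉ K, f x = 0) : ContDiff ℝ ∞ f := by
  rw [contDiff_iff_contDiffAt]
  intro x
  by_cases hx : x ∈ U
  · exact hf.contDiffAt (hU.mem_nhds hx)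
  · have hev : f =ᶠ[nhds x] fun _ => 0 := by
      filter_upwards [hK.isOpen_compl.mem_nhds fun h => hx (hKU h)] with y hy
      exact h0 y hy
    exact contDiffAt_const.congr_of_eventuallyEq hev

omit [NormedSpace ℝ E] in
theorem hasCompactSupport_of_eq_zero (hK : IsCompact K) (h0 : ∀ x ∉ K, f x = 0) :
    HasCompactSupport f := HasCompactSupport.intro hK h0

theorem integral_fderiv_eq_zero [MeasurableSpace E] [BorelSpace E] [FiniteDimensional ℝ E]
    (m : Measure E) [m.IsAddHaarMeasure] (hf : ContDiff ℝ ∞ f) (hc : HasCompactSupport f) (v : E) :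
    ∫ x, fderiv ℝ f x v ∂m = 0 := by
  have h1 : Integrable (fun x => fderiv ℝ f x v) m := by
    refine Continuous.integrable_of_hasCompactSupport ?_ ?_
    · exact (hf.continuous_fderiv (by simp)).clm_apply continuous_const
    · exact (hc.fderiv (𝕜 := ℝ)).comp_left (g := fun L : E →L[ℝ] ℂ => L v) rfl
  have h2 : Integrable f m := hf.continuous.integrable_of_hasCompactSupport hc
  have h := integral_mul_fderiv_eq_neg_fderiv_mul_of_integrable (μ := m) (f := fun _ => (1 : ℂ))
    (g := f) (v := v) (by simp) (by simpa using h1) (by simpa using h2)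
    (fun x _ => differentiableAt_const _) (fun x _ => hf.differentiable (by simp) x)
  simpa using h

end General

namespace GrassStar
open Matrix MeasureTheory
open scoped ContDiff ComplexOrder ComplexConjugate

variable {p q : ℕ}

/-- The integral with respect to Lebesgue measure. -/
def integ (F : FullRank p q → ℂ) : ℂ :=
  ∫ z : Fin (p + q) → Fin p → ℂ, zeroExt F (Matrix.of z)

theorem zeroExt_of_notMem (F : FullRank p q → ℂ) {z : Matrix (Fin (p + q)) (Fin p) ℂ}
    (hz : z ∉ fullRankSet p q) : zeroExt F z = 0 :=
  Function.extend_apply' _ _ _ fun ⟨w, hw⟩ => hz (hw ▸ w.2)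

/-- The ideal of smooth functions supported in `K`. -/
def suppIn (K : Set (Matrix (Fin (p + q)) (Fin p) ℂ)) : Ideal (SmoothFun p q) where
  carrier := {F | ∀ z : FullRank p q, z.1 ∉ K → F.1 z = 0}
  add_mem' {F G} hF hG z hz := by rw [SmoothFun.coe_add, hF z hz, hG z hz, add_zero]
  zero_mem' _ _ := rfl
  smul_mem' c F hF z hz := by rw [smul_eq_mul, SmoothFun.coe_mul, hF z hz, mul_zero]

variable {K : Set (Matrix (Fin (p + q)) (Fin p) ℂ)}

theorem zeroExt_eq_zero {F : SmoothFun p q} (hF : F ∈ suppIn K)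
    {z : Matrix (Fin (p + q)) (Fin p) ℂ} (hz : z ∉ K) : zeroExt F.1 z = 0 := by
  by_cases h : z ∈ fullRankSet p q
  · exact (zeroExt_apply F.1 ⟨z, h⟩).trans (hF ⟨z, h⟩ hz)
  · exact zeroExt_of_notMem F.1 h

theorem smul_mem_suppIn {F : SmoothFun p q} (c : ℂ) (hF : F ∈ suppIn K) : c • F ∈ suppIn K := by
  rw [Algebra.smul_def]
  exact Ideal.mul_mem_left _ _ hF

theorem dirDeriv_mem_suppIn (hK : IsClosed K) {F : SmoothFun p q} (hF : F ∈ suppIn K)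
    (v : Matrix (Fin (p + q)) (Fin p) ℂ) : dirDeriv v F ∈ suppIn K := fun z hz => by
  have hγ := hasDerivAt_line z.1 v
  refine dirDeriv_eq_of_hasDerivAt (γ := fun t : ℝ => z.1 + t • v) (t := 0) hγ (by simp)
    (f := fun s => zeroExt F.1 (z.1 + s • v)) ?_ fun s hs => (zeroExt_apply F.1 ⟨_, hs⟩).symm
  refine (hasDerivAt_const (0 : ℝ) (0 : ℂ)).congr_of_eventuallyEq ?_
  have h : ∀ᶠ s : ℝ in nhds 0, z.1 + s • v ∈ Kᶜ :=
    hγ.continuousAt.eventually_mem (hK.isOpen_compl.mem_nhds (by simpa using hz))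
  filter_upwards [h] with s hs
  exact zeroExt_eq_zero hF hs

theorem dz_mem_suppIn (hK : IsClosed K) {F : SmoothFun p q} (hF : F ∈ suppIn K) (a) :
    dz a F ∈ suppIn K := by
  rw [dz_apply]
  exact smul_mem_suppIn _ (Ideal.sub_mem _ (dirDeriv_mem_suppIn hK hF _)
    (smul_mem_suppIn _ (dirDeriv_mem_suppIn hK hF _)))

theorem holE_mem_suppIn (hK : IsClosed K) {F : SmoothFun p q} (hF : F ∈ suppIn K) (i j) :
    holE i j F ∈ suppIn K := by
  rw [holE_apply]
  exact Ideal.sum_mem _ fun A _ => Ideal.mul_mem_left _ _ (dz_mem_suppIn hK hF _)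

variable (hK : IsCompact K) (hKM : K ⊆ fullRankSet p q)
include hK hKM

theorem contDiff_zeroExt {F : SmoothFun p q} (hF : F ∈ suppIn K) : ContDiff ℝ ∞ (zeroExt F.1) :=
  contDiff_of_contDiffOn_of_eq_zero (isOpen_fullRankSet p q) hK.isClosed hKM F.2
    fun _ hz => zeroExt_eq_zero hF hz

theorem continuous_zeroExt {F : SmoothFun p q} (hF : F ∈ suppIn K) :
    Continuous fun z : Fin (p + q) → Fin p → ℂ => zeroExt F.1 (Matrix.of z) :=
  (contDiff_zeroExt hK hKM hF).continuous

omit hKM in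
theorem hasCompactSupport_zeroExt {F : SmoothFun p q} (hF : F ∈ suppIn K) :
    HasCompactSupport fun z : Fin (p + q) → Fin p → ℂ => zeroExt F.1 (Matrix.of z) :=
  hasCompactSupport_of_eq_zero (E := Fin (p + q) → Fin p → ℂ) hK fun _ hz => zeroExt_eq_zero hF hz

theorem integrable_zeroExt {F : SmoothFun p q} (hF : F ∈ suppIn K) :
    Integrable fun z : Fin (p + q) → Fin p → ℂ => zeroExt F.1 (Matrix.of z) :=
  (continuous_zeroExt hK hKM hF).integrable_of_hasCompactSupport
    (hasCompactSupport_zeroExt hK hF)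

omit hK hKM in
theorem zeroExt_add (F G : FullRank p q → ℂ) (z) : zeroExt (F + G) z = zeroExt F z + zeroExt G z := by
  by_cases h : z ∈ fullRankSet p q
  · have h1 := fun F : FullRank p q → ℂ => zeroExt_apply F ⟨z, h⟩
    simp only at h1
    rw [h1, h1, h1]
    rfl
  · rw [zeroExt_of_notMem _ h, zeroExt_of_notMem _ h, zeroExt_of_notMem _ h, add_zero]

omit hK hKM in
theorem zeroExt_smul (c : ℂ) (F : FullRank p q → ℂ) (z) : zeroExt (c • F) z = c * zeroExt F z := by
  by_cases h : z ∈ fullRankSet p q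
  · have h1 := fun F : FullRank p q → ℂ => zeroExt_apply F ⟨z, h⟩
    simp only at h1
    rw [h1, h1]
    rfl
  · rw [zeroExt_of_notMem _ h, zeroExt_of_notMem _ h, mul_zero]

theorem integ_add {F G : SmoothFun p q} (hF : F ∈ suppIn K) (hG : G ∈ suppIn K) :
    integ (F + G).1 = integ F.1 + integ G.1 := by
  rw [integ, integ, integ, ← integral_add (integrable_zeroExt hK hKM hF)
    (integrable_zeroExt hK hKM hG)]
  exact integral_congr_ae (ae_of_all _ fun z => zeroExt_add F.1 G.1 _)

omit hK hKM in
theorem integ_smul (c : ℂ) (F : SmoothFun p q) : integ (c • F).1 = c * integ F.1 := by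
  rw [integ, integ, ← integral_const_mul]
  exact integral_congr_ae (ae_of_all _ fun z => zeroExt_smul c F.1 _)

omit hK hKM in
theorem integ_zero : integ (0 : SmoothFun p q).1 = 0 := by
  rw [← zero_smul ℂ (0 : SmoothFun p q), integ_smul, zero_mul]

theorem integ_sub {F G : SmoothFun p q} (hF : F ∈ suppIn K) (hG : G ∈ suppIn K) :
    integ (F - G).1 = integ F.1 - integ G.1 := by
  rw [sub_eq_add_neg F G, ← neg_one_smul ℂ G, integ_add hK hKM hF (smul_mem_suppIn _ hG),
    integ_smul]
  ring

theorem integ_sum {ι : Type*} (s : Finset ι) {F : ι → SmoothFun p q} (hF : ∀ k, F k ∈ suppIn K) :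
    integ (∑ k ∈ s, F k).1 = ∑ k ∈ s, integ (F k).1 := by
  classical
  induction s using Finset.induction_on with
  | empty => exact integ_zero
  | insert a s ha ih =>
    rw [Finset.sum_insert ha, Finset.sum_insert ha,
      integ_add hK hKM (hF a) (Ideal.sum_mem _ fun k _ => hF k), ih]

theorem integ_dirDeriv {F : SmoothFun p q} (hF : F ∈ suppIn K)
    (v : Matrix (Fin (p + q)) (Fin p) ℂ) : integ (dirDeriv v F).1 = 0 := by
  have h := @integral_fderiv_eq_zero (Fin (p + q) → Fin p → ℂ) Pi.normedAddCommGroup Pi.normedSpace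
    (fun z => zeroExt F.1 (Matrix.of z)) _ _ _ volume
    (MeasureTheory.Measure.pi.isAddHaarMeasure _) (contDiff_zeroExt hK hKM hF)
    (hasCompactSupport_zeroExt hK hF) v
  rw [← h, integ]
  refine integral_congr_ae (ae_of_all _ fun z => ?_)
  by_cases hz : Matrix.of z ∈ fullRankSet p q
  · exact zeroExt_apply (dirDeriv v F).1 ⟨_, hz⟩
  · refine (zeroExt_eq_zero (dirDeriv_mem_suppIn hK.isClosed hF v) fun h => hz (hKM h)).trans ?_
    have h0 : (fun z : Fin (p + q) → Fin p → ℂ => zeroExt F.1 (Matrix.of z)) =ᶠ[nhds z]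
        fun _ => 0 := by
      filter_upwards [hK.isClosed.isOpen_compl.mem_nhds fun h => hz (hKM h)] with y hy
      exact zeroExt_eq_zero hF hy
    have h1 := (@Filter.EventuallyEq.fderiv_eq ℝ _ _
      Pi.normedAddCommGroup.toAddCommGroup Pi.normedSpace.toModule _ _ _ _ _ _ _ _ h0).trans
      (@fderiv_const_apply ℝ _ (Fin (p + q) → Fin p → ℂ) _ _ _ ℂ _ _ _ z (0 : ℂ))
    exact (congrArg (fun L : (Fin (p + q) → Fin p → ℂ) →L[ℝ] ℂ => L v) h1).symm

theorem integ_dz {F : SmoothFun p q} (hF : F ∈ suppIn K) (a) : integ (dz a F).1 = 0 := by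
  have h := fun v => dirDeriv_mem_suppIn hK.isClosed hF v
  rw [dz_apply, integ_smul, integ_sub hK hKM (h _) (smul_mem_suppIn _ (h _)), integ_smul,
    integ_dirDeriv hK hKM hF, integ_dirDeriv hK hKM hF]
  ring

/-- The divergence of `E_ij` is `(p + q) δ_ij`, one unit for each row. -/
theorem integ_holE {F : SmoothFun p q} (hF : F ∈ suppIn K) (i j : Fin p) :
    integ (holE i j F).1 = -(if i = j then ((p + q : ℕ) : ℂ) * integ F.1 else 0) := by
  have h : ∀ A : Fin (p + q), coordFun A i * dz (A, j) F =
      dz (A, j) (coordFun A i * F) - (if i = j then (1 : ℂ) else 0) • F := fun A => by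
    rw [dz_mul, dz_coordFun]
    by_cases hij : i = j
    · rw [if_pos ⟨rfl, hij.symm⟩, if_pos hij, one_mul, one_smul, add_sub_cancel_left]
    · rw [if_neg fun h => hij h.2.symm, if_neg hij, zero_mul, zero_smul, zero_add, sub_zero]
  have h1 : ∀ A : Fin (p + q), coordFun A i * F ∈ suppIn K := fun A => Ideal.mul_mem_left _ _ hF
  have h2 : ∀ A : Fin (p + q), integ (coordFun A i * dz (A, j) F).1 =
      -((if i = j then (1 : ℂ) else 0) * integ F.1) := fun A => by
    rw [h, integ_sub hK hKM (dz_mem_suppIn hK.isClosed (h1 A) _) (smul_mem_suppIn _ hF),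
      integ_dz hK hKM (h1 A), integ_smul, zero_sub]
  rw [holE_apply, integ_sum hK hKM _
    fun A => Ideal.mul_mem_left _ _ (dz_mem_suppIn hK.isClosed hF _), Finset.sum_congr rfl
    fun A _ => h2 A, Finset.sum_const, Finset.card_univ, Fintype.card_fin, nsmul_eq_mul]
  split_ifs <;> ring

end GrassStar
end

noncomputable section

namespace GrassStar
open Matrix MeasureTheory
open scoped ContDiff ComplexOrder ComplexConjugate

variable {p q : ℕ}

/-! ## Composition with functions of a real variable -/

/-- The function `s (Re F)`. -/
def compRe (s : ℝ → ℝ) (F : SmoothFun p q) (hs : ∀ z, ContDiffAt ℝ ∞ s (F.1 z).re) :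
    SmoothFun p q :=
  ⟨fun z => (s (F.1 z).re : ℂ), by
    refine isSmooth_of_eqOn (f := fun z => (s (zeroExt F.1 z).re : ℂ)) ?_
      fun z => by rw [zeroExt_apply]
    refine Complex.ofRealCLM.contDiff.comp_contDiffOn fun z hz => ?_
    have h1 : ContDiffAt ℝ ∞ s (zeroExt F.1 z).re := by
      have := hs ⟨z, hz⟩
      rwa [← zeroExt_apply F.1 ⟨z, hz⟩] at this
    exact h1.comp_contDiffWithinAt z (Complex.reCLM.contDiff.comp_contDiffOn F.2 z hz)⟩

theorem compRe_apply {s : ℝ → ℝ} {F : SmoothFun p q} (hs) (z) :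
    (compRe s F hs).1 z = (s (F.1 z).re : ℂ) := rfl

theorem re_of_conjFun_eq {F : SmoothFun p q} (hF : conjFun F = F) (z) :
    ((F.1 z).re : ℂ) = F.1 z := by
  have h : conj (F.1 z) = F.1 z := congrArg (fun F => F.1 z) hF
  exact Complex.conj_eq_iff_re.mp h

theorem dirDeriv_compRe {s : ℝ → ℝ} {F : SmoothFun p q} (hs) (hF : conjFun F = F) (v) (z) :
    (dirDeriv v (compRe s F hs)).1 z = ((deriv s (F.1 z).re : ℝ) : ℂ) * (dirDeriv v F).1 z := by
  rw [← re_of_conjFun_eq (F := dirDeriv v F) (by rw [← dirDeriv_conjFun, hF]) z,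
    ← Complex.ofReal_mul]
  have h1 := hasDerivAt_zeroExt_line F z v
  have h2 := Complex.reCLM.hasFDerivAt.comp_hasDerivAt 0 h1
  have h3 : HasDerivAt s (deriv s (F.1 z).re) (Complex.re (zeroExt F.1 (z.1 + (0 : ℝ) • v))) := by
    rw [zero_smul, add_zero, zeroExt_apply]
    exact ((hs z).differentiableAt (by simp)).hasDerivAt
  refine dirDeriv_eq_of_hasDerivAt (hasDerivAt_line z.1 v) (by simp)
    ((h3.comp 0 h2).ofReal_comp) fun t ht => ?_
  simp only [compRe_apply, Function.comp_apply, Complex.reCLM_apply]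
  rw [zeroExt_apply F.1 ⟨_, ht⟩]

theorem holE_compRe {s : ℝ → ℝ} {F : SmoothFun p q} (hs) (hF : conjFun F = F) (i j) (z) :
    (holE i j (compRe s F hs)).1 z = ((deriv s (F.1 z).re : ℝ) : ℂ) * (holE i j F).1 z := by
  rw [holE_eq_dirDeriv, holE_eq_dirDeriv, dirDeriv_compRe hs hF, dirDeriv_compRe hs hF]
  ring

theorem conjFun_compRe {s : ℝ → ℝ} {F : SmoothFun p q} (hs) :
    conjFun (compRe s F hs) = compRe s F hs := SmoothFun.ext fun _ => Complex.conj_ofReal _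

/-! ## The determinant of the Gram matrix -/

/-- The function `det (z† z)`. -/
def gramDet (p q : ℕ) : SmoothFun p q := (Matrix.of fun k l => gram (q := q) k l).det

theorem gramDet_apply (z : FullRank p q) : (gramDet p q).1 z = (z.1ᴴ * z.1).det := by
  let ev : SmoothFun p q →+* ℂ := (Pi.evalRingHom (fun _ => ℂ) z).comp (SmoothFun p q).val.toRingHom
  refine (RingHom.map_det ev _).trans ?_
  congr 1
  ext k l
  exact gram_apply k l z

theorem gramDet_pos (z : FullRank p q) : 0 < ((gramDet p q).1 z).re := by
  rw [gramDet_apply]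
  exact (Complex.pos_iff.mp (posDef_gram z).det_pos).1

theorem conjFun_gramDet : conjFun (gramDet p q) = gramDet p q := SmoothFun.ext fun z => by
  have h := (Complex.pos_iff.mp (posDef_gram z).det_pos).2
  rw [conjFun_apply, gramDet_apply]
  exact Complex.conj_eq_iff_im.mpr h.symm

theorem hasDerivAt_det_one_add_smul (B : Matrix (Fin p) (Fin p) ℂ) :
    HasDerivAt (fun t : ℝ => (1 + (t : ℂ) • B).det) B.trace 0 := by
  have h : (fun t : ℝ => (1 + (t : ℂ) • B).det) = fun t : ℝ => 1 + B.trace * (t : ℂ) +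
      ((Matrix.det (1 + (Polynomial.X : Polynomial ℂ) • B.map Polynomial.C)).divX.divX).eval (t : ℂ)
        * (t : ℂ) ^ 2 := funext fun t => Matrix.det_one_add_smul _ _
  rw [h]
  set P := (Matrix.det (1 + (Polynomial.X : Polynomial ℂ) • B.map Polynomial.C)).divX.divX
  have h0 : HasDerivAt (fun t : ℝ => (t : ℂ)) 1 0 := Complex.ofRealCLM.hasDerivAt
  have h1 : HasDerivAt (fun t : ℝ => P.eval (t : ℂ)) (P.derivative.eval ((0 : ℝ) : ℂ) * 1) 0 :=
    (P.hasDerivAt ((0 : ℝ) : ℂ)).comp (𝕜' := ℂ) 0 h0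
  have h2 := ((h0.const_mul B.trace).const_add 1).add (h1.mul (h0.pow 2))
  refine h2.congr_deriv ?_
  simp

theorem dirDeriv_gramDet (z : FullRank p q) (B : Matrix (Fin p) (Fin p) ℂ) :
    (dirDeriv (z.1 * B) (gramDet p q)).1 z = (B.trace + conj B.trace) * (gramDet p q).1 z := by
  have h1 := hasDerivAt_det_one_add_smul B
  have h2 := Complex.conjCLE.hasFDerivAt.comp_hasDerivAt 0 h1
  refine dirDeriv_eq_of_hasDerivAt (hasDerivAt_line z.1 (z.1 * B)) (by simp)
    ((h1.mul h2).mul_const ((gramDet p q).1 z) |>.congr_deriv ?_) fun t ht => ?_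
  · simp
  · rw [gramDet_apply, gramDet_apply]
    have h3 : z.1 + t • (z.1 * B) = z.1 * (1 + (t : ℂ) • B) := by
      rw [Matrix.mul_add, Matrix.mul_one, Matrix.mul_smul, Complex.coe_smul]
    simp only [h3, Pi.mul_apply, Function.comp_apply,
      Complex.conjCLE_apply]
    rw [Matrix.conjTranspose_mul, Matrix.mul_assoc, Matrix.det_mul, Matrix.det_conjTranspose,
      ← Matrix.mul_assoc, Matrix.det_mul]
    simp only [Complex.star_def]
    ring

theorem holE_gramDet (i j : Fin p) :
    holE i j (gramDet p q) = if i = j then gramDet p q else 0 := by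
  ext z
  rw [holE_eq_dirDeriv, dirDeriv_gramDet, dirDeriv_gramDet]
  by_cases h : i = j
  · subst h
    rw [if_pos rfl, Matrix.trace_single_eq_same, Matrix.trace_single_eq_same, Complex.conj_I,
      map_one]
    ring
  · rw [if_neg h, Matrix.trace_single_eq_of_ne _ _ _ h, Matrix.trace_single_eq_of_ne _ _ _ h]
    simp

/-- The function `log det (z† z)`. -/
def logDet (p q : ℕ) : SmoothFun p q :=
  compRe Real.log (gramDet p q) fun z => Real.contDiffAt_log.mpr (gramDet_pos z).ne'

theorem holE_logDet (i j : Fin p) :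
    holE i j (logDet p q) = algebraMap ℂ _ (if i = j then 1 else 0) := by
  ext z
  rw [logDet, holE_compRe _ conjFun_gramDet, holE_gramDet, Real.deriv_log]
  by_cases h : i = j
  · rw [if_pos h, if_pos h]
    nth_rewrite 2 [← re_of_conjFun_eq conjFun_gramDet z]
    rw [← Complex.ofReal_mul, inv_mul_cancel₀ (gramDet_pos z).ne']
    rfl
  · rw [if_neg h, if_neg h]
    exact mul_zero _

/-! ## The exponent of the fibre measure -/

/-- The function `tr x - μ log det x`, for `x = z† z`. -/
def phase (p q : ℕ) (μ : ℝ) : SmoothFun p q := ∑ i, gram i i - (μ : ℂ) • logDet p q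

theorem phase_apply (μ : ℝ) (z : FullRank p q) : (phase p q μ).1 z =
    (((z.1ᴴ * z.1).trace.re - μ * Real.log (z.1ᴴ * z.1).det.re : ℝ) : ℂ) := by
  have h : (∑ i, gram (q := q) i i).1 z = (z.1ᴴ * z.1).trace := by
    rw [SmoothFun.coe_sum]
    exact Finset.sum_congr rfl fun i _ => gram_apply i i z
  have h1 : ((z.1ᴴ * z.1).trace.re : ℂ) = (z.1ᴴ * z.1).trace := by
    refine Complex.conj_eq_iff_re.mp ?_
    rw [← Complex.star_def, ← Matrix.trace_conjTranspose, Matrix.conjTranspose_mul,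
      Matrix.conjTranspose_conjTranspose]
  rw [phase, sub_eq_add_neg, ← neg_smul, SmoothFun.coe_add, SmoothFun.coe_smul, h, logDet,
    compRe_apply, gramDet_apply]
  push_cast
  rw [h1]
  ring

theorem conjFun_phase (μ : ℝ) : conjFun (phase p q μ) = phase p q μ := SmoothFun.ext fun z => by
  rw [conjFun_apply, phase_apply, Complex.conj_ofReal]

/-- The exponent is chosen for this property: `E_ij tr x = x_ji` and `E_ij log det x = δ_ij`, so
that `E_ij exp(-Nφ)` is `-N (x-μ)_ji exp(-Nφ)`. -/
theorem holE_phase (μ : ℝ) (i j : Fin p) :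
    holE i j (phase p q μ) = momentumEntry μ j i := by
  rw [phase, map_sub, map_smul, map_sum, holE_logDet, momentumEntry_eq]
  congr 1
  · simp only [holE_gram]
    rw [Finset.sum_eq_single j, if_pos rfl]
    · intro b _ hb
      rw [if_neg hb.symm]
    · exact fun h => absurd (Finset.mem_univ _) h
  · rw [Algebra.algebraMap_eq_smul_one, Algebra.algebraMap_eq_smul_one, smul_smul]
    congr 1
    by_cases h : i = j
    · rw [if_pos h, if_pos h.symm, mul_one]
    · rw [if_neg h, if_neg fun h' => h h'.symm, mul_zero]

/-! ## Compactness of the sublevel sets -/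

/-- The sublevel set `{tr x - μ log det x ≤ c}`. -/
def sublevel (p q : ℕ) (μ c : ℝ) : Set (Matrix (Fin (p + q)) (Fin p) ℂ) :=
  {z | Real.exp (-c) ≤ ((zᴴ * z).det.re) ^ μ * Real.exp (-(zᴴ * z).trace.re)}

/-- The exponentiated inequality makes sense on the whole space of matrices, is a closed condition
there, and excludes `det x = 0` because `0^μ = 0`. -/
theorem mem_sublevel {μ : ℝ} {c : ℝ} (z : FullRank p q) :
    z.1 ∈ sublevel p q μ c ↔ ((phase p q μ).1 z).re ≤ c := by
  have h := gramDet_pos z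
  rw [gramDet_apply] at h
  rw [phase_apply, Complex.ofReal_re]
  have h0 : z.1 ∈ sublevel p q μ c ↔ Real.exp (-c) ≤
    ((z.1ᴴ * z.1).det.re) ^ μ * Real.exp (-(z.1ᴴ * z.1).trace.re) := Iff.rfl
  rw [h0, Real.rpow_def_of_pos h, ← Real.exp_add, Real.exp_le_exp]
  constructor <;> intro h <;> linarith

theorem sublevel_subset {μ : ℝ} (hμ : 0 < μ) (c : ℝ) : sublevel p q μ c ⊆ fullRankSet p q := by
  intro z hz
  rw [mem_fullRankSet_iff]
  intro h
  have hz : Real.exp (-c) ≤ _ := hz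
  rw [h, Complex.zero_re, Real.zero_rpow hμ.ne', zero_mul] at hz
  exact absurd hz (not_le.mpr (Real.exp_pos _))

theorem norm_sq_le_trace (z : Matrix (Fin (p + q)) (Fin p) ℂ) (A : Fin (p + q)) (i : Fin p) :
    ‖z A i‖ ^ 2 ≤ (zᴴ * z).trace.re := by
  have h : (zᴴ * z).trace.re = ∑ i, ∑ A, ‖z A i‖ ^ 2 := by
    rw [Matrix.trace, Complex.re_sum]
    refine Finset.sum_congr rfl fun i _ => ?_
    rw [Matrix.diag_apply, Matrix.mul_apply, Complex.re_sum]
    refine Finset.sum_congr rfl fun A _ => ?_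
    rw [Matrix.conjTranspose_apply, Complex.star_def, Complex.conj_mul', ← Complex.ofReal_pow,
      Complex.ofReal_re]
  rw [h]
  refine (Finset.single_le_sum (f := fun A => ‖z A i‖ ^ 2) (fun _ _ => by positivity)
    (Finset.mem_univ A)).trans ?_
  exact Finset.single_le_sum (f := fun i => ∑ A, ‖z A i‖ ^ 2) (fun _ _ => by positivity)
    (Finset.mem_univ i)

theorem det_gram_le (z : Matrix (Fin (p + q)) (Fin p) ℂ) :
    (zᴴ * z).det.re ≤ ((p.factorial : ℝ) * (p + q : ℕ) ^ p) * (zᴴ * z).trace.re ^ p := by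
  set τ := (zᴴ * z).trace.re
  have h1 : ∀ i j, ‖(zᴴ * z) i j‖ ≤ (p + q : ℕ) * τ := fun i j => by
    rw [Matrix.mul_apply]
    refine (norm_sum_le _ _).trans ((Finset.sum_le_card_nsmul _ _ τ fun A _ => ?_).trans ?_)
    · rw [Matrix.conjTranspose_apply, norm_mul, norm_star]
      nlinarith [norm_sq_le_trace z A i, norm_sq_le_trace z A j, sq_nonneg (‖z A i‖ - ‖z A j‖)]
    · rw [Finset.card_univ, Fintype.card_fin, nsmul_eq_mul]
  refine (Complex.re_le_norm _).trans
    ((Matrix.det_le (abv := NormedField.toAbsoluteValue ℂ) h1).trans ?_)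
  rw [Fintype.card_fin, nsmul_eq_mul, mul_pow]
  exact le_of_eq (by ring)

/-- Closedness is clear from the exponentiated form. For boundedness, `det x` is at most a constant
times `(tr x)^p`, and a power of the trace is beaten by `exp(-tr x)`. -/
theorem isCompact_sublevel {μ : ℝ} (hμ : 0 < μ) (c : ℝ) : IsCompact (sublevel p q μ c) := by
  have hcl : IsClosed (sublevel p q μ c) := by
    have hx : Continuous fun z : Matrix (Fin (p + q)) (Fin p) ℂ => zᴴ * z :=
      Continuous.matrix_mul continuous_id.matrix_conjTranspose continuous_id
    refine isClosed_le continuous_const (Continuous.mul ?_ ?_)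
    · exact (Complex.continuous_re.comp hx.matrix_det).rpow_const fun _ => Or.inr hμ.le
    · exact Real.continuous_exp.comp (Complex.continuous_re.comp hx.matrix_trace).neg
  set C : ℝ := (p.factorial : ℝ) * (p + q : ℕ) ^ p
  have hC : 0 ≤ C := by positivity
  have hlim := (tendsto_rpow_mul_exp_neg_mul_atTop_nhds_zero (p * μ) 1 one_pos).const_mul (C ^ μ)
  rw [mul_zero] at hlim
  obtain ⟨T, hT⟩ := (hlim.eventually_lt_const (Real.exp_pos (-c))).exists_forall_of_atTop
  have hb : ∀ z ∈ sublevel p q μ c, (zᴴ * z).trace.re ≤ max T 0 := fun z hz => by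
    by_contra! hlt
    have h1 := hT _ ((le_max_left T 0).trans hlt.le)
    have hτ : 0 ≤ (zᴴ * z).trace.re := (le_max_right T 0).trans hlt.le
    have hz' : Real.exp (-c) ≤ _ := hz
    refine absurd (hz'.trans ?_) (not_le.mpr h1)
    rw [← mul_assoc, neg_one_mul]
    refine mul_le_mul_of_nonneg_right ?_ (Real.exp_pos _).le
    have hd : 0 ≤ (zᴴ * z).det.re := by
      have := gramDet_pos ⟨z, sublevel_subset hμ c hz⟩
      rw [gramDet_apply] at this
      exact this.le
    rw [Real.rpow_mul hτ, Real.rpow_natCast, ← Real.mul_rpow hC (pow_nonneg hτ _)]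
    exact Real.rpow_le_rpow hd (det_gram_le z) hμ.le
  refine Metric.isCompact_of_isClosed_isBounded hcl
    ((Metric.isBounded_closedBall (x := (0 : Matrix (Fin (p + q)) (Fin p) ℂ))
      (r := Real.sqrt (max T 0))).subset fun z hz => ?_)
  rw [mem_closedBall_zero_iff]
  refine (Matrix.norm_le_iff (Real.sqrt_nonneg _)).mpr fun A i => ?_
  exact Real.le_sqrt_of_sq_le ((norm_sq_le_trace z A i).trans (hb z hz))

end GrassStar
end

noncomputable section

namespace GrassStar
open Matrix MeasureTheory
open scoped ContDiff ComplexOrder ComplexConjugate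

variable {p q : ℕ}

/-! ## Test functions -/

/-- The function `exp (- N φ)`, for the phase `φ`. -/
def weight (p q : ℕ) (μ N : ℝ) : SmoothFun p q :=
  compRe (fun t => Real.exp (-N * t)) (phase p q μ) fun _ => by fun_prop

/-- The function `det (z† z) ^ (- (p + q))`. -/
def density (p q : ℕ) : SmoothFun p q :=
  compRe (fun t => Real.exp (-(p + q : ℕ) * t)) (logDet p q) fun _ => by fun_prop

/-- A smooth function which vanishes where the phase is at least `a`, and is `1` where the phase is
at most `a - 1`. -/
def cutoff (p q : ℕ) (μ a : ℝ) : SmoothFun p q :=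
  compRe (fun t => Real.smoothTransition (a - t)) (phase p q μ) fun _ =>
    (Real.smoothTransition.contDiff.comp (by fun_prop : ContDiff ℝ ∞ fun t : ℝ => a - t)).contDiffAt

/-- The conjugate of `h`, cut off smoothly where `|h| ≤ d`. -/
def conjCut (h : SmoothFun p q) (d : ℝ) : SmoothFun p q :=
  conjFun h * compRe (fun t => Real.smoothTransition (t / d ^ 2 - 1)) (h * conjFun h) fun _ =>
    (Real.smoothTransition.contDiff.comp
      (by fun_prop : ContDiff ℝ ∞ fun t : ℝ => t / d ^ 2 - 1)).contDiffAt

theorem holE_weight (μ N : ℝ) (i j : Fin p) (z) :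
    (holE i j (weight p q μ N)).1 z =
      -N * (momentumEntry μ j i).1 z * (weight p q μ N).1 z := by
  have h : ∀ t, deriv (fun t => Real.exp (-N * t)) t = -N * Real.exp (-N * t) := fun t => by
    rw [((hasDerivAt_id' t).const_mul (-N)).exp.deriv]
    ring
  rw [weight, holE_compRe _ (conjFun_phase μ), holE_phase, h, compRe_apply]
  push_cast
  ring

theorem conjFun_logDet : conjFun (logDet p q) = logDet p q := conjFun_compRe _

theorem holE_density (i j : Fin p) (z) :
    (holE i j (density p q)).1 z =
      -(if i = j then ((p + q : ℕ) : ℂ) else 0) * (density p q).1 z := by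
  have h : ∀ t, deriv (fun t => Real.exp (-(p + q : ℕ) * t)) t =
      -(p + q : ℕ) * Real.exp (-(p + q : ℕ) * t) := fun t => by
    rw [((hasDerivAt_id' t).const_mul (-(p + q : ℕ) : ℝ)).exp.deriv]
    ring
  have h1 : (algebraMap ℂ (SmoothFun p q) (if i = j then 1 else 0)).1 z =
    if i = j then 1 else 0 := rfl
  rw [density, holE_compRe _ conjFun_logDet, holE_logDet, h, h1, compRe_apply]
  split_ifs
  · push_cast
    ring
  · simp

theorem cutoff_mem_suppIn (μ a : ℝ) : cutoff p q μ a ∈ suppIn (sublevel p q μ a) := fun z hz => by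
  rw [mem_sublevel, not_le] at hz
  rw [cutoff, compRe_apply, Real.smoothTransition.zero_of_nonpos (by linarith), Complex.ofReal_zero]

theorem holE_cutoff_eq_zero {μ a : ℝ} (i j : Fin p) {z : FullRank p q}
    (hz : ((phase p q μ).1 z).re < a - 1) : (holE i j (cutoff p q μ a)).1 z = 0 := by
  have h : (fun t => Real.smoothTransition (a - t)) =ᶠ[nhds ((phase p q μ).1 z).re]
      fun _ => 1 := by
    filter_upwards [isOpen_Iio.mem_nhds hz] with t ht
    exact Real.smoothTransition.one_of_one_le (by linarith [Set.mem_Iio.mp ht])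
  rw [cutoff, holE_compRe _ (conjFun_phase μ), h.deriv_eq, deriv_const, Complex.ofReal_zero,
    zero_mul]

theorem mul_conjFun_apply_re (h : SmoothFun p q) (z) :
    ((h * conjFun h).1 z).re = ‖h.1 z‖ ^ 2 := by
  rw [SmoothFun.coe_mul, conjFun_apply, Complex.mul_conj', ← Complex.ofReal_pow, Complex.ofReal_re]

theorem conjCut_apply (h : SmoothFun p q) (d : ℝ) (z) : (conjCut h d).1 z =
    conj (h.1 z) * (Real.smoothTransition (‖h.1 z‖ ^ 2 / d ^ 2 - 1) : ℝ) := by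
  rw [conjCut, SmoothFun.coe_mul, compRe_apply, mul_conjFun_apply_re, conjFun_apply]

theorem conjCut_mul_apply (h : SmoothFun p q) (d : ℝ) (z) : (conjCut h d * h).1 z =
    (‖h.1 z‖ ^ 2 * Real.smoothTransition (‖h.1 z‖ ^ 2 / d ^ 2 - 1) : ℝ) := by
  rw [SmoothFun.coe_mul, conjCut_apply, mul_right_comm, Complex.conj_mul']
  push_cast
  rfl

/-- Where the cut-off conjugate `ψ` is nonzero, `|h|` exceeds `d`. Thus `|ψ|` itself, and not just
`ψ h`, is controlled by the nonnegative function `ψ h`, which bounds error terms by the main term.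
-/
theorem norm_conjCut_le (h : SmoothFun p q) {d : ℝ} (hd : 0 < d) (z) :
    ‖(conjCut h d).1 z‖ ≤ d⁻¹ * ((conjCut h d * h).1 z).re := by
  rw [conjCut_mul_apply, conjCut_apply, norm_mul, RCLike.norm_conj, Complex.ofReal_re,
    Complex.norm_real, Real.norm_of_nonneg (Real.smoothTransition.nonneg _)]
  rcases le_or_gt (‖h.1 z‖) d with hle | hlt
  · rw [Real.smoothTransition.zero_of_nonpos, mul_zero, mul_zero, mul_zero]
    rw [sub_nonpos, div_le_one (by positivity)]
    gcongr
  · have h1 := Real.smoothTransition.nonneg (‖h.1 z‖ ^ 2 / d ^ 2 - 1)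
    rw [← mul_assoc]
    refine mul_le_mul_of_nonneg_right ?_ h1
    rw [inv_mul_eq_div, le_div_iff₀ hd]
    nlinarith [norm_nonneg (h.1 z)]

theorem pullGL_conjCut {h : SmoothFun p q} (hh : ∀ g, pullGL g h = h) (d : ℝ) (g) :
    pullGL g (conjCut h d) = conjCut h d := SmoothFun.ext fun z => by
  have h1 : h.1 (mulGL z g) = h.1 z := congrArg (fun F => F.1 z) (hh g)
  rw [pullGL_apply, conjCut_apply, conjCut_apply, h1]

/-! ## Integration by parts -/

/-- Integration by parts. The density cancels the divergence of `E_ij`, the weight reproduces `x -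
μ`, and `ψ` is constant along the field, so only the derivative of the cutoff survives. The formal
parameter has the value `-1/N`. -/
theorem integ_mul_testFun {μ : ℝ} (hμ : 0 < μ) {a N : ℝ} (hN : N ≠ 0) (i j : Fin p)
    (u ψ : SmoothFun p q) (hψ : holE i j ψ = 0) :
    integ ((u * momentumEntry μ j i + ((-N⁻¹ : ℝ) : ℂ) • holE i j u) *
      (ψ * density p q * cutoff p q μ a * weight p q μ N)).1 =
    ((N⁻¹ : ℝ) : ℂ) *
      integ (u * ψ * density p q * holE i j (cutoff p q μ a) * weight p q μ N).1 := by
  have hK := isCompact_sublevel (p := p) (q := q) hμ a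
  have hKM := sublevel_subset (p := p) (q := q) hμ a
  set b := density p q
  set χ := cutoff p q μ a
  set w := weight p q μ N
  set W := ψ * b * χ * w
  have hχ : χ ∈ suppIn (sublevel p q μ a) := cutoff_mem_suppIn μ a
  have hW : u * W ∈ suppIn (sublevel p q μ a) :=
    Ideal.mul_mem_left _ _ (Ideal.mul_mem_right _ _ (Ideal.mul_mem_left _ _ hχ))
  have hR : u * ψ * b * holE i j χ * w ∈ suppIn (sublevel p q μ a) :=
    Ideal.mul_mem_right _ _ (Ideal.mul_mem_left _ _ (holE_mem_suppIn hK.isClosed hχ i j))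
  set c : ℂ := if i = j then ((p + q : ℕ) : ℂ) else 0
  have hNC : (N : ℂ) ≠ 0 := Complex.ofReal_ne_zero.mpr hN
  have key : (u * momentumEntry μ j i + ((-N⁻¹ : ℝ) : ℂ) • holE i j u) * W =
      ((-N⁻¹ : ℝ) : ℂ) • (holE i j (u * W) + c • (u * W)) +
        ((N⁻¹ : ℝ) : ℂ) • (u * ψ * b * holE i j χ * w) := by
    ext z
    have hw : (holE i j w).1 z = -N * (momentumEntry μ j i).1 z * w.1 z := holE_weight μ N i j z
    have hb : (holE i j b).1 z = -c * b.1 z := holE_density i j z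
    simp only [W, holE_mul, SmoothFun.coe_mul, SmoothFun.coe_add, SmoothFun.coe_smul]
    rw [hw, hb, hψ, SmoothFun.coe_zero]
    push_cast
    field_simp
    ring
  have h1 := holE_mem_suppIn hK.isClosed hW i j
  rw [key, integ_add hK hKM (smul_mem_suppIn _ (add_mem h1 (smul_mem_suppIn _ hW)))
    (smul_mem_suppIn _ hR), integ_smul, integ_smul, integ_add hK hKM h1 (smul_mem_suppIn _ hW),
    integ_smul, integ_holE hK hKM hW]
  have h2 : -(if i = j then ((p + q : ℕ) : ℂ) * integ (u * W).1 else 0) + c * integ (u * W).1 = 0 := by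
    by_cases h : i = j
    · simp only [c, if_pos h]
      ring
    · simp only [c, if_neg h]
      ring
  rw [h2, mul_zero, zero_add]

/-! ## Estimates -/

section Estimates

variable {K : Set (Matrix (Fin (p + q)) (Fin p) ℂ)} (hK : IsCompact K) (hKM : K ⊆ fullRankSet p q)
include hK hKM

theorem re_integ {F : SmoothFun p q} (hF : F ∈ suppIn K) :
    (integ F.1).re = ∫ z : Fin (p + q) → Fin p → ℂ, (zeroExt F.1 (Matrix.of z)).re :=
  (integral_re (integrable_zeroExt hK hKM hF)).symm

theorem norm_integ_le {F G : SmoothFun p q} (hG : G ∈ suppIn K)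
    (h : ∀ z, ‖F.1 z‖ ≤ (G.1 z).re) : ‖integ F.1‖ ≤ (integ G.1).re := by
  rw [re_integ hK hKM hG]
  refine norm_integral_le_of_norm_le (integrable_zeroExt hK hKM hG).re (ae_of_all _ fun z => ?_)
  by_cases hz : Matrix.of z ∈ fullRankSet p q
  · have h1 := fun F : FullRank p q → ℂ => zeroExt_apply F ⟨_, hz⟩
    simp only at h1
    rw [h1, h1]
    exact h _
  · rw [zeroExt_of_notMem _ hz, zeroExt_of_notMem _ hz]
    simp

theorem re_integ_mono {F G : SmoothFun p q} (hF : F ∈ suppIn K) (hG : G ∈ suppIn K)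
    (h : ∀ z, (F.1 z).re ≤ (G.1 z).re) : (integ F.1).re ≤ (integ G.1).re := by
  rw [re_integ hK hKM hG, re_integ hK hKM hF]
  refine integral_mono (integrable_zeroExt hK hKM hF).re (integrable_zeroExt hK hKM hG).re
    fun z => ?_
  by_cases hz : Matrix.of z ∈ fullRankSet p q
  · have h1 := fun F : FullRank p q → ℂ => zeroExt_apply F ⟨_, hz⟩
    simp only at h1
    change (zeroExt F.1 _).re ≤ (zeroExt G.1 _).re
    rw [h1, h1]
    exact h _
  · change (zeroExt F.1 _).re ≤ (zeroExt G.1 _).re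
    rw [zeroExt_of_notMem _ hz, zeroExt_of_notMem _ hz]

theorem re_integ_pos {F : SmoothFun p q} (hF : F ∈ suppIn K) (h : ∀ z, 0 ≤ (F.1 z).re)
    {z₀ : FullRank p q} (h0 : (F.1 z₀).re ≠ 0) : 0 < (integ F.1).re := by
  rw [re_integ hK hKM hF]
  have : (volume : Measure (Fin (p + q) → Fin p → ℂ)).IsOpenPosMeasure :=
    MeasureTheory.Measure.pi.isOpenPosMeasure _
  refine Continuous.integral_pos_of_hasCompactSupport_nonneg_nonzero
    (f := fun z : Fin (p + q) → Fin p → ℂ => (zeroExt F.1 (Matrix.of z)).re)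
    (x := (z₀.1 : Fin (p + q) → Fin p → ℂ))
    (Complex.continuous_re.comp (continuous_zeroExt hK hKM hF))
    ((hasCompactSupport_zeroExt hK hF).comp_left Complex.zero_re) (fun z => ?_) ?_
  · by_cases hz : Matrix.of z ∈ fullRankSet p q
    · have h1 := zeroExt_apply F.1 ⟨_, hz⟩
      simp only at h1
      change 0 ≤ (zeroExt F.1 (Matrix.of z)).re
      rw [h1]
      exact h _
    · exact (congrArg Complex.re (zeroExt_of_notMem F.1 hz)).ge
  · have h1 := zeroExt_apply F.1 z₀
    change (zeroExt F.1 z₀.1).re ≠ 0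
    rwa [h1]

theorem norm_integ_mul_weight_le {F : SmoothFun p q} (hF : F ∈ suppIn K) {μ a N : ℝ} (hN : 0 ≤ N)
    (h : ∀ z, ((phase p q μ).1 z).re < a → F.1 z = 0) :
    ‖integ (F * weight p q μ N).1‖ ≤
      Real.exp (-N * a) * ∫ z : Fin (p + q) → Fin p → ℂ, ‖zeroExt F.1 (Matrix.of z)‖ := by
  rw [← integral_const_mul]
  refine norm_integral_le_of_norm_le ((integrable_zeroExt hK hKM hF).norm.const_mul _)
    (ae_of_all _ fun z => ?_)
  by_cases hz : Matrix.of z ∈ fullRankSet p q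
  · have h1 := fun F : FullRank p q → ℂ => zeroExt_apply F ⟨_, hz⟩
    simp only at h1
    rw [h1, h1, SmoothFun.coe_mul, norm_mul, mul_comm]
    rcases lt_or_ge (((phase p q μ).1 ⟨_, hz⟩).re) a with hlt | hle
    · rw [h _ hlt, norm_zero, mul_zero, mul_zero]
    · refine mul_le_mul_of_nonneg_right ?_ (norm_nonneg _)
      rw [weight, compRe_apply, Complex.norm_real, Real.norm_of_nonneg (Real.exp_pos _).le,
        Real.exp_le_exp]
      nlinarith
  · rw [zeroExt_of_notMem _ hz, norm_zero]
    positivity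

end Estimates

end GrassStar
end

noncomputable section

namespace GrassStar
open Matrix MeasureTheory
open scoped ContDiff ComplexOrder ComplexConjugate

variable {p q : ℕ}

/-! ## A homogeneous function in the star ideal vanishes -/

/-- For large `N` the second bound gives `N^{-n} B / 2 ≤ C₂ exp(-N (a+1))`, while the first keeps
`B` above a multiple of `exp(-N (a + 1/2))`; the gain `exp(-N/2)` defeats `N^n`. -/
theorem false_of_exp_bounds {a c C₁ C₂ : ℝ} (n : ℕ) (hc : 0 < c) (B : ℝ → ℝ)
    (h1 : ∀ N, 1 ≤ N → Real.exp (-N * (a + 1 / 2)) * c ≤ B N)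
    (h2 : ∀ N, 1 ≤ N → N⁻¹ ^ n * (B N - N⁻¹ * (C₁ * B N)) ≤ Real.exp (-N * (a + 1)) * C₂) :
    False := by
  have hlim := (tendsto_rpow_mul_exp_neg_mul_atTop_nhds_zero n (1 / 2) (by norm_num)).const_mul C₂
  rw [mul_zero] at hlim
  obtain ⟨N, hN, hN1, hN2⟩ := ((hlim.eventually_lt_const (half_pos hc)).and
    ((Filter.eventually_ge_atTop 1).and (Filter.eventually_ge_atTop (2 * C₁)))).exists
  have hN0 : 0 < N := by linarith
  have h3 := h1 N hN1
  have hB : 0 < B N := lt_of_lt_of_le (mul_pos (Real.exp_pos _) hc) h3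
  have h4 : B N / 2 ≤ B N - N⁻¹ * (C₁ * B N) := by
    have : N⁻¹ * (C₁ * B N) ≤ B N / 2 := by
      rw [inv_mul_le_iff₀ hN0]
      nlinarith
    linarith
  have h5 : N⁻¹ ^ n * (B N / 2) ≤ Real.exp (-N * (a + 1)) * C₂ :=
    (mul_le_mul_of_nonneg_left h4 (by positivity)).trans (h2 N hN1)
  rw [inv_pow, inv_mul_le_iff₀ (by positivity)] at h5
  have h6 : Real.exp (-N * (a + 1)) = Real.exp (-N * (a + 1 / 2)) * Real.exp (-(1 / 2) * N) := by
    rw [← Real.exp_add]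
    congr 1
    ring
  rw [h6] at h5
  have h7 : Real.exp (-N * (a + 1 / 2)) * (c / 2) ≤
      Real.exp (-N * (a + 1 / 2)) * (C₂ * (N ^ (n : ℝ) * Real.exp (-(1 / 2) * N))) := by
    rw [Real.rpow_natCast]
    linarith
  exact absurd (le_of_mul_le_mul_left h7 (Real.exp_pos _)) (not_le.mpr hN)

theorem suppIn_mono {K K' : Set (Matrix (Fin (p + q)) (Fin p) ℂ)} (h : K ⊆ K') :
    suppIn K ≤ suppIn K' := fun _ hF z hz => hF z fun h' => hz (h h')

theorem sublevel_mono (μ : ℝ) {a b : ℝ} (h : a ≤ b) : sublevel p q μ a ⊆ sublevel p q μ b :=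
  fun _ hz => (Real.exp_le_exp.mpr (by linarith)).trans hz

theorem exists_norm_le_of_isCompact {K : Set (Matrix (Fin (p + q)) (Fin p) ℂ)} (hK : IsCompact K)
    (hKM : K ⊆ fullRankSet p q) (F : SmoothFun p q) :
    ∃ C, 0 ≤ C ∧ ∀ z : FullRank p q, z.1 ∈ K → ‖F.1 z‖ ≤ C := by
  obtain ⟨C, hC⟩ := hK.exists_bound_of_continuousOn (F.2.continuousOn.mono hKM)
  refine ⟨max C 0, le_max_right _ _, fun z hz => ?_⟩
  have := hC z.1 hz
  rw [zeroExt_apply] at this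
  exact this.trans (le_max_left _ _)

/-! ### Upper and lower bounds for the weighted integrals -/

section

variable (h : SmoothFun p q) (d μ a : ℝ) (z₀ : FullRank p q)

theorem main_apply (N : ℝ) (z : FullRank p q) :
    (conjCut h d * h * density p q * cutoff p q μ a * weight p q μ N).1 z =
    (‖h.1 z‖ ^ 2 * Real.smoothTransition (‖h.1 z‖ ^ 2 / d ^ 2 - 1) *
      Real.exp (-(p + q : ℕ) * ((logDet p q).1 z).re) *
      Real.smoothTransition (a - ((phase p q μ).1 z).re) *
      Real.exp (-N * ((phase p q μ).1 z).re) : ℝ) := by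
  rw [SmoothFun.coe_mul, SmoothFun.coe_mul, SmoothFun.coe_mul, conjCut_mul_apply, density, cutoff,
    weight, compRe_apply, compRe_apply, compRe_apply]
  push_cast
  rfl

theorem main_apply_zero (z : FullRank p q) :
    (conjCut h d * h * density p q * cutoff p q μ a).1 z =
    (‖h.1 z‖ ^ 2 * Real.smoothTransition (‖h.1 z‖ ^ 2 / d ^ 2 - 1) *
      Real.exp (-(p + q : ℕ) * ((logDet p q).1 z).re) *
      Real.smoothTransition (a - ((phase p q μ).1 z).re) : ℝ) := by
  rw [SmoothFun.coe_mul, SmoothFun.coe_mul, conjCut_mul_apply, density, cutoff,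
    compRe_apply, compRe_apply]
  push_cast
  rfl

theorem cutoff_mul_mem (F : SmoothFun p q) {b : ℝ} (hb : a ≤ b) :
    F * cutoff p q μ a ∈ suppIn (sublevel p q μ b) :=
  Ideal.mul_mem_left _ _ (suppIn_mono (sublevel_mono μ hb) (cutoff_mem_suppIn μ a))

theorem re_integ_main_pos (hμ : 0 < μ) (hz : h.1 z₀ ≠ 0)
    (ha : a = ((phase p q μ).1 z₀).re + 1 / 2) :
    0 < (integ (conjCut h (‖h.1 z₀‖ / 2) * h * density p q * cutoff p q μ a).1).re := by
  have hn : 0 < ‖h.1 z₀‖ := norm_pos_iff.mpr hz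
  refine re_integ_pos (isCompact_sublevel hμ a) (sublevel_subset hμ a)
    (cutoff_mul_mem _ _ _ le_rfl) (fun z => ?_) (z₀ := z₀) ?_
  · rw [main_apply_zero, Complex.ofReal_re]
    exact mul_nonneg (mul_nonneg (mul_nonneg (sq_nonneg _) (Real.smoothTransition.nonneg _))
      (Real.exp_pos _).le) (Real.smoothTransition.nonneg _)
  · rw [main_apply_zero, Complex.ofReal_re]
    -- With `d` half of `|h(z₀)|` the argument of the transition function is `4 - 1`, so the cutoff
    -- is positive at `z₀`.
    have h1 : 0 < ‖h.1 z₀‖ ^ 2 / (‖h.1 z₀‖ / 2) ^ 2 - 1 := by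
      have : ‖h.1 z₀‖ ^ 2 / (‖h.1 z₀‖ / 2) ^ 2 = 4 := by
        field_simp
        norm_num
      rw [this]
      norm_num
    have h2 : 0 < a - ((phase p q μ).1 z₀).re := by rw [ha]; linarith
    exact (mul_pos (mul_pos (mul_pos (by positivity) (Real.smoothTransition.pos_of_pos h1))
      (Real.exp_pos _)) (Real.smoothTransition.pos_of_pos h2)).ne'

/-- On the support of the smaller cutoff `φ ≤ a + 1/2`; there the larger cutoff equals `1` and the
weight is at least `exp(-N (a + 1/2))`. -/
theorem exp_mul_re_integ_le (hμ : 0 < μ) {N : ℝ} (hN : 0 ≤ N) :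
    Real.exp (-N * (a + 1 / 2)) *
      (integ (conjCut h d * h * density p q * cutoff p q μ (a + 1 / 2)).1).re ≤
    (integ (conjCut h d * h * density p q * cutoff p q μ (a + 2) * weight p q μ N).1).re := by
  have hK := isCompact_sublevel (p := p) (q := q) hμ (a + 2)
  have hKM := sublevel_subset (p := p) (q := q) hμ (a + 2)
  have h1 := cutoff_mul_mem μ (a + 1 / 2) (conjCut h d * h * density p q)
    (by linarith : a + 1 / 2 ≤ a + 2)
  have h2 := cutoff_mul_mem μ (a + 2) (conjCut h d * h * density p q) le_rfl
  rw [← Complex.re_ofReal_mul, ← integ_smul]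
  refine re_integ_mono hK hKM (smul_mem_suppIn _ h1) (Ideal.mul_mem_right _ _ h2) fun z => ?_
  rw [SmoothFun.coe_smul, main_apply, main_apply_zero, ← Complex.ofReal_mul, Complex.ofReal_re,
    Complex.ofReal_re]
  set φ := ((phase p q μ).1 z).re
  have hr : 0 ≤ ‖h.1 z‖ ^ 2 * Real.smoothTransition (‖h.1 z‖ ^ 2 / d ^ 2 - 1) *
      Real.exp (-(p + q : ℕ) * ((logDet p q).1 z).re) :=
    mul_nonneg (mul_nonneg (sq_nonneg _) (Real.smoothTransition.nonneg _)) (Real.exp_pos _).le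
  refine le_of_eq_of_le (mul_left_comm _ _ _)
    ((mul_le_mul_of_nonneg_left ?_ hr).trans_eq (mul_assoc _ _ _).symm)
  rcases le_or_gt (a + 1 / 2) φ with hle | hlt
  · rw [Real.smoothTransition.zero_of_nonpos (x := a + 1 / 2 - φ) (by linarith), mul_zero]
    exact mul_nonneg (Real.smoothTransition.nonneg _) (Real.exp_pos _).le
  · rw [Real.smoothTransition.one_of_one_le (x := a + 2 - φ) (by linarith), one_mul]
    have h3 : Real.exp (-N * (a + 1 / 2)) ≤ Real.exp (-N * φ) :=
      Real.exp_le_exp.mpr (by nlinarith)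
    nlinarith [Real.smoothTransition.le_one (a + 1 / 2 - φ),
      Real.smoothTransition.nonneg (a + 1 / 2 - φ), Real.exp_pos (-N * (a + 1 / 2))]

/-- The constant does not depend on `N`: `e` is bounded on the compact support, and `|ψ|` is at most
`ψ h / d`. -/
theorem norm_integ_error_le (hμ : 0 < μ) (hd : 0 < d) (e : SmoothFun p q) :
    ∃ C, ∀ N, ‖integ (e * (conjCut h d * density p q * cutoff p q μ a * weight p q μ N)).1‖ ≤
      C * (integ (conjCut h d * h * density p q * cutoff p q μ a * weight p q μ N).1).re := by
  have hK := isCompact_sublevel (p := p) (q := q) hμ a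
  have hKM := sublevel_subset (p := p) (q := q) hμ a
  obtain ⟨C, hC0, hC⟩ := exists_norm_le_of_isCompact hK hKM e
  refine ⟨C * d⁻¹, fun N => ?_⟩
  rw [← Complex.re_ofReal_mul, ← integ_smul]
  have h2 := cutoff_mul_mem μ a (conjCut h d * h * density p q) le_rfl
  refine norm_integ_le hK hKM (smul_mem_suppIn _ (Ideal.mul_mem_right _ _ h2)) fun z => ?_
  rw [SmoothFun.coe_smul, main_apply, ← Complex.ofReal_mul, Complex.ofReal_re]
  by_cases hz : z.1 ∈ sublevel p q μ a
  · have h3 := norm_conjCut_le h hd z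
    rw [conjCut_mul_apply, Complex.ofReal_re] at h3
    rw [SmoothFun.coe_mul, SmoothFun.coe_mul, SmoothFun.coe_mul, SmoothFun.coe_mul, density, cutoff,
      weight, compRe_apply, compRe_apply, compRe_apply, norm_mul, norm_mul, norm_mul, norm_mul,
      Complex.norm_real, Complex.norm_real, Complex.norm_real,
      Real.norm_of_nonneg (Real.exp_pos _).le, Real.norm_of_nonneg (Real.exp_pos _).le,
      Real.norm_of_nonneg (Real.smoothTransition.nonneg _), mul_assoc C]
    have h4 := Real.smoothTransition.nonneg (a - ((phase p q μ).1 z).re)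
    refine mul_le_mul (hC z hz) ?_ (by positivity) hC0
    rw [← mul_assoc, ← mul_assoc, ← mul_assoc]
    gcongr
  · rw [SmoothFun.coe_mul, SmoothFun.coe_mul, SmoothFun.coe_mul, cutoff_mem_suppIn μ a z hz,
      mul_zero, zero_mul, mul_zero, norm_zero]
    have h4 := Real.smoothTransition.nonneg (a - ((phase p q μ).1 z).re)
    have h5 := Real.smoothTransition.nonneg (‖h.1 z‖ ^ 2 / d ^ 2 - 1)
    positivity

/-- The derivative of the cutoff lives where `φ ≥ a + 1`, and there the weight is at most `exp(-N
(a+1))`. -/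
theorem norm_integ_boundary_le (hμ : 0 < μ) (u ψ : SmoothFun p q) (i j : Fin p) :
    ∃ C, 0 ≤ C ∧ ∀ N, 0 ≤ N →
      ‖integ (u * ψ * density p q * holE i j (cutoff p q μ (a + 2)) * weight p q μ N).1‖ ≤
        Real.exp (-N * (a + 1)) * C := by
  have hK := isCompact_sublevel (p := p) (q := q) hμ (a + 2)
  have hKM := sublevel_subset (p := p) (q := q) hμ (a + 2)
  refine ⟨_, integral_nonneg fun _ => norm_nonneg _, fun N hN => norm_integ_mul_weight_le hK hKM
    (Ideal.mul_mem_left _ _ (holE_mem_suppIn hK.isClosed (cutoff_mem_suppIn μ (a + 2)) i j))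
    hN fun z hz => ?_⟩
  rw [SmoothFun.coe_mul, holE_cutoff_eq_zero i j (by linarith), mul_zero]

end

/-- If `h(z₀) ≠ 0`, test the identity at `l = -1/N` against the cut-off conjugate of `h`, which is
again homogeneous. The left side is `(-1/N)^n` times the main integral up to a relative error
`O(1/N)`; the right side consists of cutoff terms, exponentially smaller. -/
theorem eq_zero_of_pencil {μ : ℝ} (hμ : 0 < μ) (n : ℕ) {h e : SmoothFun p q}
    (hh : ∀ g, pullGL g h = h) (u : ℕ → Fin p → Fin p → SmoothFun p q)
    (hyp : ∀ l : ℂ, l ^ n • (h + l • e) = ∑ k ∈ Finset.range (n + 1), l ^ k •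
      ∑ i, ∑ j, (u k i j * momentumEntry μ j i + l • holE i j (u k i j))) : h = 0 := by
  by_contra hne
  obtain ⟨z₀, hz₀⟩ : ∃ z₀, h.1 z₀ ≠ 0 := by
    by_contra! hc
    exact hne (SmoothFun.ext hc)
  set a := ((phase p q μ).1 z₀).re
  set d := ‖h.1 z₀‖ / 2
  have hd : 0 < d := half_pos (norm_pos_iff.mpr hz₀)
  set ψ := conjCut h d
  have hK := isCompact_sublevel (p := p) (q := q) hμ (a + 2)
  have hKM := sublevel_subset (p := p) (q := q) hμ (a + 2)
  obtain ⟨C₁, hC₁⟩ := norm_integ_error_le h d μ (a + 2) hμ hd e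
  choose C hC0 hC using fun k i j => norm_integ_boundary_le μ a hμ (u k i j) ψ i j
  have hψ : ∀ i j, holE i j ψ = 0 := fun i j =>
    (holE_antiE_eq_zero_of_homogeneous (pullGL_conjCut hh d) i j).1
  refine false_of_exp_bounds (a := a) (C₁ := C₁)
    (C₂ := ∑ k ∈ Finset.range (n + 1), ∑ i, ∑ j, C k i j) n
    (re_integ_main_pos h μ (a + 1 / 2) z₀ hμ hz₀ rfl)
    (fun N => (integ (ψ * h * density p q * cutoff p q μ (a + 2) * weight p q μ N).1).re)
    (fun N hN => exp_mul_re_integ_le h d μ a hμ (by linarith)) fun N hN => ?_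
  have hN0 : 0 < N := by linarith
  set T := ψ * density p q * cutoff p q μ (a + 2) * weight p q μ N
  have hT : ∀ F : SmoothFun p q, F * T ∈ suppIn (sublevel p q μ (a + 2)) := fun F =>
    Ideal.mul_mem_left _ _ (Ideal.mul_mem_right _ _ (cutoff_mul_mem μ (a + 2) _ le_rfl))
  -- The value of the formal parameter at which the weight annihilates `u (x-μ)_ji + l E_ij u`.
  set l : ℂ := ((-N⁻¹ : ℝ) : ℂ)
  have hl : ‖l‖ = N⁻¹ := by
    rw [Complex.norm_real, norm_neg, Real.norm_of_nonneg (inv_nonneg.mpr hN0.le)]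
  have hl1 : ‖l‖ ≤ 1 := by rw [hl]; exact inv_le_one_of_one_le₀ hN
  set B := integ (ψ * h * density p q * cutoff p q μ (a + 2) * weight p q μ N).1
  have hL : integ ((l ^ n • (h + l • e)) * T).1 = l ^ n * (B + l * integ (e * T).1) := by
    have h1 : (l ^ n • (h + l • e)) * T = l ^ n • (h * T + l • (e * T)) := by
      ext z
      simp only [SmoothFun.coe_mul, SmoothFun.coe_add, SmoothFun.coe_smul]
      ring
    have h2 : ψ * h * density p q * cutoff p q μ (a + 2) * weight p q μ N = h * T := by
      simp only [T]
      ring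
    simp only [B]
    rw [h1, integ_smul, integ_add hK hKM (hT _) (smul_mem_suppIn _ (hT _)), integ_smul, h2]
  have hR : ‖integ ((l ^ n • (h + l • e)) * T).1‖ ≤
      Real.exp (-N * (a + 1)) * ∑ k ∈ Finset.range (n + 1), ∑ i, ∑ j, C k i j := by
    have h1 : (l ^ n • (h + l • e)) * T = ∑ k ∈ Finset.range (n + 1), l ^ k • ∑ i, ∑ j,
        ((u k i j * momentumEntry μ j i + l • holE i j (u k i j)) * T) := by
      rw [hyp, Finset.sum_mul]
      refine Finset.sum_congr rfl fun k _ => ?_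
      rw [smul_mul_assoc, Finset.sum_mul]
      simp only [Finset.sum_mul]
    have hs : ∀ k i j, (u k i j * momentumEntry μ j i + l • holE i j (u k i j)) * T ∈
      suppIn (sublevel p q μ (a + 2)) := fun k i j => hT _
    rw [h1, integ_sum hK hKM _ fun k => smul_mem_suppIn _ (Ideal.sum_mem _ fun i _ =>
      Ideal.sum_mem _ fun j _ => hs k i j), Finset.mul_sum]
    refine (norm_sum_le _ _).trans (Finset.sum_le_sum fun k _ => ?_)
    rw [integ_smul, norm_mul, norm_pow, integ_sum hK hKM _ fun i => Ideal.sum_mem _ fun j _ =>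
      hs k i j, Finset.mul_sum]
    refine (mul_le_of_le_one_left (norm_nonneg _) (pow_le_one₀ (norm_nonneg _) hl1)).trans ?_
    refine (norm_sum_le _ _).trans (Finset.sum_le_sum fun i _ => ?_)
    rw [integ_sum hK hKM _ fun j => hs k i j, Finset.mul_sum]
    refine (norm_sum_le _ _).trans (Finset.sum_le_sum fun j _ => ?_)
    have h2 : integ ((u k i j * momentumEntry μ j i + l • holE i j (u k i j)) * T).1 = _ :=
      integ_mul_testFun hμ hN0.ne' i j (u k i j) ψ (hψ i j)
    rw [h2, norm_mul, Complex.norm_real, Real.norm_of_nonneg (inv_nonneg.mpr hN0.le)]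
    exact (mul_le_of_le_one_left (norm_nonneg _) (inv_le_one_of_one_le₀ hN)).trans
      (hC k i j N hN0.le)
  rw [hL, norm_mul, norm_pow, hl] at hR
  refine le_trans (mul_le_mul_of_nonneg_left ?_ (by positivity)) hR
  have h3 : ‖l * integ (e * T).1‖ ≤ N⁻¹ * (C₁ * B.re) := by
    rw [norm_mul, hl]
    exact mul_le_mul_of_nonneg_left (hC₁ N) (inv_nonneg.mpr hN0.le)
  have h4 : B.re ≤ ‖B‖ := Complex.re_le_norm B
  have h5 := norm_sub_le (B + l * integ (e * T).1) (l * integ (e * T).1)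
  rw [add_sub_cancel_right] at h5
  linarith

/-! ### From elements of the star ideal to identities with a numerical parameter -/

theorem coeff_idealMap (μ : ℝ) (G : Fin p → Fin p → PowerSeries (SmoothFun p q)) (n : ℕ) :
    PowerSeries.coeff (n + 1) (idealMap p q μ G) =
      ∑ i, ∑ j, (PowerSeries.coeff (n + 1) (G i j) * momentumEntry μ j i +
        holE i j (PowerSeries.coeff n (G i j))) := by
  rw [idealMap_apply, map_sum]
  refine Finset.sum_congr rfl fun i _ => ?_
  rw [map_sum]
  refine Finset.sum_congr rfl fun j _ => ?_
  rw [wick_momentum, map_add, PowerSeries.coeff_mul_C, PowerSeries.coeff_succ_X_mul, coeff_mapLin]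

theorem coeff_zero_idealMap (μ : ℝ) (G : Fin p → Fin p → PowerSeries (SmoothFun p q)) :
    PowerSeries.coeff 0 (idealMap p q μ G) =
      ∑ i, ∑ j, PowerSeries.coeff 0 (G i j) * momentumEntry μ j i := by
  rw [idealMap_apply, map_sum]
  refine Finset.sum_congr rfl fun i _ => ?_
  rw [map_sum]
  refine Finset.sum_congr rfl fun j _ => ?_
  rw [wick_momentum, map_add, PowerSeries.coeff_mul_C, PowerSeries.coeff_zero_X_mul, add_zero]

theorem pencil_step {V : Type*} [AddCommGroup V] [Module ℂ V] (l : ℂ) (n : ℕ) (a b c : V) :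
    l ^ n • a + l ^ n • (b + l • c) = l ^ n • (b + a) + l ^ (n + 1) • c := by
  rw [pow_succ]
  module

/-- Truncating `G` after order `n` makes it legitimate to put a number `l` for `λ`; the truncation
leaves only one extra term, of order `l^{n+1}`. -/
theorem pencil_idealMap (μ : ℝ) (G : Fin p → Fin p → PowerSeries (SmoothFun p q)) (l : ℂ) (n : ℕ) :
    ∑ k ∈ Finset.range (n + 1), l ^ k • ∑ i, ∑ j, (PowerSeries.coeff k (G i j) *
      momentumEntry μ j i + l • holE i j (PowerSeries.coeff k (G i j))) =
    ∑ k ∈ Finset.range (n + 1), l ^ k • PowerSeries.coeff k (idealMap p q μ G) +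
      l ^ (n + 1) • ∑ i, ∑ j, holE i j (PowerSeries.coeff n (G i j)) := by
  induction n with
  | zero =>
    rw [Finset.sum_range_one, Finset.sum_range_one, coeff_zero_idealMap, pow_zero, one_smul,
      one_smul, zero_add, pow_one]
    simp only [Finset.sum_add_distrib, Finset.smul_sum]
  | succ n ih =>
    rw [Finset.sum_range_succ, ih, Finset.sum_range_succ _ (n + 1), coeff_idealMap, add_assoc,
      add_assoc]
    congr 1
    simp only [Finset.sum_add_distrib, ← Finset.smul_sum]
    exact pencil_step l (n + 1) _ _ _

/-- If all coefficients below order `n` vanish, the truncated identity exhibits the `n`-th one in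
the form excluded by `eq_zero_of_pencil`, the extra term playing the role of `e`. -/
theorem eq_zero_of_mem_starIdeal {μ : ℝ} (hμ : 0 < μ) {H : PowerSeries (SmoothFun p q)}
    (hH : IsHomogeneous H) (hJ : H ∈ starIdeal p q μ) : H = 0 := by
  obtain ⟨G, -, rfl⟩ := hJ
  ext1 n
  rw [map_zero]
  induction n using Nat.strong_induction_on with
  | _ n ih =>
    refine eq_zero_of_pencil hμ n (e := ∑ i, ∑ j, holE i j (PowerSeries.coeff n (G i j)))
      (fun g => ?_) (fun k i j => PowerSeries.coeff k (G i j)) fun l => ?_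
    · have := isHomogeneous_iff.mp hH g
      rw [← coeff_pullSeries]
      exact congrArg _ this
    · have h0 : ∑ k ∈ Finset.range n, l ^ k • PowerSeries.coeff k (idealMap p q μ G) = 0 :=
        Finset.sum_eq_zero fun k hk =>
          (congrArg (fun x => l ^ k • x) (ih k (Finset.mem_range.mp hk))).trans (smul_zero _)
      rw [pencil_idealMap, Finset.sum_range_succ, h0, zero_add, smul_add, smul_smul, pow_succ]

end GrassStar
end

noncomputable section

/-! ## Smoothness of square roots -/

section SquareRoot

open scoped ContDiff

variable {E A : Type*} [NormedAddCommGroup E] [NormedSpace ℝ E] [NormedRing A] [NormedAlgebra ℝ A]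
  [FiniteDimensional ℝ A]

/-- Inverse function theorem for squaring: its derivative at `S e` is `d ↦ S e * d + d * S e`,
injective and so invertible in finite dimension. Continuity of `S` identifies it with the local
inverse. -/
theorem contDiffAt_of_mul_self {X S : E → A} {e : E} (hX : ContDiffAt ℝ ∞ X e)
    (hS : ContinuousAt S e) (h : ∀ᶠ z in nhds e, S z * S z = X z)
    (hinj : ∀ d, S e * d + d * S e = 0 → d = 0) : ContDiffAt ℝ ∞ S e := by
  have : CompleteSpace A := FiniteDimensional.complete ℝ A
  let L : A →L[ℝ] A := S e • ContinuousLinearMap.id ℝ A +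
    MulOpposite.op (S e) • ContinuousLinearMap.id ℝ A
  have hL : ∀ d, L d = S e * d + d * S e := fun d => rfl
  have hLinj : Function.Injective L.toLinearMap := by
    rw [← LinearMap.ker_eq_bot, LinearMap.ker_eq_bot']
    exact fun d hd => hinj d hd
  let L' : A ≃L[ℝ] A := (LinearEquiv.ofInjectiveEndo L.toLinearMap hLinj).toContinuousLinearEquiv
  have hL' : (L' : A →L[ℝ] A) = L := by
    ext d
    rfl
  have hf : ContDiffAt ℝ ∞ (fun a : A => a * a) (S e) := contDiffAt_id.mul contDiffAt_id
  have hf' : HasFDerivAt (fun a : A => a * a) (L' : A →L[ℝ] A) (S e) := by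
    rw [hL']
    exact (hasFDerivAt_id (S e)).mul' (hasFDerivAt_id (S e))
  have hinf : (∞ : WithTop ℕ∞) ≠ 0 := by simp
  have hg := hf.to_localInverse hf' hinf
  have h0 : S e * S e = X e := h.self_of_nhds
  have hstrict := hf.hasStrictFDerivAt' hf' hinf
  have hev := hS.eventually hstrict.eventually_left_inverse
  have hcomp : ContDiffAt ℝ ∞ (hf.localInverse hf' hinf ∘ X) e := by
    refine ContDiffAt.comp e ?_ hX
    rw [← h0]
    exact hg
  refine hcomp.congr_of_eventuallyEq ?_
  filter_upwards [hev, h] with z hz hz'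
  rw [Function.comp_apply, ← hz']
  exact hz.symm

/-- Squaring needs a submultiplicative norm, whereas smoothness of entries is expressed in the sup
norm; the linear equivalence changes between the two. -/
theorem contDiffAt_apply_of_mul_self {V : Type*} [NormedAddCommGroup V] [NormedSpace ℝ V]
    (φ : A ≃ₗ[ℝ] V) {X S : E → A} {e : E} (hX : ContDiffAt ℝ ∞ (fun z => φ (X z)) e)
    (hS : ContinuousAt S e) (h : ∀ᶠ z in nhds e, S z * S z = X z)
    (hinj : ∀ d, S e * d + d * S e = 0 → d = 0) : ContDiffAt ℝ ∞ (fun z => φ (S z)) e := by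
  have : FiniteDimensional ℝ V := φ.finiteDimensional
  refine φ.toLinearMap.toContinuousLinearMap.contDiff.contDiffAt.comp e
    (contDiffAt_of_mul_self ?_ hS h hinj)
  have h1 := φ.symm.toLinearMap.toContinuousLinearMap.contDiff.contDiffAt.comp e hX
  refine h1.congr_of_eventuallyEq (Filter.Eventually.of_forall fun z => ?_)
  exact (φ.symm_apply_apply (X z)).symm

end SquareRoot

/-! ## Matrices with smooth entries -/

section Entries

open Matrix
open scoped ContDiff

variable {E : Type*} [NormedAddCommGroup E] [NormedSpace ℝ E] {l m n : Type*} [Fintype l]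
  [Fintype m] [Fintype n] {e : E}

/-- All entries of a matrix valued function are smooth at a point. -/
def SmoothEntriesAt (X : E → Matrix m n ℂ) (e : E) : Prop :=
  ∀ i j, ContDiffAt ℝ ∞ (fun z => X z i j) e

set_option linter.unusedSectionVars false

theorem SmoothEntriesAt.contDiffAt {X : E → Matrix m n ℂ} (hX : SmoothEntriesAt X e) :
    ContDiffAt ℝ ∞ X e := contDiffAt_pi.mpr fun i => contDiffAt_pi.mpr fun j => hX i j

theorem ContDiffAt.smoothEntriesAt {X : E → Matrix m n ℂ} (hX : ContDiffAt ℝ ∞ X e) :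
    SmoothEntriesAt X e := fun i j => contDiffAt_pi.mp (contDiffAt_pi.mp hX i) j

theorem smoothEntriesAt_const (M : Matrix m n ℂ) : SmoothEntriesAt (fun _ : E => M) e :=
  fun _ _ => contDiffAt_const

namespace SmoothEntriesAt

theorem add {X Y : E → Matrix m n ℂ} (hX : SmoothEntriesAt X e) (hY : SmoothEntriesAt Y e) :
    SmoothEntriesAt (fun z => X z + Y z) e := fun i j => (hX i j).add (hY i j)

theorem smul {c : E → ℂ} {X : E → Matrix m n ℂ} (hc : ContDiffAt ℝ ∞ c e)
    (hX : SmoothEntriesAt X e) : SmoothEntriesAt (fun z => c z • X z) e :=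
  fun i j => hc.mul (hX i j)

theorem mul {X : E → Matrix l m ℂ} {Y : E → Matrix m n ℂ} (hX : SmoothEntriesAt X e)
    (hY : SmoothEntriesAt Y e) : SmoothEntriesAt (fun z => X z * Y z) e := fun i j => by
  simp only [Matrix.mul_apply]
  exact ContDiffAt.sum fun k _ => (hX i k).mul (hY k j)

theorem conjTranspose {X : E → Matrix m n ℂ} (hX : SmoothEntriesAt X e) :
    SmoothEntriesAt (fun z => (X z)ᴴ) e := fun i j =>
  Complex.conjCLE.contDiff.contDiffAt.comp e (hX j i)

variable [DecidableEq n]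

theorem det {X : E → Matrix n n ℂ} (hX : SmoothEntriesAt X e) :
    ContDiffAt ℝ ∞ (fun z => (X z).det) e := by
  simp only [Matrix.det_apply']
  exact ContDiffAt.sum fun σ _ => contDiffAt_const.mul (contDiffAt_prod fun i _ => hX (σ i) i)

theorem inv {X : E → Matrix n n ℂ} (hX : SmoothEntriesAt X e) (h : (X e).det ≠ 0) :
    SmoothEntriesAt (fun z => (X z)⁻¹) e := by
  simp only [Matrix.inv_def, Ring.inverse_eq_inv']
  refine smul (hX.det.inv h) fun i j => ?_
  simp only [Matrix.adjugate_apply]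
  refine det fun k l => ?_
  by_cases hk : k = j
  · subst hk
    simp only [Matrix.updateRow_self]
    exact contDiffAt_const
  · simp only [Matrix.updateRow_ne hk]
    exact hX k l

theorem of_mul_self {X S : E → Matrix n n ℂ} (hX : SmoothEntriesAt X e) (hS : ContinuousAt S e)
    (h : ∀ z, S z * S z = X z) (hinj : ∀ d, S e * d + d * S e = 0 → d = 0) :
    SmoothEntriesAt S e := by
  have key : ContDiffAt ℝ ∞ (fun z => (S z : n → n → ℂ)) e := by
    open scoped Matrix.Norms.L2Operator in
    exact contDiffAt_apply_of_mul_self (Matrix.ofLinearEquiv ℝ (α := ℂ) (m := n) (n := n)).symm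
      hX.contDiffAt hS (Filter.Eventually.of_forall h) hinj
  exact fun i j => contDiffAt_pi.mp (contDiffAt_pi.mp key i) j

-- The square root is continuous on positive semidefinite matrices, and for positive definite `s`
-- the Sylvester equation `sd + ds = 0` has only the zero solution, so the inverse function theorem
-- applies.
open scoped MatrixOrder ComplexOrder in
theorem sqrt {X : E → Matrix n n ℂ} (hX : SmoothEntriesAt X e) (hpos : ∀ z, (X z).PosSemidef)
    (h : (X e).PosDef) : SmoothEntriesAt (fun z => CFC.sqrt (X z)) e := by
  have h0 : ∀ z, 0 ≤ X z := fun z => Matrix.nonneg_iff_posSemidef.mpr (hpos z)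
  have hsq : ∀ z, CFC.sqrt (X z) * CFC.sqrt (X z) = X z := fun z =>
    CFC.sqrt_mul_sqrt_self (X z) (h0 z)
  have hcont : ContinuousAt (fun z => CFC.sqrt (X z)) e := by
    have hc : ContinuousOn (CFC.sqrt : Matrix n n ℂ → Matrix n n ℂ) {a | 0 ≤ a} := by
      open scoped Matrix.Norms.L2Operator in
      exact CFC.continuousOn_sqrt
    have := (hc (X e) (h0 e)).comp (s := Set.univ) (f := X) (x := e)
      hX.contDiffAt.continuousAt.continuousWithinAt fun z _ => h0 z
    rwa [continuousWithinAt_univ] at this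
  have hs : (CFC.sqrt (X e)).PosDef := by
    have h1 : (CFC.sqrt (X e)).PosSemidef := Matrix.nonneg_iff_posSemidef.mp (CFC.sqrt_nonneg _)
    refine h1.posDef_iff_isUnit.mpr ((CFC.isUnit_sqrt_iff (X e) (h0 e)).mpr h.isUnit)
  have hinj : ∀ d, CFC.sqrt (X e) * d + d * CFC.sqrt (X e) = 0 → d = 0 := by
    intro d hd
    have ht : (CFC.sqrt (CFC.sqrt (X e)))ᴴ = CFC.sqrt (CFC.sqrt (X e)) :=
      (Matrix.nonneg_iff_posSemidef.mp (CFC.sqrt_nonneg _)).isHermitian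
    have htt := CFC.sqrt_mul_sqrt_self (CFC.sqrt (X e)) (CFC.sqrt_nonneg _)
    have htu : IsUnit (CFC.sqrt (CFC.sqrt (X e))) :=
      (CFC.isUnit_sqrt_iff _ (CFC.sqrt_nonneg _)).mpr hs.isUnit
    set t := CFC.sqrt (CFC.sqrt (X e))
    -- With `s = t²`, multiplying the equation by `d†` and taking the trace expresses it as a sum of
    -- two squared Hilbert-Schmidt norms.
    have h1 : ((t * d)ᴴ * (t * d)).trace + ((t * dᴴ)ᴴ * (t * dᴴ)).trace = 0 := by
      have h2 := congrArg (fun M => (dᴴ * M).trace) hd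
      simp only [Matrix.mul_zero, Matrix.trace_zero, Matrix.mul_add, Matrix.trace_add] at h2
      rw [← h2, ← htt, Matrix.conjTranspose_mul, Matrix.conjTranspose_mul, ht,
        Matrix.conjTranspose_conjTranspose]
      congr 1
      · simp only [Matrix.mul_assoc]
      · rw [Matrix.trace_mul_comm dᴴ]
        simp only [Matrix.mul_assoc]
    have h2 := (Matrix.posSemidef_conjTranspose_mul_self (t * d)).trace_nonneg
    have h3 := (Matrix.posSemidef_conjTranspose_mul_self (t * dᴴ)).trace_nonneg
    have h4 : t * d = 0 := Matrix.trace_conjTranspose_mul_self_eq_zero_iff.mp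
      ((add_eq_zero_iff_of_nonneg h2 h3).mp h1).1
    exact htu.mul_right_eq_zero.mp h4
  exact of_mul_self hX hcont hsq hinj

end SmoothEntriesAt

end Entries

/-! ## Smooth dependence of integrals on parameters -/

section Parametric

open MeasureTheory
open scoped ContDiff Convolution

/-- The integral is the convolution of the constant `1` with `t ↦ g z (-t)`, evaluated at `0`, and
compactly supported convolutions depend smoothly on parameters. -/
theorem contDiffOn_integral_of_support {E : Type*} [NormedAddCommGroup E] [NormedSpace ℝ E]
    {U : Set E} (hU : IsOpen U) {g : E → ℝ → ℂ} {a b : ℝ}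
    (hg : ContDiffOn ℝ ∞ (fun x : E × ℝ => g x.1 x.2) (U ×ˢ Set.univ))
    (h0 : ∀ z ∈ U, ∀ t, t ∉ Set.Icc a b → g z t = 0) :
    ContDiffOn ℝ ∞ (fun z => ∫ t, g z t) U := by
  have h := contDiffOn_convolution_right_with_param (𝕜 := ℝ) (μ := volume) (n := ⊤)
    (f := fun _ : ℝ => (1 : ℂ)) (g := fun z t => g z (-t)) (ContinuousLinearMap.mul ℝ ℂ) hU
    (isCompact_Icc (a := -b) (b := -a)) (fun z t hz ht => h0 z hz (-t) fun h => ht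
      ⟨by linarith [h.2], by linarith [h.1]⟩) (locallyIntegrable_const 1) ?_
  · have h2 := h.comp (f := fun z : E => (z, (0 : ℝ))) (s := U) (contDiff_prodMk_left 0).contDiffOn
      fun z hz => ⟨hz, Set.mem_univ _⟩
    refine h2.congr fun z _ => ?_
    simp [MeasureTheory.convolution]
  · refine hg.comp (f := fun x : E × ℝ => (x.1, -x.2))
      (contDiff_fst.prodMk contDiff_snd.neg).contDiffOn fun x hx => ⟨hx.1, Set.mem_univ _⟩

end Parametric
end

noncomputable section

namespace GrassStar
open Matrix MeasureTheory
open scoped ContDiff ComplexOrder ComplexConjugate MatrixOrder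

variable {p q : ℕ}

/-! ## The square root of the Gram matrix -/

/-- The matrix `(z† z)^{1/2}`. -/
def sqrtGram (z : Matrix (Fin (p + q)) (Fin p) ℂ) : Matrix (Fin p) (Fin p) ℂ := CFC.sqrt (zᴴ * z)

theorem sqrtGram_mul_self (z : Matrix (Fin (p + q)) (Fin p) ℂ) :
    sqrtGram z * sqrtGram z = zᴴ * z :=
  CFC.sqrt_mul_sqrt_self _ (Matrix.nonneg_iff_posSemidef.mpr (posSemidef_conjTranspose_mul_self z))

theorem posSemidef_sqrtGram (z : Matrix (Fin (p + q)) (Fin p) ℂ) : (sqrtGram z).PosSemidef :=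
  Matrix.nonneg_iff_posSemidef.mp (CFC.sqrt_nonneg _)

theorem sqrtGram_conjTranspose (z : Matrix (Fin (p + q)) (Fin p) ℂ) :
    (sqrtGram z)ᴴ = sqrtGram z := (posSemidef_sqrtGram z).isHermitian

theorem posDef_sqrtGram (z : FullRank p q) : (sqrtGram z.1).PosDef :=
  (posSemidef_sqrtGram z.1).posDef_iff_isUnit.mpr
    ((CFC.isUnit_sqrt_iff _ (Matrix.nonneg_iff_posSemidef.mpr
      (posSemidef_conjTranspose_mul_self z.1))).mpr (posDef_gram z).isUnit)

theorem sqrtGram_mul_unitary (z : Matrix (Fin (p + q)) (Fin p) ℂ)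
    (U : Matrix.unitaryGroup (Fin p) ℂ) : sqrtGram (z * U.1) = (U.1)ᴴ * sqrtGram z * U.1 := by
  refine CFC.sqrt_unique ?_ (Matrix.nonneg_iff_posSemidef.mpr
    ((posSemidef_sqrtGram z).conjTranspose_mul_mul_same U.1))
  have h : U.1 * (U.1)ᴴ = 1 := Matrix.mem_unitaryGroup_iff.mp U.2
  calc _ = (U.1)ᴴ * (sqrtGram z * (U.1 * (U.1)ᴴ) * sqrtGram z) * U.1 := by
        simp only [Matrix.mul_assoc]
    _ = _ := by
        rw [h, Matrix.mul_one, sqrtGram_mul_self, Matrix.conjTranspose_mul]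
        simp only [Matrix.mul_assoc]

theorem smoothEntriesAt_sqrtGram {E : Type*} [NormedAddCommGroup E] [NormedSpace ℝ E]
    {Z : E → Matrix (Fin (p + q)) (Fin p) ℂ} {e : E} (hZ : SmoothEntriesAt Z e)
    (h : Z e ∈ fullRankSet p q) : SmoothEntriesAt (fun x => sqrtGram (Z x)) e :=
  (hZ.conjTranspose.mul hZ).sqrt (fun x => posSemidef_conjTranspose_mul_self (Z x))
    (posDef_gram ⟨Z e, h⟩)

theorem contDiffAt_zeroExt_comp {E : Type*} [NormedAddCommGroup E] [NormedSpace ℝ E]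
    {Z : E → Matrix (Fin (p + q)) (Fin p) ℂ} {e : E} (hZ : SmoothEntriesAt Z e)
    (h : Z e ∈ fullRankSet p q) (F : SmoothFun p q) :
    ContDiffAt ℝ ∞ (fun x => zeroExt F.1 (Z x)) e :=
  ContDiffAt.comp e (contDiffAt_zeroExt F ⟨Z e, h⟩) hZ.contDiffAt

/-! ## The retraction onto the level set -/

/-- The matrix `(1 - t) (z† z)^{1/2} + t m`. -/
def pathMat (m : ℝ) (z : Matrix (Fin (p + q)) (Fin p) ℂ) (t : ℝ) : Matrix (Fin p) (Fin p) ℂ :=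
  ((1 - t : ℝ) : ℂ) • sqrtGram z + ((t * m : ℝ) : ℂ) • 1

/-- The path `z (z† z)^{-1/2} ((1 - t) (z† z)^{1/2} + t m)`. -/
def path (m : ℝ) (z : Matrix (Fin (p + q)) (Fin p) ℂ) (t : ℝ) : Matrix (Fin (p + q)) (Fin p) ℂ :=
  z * (sqrtGram z)⁻¹ * pathMat m z t

theorem posDef_smul_one_add {A : Matrix (Fin p) (Fin p) ℂ} (hA : A.PosDef) {m : ℝ} (hm : 0 ≤ m) :
    (A + (m : ℂ) • 1).PosDef :=
  hA.add_posSemidef (PosSemidef.one.smul (Complex.zero_le_real.mpr hm))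

theorem posDef_pathMat {m : ℝ} (hm : 0 < m) (z : FullRank p q) {t : ℝ} (h0 : 0 ≤ t) (h1 : t ≤ 1) :
    (pathMat m z.1 t).PosDef := by
  rcases h1.lt_or_eq with h | rfl
  · exact posDef_smul_one_add ((posDef_sqrtGram z).smul (Complex.zero_lt_real.mpr (sub_pos.mpr h)))
      (mul_nonneg h0 hm.le)
  · have : pathMat m z.1 1 = (m : ℂ) • 1 := by simp [pathMat]
    rw [this]
    exact PosDef.one.smul (Complex.zero_lt_real.mpr hm)

/-- The path stays in the GL-orbit of `z`: for `0 ≤ t ≤ 1` the right factor is a product of an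
inverse and a convex combination of positive definite matrices. -/
theorem path_mem {m : ℝ} (hm : 0 < m) (z : FullRank p q) {t : ℝ} (h0 : 0 ≤ t) (h1 : t ≤ 1) :
    path m z.1 t ∈ fullRankSet p q := by
  have h : path m z.1 t = (mulGL z (((posDef_sqrtGram z).isUnit.unit)⁻¹ *
      (posDef_pathMat hm z h0 h1).isUnit.unit)).1 := by
    refine (Matrix.mul_assoc _ _ _).trans (congrArg (z.1 * ·) ?_)
    rw [Units.val_mul, Matrix.coe_units_inv]
    rfl
  rw [h]
  exact (mulGL _ _).2

theorem path_zero {m : ℝ} (z : FullRank p q) : path m z.1 0 = z.1 := by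
  have h : pathMat m z.1 0 = sqrtGram z.1 := by simp [pathMat]
  rw [path, h, Matrix.mul_assoc, Matrix.nonsing_inv_mul _
    ((Matrix.isUnit_iff_isUnit_det _).mp (posDef_sqrtGram z).isUnit), Matrix.mul_one]

theorem pathMat_mul_unitary (m : ℝ) (z : Matrix (Fin (p + q)) (Fin p) ℂ) (t : ℝ)
    (U : Matrix.unitaryGroup (Fin p) ℂ) :
    pathMat m (z * U.1) t = (U.1)ᴴ * pathMat m z t * U.1 := by
  have h : (U.1)ᴴ * U.1 = 1 := Matrix.mem_unitaryGroup_iff'.mp U.2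
  rw [pathMat, sqrtGram_mul_unitary, pathMat, Matrix.mul_add, Matrix.add_mul, Matrix.mul_smul,
    Matrix.smul_mul, Matrix.mul_smul, Matrix.smul_mul, Matrix.mul_one, h]

theorem inv_unitary_conj (A : Matrix (Fin p) (Fin p) ℂ) (U : Matrix.unitaryGroup (Fin p) ℂ) :
    ((U.1)ᴴ * A * U.1)⁻¹ = (U.1)ᴴ * A⁻¹ * U.1 := by
  have h : (U.1)ᴴ * U.1 = 1 := Matrix.mem_unitaryGroup_iff'.mp U.2
  have h' : U.1 * (U.1)ᴴ = 1 := Matrix.mem_unitaryGroup_iff.mp U.2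
  rw [Matrix.mul_inv_rev, Matrix.mul_inv_rev, Matrix.inv_eq_left_inv h, Matrix.inv_eq_left_inv h',
    Matrix.mul_assoc]

theorem path_mul_unitary (m : ℝ) (z : Matrix (Fin (p + q)) (Fin p) ℂ) (t : ℝ)
    (U : Matrix.unitaryGroup (Fin p) ℂ) : path m (z * U.1) t = path m z t * U.1 := by
  have h' : U.1 * (U.1)ᴴ = 1 := Matrix.mem_unitaryGroup_iff.mp U.2
  rw [path, path, pathMat_mul_unitary, sqrtGram_mul_unitary, inv_unitary_conj]
  calc _ = z * (U.1 * (U.1)ᴴ) * (sqrtGram z)⁻¹ * (U.1 * (U.1)ᴴ) * pathMat m z t * U.1 := by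
        simp only [Matrix.mul_assoc]
    _ = _ := by rw [h', Matrix.mul_one, Matrix.mul_one]

theorem smoothEntriesAt_pathMat {E : Type*} [NormedAddCommGroup E] [NormedSpace ℝ E] (m : ℝ)
    {Z : E → Matrix (Fin (p + q)) (Fin p) ℂ} {T : E → ℝ} {e : E} (hZ : SmoothEntriesAt Z e)
    (hT : ContDiffAt ℝ ∞ T e) (h : Z e ∈ fullRankSet p q) :
    SmoothEntriesAt (fun x => pathMat m (Z x) (T x)) e := by
  refine SmoothEntriesAt.add (.smul ?_ (smoothEntriesAt_sqrtGram hZ h))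
    (.smul ?_ (smoothEntriesAt_const 1))
  · exact Complex.ofRealCLM.contDiff.contDiffAt.comp e (contDiffAt_const.sub hT)
  · exact Complex.ofRealCLM.contDiff.contDiffAt.comp e (hT.mul contDiffAt_const)

theorem smoothEntriesAt_path {E : Type*} [NormedAddCommGroup E] [NormedSpace ℝ E] (m : ℝ)
    {Z : E → Matrix (Fin (p + q)) (Fin p) ℂ} {T : E → ℝ} {e : E} (hZ : SmoothEntriesAt Z e)
    (hT : ContDiffAt ℝ ∞ T e) (h : Z e ∈ fullRankSet p q) :
    SmoothEntriesAt (fun x => path m (Z x) (T x)) e :=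
  (hZ.mul ((smoothEntriesAt_sqrtGram hZ h).inv (posDef_sqrtGram ⟨Z e, h⟩).det_pos.ne')).mul
    (smoothEntriesAt_pathMat m hZ hT h)

/-! ## The homogeneous part of an invariant function -/

/-- The homogeneous function which agrees with an invariant function on the level set. -/
def homPart {m : ℝ} (hm : 0 < m) (F : SmoothFun p q) : SmoothFun p q :=
  ⟨fun z => zeroExt F.1 (path m z.1 1), by
    refine isSmooth_of_eqOn (f := fun z => zeroExt F.1 (path m z 1)) (fun z hz => ?_) fun _ => rfl
    exact (contDiffAt_zeroExt_comp (smoothEntriesAt_path m contDiffAt_id.smoothEntriesAt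
      contDiffAt_const hz) (path_mem hm ⟨z, hz⟩ zero_le_one le_rfl) F).contDiffWithinAt⟩

/-- Polar decomposition: the endpoints belonging to `z` and `z g` differ by the unitary matrix `s g
s'⁻¹`. Hence an invariant function composed with the endpoint map is invariant under all of GL. -/
theorem path_one_mulGL (m : ℝ) (z : FullRank p q) (g : GL (Fin p) ℂ) :
    ∃ U : Matrix.unitaryGroup (Fin p) ℂ, path m (mulGL z g).1 1 = path m z.1 1 * U.1 := by
  set s := sqrtGram z.1
  set s' := sqrtGram (mulGL z g).1
  have hs : sᴴ = s := sqrtGram_conjTranspose _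
  have hs' : s'ᴴ = s' := sqrtGram_conjTranspose _
  have hu' : IsUnit s'.det := (Matrix.isUnit_iff_isUnit_det _).mp (posDef_sqrtGram (mulGL z g)).isUnit
  have hu : IsUnit s.det := (Matrix.isUnit_iff_isUnit_det _).mp (posDef_sqrtGram z).isUnit
  have hsq : s' * s' = g.1ᴴ * (s * s) * g.1 := by
    rw [sqrtGram_mul_self, sqrtGram_mul_self]
    change (z.1 * g.1)ᴴ * (z.1 * g.1) = _
    rw [Matrix.conjTranspose_mul]
    simp only [Matrix.mul_assoc]
  have hU : s * g.1 * s'⁻¹ ∈ Matrix.unitaryGroup (Fin p) ℂ := by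
    rw [Matrix.mem_unitaryGroup_iff', Matrix.star_eq_conjTranspose, Matrix.conjTranspose_mul,
      Matrix.conjTranspose_mul, Matrix.conjTranspose_nonsing_inv, hs, hs']
    calc _ = s'⁻¹ * (g.1ᴴ * (s * s) * g.1) * s'⁻¹ := by simp only [Matrix.mul_assoc]
      _ = 1 := by
        rw [← hsq, ← Matrix.mul_assoc, Matrix.nonsing_inv_mul _ hu', Matrix.one_mul,
          Matrix.mul_nonsing_inv _ hu']
  have hk : ∀ z : Matrix (Fin (p + q)) (Fin p) ℂ, pathMat m z 1 = (m : ℂ) • 1 := fun z => by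
    simp [pathMat]
  refine ⟨⟨_, hU⟩, ?_⟩
  rw [path, path, hk, hk]
  simp only [Matrix.mul_smul, Matrix.smul_mul, Matrix.mul_one]
  congr 1
  change z.1 * g.1 * s'⁻¹ = z.1 * s⁻¹ * (s * g.1 * s'⁻¹)
  rw [← Matrix.mul_assoc, ← Matrix.mul_assoc, Matrix.mul_assoc z.1 s⁻¹ s,
    Matrix.nonsing_inv_mul _ hu, Matrix.mul_one]

theorem pullGL_homPart {m : ℝ} (hm : 0 < m) {F : SmoothFun p q} (hF : ∀ U, pullU U F = F)
    (g : GL (Fin p) ℂ) : pullGL g (homPart hm F) = homPart hm F := SmoothFun.ext fun z => by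
  obtain ⟨U, hU⟩ := path_one_mulGL m z g
  let w : FullRank p q := ⟨path m z.1 1, path_mem hm z zero_le_one le_rfl⟩
  change zeroExt F.1 (path m (mulGL z g).1 1) = zeroExt F.1 (path m z.1 1)
  rw [hU]
  exact (zeroExt_apply F.1 (mulU w U)).trans
    ((congrArg (fun F => F.1 w) (hF U)).trans (zeroExt_apply F.1 w).symm)

/-! ## Division by the momentum map -/

/-- The matrix `((1 - t) s + t m)⁻¹ (s + m)⁻¹` for `s = (z† z)^{1/2}`. -/
def divMat (m : ℝ) (z : Matrix (Fin (p + q)) (Fin p) ℂ) (t : ℝ) : Matrix (Fin p) (Fin p) ℂ :=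
  (pathMat m z t)⁻¹ * (sqrtGram z + (m : ℂ) • 1)⁻¹

/-- The integrand of the quotient of an invariant function by the momentum map. -/
def divIntegrand (m : ℝ) (F : SmoothFun p q) (j k : Fin p)
    (z : Matrix (Fin (p + q)) (Fin p) ℂ) (u : ℝ) : ℂ :=
  ((2 * deriv Real.smoothTransition u : ℝ) : ℂ) *
    ∑ i, zeroExt (holE i j F).1 (path m z (Real.smoothTransition u)) *
      divMat m z (Real.smoothTransition u) i k

theorem deriv_smoothTransition_eq_zero {u : ℝ} (hu : u ∉ Set.Icc (0 : ℝ) 1) :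
    deriv Real.smoothTransition u = 0 := by
  rw [Set.mem_Icc, not_and_or, not_le, not_le] at hu
  rcases hu with hu | hu
  · have h : Real.smoothTransition =ᶠ[nhds u] fun _ => 0 := by
      filter_upwards [isOpen_Iio.mem_nhds hu] with t ht
      exact Real.smoothTransition.zero_of_nonpos (le_of_lt ht)
    rw [h.deriv_eq, deriv_const]
  · have h : Real.smoothTransition =ᶠ[nhds u] fun _ => 1 := by
      filter_upwards [isOpen_Ioi.mem_nhds hu] with t ht
      exact Real.smoothTransition.one_of_one_le (le_of_lt ht)
    rw [h.deriv_eq, deriv_const]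

theorem divIntegrand_eq_zero (m : ℝ) (F : SmoothFun p q) (j k : Fin p) (z) {u : ℝ}
    (hu : u ∉ Set.Icc (0 : ℝ) 1) : divIntegrand m F j k z u = 0 := by
  rw [divIntegrand, deriv_smoothTransition_eq_zero hu, mul_zero, Complex.ofReal_zero, zero_mul]

/-- Reparametrizing the path by a smooth transition function keeps its time in `[0, 1]` for all real
`u`, where the path has full rank, and gives the integrand compact support in `u`. -/
theorem contDiffOn_divIntegrand {m : ℝ} (hm : 0 < m) (F : SmoothFun p q) (j k : Fin p) :
    ContDiffOn ℝ ∞ (fun x : Matrix (Fin (p + q)) (Fin p) ℂ × ℝ => divIntegrand m F j k x.1 x.2)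
      (fullRankSet p q ×ˢ Set.univ) := fun x hx => by
  refine ContDiffAt.contDiffWithinAt ?_
  have hz : x.1 ∈ fullRankSet p q := hx.1
  have hZ : SmoothEntriesAt (fun x : Matrix (Fin (p + q)) (Fin p) ℂ × ℝ => x.1) x :=
    contDiffAt_fst.smoothEntriesAt
  have hT : ContDiffAt ℝ ∞ (fun x : Matrix (Fin (p + q)) (Fin p) ℂ × ℝ =>
    Real.smoothTransition x.2) x := Real.smoothTransition.contDiffAt.comp x contDiffAt_snd
  have h0 := Real.smoothTransition.nonneg x.2
  have h1 := Real.smoothTransition.le_one x.2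
  refine ContDiffAt.mul ?_ (ContDiffAt.sum fun i _ => ContDiffAt.mul ?_ ?_)
  · have hd : ContDiff ℝ ∞ (deriv Real.smoothTransition) :=
      (contDiff_infty_iff_deriv.mp Real.smoothTransition.contDiff).2
    exact Complex.ofRealCLM.contDiff.contDiffAt.comp x
      (contDiffAt_const.mul (hd.contDiffAt.comp x contDiffAt_snd))
  · exact contDiffAt_zeroExt_comp (smoothEntriesAt_path m hZ hT hz) (path_mem hm ⟨x.1, hz⟩ h0 h1) _
  · exact (((smoothEntriesAt_pathMat m hZ hT hz).inv
      (posDef_pathMat hm ⟨x.1, hz⟩ h0 h1).det_pos.ne').mul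
      (((smoothEntriesAt_sqrtGram hZ hz).add (smoothEntriesAt_const _)).inv
        (posDef_smul_one_add (posDef_sqrtGram ⟨x.1, hz⟩) hm.le).det_pos.ne')) i k

/-- The quotient of an invariant function by the momentum map. -/
def divMomentum {m : ℝ} (hm : 0 < m) (F : SmoothFun p q) (j k : Fin p) : SmoothFun p q :=
  ⟨fun z => ∫ u, divIntegrand m F j k z.1 u,
    isSmooth_of_eqOn (contDiffOn_integral_of_support (isOpen_fullRankSet p q)
      (contDiffOn_divIntegrand hm F j k) fun z _ _ hu => divIntegrand_eq_zero m F j k z hu)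
      fun _ => rfl⟩

theorem continuous_divIntegrand {m : ℝ} (hm : 0 < m) (F : SmoothFun p q) (j k : Fin p)
    (z : FullRank p q) : Continuous (divIntegrand m F j k z.1) := by
  rw [← continuousOn_univ]
  exact (contDiffOn_divIntegrand hm F j k).continuousOn.comp (f := fun u : ℝ => (z.1, u))
    (by fun_prop) fun u _ => ⟨z.2, Set.mem_univ _⟩

theorem integrable_divIntegrand {m : ℝ} (hm : 0 < m) (F : SmoothFun p q) (j k : Fin p)
    (z : FullRank p q) : Integrable (divIntegrand m F j k z.1) :=
  (continuous_divIntegrand hm F j k z).integrable_of_hasCompactSupport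
    (HasCompactSupport.intro isCompact_Icc fun _ hu => divIntegrand_eq_zero m F j k z.1 hu)

theorem pullGL_holE (g : GL (Fin p) ℂ) (i j : Fin p) (F : SmoothFun p q) :
    pullGL g (holE i j F) = ∑ l, ∑ k, (g.1 l i * (g⁻¹).1 j k) • holE l k (pullGL g F) := by
  ext z
  have h1 : ∀ A, ∑ k, (g⁻¹).1 j k * (dz (A, k) (pullGL g F)).1 z =
      (dz (A, j) F).1 (mulGL z g) := fun A => by
    have h2 : (g⁻¹).1 * g.1 = 1 := by rw [← Units.val_mul, inv_mul_cancel, Units.val_one]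
    simp only [dz_pullGL, SmoothFun.coe_sum, SmoothFun.coe_smul, pullGL_apply, Finset.mul_sum]
    rw [Finset.sum_comm]
    calc _ = ∑ m, ((g⁻¹).1 * g.1) j m * (dz (A, m) F).1 (mulGL z g) := by
          refine Finset.sum_congr rfl fun m _ => ?_
          rw [Matrix.mul_apply, Finset.sum_mul]
          exact Finset.sum_congr rfl fun k _ => by ring
      _ = _ := by
          rw [h2, Finset.sum_eq_single j, Matrix.one_apply_eq, one_mul]
          · intro b _ hb
            rw [Matrix.one_apply_ne hb.symm, zero_mul]
          · exact fun h => absurd (Finset.mem_univ _) h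
  have h3 : ∀ A, (coordFun A i).1 (mulGL z g) = ∑ l, z.1 A l * g.1 l i := fun A => rfl
  rw [pullGL_apply, holE_apply]
  simp only [SmoothFun.coe_sum, SmoothFun.coe_mul, SmoothFun.coe_smul, holE_apply, h3, ← h1,
    coordFun_apply]
  simp only [Finset.sum_mul, Finset.mul_sum]
  rw [Finset.sum_comm]
  conv_rhs => rw [Finset.sum_comm]
  refine Finset.sum_congr rfl fun l _ => ?_
  rw [Finset.sum_comm]
  exact Finset.sum_congr rfl fun k _ => Finset.sum_congr rfl fun A _ => by ring

end GrassStar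
end

noncomputable section

namespace GrassStar
open Matrix MeasureTheory
open scoped ContDiff ComplexOrder ComplexConjugate MatrixOrder

variable {p q : ℕ}

/-! ### Equivariance of the quotient -/

theorem holE_mulU {F : SmoothFun p q} (hF : ∀ U, pullU U F = F)
    (U : Matrix.unitaryGroup (Fin p) ℂ) (i j : Fin p) (z : FullRank p q) :
    (holE i j F).1 (mulU z U) = ∑ l, ∑ k, U.1 l i * conj (U.1 k j) * (holE l k F).1 z := by
  have h := congrArg (fun F => F.1 z) (pullGL_holE (Unitary.toUnits U) i j F)
  simp only [SmoothFun.coe_sum, SmoothFun.coe_smul] at h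
  refine h.trans (Finset.sum_congr rfl fun l _ => Finset.sum_congr rfl fun k _ => ?_)
  have h1 : pullGL (Unitary.toUnits U) F = F := hF U
  rw [h1]
  rfl

theorem divIntegrand_mulU {m : ℝ} (hm : 0 < m) {F : SmoothFun p q} (hF : ∀ U, pullU U F = F)
    (U : Matrix.unitaryGroup (Fin p) ℂ) (z : FullRank p q) (u : ℝ) (j k : Fin p) :
    divIntegrand m F j k (mulU z U).1 u =
      ∑ a, ∑ b, conj (U.1 a j) * U.1 b k * divIntegrand m F a b z.1 u := by
  set t := Real.smoothTransition u
  let w : FullRank p q := ⟨path m z.1 t, path_mem hm z (Real.smoothTransition.nonneg u)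
    (Real.smoothTransition.le_one u)⟩
  have h1 : ∀ i j, zeroExt (holE i j F).1 (path m (z.1 * U.1) t) =
      ∑ l, ∑ k, U.1 l i * conj (U.1 k j) * zeroExt (holE l k F).1 (path m z.1 t) := fun i j => by
    rw [path_mul_unitary]
    refine (zeroExt_apply (holE i j F).1 (mulU w U)).trans ((holE_mulU hF U i j w).trans ?_)
    exact Finset.sum_congr rfl fun l _ => Finset.sum_congr rfl fun k _ =>
      congrArg _ (zeroExt_apply (holE l k F).1 w).symm
  have h2 : divMat m (z.1 * U.1) t = (U.1)ᴴ * divMat m z.1 t * U.1 := by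
    have h : (U.1)ᴴ * U.1 = 1 := Matrix.mem_unitaryGroup_iff'.mp U.2
    have h' : U.1 * (U.1)ᴴ = 1 := Matrix.mem_unitaryGroup_iff.mp U.2
    have h3 : (U.1)ᴴ * sqrtGram z.1 * U.1 + (m : ℂ) • 1 =
        (U.1)ᴴ * (sqrtGram z.1 + (m : ℂ) • 1) * U.1 := by
      rw [Matrix.mul_add, Matrix.add_mul, Matrix.mul_smul, Matrix.smul_mul, Matrix.mul_one, h]
    rw [divMat, pathMat_mul_unitary, sqrtGram_mul_unitary, h3, inv_unitary_conj, inv_unitary_conj]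
    calc _ = (U.1)ᴴ * (pathMat m z.1 t)⁻¹ * (U.1 * (U.1)ᴴ) *
          (sqrtGram z.1 + (m : ℂ) • 1)⁻¹ * U.1 := by simp only [Matrix.mul_assoc]
      _ = _ := by rw [h', Matrix.mul_one, divMat, ← Matrix.mul_assoc]
  change ((2 * deriv Real.smoothTransition u : ℝ) : ℂ) *
    ∑ i, zeroExt (holE i j F).1 (path m (z.1 * U.1) t) * divMat m (z.1 * U.1) t i k = _
  have h3 : ∀ a b, divIntegrand m F a b z.1 u = ((2 * deriv Real.smoothTransition u : ℝ) : ℂ) *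
    ∑ i, zeroExt (holE i a F).1 (path m z.1 t) * divMat m z.1 t i b := fun a b => rfl
  have h4 : ∀ l a, ∑ i, U.1 l i * ((U.1)ᴴ * divMat m z.1 t * U.1) i a =
      ∑ b, divMat m z.1 t l b * U.1 b a := fun l a => by
    have h' : U.1 * (U.1)ᴴ = 1 := Matrix.mem_unitaryGroup_iff.mp U.2
    have h5 : (U.1 * ((U.1)ᴴ * divMat m z.1 t * U.1)) l a = (divMat m z.1 t * U.1) l a := by
      rw [← Matrix.mul_assoc, ← Matrix.mul_assoc, h', Matrix.one_mul]
    rwa [Matrix.mul_apply, Matrix.mul_apply] at h5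
  set e : Fin p → Fin p → ℂ := fun l a => zeroExt (holE l a F).1 (path m z.1 t)
  have h5 : ∑ i, zeroExt (holE i j F).1 (path m (z.1 * U.1) t) * divMat m (z.1 * U.1) t i k =
      ∑ a, ∑ b, conj (U.1 a j) * U.1 b k * ∑ i, e i a * divMat m z.1 t i b := by
    calc _ = ∑ l, ∑ a, conj (U.1 a j) * e l a *
          ∑ i, U.1 l i * ((U.1)ᴴ * divMat m z.1 t * U.1) i k := by
          simp only [h1, h2, Finset.sum_mul, Finset.mul_sum]
          rw [Finset.sum_comm]
          refine Finset.sum_congr rfl fun l _ => ?_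
          rw [Finset.sum_comm]
          exact Finset.sum_congr rfl fun a _ => Finset.sum_congr rfl fun i _ => by ring
      _ = _ := by
          simp only [h4, Finset.mul_sum]
          rw [Finset.sum_comm]
          refine Finset.sum_congr rfl fun a _ => ?_
          rw [Finset.sum_comm]
          exact Finset.sum_congr rfl fun b _ => Finset.sum_congr rfl fun i _ => by ring
  rw [h5]
  simp only [h3, Finset.mul_sum]
  exact Finset.sum_congr rfl fun a _ => Finset.sum_congr rfl fun b _ =>
    Finset.sum_congr rfl fun i _ => by ring

theorem pullU_divMomentum {m : ℝ} (hm : 0 < m) {F : SmoothFun p q} (hF : ∀ U, pullU U F = F)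
    (U : Matrix.unitaryGroup (Fin p) ℂ) (j k : Fin p) :
    pullGL (Unitary.toUnits U) (divMomentum hm F j k) =
      ∑ a, ∑ b, (conj (U.1 a j) * U.1 b k) • divMomentum hm F a b := by
  ext z
  simp only [SmoothFun.coe_sum, SmoothFun.coe_smul]
  change ∫ u, divIntegrand m F j k (mulU z U).1 u =
    ∑ a, ∑ b, conj (U.1 a j) * U.1 b k * ∫ u, divIntegrand m F a b z.1 u
  have hi := fun a b => (integrable_divIntegrand hm F a b z).const_mul (conj (U.1 a j) * U.1 b k)
  simp only [divIntegrand_mulU hm hF U z]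
  rw [integral_finsetSum _ fun a _ => integrable_finsetSum _ fun b _ => hi a b]
  refine Finset.sum_congr rfl fun a _ => ?_
  rw [integral_finsetSum _ fun b _ => hi a b]
  exact Finset.sum_congr rfl fun b _ => integral_const_mul _ _

/-! ### The decomposition of an invariant function -/

theorem commute_pathMat (m : ℝ) (z : Matrix (Fin (p + q)) (Fin p) ℂ) (t : ℝ) :
    Commute (pathMat m z t) ((m : ℂ) • 1 - sqrtGram z) := by
  refine Commute.sub_right (Commute.smul_right (Commute.one_right _) _) ?_
  exact Commute.add_left (Commute.smul_left (Commute.refl _) _)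
    (Commute.smul_left (Commute.one_left _) _)

theorem pathMat_conjTranspose (m : ℝ) (z : Matrix (Fin (p + q)) (Fin p) ℂ) (t : ℝ) :
    (pathMat m z t)ᴴ = pathMat m z t := by
  rw [pathMat, Matrix.conjTranspose_add, Matrix.conjTranspose_smul, Matrix.conjTranspose_smul,
    sqrtGram_conjTranspose, Matrix.conjTranspose_one, Complex.star_def,
    Complex.conj_ofReal, Complex.conj_ofReal]

/-- The velocity is `w B` with `B` Hermitian. For an invariant function the holomorphic and
antiholomorphic halves of the derivative then agree, whence the factor `2`, and `B` has the momentum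
map as a factor. -/
theorem hasDerivAt_path {m : ℝ} (hm : 0 < m) {F : SmoothFun p q} (hF : ∀ U, pullU U F = F)
    (z : FullRank p q) (u : ℝ) :
    HasDerivAt (fun u => zeroExt F.1 (path m z.1 (Real.smoothTransition u)))
      (-∑ j, ∑ k, divIntegrand m F j k z.1 u * (momentumEntry (m ^ 2) k j).1 z) u := by
  set t := Real.smoothTransition u
  set s := sqrtGram z.1
  set τ' := deriv Real.smoothTransition u
  have h0 : 0 ≤ t := Real.smoothTransition.nonneg u
  have h1 : t ≤ 1 := Real.smoothTransition.le_one u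
  let w : FullRank p q := ⟨path m z.1 t, path_mem hm z h0 h1⟩
  have hk : IsUnit (pathMat m z.1 t).det :=
    (Matrix.isUnit_iff_isUnit_det _).mp (posDef_pathMat hm z h0 h1).isUnit
  have hsm : IsUnit (s + (m : ℂ) • 1).det :=
    (Matrix.isUnit_iff_isUnit_det _).mp (posDef_smul_one_add (posDef_sqrtGram z) hm.le).isUnit
  set B : Matrix (Fin p) (Fin p) ℂ :=
    (τ' : ℂ) • ((pathMat m z.1 t)⁻¹ * ((m : ℂ) • 1 - s)) with hB
  have hBH : Bᴴ = B := by
    have hc := commute_pathMat m z.1 t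
    have h2 : (pathMat m z.1 t)⁻¹ * ((m : ℂ) • 1 - s) = ((m : ℂ) • 1 - s) * (pathMat m z.1 t)⁻¹ := by
      calc _ = (pathMat m z.1 t)⁻¹ * (((m : ℂ) • 1 - s) * pathMat m z.1 t) *
            (pathMat m z.1 t)⁻¹ := by
            rw [Matrix.mul_assoc, Matrix.mul_assoc, Matrix.mul_nonsing_inv _ hk, Matrix.mul_one]
        _ = _ := by
            rw [← hc.eq, ← Matrix.mul_assoc, Matrix.nonsing_inv_mul _ hk, Matrix.one_mul]
    rw [hB, Matrix.conjTranspose_smul, Matrix.conjTranspose_mul, Matrix.conjTranspose_nonsing_inv,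
      pathMat_conjTranspose, Matrix.conjTranspose_sub, Matrix.conjTranspose_smul,
      Matrix.conjTranspose_one, sqrtGram_conjTranspose, Complex.star_def,
      Complex.conj_ofReal, Complex.conj_ofReal, h2]
  have hpath : HasDerivAt (fun u => path m z.1 (Real.smoothTransition u)) (w.1 * B) u := by
    have hτ : HasDerivAt Real.smoothTransition τ' u :=
      ((Real.smoothTransition.contDiffAt (n := 1)).differentiableAt one_ne_zero).hasDerivAt
    have h2 := hasDerivAt_add_smul (z.1 * s⁻¹ * s) (z.1 * s⁻¹ * ((m : ℂ) • 1 - s)) hτ.ofReal_comp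
    have h3 : w.1 * B = (τ' : ℂ) • (z.1 * s⁻¹ * ((m : ℂ) • 1 - s)) := by
      change z.1 * s⁻¹ * pathMat m z.1 t * B = _
      rw [hB, Matrix.mul_smul, Matrix.mul_assoc _ (pathMat m z.1 t), ← Matrix.mul_assoc
        (pathMat m z.1 t), Matrix.mul_nonsing_inv _ hk, Matrix.one_mul]
    rw [h3]
    refine h2.congr_of_eventuallyEq (Filter.Eventually.of_forall fun v => ?_)
    change z.1 * s⁻¹ * pathMat m z.1 _ = z.1 * s⁻¹ * s +
      (Real.smoothTransition v : ℂ) • (z.1 * s⁻¹ * ((m : ℂ) • 1 - s))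
    rw [← Matrix.mul_smul, ← Matrix.mul_add, pathMat]
    congr 1
    rw [smul_sub, smul_smul]
    push_cast
    rw [sub_smul, one_smul]
    abel
  have hder := hasDerivAt_zeroExt_comp F w hpath rfl
  refine hder.congr_deriv ?_
  rw [dirDeriv_mul_matrix]
  have hanti : ∀ i j, antiE i j F = holE j i F := fun i j => (holE_eq_antiE_of_invariant hF j i).symm
  have hBc : ∀ i j, conj (B i j) = B j i := fun i j => congrFun (congrFun hBH j) i
  have hBval : ∀ i j, B i j =
      -(τ' : ℂ) * ∑ k, divMat m z.1 t i k * (momentumEntry (m ^ 2) k j).1 z := fun i j => by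
    -- The difference `s² - m²`, with `s² = x` and `m² = μ`, factors through the invertible matrix
    -- `s + m`.
    have h2 : (m : ℂ) • 1 - s = -((s + (m : ℂ) • 1)⁻¹ * (s * s - ((m ^ 2 : ℝ) : ℂ) • 1)) := by
      have h3 : s * s - ((m ^ 2 : ℝ) : ℂ) • 1 = (s + (m : ℂ) • 1) * (s - (m : ℂ) • 1) := by
        rw [Matrix.mul_sub, Matrix.add_mul, Matrix.add_mul, Matrix.mul_smul, Matrix.smul_mul,
          Matrix.mul_smul, Matrix.smul_mul, Matrix.one_mul, Matrix.mul_one, Matrix.one_mul,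
          smul_smul]
        push_cast
        rw [sq]
        abel
      rw [h3, ← Matrix.mul_assoc, Matrix.nonsing_inv_mul _ hsm, Matrix.one_mul, neg_sub]
    have h4 : ∀ k, (s * s - ((m ^ 2 : ℝ) : ℂ) • 1) k j = (momentumEntry (m ^ 2) k j).1 z := fun k => by
      rw [momentumEntry_eq, sqrtGram_mul_self, Matrix.sub_apply, Matrix.smul_apply,
        Matrix.one_apply]
      refine congrArg₂ (· - ·) (gram_apply k j z).symm ?_
      change _ = if k = j then ((m ^ 2 : ℝ) : ℂ) else 0
      split_ifs <;> simp
    rw [hB, h2, Matrix.mul_neg, ← Matrix.mul_assoc, Matrix.smul_apply, Matrix.neg_apply,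
      Matrix.mul_apply, smul_eq_mul, mul_neg, neg_mul]
    simp only [h4]
    rfl
  have h5 : ∀ i j, (holE i j F).1 w = zeroExt (holE i j F).1 (path m z.1 t) := fun i j =>
    (zeroExt_apply (holE i j F).1 w).symm
  have h6 : ∑ i, ∑ j, (B i j * (holE i j F).1 w + conj (B i j) * (antiE i j F).1 w) =
      2 * ∑ j, ∑ i, B i j * (holE i j F).1 w := by
    simp only [hanti, hBc, Finset.sum_add_distrib]
    rw [two_mul, Finset.sum_comm]
  rw [h6]
  simp only [hBval, h5, divIntegrand, Finset.mul_sum, Finset.sum_mul, ← Finset.sum_neg_distrib]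
  refine Finset.sum_congr rfl fun j _ => ?_
  rw [Finset.sum_comm]
  refine Finset.sum_congr rfl fun k _ => Finset.sum_congr rfl fun i _ => ?_
  push_cast
  ring

/-- The fundamental theorem of calculus along the path, whose endpoints are `z` and its image in the
level set. The momentum map does not depend on the time and comes out of the integral. -/
theorem eq_homPart_add {m : ℝ} (hm : 0 < m) {F : SmoothFun p q} (hF : ∀ U, pullU U F = F) :
    F = homPart hm F + ∑ j, ∑ k, divMomentum hm F j k * momentumEntry (m ^ 2) k j := by
  ext z
  have hi : ∀ j k, Integrable fun u => divIntegrand m F j k z.1 u * (momentumEntry (m ^ 2) k j).1 z :=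
    fun j k => (integrable_divIntegrand hm F j k z).mul_const _
  have hI : Integrable fun u => -∑ j, ∑ k, divIntegrand m F j k z.1 u *
      (momentumEntry (m ^ 2) k j).1 z :=
    (integrable_finsetSum _ fun j _ => integrable_finsetSum _ fun k _ => hi j k).neg
  -- The interval from `-1` to `2` contains the support `[0, 1]` of the integrand, so the interval
  -- integral equals the one over the line.
  have h1 := intervalIntegral.integral_eq_sub_of_hasDerivAt (a := -1) (b := 2)
    (fun u _ => hasDerivAt_path hm hF z u) hI.intervalIntegrable
  have hsupp : ∀ u ∉ Set.Ioc (-1 : ℝ) 2, -∑ j, ∑ k, divIntegrand m F j k z.1 u *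
      (momentumEntry (m ^ 2) k j).1 z = 0 := fun u hu => by
    have hu' : u ∉ Set.Icc (0 : ℝ) 1 := fun h => hu ⟨by linarith [h.1], by linarith [h.2]⟩
    simp only [divIntegrand_eq_zero m F _ _ z.1 hu', zero_mul, Finset.sum_const_zero, neg_zero]
  rw [intervalIntegral.integral_of_le (by norm_num),
    setIntegral_eq_integral_of_forall_compl_eq_zero hsupp, integral_neg,
    integral_finsetSum _ fun j _ => integrable_finsetSum _ fun k _ => hi j k,
    Real.smoothTransition.one_of_one_le (by norm_num : (1 : ℝ) ≤ 2),
    Real.smoothTransition.zero_of_nonpos (by norm_num : (-1 : ℝ) ≤ 0), path_zero,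
    zeroExt_apply] at h1
  have h2 : ∀ j, ∫ u, ∑ k, divIntegrand m F j k z.1 u * (momentumEntry (m ^ 2) k j).1 z =
      ∑ k, (divMomentum hm F j k).1 z * (momentumEntry (m ^ 2) k j).1 z := fun j => by
    rw [integral_finsetSum _ fun k _ => hi j k]
    exact Finset.sum_congr rfl fun k _ => integral_mul_const _ _
  simp only [h2] at h1
  simp only [SmoothFun.coe_add, SmoothFun.coe_sum, SmoothFun.coe_mul]
  have h3 : (homPart hm F).1 z = zeroExt F.1 (path m z.1 1) := rfl
  rw [h3]
  linear_combination h1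

end GrassStar
end

noncomputable section

namespace GrassStar
open Matrix PowerSeries
open scoped ComplexConjugate

variable {p q : ℕ}

/-! ### The decomposition of invariant formal functions -/

theorem isHomogeneous_C {F : SmoothFun p q} (hF : ∀ g, pullGL g F = F) : IsHomogeneous (C F) := by
  rw [isHomogeneous_iff]
  intro g
  rw [pullSeries, mapLin_C]
  exact congrArg _ (hF g)

theorem isHomogeneous_lamSum {K : ℕ → PowerSeries (SmoothFun p q)}
    (hK : ∀ r, IsHomogeneous (K r)) : IsHomogeneous (lamSum K) := by
  rw [isHomogeneous_iff]
  intro g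
  rw [linearMap_lamSum]
  exact congrArg _ (funext fun r => isHomogeneous_iff.mp (hK r) g)

/-- The remainder in the division of an invariant function by the momentum map, which is of the
first order in the formal parameter. -/
def remainder {m : ℝ} (hm : 0 < m) (F : SmoothFun p q) : SmoothFun p q :=
  -∑ i, ∑ j, holE i j (divMomentum hm F i j)

theorem sum_comm_four {ι M : Type*} [Fintype ι] [AddCommMonoid M]
    (f : ι → ι → ι → ι → ι → M) : ∑ i, ∑ l, ∑ k, ∑ a, ∑ b, f i l k a b =
      ∑ l, ∑ k, ∑ a, ∑ b, ∑ i, f i l k a b := by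
  rw [Finset.sum_comm]
  refine Finset.sum_congr rfl fun l _ => ?_
  rw [Finset.sum_comm]
  refine Finset.sum_congr rfl fun k _ => ?_
  rw [Finset.sum_comm]
  exact Finset.sum_congr rfl fun a _ => Finset.sum_comm

theorem C_smul {B : Type*} [CommRing B] [Algebra ℂ B] (c : ℂ) (x : B) :
    (C (c • x) : PowerSeries B) = c • C x := by
  ext n
  rw [PowerSeries.coeff_smul, coeff_C, coeff_C]
  split_ifs
  · rfl
  · rw [smul_zero]

theorem C_add_X_mul_C {B : Type*} [CommRing B] (a b : B) :
    (C a + X * C b : PowerSeries B) = C a - X * C (-b) := by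
  rw [map_neg]
  ring

theorem C_add_eq {B : Type*} [CommRing B] (a b c : B) :
    (C (a + b) : PowerSeries B) = C a + (C b - X * C c) + X * C c := by
  rw [map_add]
  ring

/-- The fields and the matrix `G` transform by opposite conjugations, which cancel in the sum over
both indices. The remainder of the division is thus invariant and can be divided again. -/
theorem pullU_sum_holE {G : Fin p → Fin p → SmoothFun p q} (U : Matrix.unitaryGroup (Fin p) ℂ)
    (hG : ∀ i j, pullGL (Unitary.toUnits U) (G i j) =
      ∑ a, ∑ b, (conj (U.1 a i) * U.1 b j) • G a b) :
    pullGL (Unitary.toUnits U) (∑ i, ∑ j, holE i j (G i j)) = ∑ i, ∑ j, holE i j (G i j) := by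
  have hU : U.1 * (U.1)ᴴ = 1 := Matrix.mem_unitaryGroup_iff.mp U.2
  have h1 : ∀ a b, ∑ i, U.1 a i * conj (U.1 b i) = if a = b then 1 else 0 := fun a b => by
    have := congrFun (congrFun hU a) b
    rwa [Matrix.mul_apply, Matrix.one_apply] at this
  ext z
  have hval : ∀ i j, (pullGL (Unitary.toUnits U) (holE i j (G i j))).1 z =
      ∑ l, ∑ k, ∑ a, ∑ b, (U.1 l i * conj (U.1 a i)) * (U.1 b j * conj (U.1 k j)) *
        (holE l k (G a b)).1 z := fun i j => by
    rw [pullGL_holE, hG]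
    simp only [map_sum, map_smul, SmoothFun.coe_sum, SmoothFun.coe_smul, Finset.mul_sum]
    refine Finset.sum_congr rfl fun l _ => Finset.sum_congr rfl fun k _ =>
      Finset.sum_congr rfl fun a _ => Finset.sum_congr rfl fun b _ => ?_
    change U.1 l i * conj (U.1 k j) * _ = _
    ring
  simp only [map_sum, SmoothFun.coe_sum, hval]
  calc _ = ∑ l, ∑ k, ∑ a, ∑ b, (∑ i, U.1 l i * conj (U.1 a i)) *
        (∑ j, U.1 b j * conj (U.1 k j)) * (holE l k (G a b)).1 z := by
        rw [Finset.sum_congr rfl fun i _ => sum_comm_four _, sum_comm_four]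
        refine Finset.sum_congr rfl fun l _ => Finset.sum_congr rfl fun k _ =>
          Finset.sum_congr rfl fun a _ => Finset.sum_congr rfl fun b _ => ?_
        rw [Finset.sum_mul_sum, Finset.sum_mul]
        simp only [Finset.sum_mul]
    _ = _ := by
        simp only [h1]
        refine Finset.sum_congr rfl fun l _ => Finset.sum_congr rfl fun k _ => ?_
        rw [Finset.sum_eq_single l, Finset.sum_eq_single k, if_pos rfl, if_pos rfl, one_mul, one_mul]
        · intro b _ hb
          rw [if_neg hb, mul_zero, zero_mul]
        · exact fun h => absurd (Finset.mem_univ _) h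
        · intro a _ ha
          rw [if_neg ha.symm]
          simp only [zero_mul, Finset.sum_const_zero]
        · exact fun h => absurd (Finset.mem_univ _) h

theorem pullU_remainder {m : ℝ} (hm : 0 < m) {F : SmoothFun p q} (hF : ∀ U, pullU U F = F) (U) :
    pullU U (remainder hm F) = remainder hm F :=
  (map_neg (pullU U) _).trans (congrArg _ (pullU_sum_holE U (pullU_divMomentum hm hF U)))

/-- Passing from pointwise to Wick multiplication by `x - μ` adds `λ ∑ E_ij G_ij`; its negative is
the remainder. -/
theorem C_eq_homPart_add {m : ℝ} (hm : 0 < m) {F : SmoothFun p q} (hF : ∀ U, pullU U F = F) :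
    ∃ K ∈ starIdeal p q (m ^ 2), C F = C (homPart hm F) + K + X * C (remainder hm F) := by
  refine ⟨idealMap p q (m ^ 2) fun i j => C (divMomentum hm F i j), ⟨_, ?_, rfl⟩, ?_⟩
  · change IsEquivariant _
    rw [isEquivariant_iff]
    intro U i j
    rw [pullSeries, mapLin_C]
    refine (congrArg C (pullU_divMomentum hm hF U i j)).trans ?_
    simp only [map_sum, C_smul]
  · have h1 : idealMap p q (m ^ 2) (fun i j => C (divMomentum hm F i j)) =
        C (∑ j, ∑ k, divMomentum hm F j k * momentumEntry (m ^ 2) k j) -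
          X * C (remainder hm F) := by
      rw [idealMap_apply]
      simp only [wick_momentum, mapLin_C, ← map_mul, Finset.sum_add_distrib, ← Finset.mul_sum,
        ← map_sum]
      exact C_add_X_mul_C _ _
    conv_lhs => rw [eq_homPart_add hm hF]
    rw [h1]
    exact C_add_eq _ _ _

/-- The iterated remainders. -/
def iterRemainder {m : ℝ} (hm : 0 < m) (F : SmoothFun p q) (k : ℕ) : SmoothFun p q :=
  (remainder hm)^[k] F

/-- Repeated division pushes the remainder to ever higher powers of `λ`, and the ideal and the
homogeneous functions are both closed under `λ`-adic sums. -/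
theorem exists_projection_C {m : ℝ} (hm : 0 < m) {F : SmoothFun p q} (hF : ∀ U, pullU U F = F) :
    ∃ H, IsHomogeneous H ∧ C F - H ∈ starIdeal p q (m ^ 2) := by
  have hinv : ∀ k U, pullU U (iterRemainder hm F k) = iterRemainder hm F k := fun k => by
    induction k with
    | zero => exact hF
    | succ k ih =>
      simp only [iterRemainder, Function.iterate_succ_apply']
      exact pullU_remainder hm ih
  choose K hK hFK using fun k => C_eq_homPart_add hm (hinv k)
  refine ⟨lamSum fun k => C (homPart hm (iterRemainder hm F k)), isHomogeneous_lamSum fun k =>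
    isHomogeneous_C (pullGL_homPart hm (hinv k)), ?_⟩
  -- Summing all division steps, the remainders on the right are the left side without its first
  -- term, so they cancel and only `F` is left.
  have h1 : (lamSum fun k => C (iterRemainder hm F k)) =
      (lamSum fun k => C (homPart hm (iterRemainder hm F k))) + lamSum K +
        X * lamSum fun k => C (iterRemainder hm F (k + 1)) := by
    rw [← lamSum_X_mul, ← lamSum_add, ← lamSum_add]
    refine congrArg _ (funext fun k => ?_)
    rw [hFK k, iterRemainder, iterRemainder, Function.iterate_succ_apply']
  rw [lamSum_eq_add] at h1
  have h2 := add_right_cancel h1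
  have h3 : C F - (lamSum fun k => C (homPart hm (iterRemainder hm F k))) = lamSum K :=
    sub_eq_iff_eq_add'.mpr h2
  rw [h3]
  exact lamSum_mem_starIdeal hK

theorem exists_projection {μ : ℝ} (hμ : 0 < μ) {F : PowerSeries (SmoothFun p q)}
    (hF : IsInvariant F) : ∃ H, IsHomogeneous H ∧ F - H ∈ starIdeal p q μ := by
  have hm := Real.sqrt_pos.mpr hμ
  choose H hH hFH using fun n => exists_projection_C hm (F := coeff n F) fun U =>
    SmoothFun.ext fun z => hF n z U
  rw [Real.sq_sqrt hμ.le] at hFH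
  refine ⟨lamSum H, isHomogeneous_lamSum hH, ?_⟩
  have h1 : F = lamSum (fun n => C (coeff n F) - H n) + lamSum H := by
    rw [← lamSum_add]
    conv_lhs => rw [← lamSum_C_coeff F]
    exact congrArg _ (funext fun n => (sub_add_cancel _ _).symm)
  rw [sub_eq_iff_eq_add.mpr h1]
  exact lamSum_mem_starIdeal hFH

theorem existsUnique_projection {μ : ℝ} (hμ : 0 < μ) {F : PowerSeries (SmoothFun p q)}
    (hF : IsInvariant F) : ∃! H, IsProjection μ F H := by
  obtain ⟨H, hH, hFH⟩ := exists_projection hμ hF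
  refine ⟨H, ⟨hF, hH, mem_starIdeal.mp hFH⟩, fun H' hH' => ?_⟩
  have h1 : H' - H ∈ starIdeal p q μ := by
    have := sub_mem hFH (mem_starIdeal.mpr hH'.2.2)
    rwa [sub_sub_sub_cancel_left] at this
  refine sub_eq_zero.mp (eq_zero_of_mem_starIdeal hμ ?_ h1)
  rw [isHomogeneous_iff] at hH ⊢
  intro g
  rw [map_sub, hH g, isHomogeneous_iff.mp hH'.2.1 g]

end GrassStar
end

noncomputable section

namespace GrassStar
open Matrix PowerSeries
open scoped ComplexConjugate

variable {p q : ℕ}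

/-! ## The star product on the Grassmann manifold -/

/-! ### Functions on the Grassmann manifold -/

theorem proj_mulGL (z : FullRank p q) (g : GL (Fin p) ℂ) : proj (mulGL z g) = proj z :=
  (Quotient.sound ⟨g, rfl⟩ : proj z = proj (mulGL z g)).symm

theorem proj_surjective : Function.Surjective (proj (p := p) (q := q)) := Quotient.exists_rep

theorem pullback_apply (f : SmoothGrass p q) (z : FullRank p q) :
    (pullback p q f).1 z = f.1 (proj z) := rfl

theorem pullback_injective : Function.Injective (pullback p q) := fun f g h => by
  refine Subtype.ext (funext fun y => ?_)
  obtain ⟨z, rfl⟩ := proj_surjective y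
  exact congrFun (congrArg Subtype.val h) z

theorem pullGL_pullback (γ : GL (Fin p) ℂ) (f : SmoothGrass p q) :
    pullGL γ (pullback p q f) = pullback p q f :=
  SmoothFun.ext fun z => congrArg f.1 (proj_mulGL z γ)

theorem exists_pullback_eq {F : SmoothFun p q} (hF : ∀ γ, pullGL γ F = F) :
    ∃ f, pullback p q f = F := by
  let φ : Grass p q → ℂ := Quotient.lift F.1 fun z w h => by
    obtain ⟨γ, rfl⟩ := h
    exact (congrFun (congrArg Subtype.val (hF γ)) z).symm
  exact ⟨⟨φ, F.2⟩, rfl⟩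

/-- The pullback along the canonical projection, as a linear map. -/
def pullbackLin (p q : ℕ) : SmoothGrass p q →ₗ[ℂ] SmoothFun p q where
  toFun := pullback p q
  map_add' := map_add _
  map_smul' _ _ := rfl

theorem pullbackSeries_eq (f : PowerSeries (SmoothGrass p q)) :
    pullbackSeries f = mapLin (pullbackLin p q) f := by
  ext n : 1
  rw [coeff_mapLin]
  exact PowerSeries.coeff_map _ _ _

theorem coeff_pullbackSeries (f : PowerSeries (SmoothGrass p q)) (n : ℕ) :
    coeff n (pullbackSeries f) = pullback p q (coeff n f) := PowerSeries.coeff_map _ _ _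

theorem pullbackSeries_injective : Function.Injective (pullbackSeries (p := p) (q := q)) :=
  fun f g h => by
    ext n : 1
    apply pullback_injective
    rw [← coeff_pullbackSeries, h, coeff_pullbackSeries]

theorem isHomogeneous_pullbackSeries (f : PowerSeries (SmoothGrass p q)) :
    IsHomogeneous (pullbackSeries f) := by
  rw [isHomogeneous_iff]
  intro γ
  ext n : 1
  rw [coeff_pullSeries, coeff_pullbackSeries, pullGL_pullback]

/-! ### The bidifferential operators -/

theorem contrDeriv_eq {r : ℕ} (f g : SmoothFun p q) (m : ℕ) (σ : Equiv.Perm (Fin r)) :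
    contrDeriv f g m σ = ∑ I : Fin r → Fin p, ∑ K : Fin r → Fin p, ∑ A : Fin r → Fin (p + q),
      (iterDz (fun k => (A k, I (σ⁻¹ k))) f * iterDzbar (fun k => (A k, K k)) g) *
        ∏ k, slots q m k (K k) (I k) := by
  rw [contrDeriv, Contraction.contr_apply]
  refine Finset.sum_congr rfl fun I _ => Finset.sum_congr rfl fun K _ => ?_
  rw [dTensor, Finset.sum_mul]
  rfl

/-- The contraction of the iterated derivatives as a bilinear map. -/
def contrBilin {r : ℕ} (m : ℕ) (σ : Equiv.Perm (Fin r)) :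
    SmoothFun p q →ₗ[ℂ] SmoothFun p q →ₗ[ℂ] SmoothFun p q :=
  ∑ I : Fin r → Fin p, ∑ K : Fin r → Fin p, ∑ A : Fin r → Fin (p + q),
    ((LinearMap.mul ℂ (SmoothFun p q)).compl₁₂ (iterDz fun k => (A k, I (σ⁻¹ k)))
      (iterDzbar fun k => (A k, K k))).compr₂
        (LinearMap.mulRight ℂ (∏ k, slots q m k (K k) (I k)))

theorem contrBilin_apply {r : ℕ} (m : ℕ) (σ : Equiv.Perm (Fin r)) (f g : SmoothFun p q) :
    contrBilin m σ f g = contrDeriv f g m σ := by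
  rw [contrDeriv_eq, contrBilin]
  simp only [LinearMap.sum_apply]
  rfl

theorem exists_grassTerm {r : ℕ} (σ : Equiv.Perm (Fin r)) (f g : SmoothGrass p q) :
    ∃ h, pullback p q h = contrDeriv (pullback p q f) (pullback p q g) r σ :=
  exists_pullback_eq fun γ => pullGL_contrDeriv σ γ (pullGL_pullback γ f) (pullGL_pullback γ g)

/-- A map through which a bilinear map factors along an injective linear map is bilinear. -/
def descendBilin {A B : Type*} [AddCommGroup A] [Module ℂ A] [AddCommGroup B] [Module ℂ B]
    (π : A →ₗ[ℂ] B) (hπ : Function.Injective π) (T : B →ₗ[ℂ] B →ₗ[ℂ] B) (φ : A → A → A)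
    (h : ∀ f g, π (φ f g) = T (π f) (π g)) : A →ₗ[ℂ] A →ₗ[ℂ] A :=
  LinearMap.mk₂ ℂ φ
    (fun f f' g => hπ (by rw [map_add, h, h, h, map_add, map_add, LinearMap.add_apply]))
    (fun c f g => hπ (by rw [map_smul, h, h, map_smul, map_smul, LinearMap.smul_apply]))
    (fun f g g' => hπ (by rw [map_add, h, h, h, map_add, map_add]))
    (fun c f g => hπ (by rw [map_smul, h, h, map_smul, map_smul]))

/-- The bidifferential operator on the Grassmann manifold which contracts the iterated derivatives
with `x` in all slots. -/
def grassTerm {r : ℕ} (σ : Equiv.Perm (Fin r)) :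
    SmoothGrass p q →ₗ[ℂ] SmoothGrass p q →ₗ[ℂ] SmoothGrass p q :=
  descendBilin (pullbackLin p q) pullback_injective (contrBilin r σ)
    (fun f g => (exists_grassTerm σ f g).choose) fun f g => by
      rw [contrBilin_apply]
      exact (exists_grassTerm σ f g).choose_spec

theorem pullback_grassTerm {r : ℕ} (σ : Equiv.Perm (Fin r)) (f g : SmoothGrass p q) :
    pullback p q (grassTerm σ f g) = contrDeriv (pullback p q f) (pullback p q g) r σ :=
  (exists_grassTerm σ f g).choose_spec


end GrassStar
-- Bilinear maps with values in formal series
namespace PowerSeries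

theorem lamSum_sub_lamSum {B : Type*} [Ring B] (K L : ℕ → PowerSeries B) :
    lamSum K - lamSum L = lamSum fun r => K r - L r := by
  rw [sub_eq_iff_eq_add, ← lamSum_add]
  simp only [sub_add_cancel]

theorem lamSum_smul {B : Type*} [CommRing B] [Algebra ℂ B] (c : ℂ) (K : ℕ → PowerSeries B) :
    (lamSum fun r => c • K r) = c • lamSum K := by
  ext n
  rw [PowerSeries.coeff_smul, coeff_lamSum, coeff_lamSum, Finset.smul_sum]
  rfl

/-- The bilinear map with values in formal series with the given coefficients. -/
def seriesBilin {A B ι : Type} [Fintype ι] [CommRing A] [Algebra ℂ A] [CommRing B] [Algebra ℂ B]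
    (c : ℂ) (a : ι → PowerSeries ℂ) (T : ι → A →ₗ[ℂ] A →ₗ[ℂ] B) :
    A →ₗ[ℂ] A →ₗ[ℂ] PowerSeries B :=
  c • LinearMap.mk₂ ℂ (fun f g => ∑ σ, a σ • C (T σ f g))
    (fun f f' g => by simp only [map_add, LinearMap.add_apply, smul_add, Finset.sum_add_distrib])
    (fun c f g => by
      simp only [map_smul, LinearMap.smul_apply, GrassStar.C_smul, Finset.smul_sum]
      exact Finset.sum_congr rfl fun σ _ => by
        rw [← C_smul_series, ← C_smul_series, smul_comm])
    (fun f g g' => by simp only [map_add, smul_add, Finset.sum_add_distrib])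
    (fun c f g => by
      simp only [map_smul, GrassStar.C_smul, Finset.smul_sum]
      exact Finset.sum_congr rfl fun σ _ => by
        rw [← C_smul_series, ← C_smul_series, smul_comm])

theorem seriesBilin_apply {A B ι : Type} [Fintype ι] [CommRing A] [Algebra ℂ A] [CommRing B]
    [Algebra ℂ B] (c : ℂ) (a : ι → PowerSeries ℂ) (T : ι → A →ₗ[ℂ] A →ₗ[ℂ] B) (f g : A) :
    seriesBilin c a T f g = c • ∑ σ, a σ • C (T σ f g) := rfl

/-- The sum of a sequence of bilinear maps, with the `r`-th one of order `λ^r`. -/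
def lamSumBilin {A B : Type} [CommRing A] [Algebra ℂ A] [CommRing B] [Algebra ℂ B]
    (T : ℕ → A →ₗ[ℂ] A →ₗ[ℂ] PowerSeries B) : A →ₗ[ℂ] A →ₗ[ℂ] PowerSeries B :=
  LinearMap.mk₂ ℂ (fun f g => lamSum fun r => T r f g)
    (fun f f' g => by simp only [map_add, LinearMap.add_apply, lamSum_add])
    (fun c f g => by simp only [map_smul, LinearMap.smul_apply, lamSum_smul])
    (fun f g g' => by simp only [map_add, lamSum_add])
    (fun c f g => by simp only [map_smul, lamSum_smul])

end PowerSeries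
namespace GrassStar
open PowerSeries

/-- The `r`-th term of the star product, without the power of the formal parameter. -/
def starTermBilin {μ : ℝ} (hμ : 0 < μ) (r : ℕ) :
    SmoothGrass p q →ₗ[ℂ] SmoothGrass p q →ₗ[ℂ] PowerSeries (SmoothGrass p q) :=
  seriesBilin (A := SmoothGrass p q) (B := SmoothGrass p q) (r.factorial : ℂ)⁻¹
    (fun σ => (invCycleGen p hμ r).coeff σ) fun σ => grassTerm σ

theorem starTermBilin_apply {μ : ℝ} (hμ : 0 < μ) (r : ℕ) (f g : SmoothGrass p q) :
    starTermBilin hμ r f g = (r.factorial : ℂ)⁻¹ • ∑ σ : Equiv.Perm (Fin r),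
      (invCycleGen p hμ r).coeff σ • C (grassTerm σ f g) :=
  seriesBilin_apply (A := SmoothGrass p q) (B := SmoothGrass p q) _ _ _ f g

/-- The star product on the Grassmann manifold. -/
def grassStar (p q : ℕ) {μ : ℝ} (hμ : 0 < μ) : PowerSeries (SmoothGrass p q) →ₗ[PowerSeries ℂ]
    PowerSeries (SmoothGrass p q) →ₗ[PowerSeries ℂ] PowerSeries (SmoothGrass p q) :=
  extendBilin (lamSumBilin fun r => starTermBilin hμ r)

theorem grassStar_C {μ : ℝ} (hμ : 0 < μ) (f g : SmoothGrass p q) :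
    grassStar p q hμ (C f) (C g) = lamSum fun r => starTermBilin hμ r f g :=
  extendBilin_C _ f g

end GrassStar
end

noncomputable section

namespace GrassStar
open Matrix PowerSeries
open scoped ComplexConjugate

variable {p q : ℕ}

/-! ### The star product as the projection of the Wick product -/

theorem mapLin_seriesSum {A B ι : Type} [CommRing A] [Algebra ℂ A] [CommRing B] [Algebra ℂ B]
    [Fintype ι] (T : A →ₗ[ℂ] B) (c : ℂ) (a : ι → PowerSeries ℂ) (t : ι → A) :
    mapLin T (c • ∑ σ, a σ • C (t σ)) = c • ∑ σ, a σ • C (T (t σ)) := by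
  rw [← C_smul_series, map_smul, map_sum, C_smul_series]
  simp only [map_smul, mapLin_C]

theorem pullbackSeries_starTermBilin {μ : ℝ} (hμ : 0 < μ) (r : ℕ) (f g : SmoothGrass p q) :
    mapLin (pullbackLin p q) (starTermBilin hμ r f g) = (r.factorial : ℂ)⁻¹ •
      ∑ σ : Equiv.Perm (Fin r), (invCycleGen p hμ r).coeff σ •
        C (contrDeriv (pullback p q f) (pullback p q g) r σ) := by
  rw [starTermBilin_apply]
  refine (mapLin_seriesSum (A := SmoothGrass p q) (B := SmoothFun p q) (pullbackLin p q) _ _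
    fun σ => grassTerm σ f g).trans ?_
  congr 1
  exact Finset.sum_congr rfl fun σ _ => congrArg _ (congrArg _ (pullback_grassTerm σ f g))

theorem wick_C_C (F G : SmoothFun p q) : wick (C F) (C G) =
    lamSum fun r => (r.factorial : ℂ)⁻¹ • C (contrDeriv F G 0 (1 : Equiv.Perm (Fin r))) := by
  rw [wick_eq_product, ExpProduct.product_eq_lamSum]
  congr 1
  funext r
  simp only [mapLin_C, contrDeriv_zero_one, ← map_mul, ← map_sum]
  rfl

theorem smul_sub_smul_mem_starIdeal {μ : ℝ} (c : ℂ) {F G : PowerSeries (SmoothFun p q)}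
    (h : F - G ∈ starIdeal p q μ) : c • F - c • G ∈ starIdeal p q μ := by
  rw [← C_smul_series, ← C_smul_series]
  have := (starIdeal p q μ).smul_mem (C c) h
  rwa [_root_.smul_sub] at this

/-- Term by term in the power of `λ`, this is the telescoped recursion modulo the ideal. -/
theorem grassStar_C_sub_wick_mem {μ : ℝ} (hμ : 0 < μ) (f g : SmoothGrass p q) :
    mapLin (pullbackLin p q) (grassStar p q hμ (C f) (C g)) -
      wick (C (pullback p q f)) (C (pullback p q g)) ∈ starIdeal p q μ := by
  rw [grassStar_C, linearMap_lamSum, wick_C_C, lamSum_sub_lamSum]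
  refine lamSum_mem_starIdeal fun r => ?_
  rw [pullbackSeries_starTermBilin]
  exact smul_sub_smul_mem_starIdeal _ (sum_invCycleGen_smul_contrDeriv_sub_mem hμ
    (fun γ => pullGL_pullback γ f) fun γ => pullGL_pullback γ g)

/-- The comparison of two bilinear maps after a linear map `T`. -/
def bilinDiff {A B : Type} [CommRing A] [Algebra ℂ A] [CommRing B] [Algebra ℂ B]
    (T : PowerSeries A →ₗ[PowerSeries ℂ] PowerSeries B)
    (L : PowerSeries A →ₗ[PowerSeries ℂ] PowerSeries A →ₗ[PowerSeries ℂ] PowerSeries A)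
    (L' : PowerSeries B →ₗ[PowerSeries ℂ] PowerSeries B →ₗ[PowerSeries ℂ] PowerSeries B) :
    PowerSeries A →ₗ[PowerSeries ℂ] PowerSeries A →ₗ[PowerSeries ℂ] PowerSeries B :=
  L.compr₂ T - L'.compl₁₂ T T

theorem bilinDiff_apply {A B : Type} [CommRing A] [Algebra ℂ A] [CommRing B] [Algebra ℂ B]
    (T : PowerSeries A →ₗ[PowerSeries ℂ] PowerSeries B)
    (L : PowerSeries A →ₗ[PowerSeries ℂ] PowerSeries A →ₗ[PowerSeries ℂ] PowerSeries A)
    (L' : PowerSeries B →ₗ[PowerSeries ℂ] PowerSeries B →ₗ[PowerSeries ℂ] PowerSeries B)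
    (F G : PowerSeries A) : bilinDiff T L L' F G = T (L F G) - L' (T F) (T G) := rfl

theorem bilin_mem_of_C {A : Type} [CommRing A] [Algebra ℂ A] {μ : ℝ}
    (L : PowerSeries A →ₗ[PowerSeries ℂ] PowerSeries A →ₗ[PowerSeries ℂ]
      PowerSeries (SmoothFun p q)) (h : ∀ a b, L (C a) (C b) ∈ starIdeal p q μ)
    (F G : PowerSeries A) : L F G ∈ starIdeal p q μ :=
  mem_starIdeal_of_C (L F) (fun b => mem_starIdeal_of_C (L.flip (C b)) (fun a => h a b) F) G

theorem grassStar_sub_wick_mem {μ : ℝ} (hμ : 0 < μ) (f g : PowerSeries (SmoothGrass p q)) :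
    pullbackSeries (grassStar p q hμ f g) - wick (pullbackSeries f) (pullbackSeries g) ∈
      starIdeal p q μ := by
  simp only [pullbackSeries_eq]
  rw [← wickBilin_apply]
  have hd := fun F G => bilinDiff_apply (A := SmoothGrass p q) (B := SmoothFun p q)
    (mapLin (pullbackLin p q)) (grassStar p q hμ) (wickBilin p q) F G
  rw [← hd]
  refine bilin_mem_of_C (A := SmoothGrass p q) _ (fun a b => ?_) f g
  rw [hd, wickBilin_apply]
  have h := grassStar_C_sub_wick_mem hμ a b
  rw [mapLin_C, mapLin_C]
  exact h

theorem isProjection_grassStar {μ : ℝ} (hμ : 0 < μ) (f g : PowerSeries (SmoothGrass p q)) :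
    IsProjection μ (wick (pullbackSeries f) (pullbackSeries g))
      (pullbackSeries (grassStar p q hμ f g)) :=
  ⟨(isHomogeneous_pullbackSeries f).isInvariant.wick (isHomogeneous_pullbackSeries g).isInvariant,
    isHomogeneous_pullbackSeries _, mem_starIdeal.mp (by
      rw [← neg_sub]
      exact (starIdeal p q μ).neg_mem (grassStar_sub_wick_mem hμ f g))⟩

theorem pullbackSeries_sub (f g : PowerSeries (SmoothGrass p q)) :
    pullbackSeries (f - g) = pullbackSeries f - pullbackSeries g :=
  map_sub (PowerSeries.map (pullback p q)) f g

theorem eq_of_pullbackSeries_sub_mem {μ : ℝ} (hμ : 0 < μ) {f g : PowerSeries (SmoothGrass p q)}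
    (h : pullbackSeries f - pullbackSeries g ∈ starIdeal p q μ) : f = g := by
  rw [← pullbackSeries_sub] at h
  have h1 := eq_zero_of_mem_starIdeal hμ (isHomogeneous_pullbackSeries _) h
  rw [pullbackSeries_sub, sub_eq_zero] at h1
  exact pullbackSeries_injective h1

theorem wick_sub_left (F G H : PowerSeries (SmoothFun p q)) :
    wick F H - wick G H = wick (F - G) H := by
  simp only [← wickBilin_apply, map_sub, LinearMap.sub_apply]

theorem wick_sub_right (F G H : PowerSeries (SmoothFun p q)) :
    wick H F - wick H G = wick H (F - G) := by
  simp only [← wickBilin_apply, map_sub]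

theorem add_sub_sub_eq {A : Type*} [AddCommGroup A] (a b c d e : A) :
    (a - b) + (b - c) - ((d - e) + (e - c)) = a - d := by abel

/-- Both sides are congruent to the associative triple Wick product, since the ideal absorbs
invariant factors on either side; homogeneous functions that are congruent coincide. -/
theorem grassStar_assoc {μ : ℝ} (hμ : 0 < μ) (f g h : PowerSeries (SmoothGrass p q)) :
    grassStar p q hμ (grassStar p q hμ f g) h = grassStar p q hμ f (grassStar p q hμ g h) := by
  refine eq_of_pullbackSeries_sub_mem hμ ?_
  have h1 := grassStar_sub_wick_mem hμ (grassStar p q hμ f g) h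
  have h2 := starIdeal_wick_mem (isHomogeneous_pullbackSeries h).isInvariant
    (grassStar_sub_wick_mem hμ f g)
  have h3 := grassStar_sub_wick_mem hμ f (grassStar p q hμ g h)
  have h4 := wick_mem_starIdeal (isHomogeneous_pullbackSeries f).isInvariant
    (grassStar_sub_wick_mem hμ g h)
  rw [← wick_sub_left, wick_assoc] at h2
  rw [← wick_sub_right] at h4
  have h5 := (starIdeal p q μ).sub_mem ((starIdeal p q μ).add_mem h1 h2)
    ((starIdeal p q μ).add_mem h3 h4)
  rwa [add_sub_sub_eq] at h5

theorem iterDz_one {r : ℕ} (a : Fin (r + 1) → Fin (p + q) × Fin p) : iterDz a 1 = 0 := by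
  induction r with
  | zero =>
    rw [iterDz_succ, iterDz_zero, Module.End.mul_apply, Module.End.one_apply,
      ← map_one (algebraMap ℂ (SmoothFun p q)), dz_algebraMap]
  | succ r ih => rw [iterDz_succ, Module.End.mul_apply, ih, map_zero]

theorem iterDzbar_one {r : ℕ} (a : Fin (r + 1) → Fin (p + q) × Fin p) : iterDzbar a 1 = 0 := by
  induction r with
  | zero =>
    rw [iterDzbar_succ, iterDzbar_zero, Module.End.mul_apply, Module.End.one_apply,
      ← map_one (algebraMap ℂ (SmoothFun p q)), dzbar_algebraMap]
  | succ r ih => rw [iterDzbar_succ, Module.End.mul_apply, ih, map_zero]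

theorem contrDeriv_zero (f g : SmoothFun p q) (m : ℕ) (σ : Equiv.Perm (Fin 0)) :
    contrDeriv f g m σ = f * g := by
  rw [contrDeriv_eq, Fintype.sum_unique, Fintype.sum_unique, Fintype.sum_unique, iterDz_zero,
    iterDzbar_zero, Fin.prod_univ_zero, mul_one]
  rfl

theorem contrDeriv_one_left {r : ℕ} (g : SmoothFun p q) (m : ℕ) (σ : Equiv.Perm (Fin (r + 1))) :
    contrDeriv 1 g m σ = 0 := by
  rw [contrDeriv_eq]
  refine Finset.sum_eq_zero fun I _ => Finset.sum_eq_zero fun K _ => Finset.sum_eq_zero fun A _ => ?_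
  rw [iterDz_one, zero_mul, zero_mul]

theorem contrDeriv_one_right {r : ℕ} (f : SmoothFun p q) (m : ℕ) (σ : Equiv.Perm (Fin (r + 1))) :
    contrDeriv f 1 m σ = 0 := by
  rw [contrDeriv_eq]
  refine Finset.sum_eq_zero fun I _ => Finset.sum_eq_zero fun K _ => Finset.sum_eq_zero fun A _ => ?_
  rw [iterDzbar_one, mul_zero, zero_mul]

theorem lamSum_factorial_C_of_succ_eq_zero {B : Type*} [CommRing B] [Algebra ℂ B] (K : ℕ → B)
    (h : ∀ r, K (r + 1) = 0) : (lamSum fun r => (r.factorial : ℂ)⁻¹ • C (K r)) = C (K 0) := by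
  rw [lamSum_congr_single]
  · rw [Nat.factorial_zero, Nat.cast_one, inv_one, one_smul]
  · intro r hr
    obtain ⟨s, rfl⟩ := Nat.exists_eq_succ_of_ne_zero hr
    rw [h, map_zero, smul_zero]

theorem wick_one_left (F : PowerSeries (SmoothFun p q)) : wick 1 F = F := by
  rw [← wickBilin_apply]
  refine linearMap_eq_of_C (A := SmoothFun p q) (B := SmoothFun p q) (wickBilin p q 1)
    LinearMap.id (fun a => ?_) F
  rw [wickBilin_apply, ← map_one (C (R := SmoothFun p q)), wick_C_C,
    lamSum_factorial_C_of_succ_eq_zero, contrDeriv_zero, one_mul, LinearMap.id_apply]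
  exact fun r => contrDeriv_one_left a 0 _

theorem wick_one_right (F : PowerSeries (SmoothFun p q)) : wick F 1 = F := by
  rw [← wickBilin_apply]
  refine linearMap_eq_of_C (A := SmoothFun p q) (B := SmoothFun p q) ((wickBilin p q).flip 1)
    LinearMap.id (fun a => ?_) F
  rw [LinearMap.flip_apply, wickBilin_apply, ← map_one (C (R := SmoothFun p q)), wick_C_C,
    lamSum_factorial_C_of_succ_eq_zero, contrDeriv_zero, mul_one, LinearMap.id_apply]
  exact fun r => contrDeriv_one_right a 0 _

theorem pullbackSeries_one : pullbackSeries (1 : PowerSeries (SmoothGrass p q)) = 1 :=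
  map_one (PowerSeries.map (pullback p q))

theorem grassStar_one_left {μ : ℝ} (hμ : 0 < μ) (f : PowerSeries (SmoothGrass p q)) :
    grassStar p q hμ 1 f = f := by
  refine eq_of_pullbackSeries_sub_mem hμ ?_
  have h := grassStar_sub_wick_mem hμ 1 f
  rwa [pullbackSeries_one, wick_one_left] at h

theorem grassStar_one_right {μ : ℝ} (hμ : 0 < μ) (f : PowerSeries (SmoothGrass p q)) :
    grassStar p q hμ f 1 = f := by
  refine eq_of_pullbackSeries_sub_mem hμ ?_
  have h := grassStar_sub_wick_mem hμ f 1
  rwa [pullbackSeries_one, wick_one_right] at h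

end GrassStar
end

noncomputable section

namespace GrassStar
open Matrix PowerSeries
open scoped ComplexConjugate

variable {p q : ℕ}

/-! ### The coefficients of the star product -/

theorem coeff_seriesSum {B ι : Type} [CommRing B] [Algebra ℂ B] [Fintype ι] (c : ℂ)
    (a : ι → PowerSeries ℂ) (t : ι → B) (n : ℕ) :
    coeff n (c • ∑ σ, a σ • C (t σ)) = c • ∑ σ, coeff n (a σ) • t σ := by
  rw [PowerSeries.coeff_smul, map_sum]
  congr 1
  refine Finset.sum_congr rfl fun σ _ => ?_
  rw [smul_series_def, coeff_mul_C, coeff_map, Algebra.smul_def]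

theorem coeff_grassStar_C {μ : ℝ} (hμ : 0 < μ) (f g : SmoothGrass p q) (n : ℕ) :
    coeff n (grassStar p q hμ (C f) (C g)) = ∑ r ∈ Finset.range (n + 1),
      (r.factorial : ℂ)⁻¹ • ∑ σ : Equiv.Perm (Fin r),
        coeff (n - r) ((invCycleGen p hμ r).coeff σ) • grassTerm σ f g := by
  rw [grassStar_C, coeff_lamSum]
  refine Finset.sum_congr rfl fun r _ => ?_
  rw [starTermBilin_apply]
  exact coeff_seriesSum (B := SmoothGrass p q) _ _ _ _

theorem grassTerm_zero (σ : Equiv.Perm (Fin 0)) (f g : SmoothGrass p q) :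
    grassTerm σ f g = f * g := by
  apply pullback_injective
  rw [pullback_grassTerm, contrDeriv_zero, map_mul]

theorem coeff_zero_grassStar_C {μ : ℝ} (hμ : 0 < μ) (f g : SmoothGrass p q) :
    coeff 0 (grassStar p q hμ (C f) (C g)) = f * g := by
  have h : (invCycleGen p hμ 0).coeff default = 1 := by
    rw [invCycleGen_zero, Subsingleton.elim default (1 : Equiv.Perm (Fin 0)),
      MonoidAlgebra.one_def, MonoidAlgebra.coeff_single, Finsupp.single_eq_same]
  rw [coeff_grassStar_C, zero_add, Finset.sum_range_one, Fintype.sum_unique, h, Nat.sub_zero,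
    coeff_zero_one, one_smul, Nat.factorial_zero, Nat.cast_one, inv_one, one_smul, grassTerm_zero]

theorem coeff_one_grassStar_C {μ : ℝ} (hμ : 0 < μ) (f g : SmoothGrass p q) :
    coeff 1 (grassStar p q hμ (C f) (C g)) =
      (μ : ℂ)⁻¹ • grassTerm (1 : Equiv.Perm (Fin 1)) f g := by
  have h : (invCycleGen p hμ 0).coeff default = 1 := by
    rw [invCycleGen_zero, Subsingleton.elim default (1 : Equiv.Perm (Fin 0)),
      MonoidAlgebra.one_def, MonoidAlgebra.coeff_single, Finsupp.single_eq_same]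
  have hd : (default : Equiv.Perm (Fin 1)) = 1 := Subsingleton.elim _ _
  have h1 := coeff_zero_invCycleGen_one p hμ
  rw [← coeff_zero_eq_constantCoeff_apply] at h1
  rw [coeff_grassStar_C, Finset.sum_range_succ, Finset.sum_range_one, Fintype.sum_unique,
    Fintype.sum_unique, h, Nat.sub_zero, coeff_one, if_neg one_ne_zero, zero_smul, smul_zero,
    zero_add, hd, Nat.sub_self, h1, Nat.factorial_one, Nat.cast_one, inv_one, one_smul]

/-! ### Restriction to the level set -/

theorem contrDeriv_apply {r : ℕ} (f g : SmoothFun p q) (m : ℕ) (σ : Equiv.Perm (Fin r))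
    (z : FullRank p q) : (contrDeriv f g m σ).1 z =
      ∑ I : Fin r → Fin p, ∑ K : Fin r → Fin p, ∑ A : Fin r → Fin (p + q),
        ((iterDz (fun k => (A k, I (σ⁻¹ k))) f).1 z * (iterDzbar (fun k => (A k, K k)) g).1 z) *
          ∏ k, (slots q m k (K k) (I k)).1 z := by
  rw [contrDeriv_eq]
  simp only [SmoothFun.coe_sum, SmoothFun.coe_mul, SmoothFun.coe_prod]

theorem contrDeriv_of_gram_eq {r : ℕ} (f g : SmoothFun p q) (σ : Equiv.Perm (Fin r))
    {z : FullRank p q} {c : ℂ} (hz : z.1ᴴ * z.1 = c • (1 : Matrix (Fin p) (Fin p) ℂ)) :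
    (contrDeriv f g r σ).1 z = c ^ r * (contrDeriv f g 0 σ).1 z := by
  have h : ∀ (k : Fin r) (a b : Fin p), (slots q r k a b).1 z = c * (slots q 0 k a b).1 z :=
    fun k a b => by
      rw [slots, if_pos k.2, gram_apply, hz, slots, if_neg (Nat.not_lt_zero _), Matrix.smul_apply,
        Matrix.one_apply]
      split_ifs <;> rfl
  rw [contrDeriv_apply, contrDeriv_apply]
  simp only [h, Finset.prod_mul_distrib, Finset.prod_const, Finset.card_univ, Fintype.card_fin,
    Finset.mul_sum]
  refine Finset.sum_congr rfl fun I _ => Finset.sum_congr rfl fun K _ =>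
    Finset.sum_congr rfl fun A _ => ?_
  ring

theorem levelSet_gram {μ : ℝ} (ζ : LevelSet p q μ) :
    (incl ζ).1ᴴ * (incl ζ).1 = (μ : ℂ) • (1 : Matrix (Fin p) (Fin p) ℂ) :=
  smul_right_injective _ (div_ne_zero Complex.I_ne_zero two_ne_zero) ζ.2

theorem contrDeriv_levelSet {r : ℕ} {μ : ℝ} (f g : SmoothFun p q) (σ : Equiv.Perm (Fin r))
    (ζ : LevelSet p q μ) :
    (contrDeriv f g r σ).1 (incl ζ) = (μ : ℂ) ^ r * (contrDeriv f g 0 σ).1 (incl ζ) :=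
  contrDeriv_of_gram_eq f g σ (levelSet_gram ζ)

theorem contrDeriv_fin_one (f g : SmoothFun p q) :
    contrDeriv f g 0 (1 : Equiv.Perm (Fin 1)) = ∑ a, dz a f * dzbar a g := by
  rw [contrDeriv_zero_one]
  refine Fintype.sum_equiv (Equiv.funUnique (Fin 1) _) _ _ fun a => ?_
  rw [iterDz_succ, iterDz_zero, mul_one, iterDzbar_succ, iterDzbar_zero, mul_one]
  rfl

/-- The first order term is `1/μ` times a contraction with one matrix `x`, and on the level set `x =
μ` the two factors cancel, leaving the first order Wick term. -/
theorem isReducedBracket_commutator {μ : ℝ} (hμ : 0 < μ) (f g : SmoothGrass p q) :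
    IsReducedBracket μ f g ((2 / Complex.I : ℂ) •
      coeff 1 (grassStar p q hμ (C f) (C g) - grassStar p q hμ (C g) (C f))) := by
  intro ζ
  have hμ' : (μ : ℂ) ≠ 0 := by exact_mod_cast hμ.ne'
  have key : ∀ f g : SmoothGrass p q, (coeff 1 (grassStar p q hμ (C f) (C g))).1 (proj (incl ζ)) =
      ∑ a, (dz a (pullback p q f)).1 (incl ζ) * (dzbar a (pullback p q g)).1 (incl ζ) :=
    fun f g => by
      rw [coeff_one_grassStar_C]
      change (μ : ℂ)⁻¹ * (pullback p q (grassTerm 1 f g)).1 (incl ζ) = _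
      rw [pullback_grassTerm, contrDeriv_levelSet, pow_one, inv_mul_cancel_left₀ hμ',
        contrDeriv_fin_one]
      simp only [SmoothFun.coe_sum, SmoothFun.coe_mul]
  rw [map_sub]
  change (2 / Complex.I) * ((coeff 1 (grassStar p q hμ (C f) (C g))).1 (proj (incl ζ)) -
    (coeff 1 (grassStar p q hμ (C g) (C f))).1 (proj (incl ζ))) = _
  rw [key, key, poisson, SmoothFun.coe_smul]
  simp only [SmoothFun.coe_sum, SmoothFun.coe_sub, SmoothFun.coe_mul, Finset.sum_sub_distrib]
  congr 2
  exact Finset.sum_congr rfl fun a _ => mul_comm _ _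

/-! ### Complex conjugation -/

theorem pullback_conjGrass (f : SmoothGrass p q) :
    pullback p q (conjGrass f) = conjFun (pullback p q f) := rfl

theorem conjGrass_smul (c : ℂ) (f : SmoothGrass p q) :
    conjGrass (c • f) = conj c • conjGrass f :=
  pullback_injective (conjFun_smul c (pullback p q f))

/-- Complex conjugation on the Grassmann manifold as an additive map. -/
def conjGrassHom (p q : ℕ) : SmoothGrass p q →+ SmoothGrass p q where
  toFun := conjGrass
  map_zero' := pullback_injective (map_zero (conjHom p q))
  map_add' f g := pullback_injective (map_add (conjHom p q) (pullback p q f) (pullback p q g))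

theorem conjGrass_grassTerm {r : ℕ} (σ : Equiv.Perm (Fin r)) (f g : SmoothGrass p q) :
    conjGrass (grassTerm σ f g) = grassTerm σ⁻¹ (conjGrass g) (conjGrass f) := by
  apply pullback_injective
  rw [pullback_conjGrass, pullback_grassTerm, pullback_grassTerm, conjFun_contrDeriv,
    pullback_conjGrass, pullback_conjGrass]

/-- Coefficientwise application of an additive map. -/
def mapAdd {A : Type} [CommRing A] (S : A →+ A) : PowerSeries A →+ PowerSeries A where
  toFun := mapCoeff S
  map_zero' := by ext n; simp [coeff_mapCoeff]
  map_add' F G := by ext n; simp [coeff_mapCoeff]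

theorem mapAdd_apply {A : Type} [CommRing A] (S : A →+ A) (F : PowerSeries A) :
    mapAdd S F = mapCoeff S F := rfl

theorem mapAdd_C {A : Type} [CommRing A] (S : A →+ A) (a : A) : mapAdd S (C a) = C (S a) := by
  ext n
  rw [mapAdd_apply, coeff_mapCoeff, coeff_C, coeff_C]
  split_ifs
  · rfl
  · exact map_zero S

theorem mapAdd_X_mul {A : Type} [CommRing A] (S : A →+ A) (F : PowerSeries A) :
    mapAdd S (X * F) = X * mapAdd S F := by
  ext n
  rw [mapAdd_apply, coeff_mapCoeff]
  cases n with
  | zero => rw [coeff_zero_X_mul, coeff_zero_X_mul, map_zero]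
  | succ n => rw [coeff_succ_X_mul, coeff_succ_X_mul, mapAdd_apply, coeff_mapCoeff]

theorem mapAdd_bilin_of_C {A : Type} [CommRing A] [Algebra ℂ A] (S : A →+ A)
    (M : PowerSeries A →ₗ[PowerSeries ℂ] PowerSeries A →ₗ[PowerSeries ℂ] PowerSeries A)
    (h : ∀ a b, mapAdd S (M (C a) (C b)) = M (C (S b)) (C (S a))) (F G : PowerSeries A) :
    mapAdd S (M F G) = M (mapAdd S G) (mapAdd S F) := by
  have h1 : ∀ a G, mapAdd S (M (C a) G) = M (mapAdd S G) (C (S a)) := fun a G =>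
    addMonoidHom_eq_of_C ((mapAdd S).comp (M (C a)).toAddMonoidHom)
      ((M.flip (C (S a))).toAddMonoidHom.comp (mapAdd S))
      (fun F => by
        change mapAdd S (M (C a) (X * F)) = X * mapAdd S (M (C a) F)
        rw [linearMap_X_mul, mapAdd_X_mul])
      (fun F => by
        change M.flip (C (S a)) (mapAdd S (X * F)) = X * M.flip (C (S a)) (mapAdd S F)
        rw [mapAdd_X_mul, linearMap_X_mul])
      (fun b => by
        change mapAdd S (M (C a) (C b)) = M (mapAdd S (C b)) (C (S a))
        rw [mapAdd_C, h]) G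
  exact addMonoidHom_eq_of_C ((mapAdd S).comp (M.flip G).toAddMonoidHom)
      ((M (mapAdd S G)).toAddMonoidHom.comp (mapAdd S))
      (fun F => by
        change mapAdd S (M.flip G (X * F)) = X * mapAdd S (M.flip G F)
        rw [linearMap_X_mul, mapAdd_X_mul])
      (fun F => by
        change M (mapAdd S G) (mapAdd S (X * F)) = X * M (mapAdd S G) (mapAdd S F)
        rw [mapAdd_X_mul, linearMap_X_mul])
      (fun a => by
        change mapAdd S (M (C a) G) = M (mapAdd S G) (mapAdd S (C a))
        rw [mapAdd_C, h1]) F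

theorem conj_coeff_invCycleGen {μ : ℝ} (hμ : 0 < μ) {r : ℕ} (σ : Equiv.Perm (Fin r)) (n : ℕ) :
    conj (coeff n ((invCycleGen p hμ r).coeff σ)) =
      coeff n ((invCycleGen p hμ r).coeff σ⁻¹) := by
  rw [coeff_invCycleGen_inv, ← coeff_map, map_conj_coeff_invCycleGen]

theorem semilinear_sum_sum {A : Type} [CommRing A] [Algebra ℂ A] (S : A →+ A)
    (hS : ∀ (c : ℂ) a, S (c • a) = conj c • S a) (c : ℕ → ℂ) (hc : ∀ r, conj (c r) = c r)
    (d : ∀ r, Equiv.Perm (Fin r) → ℂ) (hd : ∀ r σ, conj (d r σ) = d r σ⁻¹)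
    (t t' : ∀ r, Equiv.Perm (Fin r) → A) (ht : ∀ r σ, S (t r σ) = t' r σ⁻¹) (s : Finset ℕ) :
    S (∑ r ∈ s, c r • ∑ σ, d r σ • t r σ) = ∑ r ∈ s, c r • ∑ σ, d r σ • t' r σ := by
  simp only [map_sum, hS, hc, hd, ht]
  refine Finset.sum_congr rfl fun r _ => ?_
  congr 1
  exact Fintype.sum_equiv (Equiv.inv (Equiv.Perm (Fin r))) _ _ fun σ => rfl

theorem conjGrassHom_coeff_grassStar_C {μ : ℝ} (hμ : 0 < μ) (f g : SmoothGrass p q) (n : ℕ) :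
    conjGrassHom p q (coeff n (grassStar p q hμ (C f) (C g))) =
      coeff n (grassStar p q hμ (C (conjGrass g)) (C (conjGrass f))) := by
  have hc : ∀ r : ℕ, conj (r.factorial : ℂ)⁻¹ = (r.factorial : ℂ)⁻¹ := fun r => by
    rw [map_inv₀, map_natCast]
  rw [coeff_grassStar_C, coeff_grassStar_C]
  exact semilinear_sum_sum (A := SmoothGrass p q) (conjGrassHom p q) conjGrass_smul
    (fun r => (r.factorial : ℂ)⁻¹) hc
    (fun r σ => coeff (n - r) ((invCycleGen p hμ r).coeff σ))
    (fun r σ => conj_coeff_invCycleGen hμ σ (n - r)) (fun r σ => grassTerm σ f g)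
    (fun r σ => grassTerm σ (conjGrass g) (conjGrass f))
    (fun r σ => conjGrass_grassTerm σ f g) (Finset.range (n + 1))

theorem mapCoeff_conjGrass_grassStar {μ : ℝ} (hμ : 0 < μ) (f g : PowerSeries (SmoothGrass p q)) :
    mapCoeff conjGrass (grassStar p q hμ f g) =
      grassStar p q hμ (mapCoeff conjGrass g) (mapCoeff conjGrass f) :=
  mapAdd_bilin_of_C (A := SmoothGrass p q) (conjGrassHom p q) (grassStar p q hμ)
    (fun f g => by
      ext n : 1
      rw [mapAdd_apply, coeff_mapCoeff]
      exact conjGrassHom_coeff_grassStar_C hμ f g n) f g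

end GrassStar
end

noncomputable section

namespace GrassStar

/-! ### Differential operators -/

section DiffOp

variable {A B : Type*} [CommRing A] [CommRing B] (φ : A →+* B)

/-- Differential operators of order at most `k` along a ring homomorphism. -/
def IsDiffOpAlong : ℕ → (A → B) → Prop
  | 0, D => ∃ b, ∀ f, D f = b * φ f
  | k + 1, D => ∀ a, IsDiffOpAlong k fun f => D (a * f) - φ a * D f

variable {φ}

theorem IsDiffOpAlong.add {k : ℕ} {D D' : A → B} (h : IsDiffOpAlong φ k D)
    (h' : IsDiffOpAlong φ k D') : IsDiffOpAlong φ k fun f => D f + D' f := by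
  induction k generalizing D D' with
  | zero =>
    obtain ⟨b, hb⟩ := h
    obtain ⟨b', hb'⟩ := h'
    exact ⟨b + b', fun f => by simp only [hb, hb', add_mul]⟩
  | succ k ih =>
    intro a
    convert ih (h a) (h' a) using 2
    ring

theorem IsDiffOpAlong.mul_left {k : ℕ} {D : A → B} (h : IsDiffOpAlong φ k D) (c : B) :
    IsDiffOpAlong φ k fun f => c * D f := by
  induction k generalizing D with
  | zero =>
    obtain ⟨b, hb⟩ := h
    exact ⟨c * b, fun f => by simp only [hb, mul_assoc]⟩
  | succ k ih =>
    intro a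
    convert ih (h a) using 2
    ring

theorem isDiffOpAlong_zero (k : ℕ) : IsDiffOpAlong φ k fun _ => 0 := by
  induction k with
  | zero => exact ⟨0, fun f => by rw [zero_mul]⟩
  | succ k ih =>
    intro a
    simpa using ih

theorem IsDiffOpAlong.sum {ι : Type*} {k : ℕ} {s : Finset ι} {D : ι → A → B}
    (h : ∀ i ∈ s, IsDiffOpAlong φ k (D i)) : IsDiffOpAlong φ k fun f => ∑ i ∈ s, D i f := by
  classical
  induction s using Finset.induction_on with
  | empty => simpa using isDiffOpAlong_zero k
  | insert i s hi ih =>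
    simp only [Finset.sum_insert hi]
    exact (h i (Finset.mem_insert_self i s)).add
      (ih fun j hj => h j (Finset.mem_insert_of_mem hj))

theorem IsDiffOpAlong.succ {k : ℕ} {D : A → B} (h : IsDiffOpAlong φ k D) :
    IsDiffOpAlong φ (k + 1) D := by
  induction k generalizing D with
  | zero =>
    obtain ⟨b, hb⟩ := h
    exact fun a => ⟨0, fun f => by simp only [hb, map_mul]; ring⟩
  | succ k ih => exact fun a => ih (h a)

theorem IsDiffOpAlong.mono {k l : ℕ} (hkl : k ≤ l) {D : A → B} (h : IsDiffOpAlong φ k D) :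
    IsDiffOpAlong φ l D := by
  induction l, hkl using Nat.le_induction with
  | base => exact h
  | succ l _ ih => exact ih.succ

/-- The commutator of `δ D` with multiplication by `a` is `δ` after the commutator of `D`, plus `δ(φ
a)` times `D`. Operators along the pullback are needed because derivatives of a pullback are in
general not pullbacks. -/
theorem IsDiffOpAlong.derivation_comp {δ : B →+ B} (hδ : ∀ u v, δ (u * v) = δ u * v + u * δ v)
    {k : ℕ} {D : A → B} (h : IsDiffOpAlong φ k D) :
    IsDiffOpAlong φ (k + 1) fun f => δ (D f) := by
  induction k generalizing D with
  | zero =>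
    obtain ⟨b, hb⟩ := h
    refine fun a => ⟨δ (φ a) * b, fun f => ?_⟩
    simp only [hb, map_mul]
    rw [mul_left_comm, hδ]
    ring
  | succ k ih =>
    intro a
    have h1 := (ih (h a)).add (h.mul_left (δ (φ a)))
    convert h1 using 2
    rw [map_sub, hδ]
    ring

theorem isDiffOpAlong_self : IsDiffOpAlong φ 0 φ := ⟨1, fun _ => (one_mul _).symm⟩

theorem IsDiffOpAlong.iterate {ι : Type*} {δ : ι → B →+ B}
    (hδ : ∀ i u v, δ i (u * v) = δ i u * v + u * δ i v) (T : (r : ℕ) → (Fin r → ι) → B → B)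
    (h0 : ∀ a u, T 0 a u = u)
    (hT : ∀ r (a : Fin (r + 1) → ι) u, T (r + 1) a u = δ (a 0) (T r (fun k => a k.succ) u))
    (r : ℕ) (a : Fin r → ι) : IsDiffOpAlong φ r fun f => T r a (φ f) := by
  induction r with
  | zero =>
    simp only [h0]
    exact isDiffOpAlong_self
  | succ r ih =>
    simp only [hT]
    exact (ih _).derivation_comp (hδ _)

end DiffOp

/-! ### The coefficients of the star product are bidifferential operators -/

open Matrix PowerSeries

variable {p q : ℕ}

/-- Commutators descend through the injective pullback; in order zero the multiplier is recovered as
the value at `1`. -/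
theorem isDiffOp_of_along {k : ℕ} {D : SmoothGrass p q → SmoothGrass p q}
    (h : IsDiffOpAlong (pullback p q) k fun f => pullback p q (D f)) : IsDiffOp k D := by
  induction k generalizing D with
  | zero =>
    obtain ⟨b, hb⟩ := h
    beta_reduce at hb
    refine ⟨D 1, fun f => pullback_injective ?_⟩
    rw [map_mul, hb, hb, map_one, mul_one]
  | succ k ih =>
    intro a
    refine ih ?_
    have h1 := h a
    simp only [map_sub, map_mul]
    exact h1

theorem isDiffOpAlong_iterDz {r : ℕ} (a : Fin r → Fin (p + q) × Fin p) :
    IsDiffOpAlong (pullback p q) r fun f => iterDz a (pullback p q f) :=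
  IsDiffOpAlong.iterate (δ := fun a => (dz (p := p) (q := q) a).toAddMonoidHom)
    (fun a u v => dz_mul a u v) (fun r a u => iterDz a u)
    (fun a u => by rw [iterDz_zero, Module.End.one_apply])
    (fun r a u => by rw [iterDz_succ]; rfl) r a

theorem isDiffOpAlong_iterDzbar {r : ℕ} (a : Fin r → Fin (p + q) × Fin p) :
    IsDiffOpAlong (pullback p q) r fun f => iterDzbar a (pullback p q f) :=
  IsDiffOpAlong.iterate (δ := fun a => (dzbar (p := p) (q := q) a).toAddMonoidHom)
    (fun a u v => dzbar_mul a u v) (fun r a u => iterDzbar a u)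
    (fun a u => by rw [iterDzbar_zero, Module.End.one_apply])
    (fun r a u => by rw [iterDzbar_succ]; rfl) r a

theorem mul_mul_eq {B : Type*} [CommRing B] (a b c : B) : a * b * c = (a * c) * b := by ring

theorem mul_mul_eq_left {B : Type*} [CommRing B] (a b c : B) : a * b * c = (b * c) * a := by ring

theorem isDiffOpAlong_contrDeriv_right {r : ℕ} (m : ℕ) (σ : Equiv.Perm (Fin r))
    (F : SmoothFun p q) :
    IsDiffOpAlong (pullback p q) r fun g => contrDeriv F (pullback p q g) m σ := by
  simp only [contrDeriv_eq]
  refine IsDiffOpAlong.sum fun I _ => IsDiffOpAlong.sum fun K _ => IsDiffOpAlong.sum fun A _ => ?_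
  have h := (isDiffOpAlong_iterDzbar (p := p) (q := q) fun k => (A k, K k)).mul_left
    (iterDz (fun k => (A k, I (σ⁻¹ k))) F * ∏ k, slots q m k (K k) (I k))
  convert h using 2
  exact mul_mul_eq _ _ _

theorem isDiffOpAlong_contrDeriv_left {r : ℕ} (m : ℕ) (σ : Equiv.Perm (Fin r))
    (G : SmoothFun p q) :
    IsDiffOpAlong (pullback p q) r fun f => contrDeriv (pullback p q f) G m σ := by
  simp only [contrDeriv_eq]
  refine IsDiffOpAlong.sum fun I _ => IsDiffOpAlong.sum fun K _ => IsDiffOpAlong.sum fun A _ => ?_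
  have h := (isDiffOpAlong_iterDz (p := p) (q := q) fun k => (A k, I (σ⁻¹ k))).mul_left
    (iterDzbar (fun k => (A k, K k)) G * ∏ k, slots q m k (K k) (I k))
  convert h using 2
  exact mul_mul_eq_left _ _ _

theorem pullback_smul (c : ℂ) (f : SmoothGrass p q) :
    pullback p q (c • f) = c • pullback p q f := rfl

theorem pullback_coeff_grassStar_C {μ : ℝ} (hμ : 0 < μ) (f g : SmoothGrass p q) (n : ℕ) :
    pullback p q (coeff n (grassStar p q hμ (C f) (C g))) = ∑ r ∈ Finset.range (n + 1),
      ∑ σ : Equiv.Perm (Fin r), algebraMap ℂ (SmoothFun p q) ((r.factorial : ℂ)⁻¹ *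
        coeff (n - r) ((invCycleGen p hμ r).coeff σ)) *
          contrDeriv (pullback p q f) (pullback p q g) r σ := by
  rw [coeff_grassStar_C, map_sum]
  refine Finset.sum_congr rfl fun r _ => ?_
  rw [pullback_smul, map_sum, Finset.smul_sum]
  refine Finset.sum_congr rfl fun σ _ => ?_
  rw [pullback_smul, pullback_grassTerm, smul_smul, Algebra.smul_def]

theorem isDiffOp_coeff_grassStar_right {μ : ℝ} (hμ : 0 < μ) (n : ℕ) (f : SmoothGrass p q) :
    IsDiffOp n fun g => coeff n (grassStar p q hμ (C f) (C g)) := by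
  refine isDiffOp_of_along ?_
  simp only [pullback_coeff_grassStar_C]
  exact IsDiffOpAlong.sum fun r hr => IsDiffOpAlong.sum fun σ _ =>
    ((isDiffOpAlong_contrDeriv_right r σ _).mul_left _).mono
      (Nat.lt_succ_iff.mp (Finset.mem_range.mp hr))

theorem isDiffOp_coeff_grassStar_left {μ : ℝ} (hμ : 0 < μ) (n : ℕ) (g : SmoothGrass p q) :
    IsDiffOp n fun f => coeff n (grassStar p q hμ (C f) (C g)) := by
  refine isDiffOp_of_along ?_
  simp only [pullback_coeff_grassStar_C]
  exact IsDiffOpAlong.sum fun r hr => IsDiffOpAlong.sum fun σ _ =>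
    ((isDiffOpAlong_contrDeriv_left r σ _).mul_left _).mono
      (Nat.lt_succ_iff.mp (Finset.mem_range.mp hr))

theorem smul_commutator {A : Type*} [AddCommGroup A] [Module ℂ A] (x : A) :
    x = (Complex.I / 2) • ((2 / Complex.I : ℂ) • x) := by
  rw [smul_smul, div_mul_div_cancel₀ two_ne_zero, div_self Complex.I_ne_zero, one_smul]

theorem isStarProduct_grassStar {μ : ℝ} (hμ : 0 < μ) : IsStarProduct μ (grassStar p q hμ) where
  assoc := grassStar_assoc hμ
  one_left := grassStar_one_left hμ
  one_right := grassStar_one_right hμ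
  bidifferential n := ⟨n, fun f => ⟨isDiffOp_coeff_grassStar_right hμ n f,
    isDiffOp_coeff_grassStar_left hμ n f⟩⟩
  zeroth := coeff_zero_grassStar_C hμ
  first f g := ⟨_, isReducedBracket_commutator hμ f g, smul_commutator _⟩
  conj := mapCoeff_conjGrass_grassStar hμ

end GrassStar
end

noncomputable section

namespace PowerSeries
open GrassStar

/-! ### Bilinear maps of formal series -/

section Bilinear

variable {A B E ι κ₁ κ₂ : Type} [CommRing A] [Algebra ℂ A] [CommRing B] [Algebra ℂ B] [CommRing E]
  [Algebra ℂ E] [Fintype ι] [Fintype κ₁] [Fintype κ₂]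

/-- The bilinear map `(F, G) ↦ c ∑ s_i (D_i F) (D'_i G)`. -/
def sumMulBilin (c : ℂ) (s : ι → PowerSeries ℂ) (D D' : ι → A →ₗ[ℂ] B) :
    PowerSeries A →ₗ[PowerSeries ℂ] PowerSeries A →ₗ[PowerSeries ℂ] PowerSeries B :=
  (C c : PowerSeries ℂ) • ∑ i, s i • (LinearMap.mul (PowerSeries ℂ) (PowerSeries B)).compl₁₂
    (mapLin (D i)) (mapLin (D' i))

theorem sumMulBilin_apply (c : ℂ) (s : ι → PowerSeries ℂ) (D D' : ι → A →ₗ[ℂ] B)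
    (F G : PowerSeries A) : sumMulBilin c s D D' F G =
      c • ∑ i, s i • (mapLin (D i) F * mapLin (D' i) G) := by
  rw [sumMulBilin, LinearMap.smul_apply, LinearMap.smul_apply, C_smul_series]
  simp only [LinearMap.sum_apply, LinearMap.smul_apply, LinearMap.compl₁₂_apply,
    LinearMap.mul_apply']

theorem sumMulBilin_C_C (c : ℂ) (s : ι → PowerSeries ℂ) (D D' : ι → A →ₗ[ℂ] B) (a b : A) :
    sumMulBilin c s D D' (C a) (C b) = c • ∑ i, s i • C (D i a * D' i b) := by
  rw [sumMulBilin_apply]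
  simp only [mapLin_C, map_mul]

/-- The sum of a sequence of bilinear maps of formal series, with the `r`-th one multiplied
by `λ^r`. -/
def lamSumSeriesBilin
    (T : ℕ → PowerSeries A →ₗ[PowerSeries ℂ] PowerSeries A →ₗ[PowerSeries ℂ] PowerSeries B) :
    PowerSeries A →ₗ[PowerSeries ℂ] PowerSeries A →ₗ[PowerSeries ℂ] PowerSeries B :=
  have hs : ∀ (c : PowerSeries ℂ) (K : ℕ → PowerSeries B),
      (lamSum fun r => c • K r) = c • lamSum K := fun c K =>
    (linearMap_lamSum (LinearMap.lsmul (PowerSeries ℂ) (PowerSeries B) c) K).symm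
  LinearMap.mk₂ (PowerSeries ℂ) (fun F G => lamSum fun r => T r F G)
    (fun F F' G => by simp only [map_add, LinearMap.add_apply, lamSum_add])
    (fun c F G => by simp only [map_smul, LinearMap.smul_apply, hs])
    (fun F G G' => by simp only [map_add, lamSum_add])
    (fun c F G => by simp only [map_smul, hs])

theorem linearMap_bilin_eq_lamSum (L : PowerSeries A →ₗ[PowerSeries ℂ] PowerSeries B)
    (M : PowerSeries A →ₗ[PowerSeries ℂ] PowerSeries A →ₗ[PowerSeries ℂ] PowerSeries A)
    (T : ℕ → PowerSeries A →ₗ[PowerSeries ℂ] PowerSeries A →ₗ[PowerSeries ℂ] PowerSeries B)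
    (h : ∀ a b, L (M (C a) (C b)) = lamSum fun r => T r (C a) (C b)) (F G : PowerSeries A) :
    L (M F G) = lamSum fun r => T r F G := by
  have h1 : ∀ a G, L (M (C a) G) = lamSumSeriesBilin T (C a) G := fun a G =>
    linearMap_eq_of_C (L ∘ₗ M (C a)) (lamSumSeriesBilin T (C a)) (h a) G
  exact linearMap_eq_of_C (L ∘ₗ M.flip G) ((lamSumSeriesBilin T).flip G) (fun a => h1 a G) F

theorem smul_sum_prod_smul_C {κ : Type} [Fintype κ] (m c : ℂ) (a : ι → PowerSeries ℂ) (t : ι → B)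
    (u : ι × κ → B) (h : ∀ i, t i = m • ∑ k, u (i, k)) :
    (m * c) • ∑ i : ι × κ, a i.1 • (C (u i) : PowerSeries B) = c • ∑ i, a i • C (t i) := by
  have h1 : ∀ i, (C (t i) : PowerSeries B) = m • ∑ k, C (u (i, k)) := fun i => by
    rw [h, GrassStar.C_smul, map_sum]
  simp only [h1, Fintype.sum_prod_type, ← Finset.smul_sum]
  rw [mul_comm, mul_smul]
  congr 1
  simp only [← C_smul_series (R := ℂ), Finset.smul_sum (s := Finset.univ (α := ι))]
  exact Finset.sum_congr rfl fun i _ => smul_comm _ _ _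

theorem smul_sum_mul_smul (c : ℂ) (x : PowerSeries ℂ) (w : ι → PowerSeries ℂ)
    (u : ι → PowerSeries B) : c • ∑ i, (x * w i) • u i = x • c • ∑ i, w i • u i := by
  simp only [mul_smul, ← Finset.smul_sum, ← C_smul_series (R := ℂ)]
  exact smul_comm _ _ _

/-- The `r`-th summand is divisible by `λ^r`, so the terms with `r > n` do not reach order `n`. -/
theorem coeff_sum_range_X_pow_smul (K : ℕ → PowerSeries B) {n m : ℕ} (h : n + 1 ≤ m) :
    coeff n (∑ r ∈ Finset.range m, (X ^ r : PowerSeries ℂ) • K r) = coeff n (lamSum K) := by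
  have h1 : ∀ r, coeff n ((X ^ r : PowerSeries ℂ) • K r) =
      if r ≤ n then coeff (n - r) (K r) else 0 := fun r => by
    rw [smul_series_def, map_pow, map_X, coeff_X_pow_mul']
  rw [map_sum, coeff_lamSum, ← Finset.sum_subset (Finset.range_subset_range.mpr h)]
  · refine Finset.sum_congr rfl fun r hr => ?_
    rw [h1, if_pos (Nat.lt_succ_iff.mp (Finset.mem_range.mp hr))]
  · intro r _ hr
    rw [h1, if_neg fun h' => hr (Finset.mem_range.mpr (Nat.lt_succ_iff.mpr h'))]

theorem mapLin_sum_mul {σ : Type} [Fintype σ] (R : B →ₐ[ℂ] E) (π : A →ₗ[ℂ] B)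
    (s : σ → PowerSeries ℂ) (D : κ₁ → κ₂ → σ → Module.End ℂ B) (D' : κ₁ → κ₂ → Module.End ℂ B)
    (F G : PowerSeries A) :
    mapLin R.toLinearMap (∑ a, ∑ b, (∑ t, s t • mapLin (D a b t) (mapLin π F)) *
        mapLin (D' a b) (mapLin π G)) =
      ∑ i : σ × κ₁ × κ₂, s i.1 • (mapLin (R.toLinearMap ∘ₗ D i.2.1 i.2.2 i.1 ∘ₗ π) F *
        mapLin (R.toLinearMap ∘ₗ D' i.2.1 i.2.2 ∘ₗ π) G) := by
  have h1 : ∀ F G : PowerSeries B, mapLin R.toLinearMap (F * G) =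
      mapLin R.toLinearMap F * mapLin R.toLinearMap G := fun F G => by
    rw [← map_eq_mapLin, ← map_eq_mapLin, ← map_eq_mapLin, map_mul]
  simp only [map_sum, h1, map_smul, Finset.sum_mul, smul_mul_assoc]
  simp only [Fintype.sum_prod_type]
  rw [Finset.sum_comm (s := (Finset.univ : Finset σ))]
  refine Finset.sum_congr rfl fun a _ => ?_
  rw [Finset.sum_comm (s := (Finset.univ : Finset σ))]
  refine Finset.sum_congr rfl fun b _ => Finset.sum_congr rfl fun t _ => ?_
  congr 2
  all_goals
    ext n
    simp only [coeff_mapLin]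
    rfl

end Bilinear
end PowerSeries

namespace GrassStar
open Matrix PowerSeries
open scoped ComplexConjugate

variable {p q : ℕ}

/-! ### The explicit form of the star product -/

/-- The retraction moves each point within its GL-orbit, so pulled back functions are unchanged by
restriction to the level set and retraction. -/
theorem exists_incl_rhoBar_eq_mulGL {μ : ℝ} (hμ : 0 < μ) (z : FullRank p q) :
    ∃ γ : GL (Fin p) ℂ, incl (rhoBar hμ z) = mulGL z γ := by
  have h1 : IsUnit (invSqrtGram z) := (Matrix.isUnit_iff_isUnit_det _).mpr
    (Matrix.isUnit_det_of_left_inverse (invSqrtGram_spec z))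
  have h2 : (((√μ : ℝ) : ℂ)) ≠ 0 := by exact_mod_cast (Real.sqrt_pos.mpr hμ).ne'
  have h3 : IsUnit (((√μ : ℝ) : ℂ) • invSqrtGram z) := h1.smul (Units.mk0 _ h2)
  refine ⟨h3.unit, Subtype.ext ?_⟩
  exact (Matrix.mul_smul _ _ _).symm

theorem pullback_incl_rhoBar {μ : ℝ} (hμ : 0 < μ) (f : SmoothGrass p q) (z : FullRank p q) :
    (pullback p q f).1 (incl (rhoBar hμ z)) = (pullback p q f).1 z := by
  obtain ⟨γ, hγ⟩ := exists_incl_rhoBar_eq_mulGL hμ z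
  rw [hγ, pullback_apply, proj_mulGL, pullback_apply]

theorem contrDeriv_zero_apply {r : ℕ} (f g : SmoothFun p q) (σ : Equiv.Perm (Fin r))
    (z : FullRank p q) : (contrDeriv f g 0 σ).1 z =
      ∑ A : Fin r → Fin (p + q), ∑ I : Fin r → Fin p,
        (iterDz (fun k => (A k, (I ∘ ⇑σ⁻¹) k)) f).1 z * (iterDzbar (fun k => (A k, I k)) g).1 z := by
  have h : ∀ (k : Fin r) (a b : Fin p), (slots q 0 k a b).1 z = if a = b then 1 else 0 :=
    fun k a b => by
      rw [slots, if_neg (Nat.not_lt_zero _)]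
      split_ifs <;> rfl
  rw [contrDeriv_apply, Finset.sum_comm (s := (Finset.univ : Finset (Fin r → Fin (p + q))))]
  refine Finset.sum_congr rfl fun I _ => ?_
  rw [Finset.sum_eq_single I]
  · refine Finset.sum_congr rfl fun A _ => ?_
    simp only [h, if_true, Finset.prod_const_one, mul_one, Function.comp_apply]
  · intro K _ hK
    obtain ⟨k, hk⟩ := Function.ne_iff.mp hK
    refine Finset.sum_eq_zero fun A _ => ?_
    rw [Finset.prod_eq_zero (Finset.mem_univ k), mul_zero]
    rw [h, if_neg hk]
  · exact fun h => absurd (Finset.mem_univ _) h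

/-- Restriction to the level set followed by the pullback along the retraction. -/
def retract {μ : ℝ} (hμ : 0 < μ) : SmoothFun p q →ₐ[ℂ] (FullRank p q → ℂ) where
  toFun F z := F.1 (incl (rhoBar hμ z))
  map_one' := rfl
  map_mul' _ _ := rfl
  map_zero' := rfl
  map_add' _ _ := rfl
  commutes' _ := rfl

theorem rhoBarStarInclStar_eq {μ : ℝ} (hμ : 0 < μ) (F : PowerSeries (SmoothFun p q)) :
    rhoBarStarInclStar hμ F = mapLin (retract hμ).toLinearMap F := by
  ext n : 1
  rw [coeff_mapLin, rhoBarStarInclStar, forget, coeff_map, coeff_map, coeff_map]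
  rfl

theorem forget_pullbackSeries {μ : ℝ} (hμ : 0 < μ) (f : PowerSeries (SmoothGrass p q)) :
    forget (pullbackSeries f) = mapLin ((retract hμ).toLinearMap ∘ₗ pullbackLin p q) f := by
  ext n z
  rw [coeff_mapLin, forget, coeff_map, coeff_pullbackSeries]
  exact (pullback_incl_rhoBar hμ (coeff n f) z).symm

/-- The `r`-th term of the explicit form of the star product, without the power of the formal
parameter. -/
def explicitTerm (p q : ℕ) {μ : ℝ} (hμ : 0 < μ) (r : ℕ) :
    PowerSeries (SmoothGrass p q) →ₗ[PowerSeries ℂ] PowerSeries (SmoothGrass p q)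
      →ₗ[PowerSeries ℂ] PowerSeries (FullRank p q → ℂ) :=
  sumMulBilin (A := SmoothGrass p q) (B := FullRank p q → ℂ)
    (ι := Equiv.Perm (Fin r) × (Fin r → Fin (p + q)) × (Fin r → Fin p))
    ((μ : ℂ) ^ r * (r.factorial : ℂ)⁻¹) (fun i => (invCycleGen p hμ r).coeff i.1)
    (fun i => (retract hμ).toLinearMap ∘ₗ
      iterDz (fun k => (i.2.1 k, (i.2.2 ∘ ⇑i.1⁻¹) k)) ∘ₗ pullbackLin p q)
    (fun i => (retract hμ).toLinearMap ∘ₗ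
      iterDzbar (fun k => (i.2.1 k, i.2.2 k)) ∘ₗ pullbackLin p q)

/-- On the level set each of the `r` slots is `μ` times the identity, giving `μ^r` and the plain
contraction of indices in the explicit formula. -/
theorem forget_grassTerm {μ : ℝ} (hμ : 0 < μ) {r : ℕ} (σ : Equiv.Perm (Fin r))
    (f g : SmoothGrass p q) :
    ((retract hμ).toLinearMap ∘ₗ pullbackLin p q) (grassTerm σ f g) = (μ : ℂ) ^ r •
      ∑ k : (Fin r → Fin (p + q)) × (Fin r → Fin p),
        retract hμ (iterDz (fun l => (k.1 l, (k.2 ∘ ⇑σ⁻¹) l)) (pullback p q f)) *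
          retract hμ (iterDzbar (fun l => (k.1 l, k.2 l)) (pullback p q g)) := by
  funext z
  change (pullback p q (grassTerm σ f g)).1 (incl (rhoBar hμ z)) = _
  rw [pullback_grassTerm, contrDeriv_levelSet, contrDeriv_zero_apply, Fintype.sum_prod_type]
  simp only [Pi.smul_apply, Finset.sum_apply, smul_eq_mul]
  rfl

theorem forget_grassStar {μ : ℝ} (hμ : 0 < μ) (f g : PowerSeries (SmoothGrass p q)) :
    forget (pullbackSeries (grassStar p q hμ f g)) = lamSum fun r => explicitTerm p q hμ r f g := by
  rw [forget_pullbackSeries hμ]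
  refine linearMap_bilin_eq_lamSum (A := SmoothGrass p q) (B := FullRank p q → ℂ) _
    (grassStar p q hμ) (explicitTerm p q hμ) (fun a b => ?_) f g
  rw [grassStar_C, linearMap_lamSum]
  congr 1
  funext r
  rw [starTermBilin_apply]
  refine (mapLin_seriesSum (A := SmoothGrass p q) (B := FullRank p q → ℂ) _ _ _ _).trans ?_
  refine Eq.trans ?_ (sumMulBilin_C_C (A := SmoothGrass p q) (B := FullRank p q → ℂ)
    _ _ _ _ _ _).symm
  exact (smul_sum_prod_smul_C _ _ _ _ _ fun σ => forget_grassTerm hμ σ a b).symm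

/-- The power of `λ` contained in every `s_α` is made explicit here. -/
theorem productTerm_classCoeff {μ : ℝ} (hμ : 0 < μ) (r : ℕ) (f g : PowerSeries (SmoothGrass p q)) :
    productTerm hμ r (classCoeff p hμ r) (pullbackSeries f) (pullbackSeries g) =
      (X ^ r : PowerSeries ℂ) • explicitTerm p q hμ r f g := by
  have h := mapLin_sum_mul (A := SmoothGrass p q) (B := SmoothFun p q) (E := FullRank p q → ℂ)
    (retract hμ) (pullbackLin p q)
    (fun σ => (∑ α, classCoeff p hμ r α • classSum (PowerSeries ℂ) α).coeff σ)
    (fun (A : Fin r → Fin (p + q)) (I : Fin r → Fin p) σ => iterDz fun k => (A k, (I ∘ ⇑σ⁻¹) k))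
    (fun A I => iterDzbar fun k => (A k, I k)) f g
  rw [productTerm, rhoBarStarInclStar_eq, pullbackSeries_eq, pullbackSeries_eq]
  refine (congrArg _ h).trans ?_
  simp only [coeff_sum_smul_classSum, classCoeff_mk]
  rw [explicitTerm, sumMulBilin_apply, div_eq_mul_inv]
  exact smul_sum_mul_smul (B := FullRank p q → ℂ) _ _ _ _

theorem hasLambdaSum_productTerm {μ : ℝ} (hμ : 0 < μ) (f g : PowerSeries (SmoothGrass p q)) :
    HasLambdaSum (fun r => productTerm hμ r (classCoeff p hμ r) (pullbackSeries f)
      (pullbackSeries g)) (forget (pullbackSeries (grassStar p q hμ f g))) := by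
  simp only [productTerm_classCoeff]
  rw [forget_grassStar]
  exact fun n => ⟨n + 1, fun m hm =>
    coeff_sum_range_X_pow_smul (B := FullRank p q → ℂ) (fun r => explicitTerm p q hμ r f g) hm⟩

end GrassStar
end

theorem mainTheorem5 :
    ∃ s : (r : ℕ) → GrassStar.Con r → RatFunc ℂ,
      (∀ r : ℕ,
        GrassStar.cycleSum r * (∑ α, s r α • GrassStar.classSum (RatFunc ℂ) α) = 1 ∧
        (∑ α, s r α • GrassStar.classSum (RatFunc ℂ) α) * GrassStar.cycleSum r = 1) ∧
      ∀ (p q : ℕ) (μ : ℝ) (hμ : 0 < μ),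
        (∀ F : PowerSeries (GrassStar.SmoothFun p q), GrassStar.IsInvariant F →
          ∃! H : PowerSeries (GrassStar.SmoothFun p q), GrassStar.IsProjection μ F H) ∧
        ∃ S : (r : ℕ) → GrassStar.Con r → PowerSeries ℂ,
          (∀ (r : ℕ) (α : GrassStar.Con r),
            HahnSeries.ofPowerSeries ℤ ℂ (S r α) =
              (s r α).eval HahnSeries.C (GrassStar.cLaurent p μ)) ∧
          ∃ star : PowerSeries (GrassStar.SmoothGrass p q) →ₗ[PowerSeries ℂ]
              PowerSeries (GrassStar.SmoothGrass p q) →ₗ[PowerSeries ℂ]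
                PowerSeries (GrassStar.SmoothGrass p q),
            GrassStar.IsStarProduct μ star ∧
            ∀ f g : PowerSeries (GrassStar.SmoothGrass p q),
              GrassStar.IsProjection μ
                (GrassStar.wick (GrassStar.pullbackSeries f) (GrassStar.pullbackSeries g))
                (GrassStar.pullbackSeries (star f g)) ∧
              GrassStar.HasLambdaSum
                (fun r => GrassStar.productTerm hμ r (S r)
                  (GrassStar.pullbackSeries f) (GrassStar.pullbackSeries g))
                (GrassStar.forget (GrassStar.pullbackSeries (star f g))) := by
  -- The rational functions are the class coefficients of the inverse over `ℂ(c)`, fixed before `p`,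
  -- `q` and `μ`.
  refine ⟨GrassStar.ratCoeff, fun r => ?_, fun p q μ hμ =>
    ⟨fun F hF => GrassStar.existsUnique_projection hμ hF, GrassStar.classCoeff p hμ,
      GrassStar.ofPowerSeries_classCoeff p hμ, GrassStar.grassStar p q hμ,
      GrassStar.isStarProduct_grassStar hμ, fun f g =>
        ⟨GrassStar.isProjection_grassStar hμ f g, GrassStar.hasLambdaSum_productTerm hμ f g⟩⟩⟩
  rw [GrassStar.sum_ratCoeff]
  exact ⟨(GrassStar.isUnit_cycleSum r).mul_val_inv, (GrassStar.isUnit_cycleSum r).val_inv_mul⟩
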